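/- **Extract-and-Simulate Lemma.** Conventions. A *QPT algorithm* is a polynomial-time uniform family of quantum circuits: a classical machine computes, in time polynomial in the total input length, a description of a circuit from the classical inputs and the number of qubits of the quantum input; the circuit is applied to the quantum input and ancillas in state $|0\rangle$, a designated register is measured to give the classical output, another one is the quantum output, and the rest is discarded. A function $f:\mathbb N\to(0,1]$ is *noticeable* if $f(\lambda)\ge 1/p(\lambda)$ for some polynomial $p$ and all sufficiently large $\lambda$; a function $f:\mathbb N\to[0,1]$ is *negligible* if for every polynomial $p$ that is positive for all large arguments, $f(\lambda)<1/p(\lambda)$ for all sufficiently large $\lambda$. The input $1^{f^{-1}}$ stands for $1^{\lceil 1/f(\lambda)\rceil}$. A family of noticeable functions $\delta=\delta_\gamma$, one for each noticeable $\gamma$, is *efficiently computable from* $\gamma$ if there is one classical polynomial-time algorithm, the same for all $\gamma$, that for every $\lambda$ outputs $1^{\delta^{-1}}$ on input $(1^\lambda,1^{\gamma^{-1}})$. For ensembles $X=\{X_\lambda\}$, $Y=\{Y_\lambda\}$ of joint classical-quantum outputs, $X\stackrel{s}{\approx}_{\epsilon}Y$ means that for every computationally unbounded distinguisher $D=\{D_\lambda\}$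 there is a negligible $\nu$ with $|\Pr[D_\lambda(X_\lambda)=1]-\Pr[D_\lambda(Y_\lambda)=1]|\le\epsilon(\lambda)+\nu(\lambda)$ for all $\lambda$. Let $\mathcal G$ be a QPT algorithm that takes $1^\lambda$, an error parameter $1^{\gamma^{-1}}$, a quantum state $\rho$ and a classical string $z$, and outputs $b\in\{\top,\bot\}$ and a quantum state $\rho_{\mathsf{out}}$. Let $\mathcal K$ be a QPT algorithm that takes inputs of the same form and outputs $s\in\{0,1\}^*\cup\{\bot\}$, and let $\{s^*_z\}_{z\in\{0,1\}^*}$ be classical strings such that: 1. For all $\lambda$, all error parameters $1^t$ with $t\ge 1$, all $\rho$ and all $z$, the output $s$ of $\mathcal K(1^\lambda,1^{t},\rho,z)$ equals $s^*_z$ whenever $s\ne\bot$. 2. For every noticeable function $\gamma$ there is a noticeable function $\delta$, efficiently computable from $\gamma$, such that for every sequence $\{\rho_\lambda,z_\lambda\}_{\lambda\in\mathbb N}$ of polynomial-size quantum states and classical strings and every $\lambda$: if $$\Pr[b=\top:(b,\rho_{\mathsf{out}})\leftarrow\mathcal G(1^\lambda,1^{\gamma^{-1}},\rho_\lambda,z_\lambda)]\ge\gamma(\lambda),$$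 then $$\Pr[\mathcal K(1^\lambda,1^{\gamma^{-1}},\rho_\lambda,z_\lambda)=s^*_{z_\lambda}]\ge\delta(\lambda).$$ Then there is a QPT algorithm $\mathcal{SE}$ such that for every noticeable function $\epsilon$ there is a noticeable function $\gamma\le\epsilon$, efficiently computable from $\epsilon$, such that for every sequence $\{\rho_\lambda,z_\lambda\}_{\lambda\in\mathbb N}$ of polynomial-size quantum states and classical strings, $$\{\mathcal{SE}(1^\lambda,1^{\epsilon^{-1}},\rho_\lambda,z_\lambda)\}_{\lambda}\ \stackrel{s}{\approx}_{\epsilon}\ \{(\rho_{\mathsf{out}},\Gamma_b(s^*_{z_\lambda})):(b,\rho_{\mathsf{out}})\leftarrow\mathcal G(1^\lambda,1^{\gamma^{-1}},\rho_\lambda,z_\lambda)\}_{\lambda},$$ where $\Gamma_b(s):=s$ if $b=\top$ and $\Gamma_b(s):=\bot$ otherwise. -/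

import Mathlib

namespace ExtractSim

noncomputable section

open Filter
open scoped ComplexOrder

/-! ### Classical polynomial time: structured multi-stack machines with a step count -/

/-- Programs of a machine with finitely many stacks (registers) of bits. A program mentions only
finitely many registers; this is a multi-stack Turing machine with structured control. -/
inductive Prog : Type
  | skip : Prog
  | push (r : ℕ) (b : Bool) : Prog
  | pop (r : ℕ) : Prog
  | seq (P Q : Prog) : Prog
  /-- three-way branch on register `r`: empty, top bit `0`, top bit `1` -/
  | branch (r : ℕ) (Pe Pf Pt : Prog) : Prog
  /-- while register `r` is nonempty, run `P` -/
  | loop (r : ℕ) (P : Prog) : Prog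

/-- Contents of the registers; the head of a list is the top of the stack. -/
abbrev Store : Type := ℕ → List Bool

/-- Initial store: the inputs in registers `0, 1, 2, …`, all other registers empty. -/
def Store.init (inputs : List (List Bool)) : Store := fun r => inputs.getD r []

/-- `Exec P σ s σ'`: started in `σ`, the program `P` halts in `σ'` after exactly `s` steps. -/
inductive Exec : Prog → Store → ℕ → Store → Prop
  | skip (σ : Store) : Exec .skip σ 1 σ
  | push (σ : Store) (r : ℕ) (b : Bool) :
      Exec (.push r b) σ 1 (Function.update σ r (b :: σ r))
  | pop (σ : Store) (r : ℕ) :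
      Exec (.pop r) σ 1 (Function.update σ r (σ r).tail)
  | seq {P Q : Prog} {σ σ' σ'' : Store} {s s' : ℕ} :
      Exec P σ s σ' → Exec Q σ' s' σ'' → Exec (.seq P Q) σ (s + s') σ''
  | branch_empty {r : ℕ} {Pe Pf Pt : Prog} {σ σ' : Store} {s : ℕ} :
      σ r = [] → Exec Pe σ s σ' → Exec (.branch r Pe Pf Pt) σ (s + 1) σ'
  | branch_false {r : ℕ} {Pe Pf Pt : Prog} {σ σ' : Store} {s : ℕ} :
      (σ r).head? = some false → Exec Pf σ s σ' → Exec (.branch r Pe Pf Pt) σ (s + 1) σ'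
  | branch_true {r : ℕ} {Pe Pf Pt : Prog} {σ σ' : Store} {s : ℕ} :
      (σ r).head? = some true → Exec Pt σ s σ' → Exec (.branch r Pe Pf Pt) σ (s + 1) σ'
  | loop_done {r : ℕ} {P : Prog} {σ : Store} :
      σ r = [] → Exec (.loop r P) σ 1 σ
  | loop_step {r : ℕ} {P : Prog} {σ σ' σ'' : Store} {s s' : ℕ} :
      σ r ≠ [] → Exec P σ s σ' → Exec (.loop r P) σ' s' σ'' →
        Exec (.loop r P) σ (s + s' + 1) σ''

/-- On the given inputs, `P` halts within `T` steps and leaves `output` in register `0`. -/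
def Computes (P : Prog) (inputs : List (List Bool)) (output : List Bool) (T : ℕ) : Prop :=
  ∃ s ≤ T, ∃ σ : Store, Exec P (Store.init inputs) s σ ∧ σ 0 = output

/-- The string `1ᵏ`. -/
def unary (k : ℕ) : List Bool := List.replicate k true

/-- `(1^κ, 1^t) ↦ 1^(d κ t)` is computable in time polynomial in `κ + t`. -/
def PolyTimeUnary (d : ℕ → ℕ → ℕ) : Prop :=
  ∃ (P : Prog) (p : Polynomial ℕ), ∀ κ t : ℕ,
    Computes P [unary κ, unary t] (unary (d κ t)) (p.eval (κ + t))

/-! ### Quantum circuits -/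

abbrev Bits (ι : Type) : Type := ι → Bool

/-- Operators on qubits labelled by `ι`, in the computational basis. -/
abbrev Op (ι : Type) : Type := Matrix (Bits ι) (Bits ι) ℂ

/-- Elementary gates (Clifford + T) on wires labelled by `W`. -/
inductive Gate (W : Type) : Type
  | had (i : W) : Gate W
  | phaseT (i : W) : Gate W
  | phaseTdg (i : W) : Gate W
  | not (i : W) : Gate W
  | cnot (c i : W) (h : c ≠ i) : Gate W
  | toffoli (c c' i : W) (h : c ≠ i) (h' : c' ≠ i) : Gate W

/-- The operator `|y⟩ ↦ |f y⟩`. -/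
def basisOp {W : Type} [DecidableEq W] [Fintype W] (f : Bits W → Bits W) : Op W :=
  Matrix.of fun x y => if x = f y then 1 else 0

def Gate.op {W : Type} [DecidableEq W] [Fintype W] : Gate W → Op W
  | .had i => Matrix.of fun x y =>
      if ∀ j, j ≠ i → x j = y j then
        (if x i = true ∧ y i = true then -1 else 1) / (Real.sqrt 2 : ℂ)
      else 0
  | .phaseT i => Matrix.diagonal fun x =>
      if x i = true then Complex.exp (Real.pi / 4 * Complex.I) else 1
  | .phaseTdg i => Matrix.diagonal fun x =>
      if x i = true then Complex.exp (-(Real.pi / 4 * Complex.I)) else 1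
  | .not i => basisOp fun y => Function.update y i (!(y i))
  | .cnot c i _ => basisOp fun y => Function.update y i (xor (y i) (y c))
  | .toffoli c c' i _ _ => basisOp fun y => Function.update y i (xor (y i) (y c && y c'))

/-- The unitary of a gate sequence; the head of the list is applied first. -/
def gatesOp {W : Type} [DecidableEq W] [Fintype W] : List (Gate W) → Op W
  | [] => 1
  | g :: gs => gatesOp gs * g.op

/-- Wires: `n` input qubits, `c` qubits measured at the end (classical output), `m` qubits that
form the quantum output, and `a` further work qubits. -/
abbrev Wire (n c m a : ℕ) : Type := Fin n ⊕ Fin c ⊕ Fin m ⊕ Fin a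

/-- A circuit on `n` input qubits. -/
structure Circuit (n : ℕ) where
  cOut : ℕ
  qOut : ℕ
  work : ℕ
  gates : List (Gate (Wire n cOut qOut work))

/-- `ρ ⊗ |0…0⟩⟨0…0|`. -/
def withAncillas {n c m a : ℕ} (ρ : Op (Fin n)) : Op (Wire n c m a) :=
  Matrix.of fun x y =>
    if (∀ j, x (Sum.inr j) = false) ∧ (∀ j, y (Sum.inr j) = false) then
      ρ (fun i => x (Sum.inl i)) (fun i => y (Sum.inl i))
    else 0

def joinBits {n c m a : ℕ} (u : Bits (Fin n)) (w : Bits (Fin c)) (q : Bits (Fin m))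
    (v : Bits (Fin a)) : Bits (Wire n c m a) :=
  Sum.elim u (Sum.elim w (Sum.elim q v))

/-- The state of all wires at the end of the computation, before the measurement. -/
def Circuit.final {n : ℕ} (C : Circuit n) (ρ : Op (Fin n)) :
    Op (Wire n C.cOut C.qOut C.work) :=
  gatesOp C.gates * withAncillas ρ * (gatesOp C.gates).conjTranspose

/-- The subnormalized state of the quantum output register on measurement outcome `w` of the
classical output register; the input and work registers are traced out. -/
def Circuit.outcome {n : ℕ} (C : Circuit n) (ρ : Op (Fin n)) (w : Bits (Fin C.cOut)) :
    Op (Fin C.qOut) :=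
  Matrix.of fun q q' => ∑ u : Bits (Fin n), ∑ v : Bits (Fin C.work),
    C.final ρ (joinBits u w q v) (joinBits u w q' v)

/-- A joint classical-quantum output: a classical label in `α` together with some number of qubits.
`part v` is the subnormalized quantum state belonging to the label `v`, so that its trace is the
probability of `v`. -/
structure CQOutput (α : Type) where
  qubits : ℕ
  part : α →₀ Op (Fin qubits)

/-- Classical postprocessing of the label. -/
def CQOutput.map {α β : Type} (f : α → β) (X : CQOutput α) : CQOutput β :=
  ⟨X.qubits, X.part.mapDomain f⟩

/-- Probability of the label `v`. -/
def CQOutput.prob {α : Type} (X : CQOutput α) (v : α) : ℝ := (X.part v).trace.re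

/-- The output of a circuit: the measured bit string and the quantum output. -/
def Circuit.run {n : ℕ} (C : Circuit n) (ρ : Op (Fin n)) : CQOutput (List Bool) :=
  ⟨C.qOut, ∑ w : Bits (Fin C.cOut), Finsupp.single (List.ofFn w) (C.outcome ρ w)⟩

/-! ### Descriptions of circuits by bit strings -/

/-- Reads `1^a 0 1^b 0 …` as `[a, b, …]` (`acc` counts the ones read since the last zero). -/
def readUnary : ℕ → List Bool → List ℕ
  | _, [] => []
  | acc, true :: l => readUnary (acc + 1) l
  | acc, false :: l => acc :: readUnary 0 l

/-- The wire with number `j`: input, classical output, quantum output and work wires are numbered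
consecutively. -/
def wireOf (n c m a j : ℕ) : Option (Wire n c m a) :=
  if h : j < n then some (.inl ⟨j, h⟩)
  else if h : j - n < c then some (.inr (.inl ⟨j - n, h⟩))
  else if h : j - n - c < m then some (.inr (.inr (.inl ⟨j - n - c, h⟩)))
  else if h : j - n - c - m < a then some (.inr (.inr (.inr ⟨j - n - c - m, h⟩)))
  else none

/-- The gate with code `g` on the wires `i`, `j`, `l` (a one- or two-qubit gate ignores the
superfluous arguments); `none` if this is not a gate. -/
def gateOf {W : Type} [DecidableEq W] (wire : ℕ → Option W) (g i j l : ℕ) : Option (Gate W) :=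
  match g with
  | 0 => (wire i).map .had
  | 1 => (wire i).map .phaseT
  | 2 => (wire i).map .phaseTdg
  | 3 => (wire i).map .not
  | 4 => (wire i).bind fun x => (wire j).bind fun y =>
      if h : x ≠ y then some (.cnot x y h) else none
  | 5 => (wire i).bind fun x => (wire j).bind fun y => (wire l).bind fun t =>
      if h : x ≠ t ∧ y ≠ t then some (.toffoli x y t h.1 h.2) else none
  | _ => none

/-- Reads the gates from consecutive blocks of four numbers; blocks that are not gates are
skipped. -/
def readGates {W : Type} [DecidableEq W] (wire : ℕ → Option W) : List ℕ → List (Gate W)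
  | g :: i :: j :: l :: rest => (gateOf wire g i j l).toList ++ readGates wire rest
  | _ => []

/-- The circuit with `n` input qubits described by a bit string: first the sizes of the classical
output, quantum output and work registers in unary, then the gates. -/
def circuitOf (n : ℕ) (d : List Bool) : Circuit n :=
  match readUnary 0 d with
  | c :: m :: a :: rest => ⟨c, m, a, readGates (wireOf n c m a) rest⟩
  | _ => ⟨0, 0, 0, []⟩

/-! ### Quantum polynomial-time algorithms -/

/-- A QPT algorithm taking `(1^κ, 1^t, ρ, z)`, as a polynomial-time uniform family of quantum
circuits: a classical machine computes from `1^κ`, `1^t`, the number `n` of qubits of `ρ` (in unary)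
and the string `z` the description of the circuit that is applied to `ρ`, in time polynomial in the
total input length. -/
structure QPT where
  descr : ℕ → ℕ → ℕ → List Bool → List Bool
  polyTime : ∃ (P : Prog) (p : Polynomial ℕ), ∀ (κ t n : ℕ) (z : List Bool),
    Computes P [unary κ, unary t, unary n, z] (descr κ t n z) (p.eval (κ + t + n + z.length))

/-- Density matrices of `n` qubits. -/
structure QState (n : ℕ) where
  mat : Op (Fin n)
  posSemidef : mat.PosSemidef
  trace_one : mat.trace = 1

/-- The output of the algorithm on `(1^κ, 1^t, ρ, z)`. -/
def QPT.run (A : QPT) (κ t : ℕ) {n : ℕ} (ρ : QState n) (z : List Bool) : CQOutput (List Bool) :=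
  (circuitOf n (A.descr κ t n z)).run ρ.mat

/-- A measured string as an element of `{0,1}* ∪ {⊥}`: `1s` stands for `s`, every other string for
`⊥` (that is, `none`). -/
def toValue : List Bool → Option (List Bool)
  | true :: s => some s
  | _ => none

/-- A measured string as a decision: `true` (that is, `⊤`) iff the first bit is `1`. -/
def toDecision (w : List Bool) : Bool := w.headD false

/-- `Γ_b(s)`. -/
def Gam (s : List Bool) (b : Bool) : Option (List Bool) := if b = true then some s else none

/-! ### Asymptotics and statistical closeness -/

/-- Noticeable functions. They are positive, since `1 ^ (f κ)⁻¹` occurs as an input. -/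
def Noticeable (f : ℕ → ℝ) : Prop :=
  (∀ κ, 0 < f κ ∧ f κ ≤ 1) ∧
    ∃ p : Polynomial ℕ, ∀ᶠ κ in atTop, 0 < p.eval κ ∧ 1 / ((p.eval κ : ℕ) : ℝ) ≤ f κ

def Negligible (f : ℕ → ℝ) : Prop :=
  (∀ κ, 0 ≤ f κ ∧ f κ ≤ 1) ∧
    ∀ p : Polynomial ℕ, p ≠ 0 → ∀ᶠ κ in atTop, f κ < 1 / ((p.eval κ : ℕ) : ℝ)

/-- The length of the error parameter `1^{f⁻¹}`, rounded up to an integer. -/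
def invLen (f : ℕ → ℝ) (κ : ℕ) : ℕ := ⌈(f κ)⁻¹⌉₊

/-- A (computationally unbounded) distinguisher: for every label and every number of qubits the
effect `0 ≤ E ≤ 1` of accepting. -/
structure Distinguisher (α : Type) where
  effect : (m : ℕ) → α → Op (Fin m)
  nonneg : ∀ m v, (effect m v).PosSemidef
  le_one : ∀ m v, (1 - effect m v).PosSemidef

def Distinguisher.acceptProb {α : Type} (D : Distinguisher α) (X : CQOutput α) : ℝ :=
  X.part.sum fun v ρ => (D.effect X.qubits v * ρ).trace.re

/-- `ε`-statistical indistinguishability of two ensembles. -/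
def StatClose {α : Type} (ε : ℕ → ℝ) (X Y : ℕ → CQOutput α) : Prop :=
  ∀ D : ℕ → Distinguisher α, ∃ ν : ℕ → ℝ, Negligible ν ∧
    ∀ κ, |(D κ).acceptProb (X κ) - (D κ).acceptProb (Y κ)| ≤ ε κ + ν κ

/-- A sequence of polynomial-size quantum states and classical strings. -/
structure PolySeq where
  n : ℕ → ℕ
  ρ : (κ : ℕ) → QState (n κ)
  z : ℕ → List Bool
  poly : ∃ p : Polynomial ℕ, ∀ κ, n κ ≤ p.eval κ ∧ (z κ).length ≤ p.eval κ

end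

end ExtractSim

open ExtractSim

/-! The simulator must learn `sstar z` from the input state and still have that state intact for the
simulated algorithm, and it must extract only when the algorithm accepts, which is not known
beforehand. Everything is therefore done coherently, and the decision is guessed.

Extraction. Let `R` be the effect that one run of the extractor on fresh ancillas fails. A round
runs the extractor, copies a success, undoes the run and records whether the ancillas are back at
zero. This alternates two projections, as in Marriott-Watrous rewinding. On an eigenvector of `R`
with eigenvalue `x` the first round fails with probability `x`, and each further one with
probability `x² + (1 - x)²`, averaged over the record. So failing in all of `m + 1` rounds has the
effect `φ = R (1 - 2R + 2R²)^m` (`failEff_succ`, `conj_failEff`, `crZero_ampOp_allFail`). What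
survives all failures is hard to extract from: `φ (1 - R) φ` has norm at most `1 / (2(m + 1))`. By
the assumption linking acceptance to extraction it is then also rarely accepted. This is
`norm_mul_failOp_le`: the acceptance amplitude `Y` satisfies `‖Y φ‖ ≤ √γ` as soon as `1 / (2(m + 1))
≤ γ δ`.

Restoring the input. The extractor never outputs a wrong value when its ancillas start at zero, and
this persists through all rounds although later rounds need not start there (`badK_mul_roundOp`,
`badC_mul_ampOp`). Hence every success carries the same string, and copying the first success
reveals nothing except whether all rounds failed. After the rounds are undone, the component with
clean registers is the input multiplied by `1 - φ` with the value written, plus the input multiplied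
by `φ` with nothing written (`ancZero_extractOp_mul_inp_true`).

Guessing. Guess bit and flag are put into uniform superposition, extraction is made if the guess is
`1`, and the algorithm is run. The good event is that the guess equals the decision, the flag is
`0`, the value is present exactly when the guess is `1`, and the registers are clean. For every
input its amplitude is one half of the amplitude of the simulated computation, up to the small term
`Y φ` (`guessOp_amplitude`). The flag serves to lower `1/√2` to `1/2 = sin(π/6)`, from which a
single step of oblivious amplitude amplification leads to `sin(π/2) = 1` (`amplification_eq`). The
result is within `4√γ` in operator norm of minus the target isometry (`norm_simOp_add_le`), so the
effects measured by any distinguisher differ by at most `8√γ`. A further `2γ` covers an extractor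
whose output register has the wrong length for the string. With `γ = 1 / (100 ⌈1/ε⌉²)` the sum is at
most `ε`, and no negligible term is needed.

The rest is realization. `Impl` says that gates on wires and auxiliary zeros implement an operator
cleanly. The circuit is written as a list of numeric blocks, and `PT` is a class of functions on
stores that contains the given machines and is closed under composition and bounded iteration, so
that the description is computed in polynomial time. -/

set_option linter.unusedSectionVars false
namespace ExtractSim

open Filter
open scoped ComplexOrder Matrix Matrix.Norms.L2Operator

/-! ### Running programs -/

/-- `P` takes `σ` to `σ'` within `T` steps. -/
def Runs (P : Prog) (σ : Store) (T : ℕ) (σ' : Store) : Prop := ∃ s ≤ T, Exec P σ s σ'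

theorem Runs.mono {P : Prog} {σ σ' : Store} {T T' : ℕ} (h : Runs P σ T σ') (hT : T ≤ T') :
    Runs P σ T' σ' := by
  obtain ⟨s, hs, h⟩ := h
  exact ⟨s, hs.trans hT, h⟩

theorem Runs.seq {P Q : Prog} {σ σ' σ'' : Store} {T T' : ℕ} (h : Runs P σ T σ')
    (h' : Runs Q σ' T' σ'') : Runs (.seq P Q) σ (T + T') σ'' := by
  obtain ⟨s, hs, h⟩ := h
  obtain ⟨s', hs', h'⟩ := h'
  exact ⟨s + s', by omega, .seq h h'⟩

theorem Runs.skip (σ : Store) : Runs .skip σ 1 σ := ⟨1, le_rfl, .skip σ⟩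

theorem Runs.push (σ : Store) (r : ℕ) (b : Bool) :
    Runs (.push r b) σ 1 (Function.update σ r (b :: σ r)) := ⟨1, le_rfl, .push σ r b⟩

theorem Runs.pop (σ : Store) (r : ℕ) :
    Runs (.pop r) σ 1 (Function.update σ r (σ r).tail) := ⟨1, le_rfl, .pop σ r⟩

theorem Runs.branch {r : ℕ} {Pe Pf Pt : Prog} {σ σ' : Store} {T : ℕ}
    (he : σ r = [] → Runs Pe σ T σ') (hf : ∀ l, σ r = false :: l → Runs Pf σ T σ')
    (ht : ∀ l, σ r = true :: l → Runs Pt σ T σ') : Runs (.branch r Pe Pf Pt) σ (T + 1) σ' := by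
  rcases hr : σ r with _ | ⟨_ | _, l⟩
  · obtain ⟨s, hs, h⟩ := he hr
    exact ⟨s + 1, by omega, .branch_empty hr h⟩
  · obtain ⟨s, hs, h⟩ := hf l hr
    exact ⟨s + 1, by omega, .branch_false (by simp [hr]) h⟩
  · obtain ⟨s, hs, h⟩ := ht l hr
    exact ⟨s + 1, by omega, .branch_true (by simp [hr]) h⟩

/-- A loop whose `i`-th pass leads from `S i` to `S (i + 1)`. -/
theorem Runs.loop {r : ℕ} {P : Prog} (S : ℕ → Store) (n T : ℕ)
    (hS : ∀ i < n, S i r ≠ [] ∧ Runs P (S i) T (S (i + 1))) (hn : S n r = []) :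
    Runs (.loop r P) (S 0) (n * (T + 1) + 1) (S n) := by
  induction n generalizing S with
  | zero => exact ⟨1, by omega, .loop_done hn⟩
  | succ n ih =>
    obtain ⟨h0, s, hs, h⟩ := hS 0 (by omega)
    obtain ⟨s', hs', h'⟩ := ih (fun i => S (i + 1)) (fun i hi => hS (i + 1) (by omega)) hn
    refine ⟨s + s' + 1, ?_, .loop_step h0 h h'⟩
    rw [Nat.succ_mul]
    omega

/-- A step pushes at most one bit. Running times thereby also bound the sizes of intermediate
results, which is what makes compositions polynomial. -/
theorem Exec.length_le {P : Prog} {σ σ' : Store} {s : ℕ} (h : Exec P σ s σ') (r : ℕ) :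
    (σ' r).length ≤ (σ r).length + s := by
  induction h with
  | skip => omega
  | push σ q b =>
    rcases eq_or_ne r q with rfl | hr
    · simp
    · simp [hr]
  | pop σ q =>
    rcases eq_or_ne r q with rfl | hr
    · simp; omega
    · simp [hr]
  | seq _ _ h1 h2 => omega
  | branch_empty _ _ h => omega
  | branch_false _ _ h => omega
  | branch_true _ _ h => omega
  | loop_done _ => omega
  | loop_step _ _ _ h1 h2 => omega

theorem Runs.length_le {P : Prog} {σ σ' : Store} {T : ℕ} (h : Runs P σ T σ') (r : ℕ) :
    (σ' r).length ≤ (σ r).length + T := by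
  obtain ⟨s, hs, h⟩ := h
  exact (h.length_le r).trans (by omega)

/-- A strict upper bound of the registers that occur in a program. -/
def Prog.bound : Prog → ℕ
  | .skip => 0
  | .push r _ => r + 1
  | .pop r => r + 1
  | .seq P Q => max P.bound Q.bound
  | .branch r P Q R => max (r + 1) (max P.bound (max Q.bound R.bound))
  | .loop r P => max (r + 1) P.bound

/-- Finitely many registers are at risk in a call, so finitely many have to be cleared afterwards.
-/
theorem Exec.eq_of_bound_le {P : Prog} {σ σ' : Store} {s : ℕ} (h : Exec P σ s σ') (r : ℕ)
    (hr : P.bound ≤ r) : σ' r = σ r := by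
  induction h with
  | skip => rfl
  | push σ q b =>
    have : r ≠ q := by simp only [Prog.bound] at hr; omega
    simp [this]
  | pop σ q =>
    have : r ≠ q := by simp only [Prog.bound] at hr; omega
    simp [this]
  | seq _ _ h1 h2 =>
    simp only [Prog.bound] at hr
    rw [h2 (by omega), h1 (by omega)]
  | branch_empty _ _ h => simp only [Prog.bound] at hr; exact h (by omega)
  | branch_false _ _ h => simp only [Prog.bound] at hr; exact h (by omega)
  | branch_true _ _ h => simp only [Prog.bound] at hr; exact h (by omega)
  | loop_done _ => rfl
  | loop_step _ _ _ h1 h2 =>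
    rw [h2 hr]
    simp only [Prog.bound] at hr
    exact h1 (by omega)

/-- Renaming of registers. -/
def Prog.rename (f : ℕ → ℕ) : Prog → Prog
  | .skip => .skip
  | .push r b => .push (f r) b
  | .pop r => .pop (f r)
  | .seq P Q => .seq (P.rename f) (Q.rename f)
  | .branch r P Q R => .branch (f r) (P.rename f) (Q.rename f) (R.rename f)
  | .loop r P => .loop (f r) (P.rename f)

/-- A machine cannot notice that its registers are a part of a larger store. Subroutines are run on
disjoint blocks of registers in this way. -/
theorem Exec.rename {f : ℕ → ℕ} (hf : Function.Injective f) {P : Prog} {σ σ' : Store} {s : ℕ}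
    (h : Exec P σ s σ') (τ : Store) (hτ : ∀ r, τ (f r) = σ r) :
    ∃ τ' : Store, Exec (P.rename f) τ s τ' ∧ (∀ r, τ' (f r) = σ' r) ∧
      ∀ r, r ∉ Set.range f → τ' r = τ r := by
  have upd : ∀ (σ τ : Store) (q : ℕ) (v : List Bool), (∀ r, τ (f r) = σ r) →
      (∀ r, Function.update τ (f q) v (f r) = Function.update σ q v r) ∧
        ∀ r, r ∉ Set.range f → Function.update τ (f q) v r = τ r := by
    refine fun σ τ q v h => ⟨fun r => ?_, fun r hr => ?_⟩
    · rcases eq_or_ne r q with rfl | hr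
      · simp
      · simp [hr, hf.ne hr, h]
    · rw [Function.update_of_ne]
      rintro rfl
      exact hr ⟨q, rfl⟩
  induction h generalizing τ with
  | skip σ => exact ⟨τ, .skip τ, hτ, fun _ _ => rfl⟩
  | push σ q b =>
    refine ⟨_, .push τ (f q) b, ?_⟩
    rw [hτ q]
    exact upd σ τ q _ hτ
  | pop σ q =>
    refine ⟨_, .pop τ (f q), ?_⟩
    rw [hτ q]
    exact upd σ τ q _ hτ
  | seq _ _ h1 h2 =>
    obtain ⟨τ1, e1, a1, b1⟩ := h1 τ hτ
    obtain ⟨τ2, e2, a2, b2⟩ := h2 τ1 a1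
    exact ⟨τ2, .seq e1 e2, a2, fun r hr => (b2 r hr).trans (b1 r hr)⟩
  | branch_empty h0 _ h =>
    obtain ⟨τ1, e1, a1, b1⟩ := h τ hτ
    exact ⟨τ1, .branch_empty (by rw [hτ, h0]) e1, a1, b1⟩
  | branch_false h0 _ h =>
    obtain ⟨τ1, e1, a1, b1⟩ := h τ hτ
    exact ⟨τ1, .branch_false (by rw [hτ, h0]) e1, a1, b1⟩
  | branch_true h0 _ h =>
    obtain ⟨τ1, e1, a1, b1⟩ := h τ hτ
    exact ⟨τ1, .branch_true (by rw [hτ, h0]) e1, a1, b1⟩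
  | loop_done h0 => exact ⟨τ, .loop_done (by rw [hτ, h0]), hτ, fun _ _ => rfl⟩
  | loop_step h0 _ _ h1 h2 =>
    obtain ⟨τ1, e1, a1, b1⟩ := h1 τ hτ
    obtain ⟨τ2, e2, a2, b2⟩ := h2 τ1 a1
    exact ⟨τ2, .loop_step (by rwa [hτ]) e1 e2, a2, fun r hr => (b2 r hr).trans (b1 r hr)⟩

/-! ### Elementary programs -/

def Prog.clear (r : ℕ) : Prog := .loop r (.pop r)

theorem runs_clear (σ : Store) (r : ℕ) :
    Runs (.clear r) σ (2 * (σ r).length + 1) (Function.update σ r []) := by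
  have := Runs.loop (r := r) (P := .pop r) (fun i => Function.update σ r ((σ r).drop i))
    (σ r).length 1 (fun i hi => ⟨by simpa using hi, by
      simpa [List.tail_drop] using Runs.pop (Function.update σ r ((σ r).drop i)) r⟩) (by simp)
  simp only [List.drop_zero, Function.update_eq_self, List.drop_length] at this
  exact this.mono (by omega)

/-- Clears the registers `a, …, a + n - 1`. -/
def Prog.clearRange (a : ℕ) : ℕ → Prog
  | 0 => .skip
  | n + 1 => .seq (Prog.clearRange a n) (.clear (a + n))

theorem runs_clearRange (σ : Store) (a n T : ℕ) (hT : ∀ r, (σ r).length ≤ T) :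
    Runs (.clearRange a n) σ (n * (2 * T + 1) + 1)
      (fun r => if a ≤ r ∧ r < a + n then [] else σ r) := by
  induction n with
  | zero =>
    have : (fun r => if a ≤ r ∧ r < a + 0 then [] else σ r) = σ := by
      funext r; rw [if_neg (by omega)]
    rw [this]
    exact (Runs.skip σ).mono (by omega)
  | succ n ih =>
    have h := runs_clear (fun r => if a ≤ r ∧ r < a + n then [] else σ r) (a + n)
    rw [if_neg (by omega)] at h
    have : (fun r => if a ≤ r ∧ r < a + (n + 1) then [] else σ r) =
        Function.update (fun r => if a ≤ r ∧ r < a + n then [] else σ r) (a + n) [] := by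
      funext r
      rcases eq_or_ne r (a + n) with rfl | hr
      · simp
      · simp only [Function.update_of_ne hr]
        congr 1
        apply propext
        omega
    rw [this]
    refine (ih.seq h).mono ?_
    have := hT (a + n)
    rw [Nat.succ_mul n (2 * T + 1)]
    omega

/-- Moves the contents of register `a` to register `b`, reversing them. -/
def Prog.moveRev (a b : ℕ) : Prog :=
  .loop a (.branch a .skip (.seq (.push b false) (.pop a)) (.seq (.push b true) (.pop a)))

theorem runs_moveRev (σ : Store) {a b : ℕ} (hab : a ≠ b) :
    Runs (.moveRev a b) σ (4 * (σ a).length + 1)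
      (Function.update (Function.update σ b ((σ a).reverse ++ σ b)) a []) := by
  have key : ∀ (l m : List Bool) (c : Bool) (τ : Store),
      Runs (.seq (.push b c) (.pop a))
        (Function.update (Function.update τ b m) a (c :: l)) 2
        (Function.update (Function.update τ b (c :: m)) a l) := by
    intro l m c τ
    have h1 := Runs.push (Function.update (Function.update τ b m) a (c :: l)) b c
    refine (h1.seq (Runs.pop _ a)).mono le_rfl |> fun h => ?_
    convert h using 1
    funext r
    rcases eq_or_ne r a with rfl | ha
    · simp [hab]
    · rcases eq_or_ne r b with rfl | hb
      · simp [hab.symm]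
      · simp [ha, hb]
  have := Runs.loop (r := a)
    (P := .branch a .skip (.seq (.push b false) (.pop a)) (.seq (.push b true) (.pop a)))
    (fun i => Function.update (Function.update σ b (((σ a).take i).reverse ++ σ b)) a
      ((σ a).drop i)) (σ a).length 3 ?_ (by simp)
  · simp only [List.drop_zero, List.drop_length, List.take_zero, List.reverse_nil,
      List.nil_append, Function.update_eq_self, List.take_length] at this
    exact this.mono (by omega)
  · intro i hi
    have hd : (σ a).drop i = (σ a)[i] :: (σ a).drop (i + 1) := List.drop_eq_getElem_cons hi
    have ht : ((σ a).take (i + 1)).reverse ++ σ b =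
        (σ a)[i] :: (((σ a).take i).reverse ++ σ b) := by
      rw [List.take_succ_eq_append_getElem hi]
      simp only [List.reverse_append, List.reverse_cons, List.reverse_nil, List.nil_append,
        List.cons_append]
    simp only [Function.update_self]
    refine ⟨by rw [hd]; exact List.cons_ne_nil _ _, ?_⟩
    rw [ht, hd]
    refine Runs.branch (T := 2) (fun h => by rw [Function.update_self] at h; exact absurd h (List.cons_ne_nil _ _))
      (fun l h => ?_) (fun l h => ?_)
    · simp only [Function.update_self, List.cons.injEq] at h
      rw [h.1]
      exact key _ _ _ _
    · simp only [Function.update_self, List.cons.injEq] at h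
      rw [h.1]
      exact key _ _ _ _

/-- Copies the contents of register `a` to register `b`, with an auxiliary register `c`. -/
def Prog.copy (a b c : ℕ) : Prog :=
  .seq (.moveRev a c) (.loop c (.branch c .skip
    (.seq (.pop c) (.seq (.push a false) (.push b false)))
    (.seq (.pop c) (.seq (.push a true) (.push b true)))))

/-- Emptying `a` into `c` reverses the string; emptying `c` onto both `a` and `b` reverses it again,
so `a` is restored. -/
theorem runs_copy (σ : Store) {a b c : ℕ} (hab : a ≠ b) (hac : a ≠ c) (hbc : b ≠ c)
    (hb : σ b = []) (hc : σ c = []) :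
    Runs (.copy a b c) σ (9 * (σ a).length + 2) (Function.update σ b (σ a)) := by
  set L := (σ a).reverse with hL
  have key : ∀ (l m : List Bool) (x : Bool),
      Runs (.seq (.pop c) (.seq (.push a x) (.push b x)))
        (Function.update (Function.update (Function.update σ a m) b m) c (x :: l)) 3
        (Function.update (Function.update (Function.update σ a (x :: m)) b (x :: m)) c l) := by
    intro l m x
    have h := (Runs.pop (Function.update (Function.update (Function.update σ a m) b m) c
      (x :: l)) c).seq ((Runs.push _ a x).seq (Runs.push _ b x))
    convert h using 1
    funext r
    rcases eq_or_ne r a with rfl | ha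
    · simp [hab, hac]
    · rcases eq_or_ne r b with rfl | hb'
      · simp [hab.symm, hbc]
      · rcases eq_or_ne r c with rfl | hc'
        · simp [hac.symm, hbc.symm]
        · simp [ha, hb', hc']
  have h1 := runs_moveRev σ hac
  have h2 := Runs.loop (r := c) (P := (.branch c .skip
    (.seq (.pop c) (.seq (.push a false) (.push b false)))
    (.seq (.pop c) (.seq (.push a true) (.push b true)))))
    (fun i => Function.update (Function.update (Function.update σ a (L.take i).reverse) b
      (L.take i).reverse) c (L.drop i)) L.length 4 ?_ (by simp)
  · refine ((h1.seq (T' := L.length * 5 + 1) (σ'' := Function.update σ b (σ a)) ?_).mono ?_)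
    · convert h2 using 1
      · funext r
        rcases eq_or_ne r a with rfl | ha
        · simp [hab, hac]
        · rcases eq_or_ne r b with rfl | hb'
          · simp [hab.symm, hbc, hb]
          · rcases eq_or_ne r c with rfl | hc'
            · simp [hac.symm, hc, L]
            · simp [ha, hb', hc']
      · funext r
        rcases eq_or_ne r a with rfl | ha
        · simp [hab, hac, L, List.take_of_length_le]
        · rcases eq_or_ne r b with rfl | hb'
          · simp [hbc, L, List.take_of_length_le]
          · rcases eq_or_ne r c with rfl | hc'
            · simp [hbc.symm, hc]
            · simp [ha, hb', hc']
    · simp only [hL, List.length_reverse]; omega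
  · intro i hi
    have hd : L.drop i = L[i] :: L.drop (i + 1) := List.drop_eq_getElem_cons hi
    have ht : (L.take (i + 1)).reverse = L[i] :: (L.take i).reverse := by
      rw [List.take_succ_eq_append_getElem hi]
      simp only [List.reverse_append, List.reverse_cons, List.reverse_nil, List.nil_append,
        List.cons_append]
    simp only [Function.update_self]
    refine ⟨by rw [hd]; exact List.cons_ne_nil _ _, ?_⟩
    rw [ht, hd]
    refine Runs.branch (T := 3) (fun h => by rw [Function.update_self] at h; exact absurd h (List.cons_ne_nil _ _))
      (fun l h => ?_) (fun l h => ?_)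
    · simp only [Function.update_self, List.cons.injEq] at h
      rw [h.1]
      exact key _ _ _
    · simp only [Function.update_self, List.cons.injEq] at h
      rw [h.1]
      exact key _ _ _

/-! ### Functions of the first registers that are computable in polynomial time -/

theorem eval_mono (p : Polynomial ℕ) {a b : ℕ} (h : a ≤ b) : p.eval a ≤ p.eval b := by
  rw [Polynomial.eval_eq_sum, Polynomial.eval_eq_sum]
  exact Finset.sum_le_sum fun i _ => Nat.mul_le_mul le_rfl (Nat.pow_le_pow_left h i)

/-- Total length of the first `k` registers. -/
def sz (k : ℕ) (σ : Store) : ℕ := ∑ r ∈ Finset.range k, (σ r).length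

theorem length_le_sz {k : ℕ} (σ : Store) {r : ℕ} (hr : r < k) : (σ r).length ≤ sz k σ :=
  Finset.single_le_sum (f := fun r => (σ r).length) (fun _ _ => Nat.zero_le _)
    (Finset.mem_range.2 hr)

/-- The registers from `k` on are empty. -/
def EmptyFrom (k : ℕ) (σ : Store) : Prop := ∀ r, k ≤ r → σ r = []

/-- Forgets the contents of the registers from `k` on. -/
def trunc (k : ℕ) (σ : Store) : Store := fun r => if r < k then σ r else []

theorem trunc_eq_self {k : ℕ} {σ : Store} (h : EmptyFrom k σ) : trunc k σ = σ := by
  funext r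
  by_cases hr : r < k
  · simp [trunc, hr]
  · simp [trunc, hr, h r (by omega)]

theorem emptyFrom_trunc (k : ℕ) (σ : Store) : EmptyFrom k (trunc k σ) := fun r hr => by
  simp [trunc, Nat.not_lt.2 hr]

theorem sz_trunc (k : ℕ) (σ : Store) : sz k (trunc k σ) = sz k σ :=
  Finset.sum_congr rfl fun r hr => by simp [trunc, Finset.mem_range.1 hr]

/-- A program that, started with all registers from `k` on empty, appends the value of `f` as
register `k` and changes nothing else, in time polynomial in the total length of the first `k`
registers. -/
def PT (k : ℕ) (f : Store → List Bool) : Prop :=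
  ∃ (P : Prog) (p : Polynomial ℕ), ∀ σ, EmptyFrom k σ →
    Runs P σ (p.eval (sz k σ)) (Function.update σ k (f σ))

theorem PT.congr {k : ℕ} {f g : Store → List Bool} (h : PT k f)
    (hfg : ∀ σ, EmptyFrom k σ → f σ = g σ) : PT k g := by
  obtain ⟨P, p, h⟩ := h
  exact ⟨P, p, fun σ hσ => hfg σ hσ ▸ h σ hσ⟩

/-- The result may be put into any register `b ≥ k`. -/
theorem PT.at {k : ℕ} {f : Store → List Bool} (h : PT k f) {b : ℕ} (hb : k ≤ b) :
    ∃ (P : Prog) (p : Polynomial ℕ), ∀ σ, EmptyFrom b σ →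
      Runs P σ (p.eval (sz k σ)) (Function.update σ b (f (trunc k σ))) := by
  obtain ⟨P, p, h⟩ := h
  -- The registers between `k` and `b` lie outside the range of the renaming and are preserved.
  let ren : ℕ → ℕ := fun r => if r < k then r else r + (b - k)
  have hren : Function.Injective ren := by
    intro r s hrs
    simp only [ren] at hrs
    split_ifs at hrs <;> omega
  refine ⟨P.rename ren, p, fun σ hσ => ?_⟩
  obtain ⟨s, hs, he⟩ := h (trunc k σ) (emptyFrom_trunc k σ)
  rw [sz_trunc] at hs
  obtain ⟨τ, h1, h2, h3⟩ := he.rename hren σ (fun r => by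
    by_cases hr : r < k
    · simp [ren, trunc, hr]
    · simp only [ren, trunc, hr, if_false]
      exact hσ _ (by omega))
  have : τ = Function.update σ b (f (trunc k σ)) := by
    funext r
    by_cases hr : r < k
    · have := h2 r
      rw [Function.update_of_ne (by omega)] at this
      simp only [ren, trunc, hr, if_true] at this
      rw [this, Function.update_of_ne (by omega)]
    · by_cases hr' : r < b
      · rw [Function.update_of_ne (by omega), h3]
        rintro ⟨s, rfl⟩
        simp only [ren] at hr hr'
        split_ifs at hr hr' <;> omega
      · have := h2 (r - (b - k))
        simp only [ren, show ¬ r - (b - k) < k by omega, if_false,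
          show r - (b - k) + (b - k) = r by omega] at this
        rw [this]
        rcases eq_or_ne r b with rfl | hrb
        · rw [show r - (r - k) = k by omega]; simp
        · rw [Function.update_of_ne (by omega), Function.update_of_ne hrb, hσ r (by omega)]
          exact emptyFrom_trunc k σ _ (by omega)
  exact ⟨s, hs, this ▸ h1⟩

theorem EmptyFrom.update {k b : ℕ} {σ : Store} (h : EmptyFrom k σ) (hb : b < k)
    (v : List Bool) : EmptyFrom k (Function.update σ b v) := fun r hr => by
  rw [Function.update_of_ne (by omega), h r hr]

theorem EmptyFrom.mono {k b : ℕ} {σ : Store} (h : EmptyFrom k σ) (hb : k ≤ b) :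
    EmptyFrom b σ := fun r hr => h r (hb.trans hr)

theorem trunc_update {k b : ℕ} {σ : Store} (hb : k ≤ b) (v : List Bool) :
    trunc k (Function.update σ b v) = trunc k σ := by
  funext r
  by_cases hr : r < k
  · simp [trunc, hr, show r ≠ b by omega]
  · simp [trunc, hr]

theorem sz_update {k b : ℕ} {σ : Store} (hb : k ≤ b) (v : List Bool) :
    sz k (Function.update σ b v) = sz k σ :=
  Finset.sum_congr rfl fun r hr => by
    rw [Function.update_of_ne (by have := Finset.mem_range.1 hr; omega)]

theorem PT.nil (k : ℕ) : PT k fun _ => [] := by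
  refine ⟨.skip, 1, fun σ hσ => ?_⟩
  have : Function.update σ k [] = σ := by
    rw [← hσ k le_rfl, Function.update_eq_self]
  rw [this]
  simpa using Runs.skip σ

theorem PT.cons {k : ℕ} {f : Store → List Bool} (b : Bool) (hf : PT k f) :
    PT k fun σ => b :: f σ := by
  obtain ⟨P, p, h⟩ := hf
  refine ⟨.seq P (.push k b), p + 1, fun σ hσ => ?_⟩
  have := (h σ hσ).seq (Runs.push _ k b)
  simpa using this

theorem PT.var {k i : ℕ} (hi : i < k) : PT k fun σ => σ i := by
  refine ⟨.copy i k (k + 1), 9 * Polynomial.X + 2, fun σ hσ => ?_⟩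
  refine (runs_copy σ (by omega) (by omega) (by omega) (hσ k le_rfl)
    (hσ (k + 1) (by omega))).mono ?_
  have := length_le_sz σ hi
  simp only [Polynomial.eval_add, Polynomial.eval_mul, Polynomial.eval_ofNat, Polynomial.eval_X]
  omega

/-- The suffix is computed first, because the prefix can then be pushed on top of it; two reversals
through `k + 2` keep its order. -/
theorem PT.append {k : ℕ} {f g : Store → List Bool} (hf : PT k f) (hg : PT k g) :
    PT k fun σ => f σ ++ g σ := by
  obtain ⟨Q, q, h⟩ := hg
  obtain ⟨P, p, h'⟩ := hf.at (b := k + 1) (by omega)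
  refine ⟨.seq (.seq Q P) (.seq (.moveRev (k + 1) (k + 2)) (.moveRev (k + 2) k)),
    q + 9 * p + 2, fun σ hσ => ?_⟩
  have h1 := h σ hσ
  have h2 := h' (Function.update σ k (g σ)) ((hσ.mono (by omega)).update (by omega) _)
  rw [trunc_update le_rfl, trunc_eq_self hσ, sz_update le_rfl] at h2
  have h3 := runs_moveRev (Function.update (Function.update σ k (g σ)) (k + 1) (f σ))
    (a := k + 1) (b := k + 2) (by omega)
  have h4 := runs_moveRev (Function.update (Function.update (Function.update (Function.update σ k
    (g σ)) (k + 1) (f σ)) (k + 2) ((Function.update (Function.update σ k (g σ)) (k + 1) (f σ)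
    (k + 1)).reverse ++ (Function.update (Function.update σ k (g σ)) (k + 1) (f σ) (k + 2))))
    (k + 1) []) (a := k + 2) (b := k) (by omega)
  have hl := h2.length_le (k + 1)
  have hk2 := hσ (k + 2) (by omega)
  have hk1 := hσ (k + 1) (by omega)
  simp only [Function.update_self, ne_eq, Nat.add_eq_left, one_ne_zero, not_false_eq_true,
    Function.update_of_ne, hk1, List.length_nil] at hl
  have h5 := (h1.seq h2).seq (h3.seq h4)
  simp [hk2] at h5
  have := h5.mono (T' := (q + 9 * p + 2).eval (sz k σ)) (by simp; omega)
  convert this using 1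
  funext r
  rcases eq_or_ne r k with rfl | h0
  · simp
  · rcases eq_or_ne r (k + 1) with rfl | h1
    · simp [hk1]
    · rcases eq_or_ne r (k + 2) with rfl | h2
      · simp [hk2]
      · simp [h0, h1, h2]

theorem PT.drop {k : ℕ} {f g : Store → List Bool} (hf : PT k f) (hg : PT k g) :
    PT k fun σ => (g σ).drop (f σ).length := by
  obtain ⟨Q, q, h⟩ := hg
  obtain ⟨P, p, h'⟩ := hf.at (b := k + 1) (by omega)
  refine ⟨.seq (.seq Q P) (.loop (k + 1) (.seq (.pop (k + 1)) (.pop k))),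
    q + 4 * p + 1, fun σ hσ => ?_⟩
  have h1 := h σ hσ
  have h2 := h' (Function.update σ k (g σ)) ((hσ.mono (by omega)).update (by omega) _)
  rw [trunc_update le_rfl, trunc_eq_self hσ, sz_update le_rfl] at h2
  have hl := h2.length_le (k + 1)
  have hk1 := hσ (k + 1) (by omega)
  simp only [Function.update_self, ne_eq, Nat.add_eq_left, one_ne_zero, not_false_eq_true,
    Function.update_of_ne, hk1, List.length_nil] at hl
  have h3 := Runs.loop (r := k + 1) (P := .seq (.pop (k + 1)) (.pop k))
    (fun i => Function.update (Function.update σ k ((g σ).drop i)) (k + 1) ((f σ).drop i))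
    (f σ).length 2 (fun i hi => ⟨by simpa using hi, by
      have := (Runs.pop (Function.update (Function.update σ k ((g σ).drop i)) (k + 1)
        ((f σ).drop i)) (k + 1)).seq (Runs.pop _ k)
      convert this using 1
      funext r
      rcases eq_or_ne r k with rfl | h0
      · simp
      · rcases eq_or_ne r (k + 1) with rfl | h1
        · simp
        · simp [h0, h1]⟩) (by simp)
  simp only [List.drop_zero, List.drop_length] at h3
  have h5 := ((h1.seq h2).seq h3).mono (T' := (q + 4 * p + 1).eval (sz k σ)) (by simp; omega)
  convert h5 using 1
  funext r
  rcases eq_or_ne r (k + 1) with rfl | h1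
  · simp [hk1]
  · simp [h1]

theorem PT.case {k : ℕ} {x f g h : Store → List Bool} (hx : PT k x) (hf : PT k f) (hg : PT k g)
    (hh : PT k h) : PT k fun σ => match x σ with
      | [] => f σ
      | false :: _ => g σ
      | true :: _ => h σ := by
  obtain ⟨X, px, hx⟩ := hx
  obtain ⟨P, p, hf⟩ := hf
  obtain ⟨Q, q, hg⟩ := hg
  obtain ⟨R, r, hh⟩ := hh
  refine ⟨.seq X (.branch k P (.seq (.clear k) Q) (.seq (.clear k) R)),
    3 * px + p + q + r + 2, fun σ hσ => ?_⟩
  have h1 := hx σ hσ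
  have hl := h1.length_le k
  have hk := hσ k le_rfl
  simp only [Function.update_self, hk, List.length_nil] at hl
  have h2 := runs_clear (Function.update σ k (x σ)) k
  have hself : Function.update σ k [] = σ := by rw [← hk, Function.update_eq_self]
  simp only [Function.update_self, Function.update_idem, hself] at h2
  have h3 : Runs (.branch k P (.seq (.clear k) Q) (.seq (.clear k) R))
      (Function.update σ k (x σ)) (2 * px.eval (sz k σ) + 1 + (p + q + r).eval (sz k σ) + 1)
      (Function.update σ k (match x σ with
        | [] => f σ
        | false :: _ => g σ
        | true :: _ => h σ)) := by
    rw [Polynomial.eval_add, Polynomial.eval_add]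
    refine Runs.branch ?_ ?_ ?_
    · intro he
      rw [Function.update_self] at he
      rw [he, hself]
      exact Runs.mono (hf σ hσ) (by omega)
    · intro l he
      rw [Function.update_self] at he
      have := Runs.mono (h2.seq (hg σ hσ)) (T' := 2 * px.eval (sz k σ) + 1 + (p.eval (sz k σ) +
        q.eval (sz k σ) + r.eval (sz k σ))) (by omega)
      simpa only [he] using this
    · intro l he
      rw [Function.update_self] at he
      have := Runs.mono (h2.seq (hh σ hσ)) (T' := 2 * px.eval (sz k σ) + 1 + (p.eval (sz k σ) +
        q.eval (sz k σ) + r.eval (sz k σ))) (by omega)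
      simpa only [he] using this
  refine Runs.mono (h1.seq h3) ?_
  simp only [Polynomial.eval_add, Polynomial.eval_mul, Polynomial.eval_ofNat]
  omega

/-- Each argument depends only on the first `k` registers, so those already written do not disturb
the next ones. -/
theorem PT.args {k m : ℕ} {g : ℕ → Store → List Bool} (hg : ∀ i < m, PT k (g i)) :
    ∃ (P : Prog) (p : Polynomial ℕ), ∀ σ, EmptyFrom k σ → Runs P σ (p.eval (sz k σ))
      (fun r => if k ≤ r ∧ r < k + m then g (r - k) σ else σ r) := by
  induction m with
  | zero =>
    refine ⟨.skip, 1, fun σ hσ => ?_⟩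
    have : (fun r => if k ≤ r ∧ r < k + 0 then g (r - k) σ else σ r) = σ := by
      funext r; rw [if_neg (by omega)]
    rw [this]
    simpa using Runs.skip σ
  | succ m ih =>
    obtain ⟨P, p, hP⟩ := ih fun i hi => hg i (by omega)
    obtain ⟨Q, q, hQ⟩ := (hg m (by omega)).at (b := k + m) (by omega)
    refine ⟨.seq P Q, p + q, fun σ hσ => ?_⟩
    set τ : Store := fun r => if k ≤ r ∧ r < k + m then g (r - k) σ else σ r with hτ
    have ht : trunc k τ = σ := by
      rw [← trunc_eq_self hσ]
      funext r
      by_cases hr : r < k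
      · simp [trunc, hr, hτ, show ¬ k ≤ r by omega]
      · simp [trunc, hr]
    have hs : sz k τ = sz k σ := by rw [← sz_trunc, ht]
    have h2 := hQ τ (fun r hr => by simp only [hτ]; rw [if_neg (by omega), hσ r (by omega)])
    rw [ht, hs] at h2
    have := (hP σ hσ).seq h2
    rw [← Polynomial.eval_add] at this
    convert this using 1
    funext r
    rcases eq_or_ne r (k + m) with rfl | hr
    · simp
    · rw [Function.update_of_ne hr]
      simp only [hτ]
      congr 1
      apply propext
      omega

/-- Calling a polynomial-time machine on polynomial-time computable arguments. -/
theorem PT.call {k m : ℕ} {g : ℕ → Store → List Bool} (hg : ∀ i < m, PT k (g i))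
    {f : Store → List Bool} {P : Prog} {q : Polynomial ℕ}
    (h : ∀ σ, EmptyFrom k σ → Computes P ((List.range m).map fun i => g i σ) (f σ)
      (q.eval (∑ i ∈ Finset.range m, (g i σ).length))) : PT k f := by
  obtain ⟨A, p, hA⟩ := PT.args hg
  -- The machine works on the registers from `k` on and leaves its output in `k`. Beyond `P.bound +
  -- m` further registers there is neither an argument nor a trace of the machine, so clearing these
  -- restores emptiness.
  refine ⟨.seq A (.seq (P.rename (k + ·)) (.clearRange (k + 1) (P.bound + m))),
    p + (q.comp ((m : Polynomial ℕ) * p) + (((P.bound + m : ℕ) : Polynomial ℕ) * (2 * (Polynomial.X + p + q.comp ((m : Polynomial ℕ) * p)) + 1) + 1)),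
    fun σ hσ => ?_⟩
  have h1 := hA σ hσ
  set τ : Store := fun r => if k ≤ r ∧ r < k + m then g (r - k) σ else σ r with hτ
  obtain ⟨s, hs, σ', hex, hout⟩ := h σ hσ
  have hlen : ∀ i ∈ Finset.range m, (g i σ).length ≤ p.eval (sz k σ) := by
    intro i hi
    have hi := Finset.mem_range.1 hi
    have := h1.length_le (k + i)
    simpa [hτ, hi, hσ (k + i) (by omega)] using this
  have hs' : s ≤ (q.comp ((m : Polynomial ℕ) * p)).eval (sz k σ) := by
    refine hs.trans ?_
    rw [Polynomial.eval_comp]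
    refine eval_mono q ((Finset.sum_le_card_nsmul _ _ _ hlen).trans ?_)
    simp
  have hinit : ∀ r, τ (k + r) = Store.init ((List.range m).map fun i => g i σ) r := by
    intro r
    simp only [hτ, Store.init]
    by_cases hr : r < m
    · simp [hr]
    · simp [hr, hσ (k + r) (by omega)]
  obtain ⟨τ', e1, e2, e3⟩ := hex.rename (f := (k + ·)) (add_right_injective k) τ hinit
  -- The cost of clearing depends on the lengths that the call leaves behind; these are bounded by
  -- input length plus time.
  have hT : ∀ r, (τ' r).length ≤ (Polynomial.X + p + q.comp ((m : Polynomial ℕ) * p)).eval (sz k σ) := by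
    intro r
    have a1 := e1.length_le r
    have a2 := h1.length_le r
    have a3 : (σ r).length ≤ sz k σ := by
      by_cases hr : r < k
      · exact length_le_sz σ hr
      · simp [hσ r (by omega)]
    simp only [Polynomial.eval_add, Polynomial.eval_X]
    omega
  have h2 := runs_clearRange τ' (k + 1) (P.bound + m) _ hT
  have h3 := h1.seq (Runs.seq ⟨s, hs', e1⟩ h2)
  convert h3 using 1
  · simp
  · funext r
    by_cases hr : r < k
    · rw [Function.update_of_ne (by omega), if_neg (by omega), e3 r (by rintro ⟨x, rfl⟩; simp at hr)]
      simp [hτ, show ¬ k ≤ r by omega]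
    · obtain ⟨x, rfl⟩ := Nat.exists_eq_add_of_le (Nat.le_of_not_lt hr)
      rcases x with _ | x
      · simp only [Nat.add_zero, Function.update_self]
        rw [if_neg (by omega), ← hout]
        exact (e2 0).symm
      · rw [Function.update_of_ne (by omega), hσ _ (by omega)]
        by_cases hx : x < P.bound + m
        · rw [if_pos (by omega)]
        · rw [if_neg (by omega), e2 (x + 1), hex.eq_of_bound_le _ (by omega), Store.init,
            List.getD_eq_default _ _ (by simp; omega)]

/-- Passage to the convention of `Computes`, with the output in register `0`: the first input is
cleared and the result moved there by two reversals. -/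
theorem PT.computes {k : ℕ} (hk : 0 < k) {f : Store → List Bool} (hf : PT k f) :
    ∃ (P : Prog) (p : Polynomial ℕ), ∀ v : List (List Bool), v.length = k →
      Computes P v (f (Store.init v)) (p.eval (v.map List.length).sum) := by
  obtain ⟨P, p, h⟩ := hf
  refine ⟨.seq P (.seq (.clear 0) (.seq (.moveRev k (k + 1)) (.moveRev (k + 1) 0))),
    9 * p + 2 * (Polynomial.X + p) + 3, ?_⟩
  intro v hv
  set σ := Store.init v with hσ'
  have hσ : EmptyFrom k σ := fun r hr => List.getD_eq_default _ _ (by omega)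
  have hsz : sz k σ = (v.map List.length).sum := by
    subst hv
    rw [sz, Finset.sum_range, ← List.sum_ofFn]
    congr 1
    apply List.ext_getElem
    · simp
    · intro i h1 h2
      simp [hσ', Store.init]
  rw [← hsz]
  have h1 := h σ hσ
  have hl := h1.length_le k
  simp only [Function.update_self, hσ k le_rfl, List.length_nil, zero_add] at hl
  have h0 : (Function.update σ k (f σ) 0).length ≤ (Polynomial.X + p).eval (sz k σ) := by
    have := h1.length_le 0
    have := length_le_sz σ hk
    simp only [Polynomial.eval_add, Polynomial.eval_X]
    omega
  have h2 := runs_clear (Function.update σ k (f σ)) 0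
  set σ2 := Function.update (Function.update σ k (f σ)) 0 [] with hσ2
  have h3 := runs_moveRev σ2 (a := k) (b := k + 1) (by omega)
  set σ3 := Function.update (Function.update σ2 (k + 1) ((σ2 k).reverse ++ σ2 (k + 1))) k []
    with hσ3
  have h4 := runs_moveRev σ3 (a := k + 1) (b := 0) (by omega)
  have e2 : σ2 k = f σ := by rw [hσ2, Function.update_of_ne (by omega), Function.update_self]
  have e3 : σ3 (k + 1) = (f σ).reverse := by
    rw [hσ3, Function.update_of_ne (by omega), Function.update_self, e2]
    simp [hσ2, hσ (k + 1) (by omega)]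
  have e0 : σ3 0 = [] := by simp [hσ3, hσ2, show (0 : ℕ) ≠ k by omega]
  obtain ⟨s, hs, he⟩ := h1.seq (h2.seq (h3.seq h4))
  refine ⟨s, hs.trans ?_, _, he, ?_⟩
  · rw [e2, e3]
    simp only [Polynomial.eval_add, Polynomial.eval_X, Polynomial.eval_mul, List.length_reverse,
      Polynomial.eval_ofNat] at h0 ⊢
    omega
  · simp [e3, e0]

theorem length_unary (k : ℕ) : (unary k).length = k := by simp [unary]

/-- The only loop from which the functions below are built. The number of passes is the length of a
computed string, and the accumulator grows by a polynomially bounded amount per pass, so the total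
time is polynomial. -/
theorem PT.flatMap {k : ℕ} {x F : Store → List Bool} (hx : PT k x) (hF : PT (k + 1) F) :
    PT k fun σ => (List.range (x σ).length).flatMap fun i =>
      F (Function.update σ k (unary i)) := by
  obtain ⟨X, px, hx⟩ := hx
  obtain ⟨P, p, hF⟩ := hF
  -- Registers `k` and `k + 1` are kept for the loop: the body finds the counter in `k + 2` and
  -- leaves its result in `k + 3`.
  let ren : ℕ → ℕ := fun r => if r < k then r else r + 2
  have hren : Function.Injective ren := by
    intro r s hrs
    simp only [ren] at hrs
    split_ifs at hrs <;> omega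
  let pF := p.comp (Polynomial.X + px)
  refine ⟨.seq X (.seq (.loop k (.seq (P.rename ren) (.seq (.moveRev (k + 3) (k + 1))
    (.seq (.push (k + 2) true) (.pop k))))) (.seq (.clear (k + 2)) (.moveRev (k + 1) k))),
    px + (px * (5 * pF + 4) + 1) + (2 * px + 1) + (4 * (px * pF) + 1), fun σ hσ => ?_⟩
  have h1 := hx σ hσ
  have hl := h1.length_le k
  simp only [Function.update_self, hσ k le_rfl, List.length_nil, zero_add] at hl
  set n := (x σ).length with hn
  have hF' : ∀ i ≤ n, Runs P (Function.update σ k (unary i)) (pF.eval (sz k σ))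
      (Function.update (Function.update σ k (unary i)) (k + 1)
        (F (Function.update σ k (unary i)))) := by
    intro i hi
    refine (hF _ ((hσ.mono (by omega)).update (by omega) _)).mono ?_
    simp only [pF, Polynomial.eval_comp]
    refine eval_mono p ?_
    rw [sz, Finset.sum_range_succ, Function.update_self, length_unary]
    change sz k _ + i ≤ _
    rw [sz_update le_rfl, Polynomial.eval_add, Polynomial.eval_X]
    omega
  have hFl : ∀ i ≤ n, (F (Function.update σ k (unary i))).length ≤ pF.eval (sz k σ) := by
    intro i hi
    have := (hF' i hi).length_le (k + 1)
    simpa [hσ (k + 1) (by omega)] using this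
  let acc : ℕ → List Bool := fun i =>
    (List.range i).flatMap fun i => F (Function.update σ k (unary i))
  have hacc : ∀ i, acc (i + 1) = acc i ++ F (Function.update σ k (unary i)) := by
    intro i; simp [acc, List.range_succ, List.flatMap_append]
  have haccl : ∀ i ≤ n, (acc i).length ≤ i * pF.eval (sz k σ) := by
    intro i
    induction i with
    | zero => simp [acc]
    | succ i ih =>
      intro hi
      rw [hacc, List.length_append, Nat.succ_mul]
      have := ih (by omega)
      have := hFl i (by omega)
      omega
  -- The accumulator is stored reversed, so that one reversing move appends a new piece.
  let S : ℕ → Store := fun i => Function.update (Function.update (Function.update σ k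
    ((x σ).drop i)) (k + 1) (acc i).reverse) (k + 2) (unary i)
  have hloop := Runs.loop (r := k) (P := .seq (P.rename ren) (.seq (.moveRev (k + 3) (k + 1))
    (.seq (.push (k + 2) true) (.pop k)))) S n (5 * pF.eval (sz k σ) + 3) ?_ (by simp [S, hn])
  · have hS0 : S 0 = Function.update σ k (x σ) := by
      funext r
      rcases eq_or_ne r (k + 2) with rfl | h2
      · simp [S, unary, hσ (k + 2) (by omega)]
      · rcases eq_or_ne r (k + 1) with rfl | h1
        · simp [S, acc, hσ (k + 1) (by omega)]
        · simp [S, h1, h2]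
    rw [hS0] at hloop
    have h2 := runs_clear (S n) (k + 2)
    have h3 := runs_moveRev (Function.update (S n) (k + 2) []) (a := k + 1) (b := k) (by omega)
    have e1 : S n (k + 2) = unary n := by simp [S]
    have e2 : Function.update (S n) (k + 2) [] (k + 1) = (acc n).reverse := by simp [S]
    have e3 : Function.update (S n) (k + 2) [] k = [] := by simp [S, hn]
    rw [e2, e3, List.reverse_reverse, List.append_nil, List.length_reverse] at h3
    rw [e1, length_unary] at h2
    have h4 := h1.seq (hloop.seq (h2.seq h3))
    have hfin : Function.update σ k (acc n) = Function.update (Function.update (Function.update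
        (S n) (k + 2) []) k (acc n)) (k + 1) [] := by
      funext r
      rcases eq_or_ne r (k + 2) with rfl | h2
      · simp [hσ (k + 2) (by omega)]
      · rcases eq_or_ne r (k + 1) with rfl | h1
        · simp [hσ (k + 1) (by omega)]
        · rcases eq_or_ne r k with rfl | h0
          · simp
          · simp [S, h0, h1, h2]
    rw [← hfin] at h4
    refine h4.mono ?_
    have m1 : n * (5 * pF.eval (sz k σ) + 3 + 1) ≤ px.eval (sz k σ) * (5 * pF.eval (sz k σ) + 4) :=
      Nat.mul_le_mul_right _ hl
    have m2 := (haccl n le_rfl).trans (Nat.mul_le_mul_right (pF.eval (sz k σ)) hl)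
    simp only [Polynomial.eval_add, Polynomial.eval_mul, Polynomial.eval_ofNat,
      Polynomial.eval_one]
    omega
  · intro i hi
    have hSk : S i k = (x σ).drop i := by simp [S]
    refine ⟨by rw [hSk]; simpa [hn] using hi, ?_⟩
    obtain ⟨s, hs, he⟩ := hF' i hi.le
    obtain ⟨τ, t1, t2, t3⟩ := he.rename hren (S i) (fun r => by
      by_cases hr : r < k
      · simp [ren, hr, S, show r ≠ k by omega, show r ≠ k + 1 by omega, show r ≠ k + 2 by omega]
      · rcases eq_or_ne r k with rfl | hrk
        · simp [ren, S]
        · have a1 : r + 2 ≠ k := by omega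
          have a2 : r + 2 ≠ k + 1 := by omega
          have a3 : r + 2 ≠ k + 2 := by omega
          simp only [ren, hr, if_false, S, ne_eq, a1, a2, a3, hrk, not_false_eq_true,
            Function.update_of_ne]
          rw [hσ _ (by omega), hσ _ (by omega)])
    have hτ : τ = Function.update (S i) (k + 3) (F (Function.update σ k (unary i))) := by
      funext r
      by_cases hr : r < k
      · have := t2 r
        simp only [ren, hr, if_true] at this
        rw [this]
        simp [S, show r ≠ k by omega, show r ≠ k + 1 by omega, show r ≠ k + 2 by omega,
          show r ≠ k + 3 by omega]
      · by_cases hr' : r < k + 2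
        · rw [Function.update_of_ne (by omega), t3]
          rintro ⟨s, rfl⟩
          simp only [ren] at hr hr'
          split_ifs at hr hr' <;> omega
        · have := t2 (r - 2)
          simp only [ren, show ¬ r - 2 < k by omega, if_false,
            show r - 2 + 2 = r by omega] at this
          rw [this]
          rcases eq_or_ne r (k + 3) with rfl | h3
          · simp
          · rw [Function.update_of_ne (by omega), Function.update_of_ne h3]
            rcases eq_or_ne r (k + 2) with rfl | h2
            · simp [S]
            · simp only [S]
              rw [Function.update_of_ne (by omega), Function.update_of_ne h2,
                Function.update_of_ne (by omega), Function.update_of_ne (by omega),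
                hσ _ (by omega), hσ _ (by omega)]
    subst hτ
    have h2 := runs_moveRev (Function.update (S i) (k + 3) (F (Function.update σ k (unary i))))
      (a := k + 3) (b := k + 1) (by omega)
    have h3 := Runs.push (Function.update (Function.update (Function.update (S i) (k + 3)
      (F (Function.update σ k (unary i)))) (k + 1)
      ((F (Function.update σ k (unary i))).reverse ++ (acc i).reverse)) (k + 3) []) (k + 2) true
    have h4 := Runs.pop (Function.update (Function.update (Function.update (Function.update (S i)
      (k + 3) (F (Function.update σ k (unary i)))) (k + 1)
      ((F (Function.update σ k (unary i))).reverse ++ (acc i).reverse)) (k + 3) []) (k + 2)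
      (true :: unary i)) k
    have e1 : Function.update (S i) (k + 3) (F (Function.update σ k (unary i))) (k + 1) =
        (acc i).reverse := by simp [S]
    rw [e1, Function.update_self] at h2
    have e2 : Function.update (Function.update (Function.update (S i) (k + 3)
      (F (Function.update σ k (unary i)))) (k + 1)
      ((F (Function.update σ k (unary i))).reverse ++ (acc i).reverse)) (k + 3) [] (k + 2) =
        unary i := by simp [S]
    rw [e2] at h3
    have h5 := Runs.seq ⟨s, hs, t1⟩ (h2.seq (h3.seq h4))
    have := hFl i hi.le
    have h6 := h5.mono (T' := 5 * pF.eval (sz k σ) + 3) (by omega)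
    convert h6 using 1
    funext r
    rcases eq_or_ne r k with rfl | h0
    · simp [S, List.tail_drop]
    · rcases eq_or_ne r (k + 1) with rfl | h1
      · simp [S, hacc, List.reverse_append]
      · rcases eq_or_ne r (k + 2) with rfl | h2
        · simp [S, unary, List.replicate_succ]
        · rcases eq_or_ne r (k + 3) with rfl | h3
          · simp [S, hσ (k + 3) (by omega)]
          · simp [S, h0, h1, h2, h3]

/-- Composition. -/
theorem PT.comp {k m : ℕ} (hm : 0 < m) {f : Store → List Bool} (hf : PT m f)
    {g : ℕ → Store → List Bool} (hg : ∀ i < m, PT k (g i)) :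
    PT k fun σ => f fun r => if r < m then g r σ else [] := by
  obtain ⟨P, p, h⟩ := hf.computes hm
  refine PT.call (P := P) (q := p) hg fun σ _ => ?_
  have h1 := h ((List.range m).map fun i => g i σ) (by simp)
  have e1 : Store.init ((List.range m).map fun i => g i σ) =
      fun r => if r < m then g r σ else [] := by
    funext r
    by_cases hr : r < m
    · simp [Store.init, hr]
    · simp [Store.init, hr]
  have e2 : (((List.range m).map fun i => g i σ).map List.length).sum =
      ∑ i ∈ Finset.range m, (g i σ).length := by
    rw [List.map_map]
    clear h1 e1 hg h hf hm
    induction m with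
    | zero => rfl
    | succ m ih => rw [Finset.sum_range_succ, List.range_succ, List.map_append, List.sum_append, ih]; simp
  rwa [e1, e2] at h1

/-! ### Arithmetic in unary -/

theorem unary_add (a b : ℕ) : unary (a + b) = unary a ++ unary b := List.replicate_add ..

/-- Surplus passes that contribute nothing are harmless. With this a crude bound on the number of
passes is enough, as for division. -/
theorem flatMap_range_ite_lt {α : Type*} {q L : ℕ} (h : q ≤ L) (F : ℕ → List α) :
    ((List.range L).flatMap fun i => if i < q then F i else []) = (List.range q).flatMap F := by
  induction L with
  | zero => obtain rfl : q = 0 := by omega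
            rfl
  | succ L ih =>
    rw [List.range_succ, List.flatMap_append]
    rcases eq_or_ne q (L + 1) with rfl | hq
    · rw [List.range_succ, List.flatMap_append]
      congr 1
      · refine List.flatMap_congr fun i hi => ?_
        rw [if_pos (by have := List.mem_range.1 hi; omega)]
      · simp
    · rw [ih (by omega)]
      simp [show ¬ L < q by omega]

/-- A function to `ℕ` that is computable in polynomial time, with output in unary. -/
def PTN (k : ℕ) (f : Store → ℕ) : Prop := PT k fun σ => unary (f σ)

theorem PTN.congr {k : ℕ} {f g : Store → ℕ} (h : PTN k f) (hfg : ∀ σ, f σ = g σ) : PTN k g :=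
  (funext hfg : f = g) ▸ h

theorem PT.const (k : ℕ) (l : List Bool) : PT k fun _ => l := by
  induction l with
  | nil => exact PT.nil k
  | cons b l ih => exact ih.cons b

theorem PTN.const (k c : ℕ) : PTN k fun _ => c := PT.const k _

/-- Bounded iteration; `F` does not depend on the register that holds the counter. -/
theorem PT.flatMapRange {k : ℕ} {n : Store → ℕ} {F : Store → ℕ → List Bool} (hn : PTN k n)
    (hF : PT (k + 1) fun σ => F σ (σ k).length)
    (hc : ∀ σ v i, F (Function.update σ k v) i = F σ i) :
    PT k fun σ => (List.range (n σ)).flatMap (F σ) := by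
  refine (PT.flatMap hn hF).congr fun σ _ => ?_
  simp only [length_unary, Function.update_self, hc]

theorem PT.length {k : ℕ} {f : Store → List Bool} (hf : PT k f) : PTN k fun σ => (f σ).length := by
  refine (PT.flatMap hf (PT.const (k + 1) [true])).congr fun σ _ => ?_
  change _ = unary (f σ).length
  generalize (f σ).length = m
  induction m with
  | zero => rfl
  | succ m ih => rw [List.range_succ, List.flatMap_append, ih, unary_add]; rfl

theorem PTN.var {k i : ℕ} (hi : i < k) : PTN k fun σ => (σ i).length := (PT.var hi).length

theorem PTN.add {k : ℕ} {f g : Store → ℕ} (hf : PTN k f) (hg : PTN k g) :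
    PTN k fun σ => f σ + g σ :=
  (PT.append hf hg).congr fun _ _ => (unary_add _ _).symm

theorem PTN.sub {k : ℕ} {f g : Store → ℕ} (hf : PTN k f) (hg : PTN k g) :
    PTN k fun σ => f σ - g σ :=
  (PT.drop hg hf).congr fun _ _ => by simp [unary]

/-- Truncated subtraction decides the comparison: `b - a` in unary is nonempty exactly if `a < b`.
-/
theorem PT.ite_lt {k : ℕ} {a b : Store → ℕ} {f g : Store → List Bool} (ha : PTN k a)
    (hb : PTN k b) (hf : PT k f) (hg : PT k g) :
    PT k fun σ => if a σ < b σ then f σ else g σ := by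
  refine (PT.case (hb.sub ha) hg hg hf).congr fun σ _ => ?_
  by_cases h : a σ < b σ
  · obtain ⟨c, hc⟩ : ∃ c, b σ - a σ = c + 1 := ⟨b σ - a σ - 1, by omega⟩
    simp [hc, unary, List.replicate_succ, h]
  · simp [h, show b σ - a σ = 0 by omega, unary]

theorem PT.ite_eq {k : ℕ} {a b : Store → ℕ} {f g : Store → List Bool} (ha : PTN k a)
    (hb : PTN k b) (hf : PT k f) (hg : PT k g) :
    PT k fun σ => if a σ = b σ then f σ else g σ := by
  refine (PT.ite_lt ha hb hg (PT.ite_lt hb ha hg hf)).congr fun σ _ => ?_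
  rcases lt_trichotomy (a σ) (b σ) with h | h | h
  · rw [if_pos h, if_neg h.ne]
  · simp [h]
  · rw [if_neg (by omega), if_pos h, if_neg h.ne']

theorem PTN.ite_lt {k : ℕ} {a b f g : Store → ℕ} (ha : PTN k a) (hb : PTN k b) (hf : PTN k f)
    (hg : PTN k g) : PTN k fun σ => if a σ < b σ then f σ else g σ :=
  (PT.ite_lt ha hb hf hg).congr fun σ _ => by beta_reduce; split_ifs <;> rfl

theorem PTN.ite_eq {k : ℕ} {a b f g : Store → ℕ} (ha : PTN k a) (hb : PTN k b) (hf : PTN k f)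
    (hg : PTN k g) : PTN k fun σ => if a σ = b σ then f σ else g σ :=
  (PT.ite_eq ha hb hf hg).congr fun σ _ => by beta_reduce; split_ifs <;> rfl

/-- The body in `PT.flatMapRange` must not depend on the counter register. Proving a claim for two
variables and substituting avoids that condition on `f` and `g`. -/
theorem PT.comp₂ {k : ℕ} {F : List Bool → List Bool → List Bool}
    (hF : PT 2 fun σ => F (σ 0) (σ 1)) {f g : Store → List Bool} (hf : PT k f) (hg : PT k g) :
    PT k fun σ => F (f σ) (g σ) := by
  have := PT.comp (k := k) (by norm_num) hF (g := fun i => if i = 0 then f else g)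
    (fun i _ => by split_ifs <;> assumption)
  simpa using this

theorem flatMap_range_unary (a b : ℕ) : ((List.range a).flatMap fun _ => unary b) =
    unary (a * b) := by
  induction a with
  | zero => simp [unary]
  | succ a ih => rw [List.range_succ, List.flatMap_append, ih, Nat.succ_mul, unary_add]; simp

theorem PTN.mul {k : ℕ} {f g : Store → ℕ} (hf : PTN k f) (hg : PTN k g) :
    PTN k fun σ => f σ * g σ := by
  have h : PT 2 fun σ => (List.range (σ 0).length).flatMap fun _ => unary (σ 1).length := by
    refine PT.flatMapRange (k := 2) (F := fun σ _ => unary (σ 1).length) (PTN.var (by norm_num))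
      (PTN.var (by norm_num)) fun σ v i => ?_
    simp
  refine (PT.comp₂ (F := fun x y => (List.range x.length).flatMap fun _ => unary y.length)
    h hf hg).congr fun σ _ => ?_
  simp only [length_unary, flatMap_range_unary]

/-! ### Reading numbers from bit strings -/

theorem length_readUnary (c : ℕ) (s : List Bool) :
    (readUnary c s).length = s.count false := by
  induction s generalizing c with
  | nil => rfl
  | cons b s ih => cases b <;> simp [readUnary, ih]

/-- The string `1^a` for the number `a` with index `i` in a string `1^a₀ 0 1^a₁ 0 …`. -/
def nthOnes (s : List Bool) (i : ℕ) : List Bool :=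
  (List.range s.length).flatMap fun p => match s.drop p with
    | true :: _ => if (s.take p).count false = i then [true] else []
    | _ => []

theorem nthOnes_true (s : List Bool) (i : ℕ) :
    nthOnes (true :: s) i = (if i = 0 then [true] else []) ++ nthOnes s i := by
  simp only [nthOnes, List.length_cons, List.range_succ_eq_map, List.flatMap_cons,
    List.flatMap_map]
  simp [eq_comm]

theorem nthOnes_false_zero (s : List Bool) : nthOnes (false :: s) 0 = [] := by
  simp only [nthOnes, List.length_cons, List.range_succ_eq_map, List.flatMap_cons,
    List.flatMap_map]
  simp only [List.drop_zero, List.drop_succ_cons, List.take_succ_cons, List.count_cons_self,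
    Nat.add_eq_zero_iff, one_ne_zero, and_false, if_false, List.nil_append]
  rw [List.flatMap_eq_nil_iff]
  intro p _
  split <;> rfl

theorem nthOnes_false_succ (s : List Bool) (i : ℕ) :
    nthOnes (false :: s) (i + 1) = nthOnes s i := by
  simp only [nthOnes, List.length_cons, List.range_succ_eq_map, List.flatMap_cons,
    List.flatMap_map]
  simp

/-- The bound on `i` excludes a trailing run of ones without a final zero, which `readUnary` drops
but `nthOnes` would count. -/
theorem getD_readUnary (c : ℕ) (s : List Bool) (i : ℕ) (h : i < s.count false) :
    unary ((readUnary c s).getD i 0) = (if i = 0 then unary c else []) ++ nthOnes s i := by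
  induction s generalizing c i with
  | nil => simp at h
  | cons b s ih =>
    cases b with
    | true =>
      rw [nthOnes_true, readUnary, ih _ _ (by simpa using h)]
      by_cases hi : i = 0
      · rw [if_pos hi, if_pos hi, if_pos hi, unary_add, List.append_assoc]
        rfl
      · simp [hi]
    | false =>
      rw [readUnary]
      cases i with
      | zero => simp [nthOnes_false_zero]
      | succ i =>
        rw [nthOnes_false_succ, List.getD_cons_succ, ih _ _ (by simpa using h)]
        simp [unary]

theorem count_false_flatMap (s : List Bool) (p : ℕ) (hp : p ≤ s.length) :
    ((List.range p).flatMap fun q => match s.drop q with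
      | false :: _ => [true]
      | _ => []) = unary ((s.take p).count false) := by
  induction p with
  | zero => simp [unary]
  | succ p ih =>
    rw [List.range_succ, List.flatMap_append, ih (by omega),
      List.take_succ_eq_append_getElem (by omega), List.count_append, unary_add]
    congr 1
    rw [List.flatMap_singleton, List.drop_eq_getElem_cons (by omega)]
    cases s[p] <;> rfl

/-- The number of zeros among the first `i` bits. -/
theorem PTN.countTake {k : ℕ} {s : Store → List Bool} {i : Store → ℕ} (hs : PT k s)
    (hi : PTN k i) :
    PTN k fun σ => ((s σ).take (i σ)).count false := by
  have h2 : PT 2 fun σ => (List.range (if (σ 1).length < (σ 0).length then (σ 1).length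
      else (σ 0).length)).flatMap fun q => match (σ 0).drop q with
        | false :: _ => [true]
        | _ => [] := by
    refine PT.flatMapRange (k := 2) (F := fun σ q => match (σ 0).drop q with
        | false :: _ => [true]
        | _ => []) (PTN.ite_lt (PTN.var (by norm_num)) (PTN.var (by norm_num))
          (PTN.var (by norm_num)) (PTN.var (by norm_num))) ?_ fun σ v i => by simp
    refine (PT.case (PT.drop (PT.var (k := 3) (i := 2) (by norm_num)) (PT.var (k := 3) (i := 0)
      (by norm_num))) (PT.const 3 []) (PT.const 3 [true]) (PT.const 3 [])).congr fun σ _ => ?_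
    rcases (σ 0).drop (σ 2).length with _ | ⟨_ | _, l⟩ <;> rfl
  refine (PT.comp₂ (F := fun x y => (List.range (if y.length < x.length then y.length
    else x.length)).flatMap fun q => match x.drop q with
        | false :: _ => [true]
        | _ => []) h2 hs hi).congr fun σ _ => ?_
  simp only [length_unary]
  rw [count_false_flatMap _ _ (by split_ifs <;> omega)]
  split_ifs with h
  · rfl
  · rw [List.take_of_length_le le_rfl, List.take_of_length_le (by omega)]

/-- The length of the list of numbers encoded by a string. -/
theorem PTN.lengthRead {k : ℕ} {s : Store → List Bool} (hs : PT k s) :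
    PTN k fun σ => (readUnary 0 (s σ)).length :=
  (PTN.countTake hs hs.length).congr fun σ => by
    rw [length_readUnary, List.take_length]

theorem PTN.getD {k : ℕ} {s : Store → List Bool} {i : Store → ℕ} (hs : PT k s) (hi : PTN k i) :
    PTN k fun σ => (readUnary 0 (s σ)).getD (i σ) 0 := by
  have h2 : PT 2 fun σ => if (σ 1).length < (readUnary 0 (σ 0)).length then
      nthOnes (σ 0) (σ 1).length else [] := by
    refine PT.ite_lt (PTN.var (by norm_num)) (PTN.lengthRead (PT.var (by norm_num))) ?_
      (PT.nil 2)
    refine PT.flatMapRange (k := 2) (F := fun σ p => match (σ 0).drop p with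
      | true :: _ => if ((σ 0).take p).count false = (σ 1).length then [true] else []
      | _ => []) (PTN.var (by norm_num)) ?_ fun σ v i => by simp
    refine (PT.case (PT.drop (PT.var (k := 3) (i := 2) (by norm_num)) (PT.var (k := 3) (i := 0)
      (by norm_num))) (PT.const 3 []) (PT.const 3 []) (PT.ite_eq (PTN.countTake
      (PT.var (k := 3) (i := 0) (by norm_num)) (PTN.var (k := 3) (i := 2) (by norm_num))) (PTN.var (k := 3) (i := 1) (by norm_num)) (PT.const 3 [true])
      (PT.const 3 []))).congr fun σ _ => ?_
    rcases (σ 0).drop (σ 2).length with _ | ⟨_ | _, l⟩ <;> rfl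
  refine (PT.comp₂ (F := fun x y => if y.length < (readUnary 0 x).length then
      nthOnes x y.length else []) h2 hs hi).congr fun σ _ => ?_
  simp only [length_unary]
  split_ifs with h
  · rw [getD_readUnary _ _ _ (by rwa [length_readUnary] at h)]
    split_ifs <;> simp [unary]
  · rw [List.getD_eq_default _ _ (by omega)]
    rfl

/-- The string `1^a 0 1^b 0 …` for a list `[a, b, …]`. -/
def enc (l : List ℕ) : List Bool := l.flatMap fun a => unary a ++ [false]

theorem readUnary_unary (c a : ℕ) (s : List Bool) :
    readUnary c (unary a ++ s) = readUnary (c + a) s := by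
  induction a generalizing c with
  | zero => rfl
  | succ a ih =>
    change readUnary c (true :: (unary a ++ s)) = _
    rw [readUnary, ih, Nat.add_right_comm, Nat.add_assoc]

theorem readUnary_enc (l : List ℕ) : readUnary 0 (enc l) = l := by
  induction l with
  | nil => rfl
  | cons a l ih =>
    rw [enc, List.flatMap_cons, List.append_assoc, readUnary_unary, Nat.zero_add]
    change a :: readUnary 0 (enc l) = _
    rw [ih]

theorem enc_append (l l' : List ℕ) : enc (l ++ l') = enc l ++ enc l' := List.flatMap_append

/-- A block of four numbers that describes a gate. -/
abbrev Blk : Type := ℕ × ℕ × ℕ × ℕ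

def flat (bs : List Blk) : List ℕ := bs.flatMap fun b => [b.1, b.2.1, b.2.2.1, b.2.2.2]

theorem flat_append (l l' : List Blk) : flat (l ++ l') = flat l ++ flat l' := List.flatMap_append

theorem length_flat (bs : List Blk) : (flat bs).length = 4 * bs.length := by
  induction bs with
  | nil => rfl
  | cons b bs ih => rw [flat, List.flatMap_cons, List.length_append, ← flat, ih]; simp; omega

def PTL (k : ℕ) (f : Store → List ℕ) : Prop := PT k fun σ => enc (f σ)

def PTB (k : ℕ) (f : Store → List Blk) : Prop := PTL k fun σ => flat (f σ)

theorem PTB.congr {k : ℕ} {f g : Store → List Blk} (h : PTB k f) (hfg : ∀ σ, f σ = g σ) :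
    PTB k g := (funext hfg : f = g) ▸ h

theorem PTL.cons {k : ℕ} {a : Store → ℕ} {l : Store → List ℕ} (ha : PTN k a) (hl : PTL k l) :
    PTL k fun σ => a σ :: l σ :=
  (PT.append (PT.append ha (PT.const k [false])) hl).congr fun σ _ => by simp [enc]

theorem PTL.append {k : ℕ} {l m : Store → List ℕ} (hl : PTL k l) (hm : PTL k m) :
    PTL k fun σ => l σ ++ m σ :=
  (PT.append hl hm).congr fun σ _ => (enc_append _ _).symm

theorem PTB.append {k : ℕ} {l m : Store → List Blk} (hl : PTB k l) (hm : PTB k m) :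
    PTB k fun σ => l σ ++ m σ :=
  (PTL.append hl hm).congr fun σ _ => by beta_reduce; rw [flat_append]

theorem PTB.nil (k : ℕ) : PTB k fun _ => [] := PT.nil k

theorem PTB.cons {k : ℕ} {a b c d : Store → ℕ} {l : Store → List Blk} (ha : PTN k a)
    (hb : PTN k b) (hc : PTN k c) (hd : PTN k d) (hl : PTB k l) :
    PTB k fun σ => (a σ, b σ, c σ, d σ) :: l σ :=
  PTL.cons ha (PTL.cons hb (PTL.cons hc (PTL.cons hd hl)))

theorem PTB.flatMapRange {k : ℕ} {n : Store → ℕ} {F : Store → ℕ → List Blk} (hn : PTN k n)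
    (hF : PTB (k + 1) fun σ => F σ (σ k).length)
    (hc : ∀ σ v i, F (Function.update σ k v) i = F σ i) :
    PTB k fun σ => (List.range (n σ)).flatMap (F σ) := by
  refine (PT.flatMapRange (F := fun σ i => enc (flat (F σ i))) hn hF
    fun σ v i => by rw [hc]).congr fun σ _ => ?_
  simp only [enc, flat, List.flatMap_assoc]

theorem PTB.mapRange {k : ℕ} {n : Store → ℕ} {a b c d : Store → ℕ → ℕ} (hn : PTN k n)
    (ha : PTN (k + 1) fun σ => a σ (σ k).length) (hb : PTN (k + 1) fun σ => b σ (σ k).length)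
    (hc : PTN (k + 1) fun σ => c σ (σ k).length) (hd : PTN (k + 1) fun σ => d σ (σ k).length)
    (h : ∀ σ v i, a (Function.update σ k v) i = a σ i ∧ b (Function.update σ k v) i = b σ i ∧
      c (Function.update σ k v) i = c σ i ∧ d (Function.update σ k v) i = d σ i) :
    PTB k fun σ => (List.range (n σ)).map fun i => (a σ i, b σ i, c σ i, d σ i) := by
  refine (PTB.flatMapRange (F := fun σ i => [(a σ i, b σ i, c σ i, d σ i)]) hn
    (PTB.cons ha hb hc hd (PTB.nil _)) fun σ v i => ?_).congr fun σ => ?_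
  · obtain ⟨h1, h2, h3, h4⟩ := h σ v i
    rw [h1, h2, h3, h4]
  · rw [List.map_eq_flatMap]

/-- The quotient of `n` by four is the number of `i` with `4 * i + 3 < n`, which bounded iteration
can count. -/
theorem PTN.divFour {k : ℕ} {f : Store → ℕ} (hf : PTN k f) : PTN k fun σ => f σ / 4 := by
  have h1 : PT 1 fun σ => (List.range (σ 0).length).flatMap fun i =>
      if 4 * i + 3 < (σ 0).length then [true] else [] := by
    refine PT.flatMapRange (k := 1) (F := fun σ i => if 4 * i + 3 < (σ 0).length then [true]
      else []) (PTN.var (by norm_num)) (PT.ite_lt (((PTN.const 2 4).mul (PTN.var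
        (by norm_num))).add (PTN.const 2 3)) (PTN.var (by norm_num)) (PT.const 2 _)
        (PT.const 2 _)) fun σ v i => by simp
  have := PT.comp (k := k) (by norm_num) h1 (g := fun _ σ => unary (f σ)) (fun i _ => hf)
  refine this.congr fun σ _ => ?_
  simp only [Nat.lt_one_iff, if_true, length_unary]
  have e := flatMap_range_ite_lt (q := f σ / 4) (L := f σ) (by omega) (fun _ => unary 1)
  rw [flatMap_range_unary, Nat.mul_one] at e
  rw [← e]
  congr 1
  funext i
  congr 1
  apply propext
  omega

/-- Cuts a list into blocks of four numbers; an incomplete last block is dropped. -/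
def toBlocks : List ℕ → List Blk
  | g :: i :: j :: l :: rest => (g, i, j, l) :: toBlocks rest
  | _ => []

/-- A form with random access instead of recursion, as bounded iteration requires. -/
theorem toBlocks_eq (l : List ℕ) : toBlocks l = (List.range (l.length / 4)).map fun i =>
    (l.getD (4 * i) 0, l.getD (4 * i + 1) 0, l.getD (4 * i + 2) 0, l.getD (4 * i + 3) 0) := by
  induction l using toBlocks.induct with
  | case1 g i j l rest ih =>
    rw [toBlocks, ih]
    have : (g :: i :: j :: l :: rest).length / 4 = rest.length / 4 + 1 := by simp; omega
    rw [this, List.range_succ_eq_map, List.map_cons, List.map_map]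
    congr 1
  | case2 l h =>
    have : l.length / 4 = 0 := by
      rcases l with _ | ⟨a, _ | ⟨b, _ | ⟨c, _ | ⟨d, l⟩⟩⟩⟩
      · rfl
      · simp
      · simp
      · simp
      · exact absurd rfl (h a b c d l)
    rw [this, toBlocks]
    · rfl
    · exact h

theorem toBlocks_flat (bs : List Blk) : toBlocks (flat bs) = bs := by
  induction bs with
  | nil => rfl
  | cons b bs ih =>
    change toBlocks (b.1 :: b.2.1 :: b.2.2.1 :: b.2.2.2 :: flat bs) = _
    rw [toBlocks, ih]

/-- The description of the inverse gate. -/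
def Blk.inv (b : Blk) : Blk := (if b.1 = 1 then 2 else if b.1 = 2 then 1 else b.1, b.2)

/-- The description of the inverse circuit. -/
def invBlocks (bs : List Blk) : List Blk := bs.reverse.map Blk.inv

/-- With `q` blocks, pass `i` reads block `q - 1 - i`, which reverses the order. Only the codes `1`
and `2` of T and its inverse change; the other gates are involutions. -/
theorem PTB.inv {k : ℕ} {f : Store → List Blk} (hf : PTB k f) :
    PTB k fun σ => invBlocks (f σ) := by
  let rd : List Bool → ℕ → ℕ := fun s i => (readUnary 0 s).getD i 0
  let q : List Bool → ℕ := fun s => (readUnary 0 s).length / 4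
  let F : List Bool → List Blk := fun s => (List.range (q s)).map fun i =>
    (if rd s (4 * (q s - 1 - i)) = 1 then 2 else if rd s (4 * (q s - 1 - i)) = 2 then 1 else
      rd s (4 * (q s - 1 - i)), rd s (4 * (q s - 1 - i) + 1), rd s (4 * (q s - 1 - i) + 2),
      rd s (4 * (q s - 1 - i) + 3))
  have h1 : PT 1 fun σ => enc (flat (F (σ 0))) := by
    have hq : ∀ k, 0 < k → PTN k fun σ => q (σ 0) := fun k hk =>
      (PTN.lengthRead (PT.var hk)).divFour
    have hi : PTN 2 fun σ => 4 * (q (σ 0) - 1 - (σ 1).length) :=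
      (PTN.const 2 4).mul (((hq 2 (by norm_num)).sub (PTN.const 2 1)).sub (PTN.var (by norm_num)))
    have hr : ∀ c, PTN 2 fun σ => rd (σ 0) (4 * (q (σ 0) - 1 - (σ 1).length) + c) := fun c =>
      PTN.getD (PT.var (by norm_num)) (hi.add (PTN.const 2 c))
    refine PTB.mapRange (k := 1) (n := fun σ => q (σ 0))
      (a := fun σ i => if rd (σ 0) (4 * (q (σ 0) - 1 - i)) = 1 then 2 else
        if rd (σ 0) (4 * (q (σ 0) - 1 - i)) = 2 then 1 else rd (σ 0) (4 * (q (σ 0) - 1 - i)))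
      (hq 1 (by norm_num)) ?_ (hr 1) (hr 2) (hr 3) fun σ v i => by simp
    exact PTN.ite_eq (hr 0) (PTN.const 2 1) (PTN.const 2 2)
      (PTN.ite_eq (hr 0) (PTN.const 2 2) (PTN.const 2 1) (hr 0))
  have := PT.comp (k := k) (by norm_num) h1 (g := fun _ σ => enc (flat (f σ))) (fun i _ => hf)
  refine this.congr fun σ _ => ?_
  simp only [Nat.lt_one_iff, if_true]
  congr 2
  simp only [F, rd, q, readUnary_enc]
  generalize f σ = bs
  have hl : (flat bs).length / 4 = bs.length := by rw [length_flat]; omega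
  have hb := toBlocks_eq (flat bs)
  rw [toBlocks_flat, hl] at hb
  rw [hl]
  apply List.ext_getElem
  · simp [invBlocks]
  · intro i h1 h2
    have hi : i < bs.length := by simpa using h1
    have e : bs[bs.length - 1 - i]'(by omega) = ((flat bs).getD (4 * (bs.length - 1 - i)) 0,
        (flat bs).getD (4 * (bs.length - 1 - i) + 1) 0,
        (flat bs).getD (4 * (bs.length - 1 - i) + 2) 0,
        (flat bs).getD (4 * (bs.length - 1 - i) + 3) 0) := by
      have := congrArg (fun l => l[bs.length - 1 - i]?) hb
      simpa [show bs.length - 1 - i < bs.length by omega] using this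
    simp only [invBlocks, List.getElem_map, List.getElem_range, List.getElem_reverse, e, Blk.inv]

/-! ### Matrices of functions between basis states, and projections -/

/-- The matrix of `|y⟩ ↦ |f y⟩`. -/
noncomputable def pmat {α β : Type*} [DecidableEq β] (f : α → β) : Matrix β α ℂ :=
  Matrix.of fun x y => if x = f y then 1 else 0

/-- The projection to the basis states with the property `p`. -/
noncomputable def proj {α : Type*} [DecidableEq α] (p : α → Bool) : Matrix α α ℂ :=
  Matrix.diagonal fun x => if p x then 1 else 0

section Basis

variable {α β δ : Type*} [Fintype α] [DecidableEq α] [Fintype β] [DecidableEq β] [Fintype δ]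
  [DecidableEq δ]

theorem mul_pmat_apply (A : Matrix δ β ℂ) (f : α → β) (x : δ) (y : α) :
    (A * pmat f) x y = A x (f y) := by
  simp [Matrix.mul_apply, pmat]

theorem conjTranspose_pmat_mul_apply (f : α → β) (A : Matrix β δ ℂ) (y : α) (z : δ) :
    ((pmat f)ᴴ * A) y z = A (f y) z := by
  simp [Matrix.mul_apply, pmat, Matrix.conjTranspose_apply, apply_ite (star : ℂ → ℂ)]

theorem pmat_mul_pmat (f : β → δ) (g : α → β) : pmat f * pmat g = pmat (f ∘ g) := by
  ext x y
  rw [mul_pmat_apply]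
  rfl

theorem pmat_id : pmat (id : α → α) = 1 := by
  ext x y
  simp [pmat, Matrix.one_apply]

theorem conjTranspose_pmat_mul_self {f : α → β} (hf : Function.Injective f) :
    (pmat f)ᴴ * pmat f = 1 := by
  ext x y
  rw [conjTranspose_pmat_mul_apply]
  simp [pmat, Matrix.one_apply, hf.eq_iff]

theorem conjTranspose_pmat_mul_mul_pmat (f : α → β) (A : Matrix β β ℂ) :
    (pmat f)ᴴ * A * pmat f = A.submatrix f f := by
  ext x y
  rw [mul_pmat_apply, conjTranspose_pmat_mul_apply]
  rfl

theorem proj_mul_apply (p : α → Bool) (A : Matrix α δ ℂ) (x : α) (y : δ) :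
    (proj p * A) x y = if p x then A x y else 0 := by
  rw [proj, Matrix.diagonal_mul]
  split_ifs <;> simp

theorem mul_proj_apply (p : α → Bool) (A : Matrix δ α ℂ) (x : δ) (y : α) :
    (A * proj p) x y = if p y then A x y else 0 := by
  rw [proj, Matrix.mul_diagonal]
  split_ifs <;> simp

theorem proj_mul_proj (p q : α → Bool) : proj p * proj q = proj fun x => p x && q x := by
  ext x y
  rw [proj_mul_apply]
  by_cases h : x = y
  · subst h; cases hp : p x <;> cases hq : q x <;> simp [proj, hp, hq]
  · simp [proj, h]

theorem conjTranspose_proj (p : α → Bool) : (proj p)ᴴ = proj p := by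
  rw [proj, Matrix.diagonal_conjTranspose]
  congr 1
  funext x
  by_cases h : p x <;> simp [h]

theorem proj_not (p : α → Bool) : proj (fun x => !p x) = 1 - proj p := by
  ext x y
  by_cases h : x = y
  · subst h; cases hp : p x <;> simp [proj, hp]
  · simp [proj, h]

theorem proj_idem (p : α → Bool) : proj p * proj p = proj p := by
  rw [proj_mul_proj]; simp

theorem proj_true : proj (fun _ : α => true) = 1 := by
  ext x y; simp [proj, Matrix.one_apply, Matrix.diagonal_apply]

theorem proj_mul_pmat (p : β → Bool) (f : α → β) :
    proj p * pmat f = pmat f * proj (fun y => p (f y)) := by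
  ext x y
  rw [proj_mul_apply, mul_proj_apply]
  by_cases h : x = f y
  · subst h; rfl
  · simp [pmat, h]

theorem proj_mul_pmat_of_forall {p : β → Bool} {f : α → β} (h : ∀ y, p (f y) = true) :
    proj p * pmat f = pmat f := by
  rw [proj_mul_pmat, show (fun y => p (f y)) = fun _ => true from funext h, proj_true, Matrix.mul_one]

theorem proj_mul_pmat_eq_zero {p : β → Bool} {f : α → β} (h : ∀ y, p (f y) = false) :
    proj p * pmat f = 0 := by
  ext x y
  rw [proj_mul_apply]
  by_cases hx : x = f y
  · subst hx; simp [h]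
  · simp [pmat, hx]

theorem pmat_mul_proj_congr {p : α → Bool} {f g : α → β} (h : ∀ y, p y = true → f y = g y) :
    pmat f * proj p = pmat g * proj p := by
  ext x y
  rw [mul_proj_apply, mul_proj_apply]
  split_ifs with hy
  · simp [pmat, h y hy]
  · rfl

/-- An injective map of basis states is an isometry, and `pmat f * (pmat f)ᴴ` is the projection to
its range. -/
theorem proj_eq_pmat_mul_conjTranspose (f : α → β) (hf : Function.Injective f) (p : β → Bool)
    (hp : ∀ x, p x = true ↔ ∃ y, f y = x) : proj p = pmat f * (pmat f)ᴴ := by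
  ext x z
  have : (pmat f * (pmat f)ᴴ) x z = star ((pmat f * (pmat f)ᴴ) z x) := by
    rw [← Matrix.conjTranspose_apply, Matrix.conjTranspose_mul, Matrix.conjTranspose_conjTranspose]
  by_cases hx : p x = true
  · obtain ⟨y, rfl⟩ := (hp x).1 hx
    rw [Matrix.mul_apply, Finset.sum_eq_single y]
    · by_cases hz : z = f y
      · subst hz; simp [proj, hx, pmat]
      · simp [proj, pmat, hz, Ne.symm hz]
    · intro b _ hb; simp [pmat, hf.eq_iff, Ne.symm hb]
    · simp
  · have h0 : ∀ y, x ≠ f y := fun y h => hx ((hp x).2 ⟨y, h.symm⟩)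
    rw [Matrix.mul_apply, Finset.sum_eq_zero]
    · by_cases hz : x = z
      · subst hz; simp [proj, hx]
      · simp [proj, hz]
    · intro y _; simp [pmat, h0 y]

end Basis

/-! ### Operators on a part of the wires -/

open Classical in
/-- The operator `A` on the wires `e v`, tensored with the identity on the other wires. -/
noncomputable def liftOp {V W : Type} (e : V → W) (A : Op V) : Op W := Matrix.of fun x y =>
  if ∀ w, w ∉ Set.range e → x w = y w then A (x ∘ e) (y ∘ e) else 0

/-- `A` acts as the identity on the wires outside of `s`. -/
def ActsOn {W : Type} (s : Set W) (A : Op W) : Prop := ∃ A' : Op s, A = liftOp Subtype.val A'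

section Lift

variable {V W : Type} [Fintype V] [DecidableEq V] [Fintype W] [DecidableEq W]

theorem liftOp_apply_of_agree {e : V → W} (A : Op V) {x y : Bits W}
    (h : ∀ w, w ∉ Set.range e → x w = y w) : liftOp e A x y = A (x ∘ e) (y ∘ e) := by
  simp only [liftOp, Matrix.of_apply]
  rw [if_pos h]

theorem liftOp_apply_of_not_agree {e : V → W} (A : Op V) {x y : Bits W}
    (h : ¬ ∀ w, w ∉ Set.range e → x w = y w) : liftOp e A x y = 0 := by
  simp only [liftOp, Matrix.of_apply]
  rw [if_neg h]

theorem extend_comp_self {e : V → W} (he : Function.Injective e) (v : Bits V) (x : Bits W) :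
    Function.extend e v x ∘ e = v := funext fun u => he.extend_apply v x u

theorem extend_of_notMem {e : V → W} (v : Bits V) (x : Bits W) {w : W}
    (hw : w ∉ Set.range e) : Function.extend e v x w = x w :=
  Function.extend_apply' _ _ _ hw

theorem extend_eq_iff {e : V → W} (he : Function.Injective e) (v : Bits V) (x y : Bits W) :
    y = Function.extend e v x ↔ (∀ w, w ∉ Set.range e → y w = x w) ∧ y ∘ e = v := by
  constructor
  · rintro rfl
    exact ⟨fun w hw => extend_of_notMem v x hw, extend_comp_self he v x⟩
  · rintro ⟨h, rfl⟩
    funext w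
    by_cases hw : w ∈ Set.range e
    · obtain ⟨u, rfl⟩ := hw
      rw [he.extend_apply]
      rfl
    · rw [extend_of_notMem _ _ hw, h w hw]

/-- The states that agree with `x` off the range of `e` are parametrized by their values on it.
Products with lifted operators reduce to sums over the small space in this way. -/
theorem sum_eq_sum_extend {e : V → W} (he : Function.Injective e) (x : Bits W) (F : Bits W → ℂ)
    (hF : ∀ y, ¬ (∀ w, w ∉ Set.range e → x w = y w) → F y = 0) :
    ∑ y, F y = ∑ v : Bits V, F (Function.extend e v x) := by
  classical
  symm
  refine Finset.sum_of_injOn (fun v => Function.extend e v x) ?_ (by simp) ?_ (by simp)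
  · intro v _ v' _ h
    have := congrArg (fun y => y ∘ e) h
    simpa [extend_comp_self he] using this
  · intro y _ hy
    refine hF y fun h => hy ?_
    refine ⟨y ∘ e, by simp, ?_⟩
    exact ((extend_eq_iff he _ _ _).2 ⟨fun w hw => (h w hw).symm, rfl⟩).symm

theorem liftOp_mul {e : V → W} (he : Function.Injective e) (A B : Op V) :
    liftOp e A * liftOp e B = liftOp e (A * B) := by
  ext x z
  rw [Matrix.mul_apply, sum_eq_sum_extend he x]
  · by_cases h : ∀ w, w ∉ Set.range e → x w = z w
    · rw [liftOp_apply_of_agree _ h, Matrix.mul_apply]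
      refine Finset.sum_congr rfl fun v _ => ?_
      rw [liftOp_apply_of_agree A fun w hw => (extend_of_notMem v x hw).symm,
        liftOp_apply_of_agree B fun w hw => (extend_of_notMem v x hw).trans (h w hw),
        extend_comp_self he]
    · rw [liftOp_apply_of_not_agree _ h]
      refine Finset.sum_eq_zero fun v _ => ?_
      rw [liftOp_apply_of_not_agree B, mul_zero]
      intro h'
      exact h fun w hw => (extend_of_notMem v x hw).symm.trans (h' w hw)
  · intro y hy
    rw [liftOp_apply_of_not_agree A hy, zero_mul]

theorem liftOp_one {e : V → W} : liftOp e (1 : Op V) = 1 := by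
  ext x y
  by_cases h : ∀ w, w ∉ Set.range e → x w = y w
  · rw [liftOp_apply_of_agree _ h, Matrix.one_apply, Matrix.one_apply]
    congr 1
    apply propext
    constructor
    · intro h'
      funext w
      by_cases hw : w ∈ Set.range e
      · obtain ⟨u, rfl⟩ := hw
        exact congrFun h' u
      · exact h w hw
    · rintro rfl; rfl
  · rw [liftOp_apply_of_not_agree _ h, Matrix.one_apply_ne]
    rintro rfl
    exact h fun _ _ => rfl

theorem conjTranspose_liftOp (e : V → W) (A : Op V) : (liftOp e A)ᴴ = liftOp e Aᴴ := by
  ext x y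
  rw [Matrix.conjTranspose_apply]
  by_cases h : ∀ w, w ∉ Set.range e → x w = y w
  · rw [liftOp_apply_of_agree _ h, liftOp_apply_of_agree _ fun w hw => (h w hw).symm]
    rfl
  · rw [liftOp_apply_of_not_agree _ h, liftOp_apply_of_not_agree, star_zero]
    exact fun h' => h fun w hw => (h' w hw).symm

theorem liftOp_add (e : V → W) (A B : Op V) : liftOp e (A + B) = liftOp e A + liftOp e B := by
  ext x y
  by_cases h : ∀ w, w ∉ Set.range e → x w = y w
  · simp only [Matrix.add_apply, liftOp_apply_of_agree _ h]
  · simp only [Matrix.add_apply, liftOp_apply_of_not_agree _ h, add_zero]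

theorem liftOp_sub (e : V → W) (A B : Op V) : liftOp e (A - B) = liftOp e A - liftOp e B := by
  ext x y
  by_cases h : ∀ w, w ∉ Set.range e → x w = y w
  · simp only [Matrix.sub_apply, liftOp_apply_of_agree _ h]
  · simp only [Matrix.sub_apply, liftOp_apply_of_not_agree _ h, sub_zero]

theorem liftOp_zero (e : V → W) : liftOp e (0 : Op V) = 0 := by
  ext x y
  by_cases h : ∀ w, w ∉ Set.range e → x w = y w
  · rw [liftOp_apply_of_agree _ h]; rfl
  · rw [liftOp_apply_of_not_agree _ h]; rfl

theorem liftOp_diagonal (e : V → W) (d : Bits V → ℂ) :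
    liftOp e (Matrix.diagonal d) = Matrix.diagonal fun x => d (x ∘ e) := by
  ext x y
  by_cases hxy : x = y
  · subst hxy
    rw [liftOp_apply_of_agree _ fun _ _ => rfl]
    simp
  · rw [Matrix.diagonal_apply_ne _ hxy]
    by_cases h : ∀ w, w ∉ Set.range e → x w = y w
    · rw [liftOp_apply_of_agree _ h, Matrix.diagonal_apply_ne]
      intro h'
      apply hxy
      funext w
      by_cases hw : w ∈ Set.range e
      · obtain ⟨u, rfl⟩ := hw
        exact congrFun h' u
      · exact h w hw
    · rw [liftOp_apply_of_not_agree _ h]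

theorem liftOp_proj (e : V → W) (p : Bits V → Bool) :
    liftOp e (proj p) = proj fun x => p (x ∘ e) := liftOp_diagonal e _

theorem liftOp_pmat {e : V → W} (he : Function.Injective e) (f : Bits V → Bits V) :
    liftOp e (pmat f) = pmat fun x => Function.extend e (f (x ∘ e)) x := by
  ext x y
  simp only [pmat, Matrix.of_apply, extend_eq_iff he]
  by_cases h : ∀ w, w ∉ Set.range e → x w = y w
  · rw [liftOp_apply_of_agree _ h]
    simp only [and_iff_right h, Matrix.of_apply]
  · rw [liftOp_apply_of_not_agree _ h, if_neg fun h' => h h'.1]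

theorem liftOp_liftOp {U : Type} [Fintype U] [DecidableEq U] {e : V → W} {e' : U → V}
    (he : Function.Injective e) (A : Op U) :
    liftOp e (liftOp e' A) = liftOp (e ∘ e') A := by
  ext x y
  by_cases h : ∀ w, w ∉ Set.range (e ∘ e') → x w = y w
  · rw [liftOp_apply_of_agree _ h, liftOp_apply_of_agree, liftOp_apply_of_agree]
    · rfl
    · intro v hv
      exact h (e v) fun ⟨u, hu⟩ => hv ⟨u, he hu⟩
    · intro w hw
      exact h w fun ⟨u, hu⟩ => hw ⟨e' u, hu⟩
  · rw [liftOp_apply_of_not_agree _ h]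
    by_cases h1 : ∀ w, w ∉ Set.range e → x w = y w
    · rw [liftOp_apply_of_agree _ h1, liftOp_apply_of_not_agree]
      intro h2
      apply h
      intro w hw
      by_cases hw' : w ∈ Set.range e
      · obtain ⟨v, rfl⟩ := hw'
        exact h2 v fun ⟨u, hu⟩ => hw ⟨u, by simp [hu]⟩
      · exact h1 w hw'
    · rw [liftOp_apply_of_not_agree _ h1]

theorem actsOn_liftOp {e : V → W} (A : Op V) {s : Set W}
    (hs : ∀ v, e v ∈ s) : ActsOn s (liftOp e A) :=
  ⟨liftOp (fun v => ⟨e v, hs v⟩) A, by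
    classical
    rw [liftOp_liftOp Subtype.val_injective]
    rfl⟩

theorem ActsOn.mul {s : Set W} {A B : Op W} (hA : ActsOn s A) (hB : ActsOn s B) :
    ActsOn s (A * B) := by
  classical
  obtain ⟨A, rfl⟩ := hA
  obtain ⟨B, rfl⟩ := hB
  exact ⟨A * B, liftOp_mul Subtype.val_injective A B⟩

theorem ActsOn.conjTranspose {s : Set W} {A : Op W} (hA : ActsOn s A) : ActsOn s Aᴴ := by
  classical
  obtain ⟨A, rfl⟩ := hA
  exact ⟨Aᴴ, conjTranspose_liftOp _ A⟩

theorem actsOn_one (s : Set W) : ActsOn s (1 : Op W) := by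
  classical
  exact ⟨1, liftOp_one.symm⟩

theorem ActsOn.mono {s t : Set W} {A : Op W} (hA : ActsOn s A) (h : s ⊆ t) : ActsOn t A := by
  classical
  obtain ⟨A, rfl⟩ := hA
  exact actsOn_liftOp A fun v => h v.2

open Classical in
theorem actsOn_proj {s : Set W} {p : Bits W → Bool}
    (hp : ∀ x y : Bits W, (∀ w ∈ s, x w = y w) → p x = p y) : ActsOn s (proj p) := by
  refine ⟨proj fun u => p fun w => if h : w ∈ s then u ⟨w, h⟩ else false, ?_⟩
  rw [liftOp_proj]
  congr 1
  funext x
  refine hp _ _ fun w hw => ?_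
  simp [hw]

open Classical in
theorem actsOn_pmat {s : Set W} {f : Bits W → Bits W} (h1 : ∀ x, ∀ w ∉ s, f x w = x w)
    (h2 : ∀ x y : Bits W, (∀ w ∈ s, x w = y w) → ∀ w ∈ s, f x w = f y w) :
    ActsOn s (pmat f) := by
  refine ⟨pmat fun u w => f (fun w => if h : w ∈ s then u ⟨w, h⟩ else false) w, ?_⟩
  rw [liftOp_pmat Subtype.val_injective]
  congr 1
  funext x
  refine (extend_eq_iff Subtype.val_injective _ _ _).2 ⟨fun w hw => h1 x w (by simpa using hw), ?_⟩
  funext w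
  refine h2 _ _ (fun w hw => ?_) _ w.2
  simp [hw]

/-- Between basis states `x` and `z` only one intermediate state contributes to the product: `z` on
`s` and `x` elsewhere. The resulting entry is a product of an entry of each factor, and this formula
is symmetric. -/
theorem ActsOn.commute {s t : Set W} {A B : Op W} (hA : ActsOn s A) (hB : ActsOn t B)
    (h : Disjoint s t) : A * B = B * A := by
  classical
  obtain ⟨A, rfl⟩ := hA
  obtain ⟨B, rfl⟩ := hB
  have key : ∀ {s t : Set W} (A : Op s) (B : Op t), Disjoint s t → ∀ x z : Bits W,
      (liftOp Subtype.val A * liftOp Subtype.val B) x z =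
        if ∀ w, w ∉ s → w ∉ t → x w = z w then
          A (fun w => x w) (fun w => z w) * B (fun w => x w) (fun w => z w) else 0 := by
    intro s t A B h x z
    rw [Matrix.mul_apply, sum_eq_sum_extend (Subtype.val_injective (p := (· ∈ s))) x,
      Finset.sum_eq_single (z ∘ Subtype.val)]
    · rw [liftOp_apply_of_agree A fun w hw => (extend_of_notMem _ x hw).symm,
        extend_comp_self Subtype.val_injective]
      by_cases hxz : ∀ w, w ∉ s → w ∉ t → x w = z w
      · rw [if_pos hxz, liftOp_apply_of_agree]
        · congr 2
          funext w
          have : (w : W) ∉ Set.range (Subtype.val : s → W) := by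
            simpa using Set.disjoint_right.1 h w.2
          exact extend_of_notMem _ x this
        · intro w hw
          by_cases hws : w ∈ s
          · exact Subtype.val_injective.extend_apply _ _ (⟨w, hws⟩ : s)
          · rw [extend_of_notMem _ _ (by simpa using hws)]
            exact hxz w hws (by simpa using hw)
      · rw [if_neg hxz, liftOp_apply_of_not_agree B, mul_zero]
        intro h'
        apply hxz
        intro w hws hwt
        rw [← h' w (by simpa using hwt), extend_of_notMem _ _ (by simpa using hws)]
    · intro v _ hv
      rw [liftOp_apply_of_not_agree B, mul_zero]
      intro h'
      apply hv
      funext w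
      have := h' w (by simpa using Set.disjoint_left.1 h w.2)
      rwa [Subtype.val_injective.extend_apply] at this
    · simp
    · intro y hy
      rw [liftOp_apply_of_not_agree A hy, zero_mul]
  ext x z
  rw [key A B h, key B A h.symm]
  congr 1
  · apply propext
    exact ⟨fun h w a b => h w b a, fun h w a b => h w b a⟩
  · rw [mul_comm]

end Lift

/-! ### Gates -/

section Gates

/-- Renaming of wires. -/
def Gate.map {V W : Type} (e : V → W) (he : Function.Injective e) : Gate V → Gate W
  | .had i => .had (e i)
  | .phaseT i => .phaseT (e i)
  | .phaseTdg i => .phaseTdg (e i)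
  | .not i => .not (e i)
  | .cnot c i h => .cnot (e c) (e i) (he.ne h)
  | .toffoli c c' i h h' => .toffoli (e c) (e c') (e i) (he.ne h) (he.ne h')

def Gate.inv {W : Type} : Gate W → Gate W
  | .phaseT i => .phaseTdg i
  | .phaseTdg i => .phaseT i
  | g => g

variable {V W : Type} [Fintype V] [DecidableEq V] [Fintype W] [DecidableEq W]

theorem agree_iff {e : V → W} (he : Function.Injective e) (i : V) (x y : Bits W) :
    (∀ j, j ≠ e i → x j = y j) ↔
      (∀ w, w ∉ Set.range e → x w = y w) ∧ ∀ j, j ≠ i → (x ∘ e) j = (y ∘ e) j := by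
  constructor
  · intro h
    refine ⟨fun w hw => h w ?_, fun j hj => h _ (he.ne hj)⟩
    rintro rfl
    exact hw ⟨i, rfl⟩
  · rintro ⟨h1, h2⟩ w hw
    by_cases hw' : w ∈ Set.range e
    · obtain ⟨j, rfl⟩ := hw'
      exact h2 j fun h => hw (h ▸ rfl)
    · exact h1 w hw'

theorem basisOp_eq_liftOp {e : V → W} (he : Function.Injective e) (i : V) (f : Bits V → Bool) :
    basisOp (fun y : Bits W => Function.update y (e i) (f (y ∘ e))) =
      liftOp e (basisOp fun y => Function.update y i (f y)) := by
  change pmat _ = liftOp e (pmat _)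
  rw [liftOp_pmat he]
  congr 1
  funext y
  refine (extend_eq_iff he _ _ _).2 ⟨fun w hw => Function.update_of_ne ?_ _ _, ?_⟩
  · rintro rfl
    exact hw ⟨i, rfl⟩
  · rw [Function.update_comp_eq_of_injective _ he]

theorem Gate.op_map {e : V → W} (he : Function.Injective e) (g : Gate V) :
    (g.map e he).op = liftOp e g.op := by
  cases g with
  | had i =>
    ext x y
    simp only [Gate.map, Gate.op, Matrix.of_apply, agree_iff he]
    by_cases h : ∀ w, w ∉ Set.range e → x w = y w
    · rw [liftOp_apply_of_agree _ h]
      simp only [and_iff_right h, Matrix.of_apply]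
      rfl
    · rw [liftOp_apply_of_not_agree _ h, if_neg fun h' => h h'.1]
  | phaseT i => simp only [Gate.map, Gate.op, liftOp_diagonal]; rfl
  | phaseTdg i => simp only [Gate.map, Gate.op, liftOp_diagonal]; rfl
  | not i => exact basisOp_eq_liftOp he i fun y => !(y i)
  | cnot c i h => exact basisOp_eq_liftOp he i fun y => xor (y i) (y c)
  | toffoli c c' i h h' => exact basisOp_eq_liftOp he i fun y => xor (y i) (y c && y c')

theorem gatesOp_append (gs gs' : List (Gate W)) :
    gatesOp (gs ++ gs') = gatesOp gs' * gatesOp gs := by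
  induction gs with
  | nil => simp [gatesOp]
  | cons g gs ih => rw [List.cons_append, gatesOp, gatesOp, ih, Matrix.mul_assoc]

theorem gatesOp_map {e : V → W} (he : Function.Injective e) (gs : List (Gate V)) :
    gatesOp (gs.map (Gate.map e he)) = liftOp e (gatesOp gs) := by
  induction gs with
  | nil => exact liftOp_one.symm
  | cons g gs ih => rw [List.map_cons, gatesOp, gatesOp, ih, Gate.op_map, liftOp_mul he]

/-- The gate is lifted from a single wire, where the claim concerns a two by two matrix. -/
theorem had_mul_had (i : W) : (Gate.had i).op * (Gate.had i).op = 1 := by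
  have he : Function.Injective (fun _ : Fin 1 => i) := Function.injective_of_subsingleton _
  have h : (Gate.had i).op = liftOp (fun _ : Fin 1 => i) (Gate.had 0).op := Gate.op_map he (.had 0)
  rw [h, liftOp_mul he]
  suffices hh : (Gate.had (0 : Fin 1)).op * (Gate.had 0).op = 1 by rw [hh, liftOp_one]
  ext x y
  have h2 : (Real.sqrt 2 : ℂ) * (Real.sqrt 2 : ℂ) = 2 := by
    rw [← Complex.ofReal_mul, Real.mul_self_sqrt (by norm_num)]; norm_num
  have h2' : (Real.sqrt 2 : ℂ) ≠ 0 := by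
    intro h; rw [h] at h2; norm_num at h2
  have hx : x = fun _ => x 0 := by funext j; rw [Subsingleton.elim j 0]
  have hy : y = fun _ => y 0 := by funext j; rw [Subsingleton.elim j 0]
  have hj : ∀ j : Fin 1, j = 0 := fun j => Subsingleton.elim j 0
  rw [Matrix.mul_apply, ← (Equiv.funUnique (Fin 1) Bool).symm.sum_comp]
  simp only [Fintype.sum_bool, Gate.op, Matrix.of_apply, hj, ne_eq, not_true_eq_false,
    false_imp_iff, implies_true, if_true]
  rw [hx, hy]
  cases x 0 <;> cases y 0 <;> simp [funext_iff] <;> field_simp <;>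
    simp [pow_two, h2] <;> norm_num

/-- The condition `f` does not see the target bit, so flipping twice under it is the identity. -/
theorem basisOp_update_mul_self (i : W) (f : Bits W → Bool)
    (hf : ∀ y b, f (Function.update y i b) = f y) :
    basisOp (fun y : Bits W => Function.update y i (xor (y i) (f y))) *
      basisOp (fun y : Bits W => Function.update y i (xor (y i) (f y))) = 1 := by
  change pmat _ * pmat _ = 1
  rw [pmat_mul_pmat, ← pmat_id]
  congr 1
  funext y
  simp [hf]

theorem conjTranspose_basisOp_update (i : W) (f : Bits W → Bool)
    (hf : ∀ y b, f (Function.update y i b) = f y) :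
    (basisOp (fun y : Bits W => Function.update y i (xor (y i) (f y))))ᴴ =
      basisOp (fun y : Bits W => Function.update y i (xor (y i) (f y))) := by
  have key : ∀ x y : Bits W, x = Function.update y i (xor (y i) (f y)) →
      y = Function.update x i (xor (x i) (f x)) := by
    rintro x y rfl
    simp [hf]
  ext x y
  simp only [basisOp, Matrix.conjTranspose_apply, Matrix.of_apply, apply_ite (star : ℂ → ℂ),
    star_one, star_zero]
  congr 1
  exact propext ⟨key y x, key x y⟩

theorem Gate.conjTranspose_op (g : Gate W) : g.opᴴ = g.inv.op := by
  have hexp : ∀ z : ℂ, star (Complex.exp z) = Complex.exp (star z) := fun z =>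
    (Complex.exp_conj z).symm
  cases g with
  | had i =>
    ext x y
    simp only [Gate.inv, Gate.op, Matrix.conjTranspose_apply, Matrix.of_apply]
    have : (∀ j, j ≠ i → y j = x j) ↔ ∀ j, j ≠ i → x j = y j :=
      ⟨fun h j hj => (h j hj).symm, fun h j hj => (h j hj).symm⟩
    simp only [this]
    split_ifs <;> simp_all
  | phaseT i =>
    simp only [Gate.inv, Gate.op, Matrix.diagonal_conjTranspose]
    congr 1
    funext x
    by_cases h : x i = true
    · simp only [Pi.star_apply, h, if_true, hexp]
      congr 1
      simp
    · simp [h]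
  | phaseTdg i =>
    simp only [Gate.inv, Gate.op, Matrix.diagonal_conjTranspose]
    congr 1
    funext x
    by_cases h : x i = true
    · simp only [Pi.star_apply, h, if_true, hexp]
      congr 1
      simp
    · simp [h]
  | not i =>
    have := conjTranspose_basisOp_update i (fun _ => true) (by simp)
    simpa [Gate.inv, Gate.op] using this
  | cnot c i h => exact conjTranspose_basisOp_update i (fun y => y c) (by simp [h])
  | toffoli c c' i h h' =>
    exact conjTranspose_basisOp_update i (fun y => y c && y c') (by simp [h, h'])

theorem Gate.conjTranspose_op_mul_op (g : Gate W) : g.opᴴ * g.op = 1 := by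
  rw [Gate.conjTranspose_op]
  have hexp : Complex.exp (-(Real.pi / 4 * Complex.I)) * Complex.exp (Real.pi / 4 * Complex.I) = 1 := by
    rw [← Complex.exp_add]; simp
  cases g with
  | had i => exact had_mul_had i
  | phaseT i =>
    simp only [Gate.inv, Gate.op, Matrix.diagonal_mul_diagonal, ← Matrix.diagonal_one]
    congr 1
    funext x
    by_cases h : x i = true
    · simp only [h, if_true, hexp]
    · simp [h]
  | phaseTdg i =>
    simp only [Gate.inv, Gate.op, Matrix.diagonal_mul_diagonal, ← Matrix.diagonal_one]
    congr 1
    funext x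
    by_cases h : x i = true
    · simp only [h, if_true]
      rw [mul_comm, hexp]
    · simp [h]
  | not i =>
    have := basisOp_update_mul_self i (fun _ => true) (by simp)
    simpa [Gate.inv, Gate.op] using this
  | cnot c i h => exact basisOp_update_mul_self i (fun y => y c) (by simp [h])
  | toffoli c c' i h h' => exact basisOp_update_mul_self i (fun y => y c && y c') (by simp [h, h'])

theorem conjTranspose_gatesOp_mul_self (gs : List (Gate W)) : (gatesOp gs)ᴴ * gatesOp gs = 1 := by
  induction gs with
  | nil => simp [gatesOp]
  | cons g gs ih =>
    rw [gatesOp, Matrix.conjTranspose_mul, Matrix.mul_assoc, ← Matrix.mul_assoc _ (gatesOp gs),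
      ih, Matrix.one_mul, Gate.conjTranspose_op_mul_op]

theorem gatesOp_mul_conjTranspose_self (gs : List (Gate W)) : gatesOp gs * (gatesOp gs)ᴴ = 1 :=
  mul_eq_one_comm.1 (conjTranspose_gatesOp_mul_self gs)

/-- The inverse circuit. -/
def invGates (gs : List (Gate W)) : List (Gate W) := gs.reverse.map Gate.inv

theorem gatesOp_invGates (gs : List (Gate W)) : gatesOp (invGates gs) = (gatesOp gs)ᴴ := by
  induction gs with
  | nil => simp [gatesOp, invGates]
  | cons g gs ih =>
    rw [invGates, List.reverse_cons, List.map_append, gatesOp_append, ← invGates, ih, gatesOp,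
      Matrix.conjTranspose_mul, Gate.conjTranspose_op]
    simp [gatesOp]

end Gates

/-! ### Norms -/

section Norms

variable {α β δ : Type*} [Fintype α] [DecidableEq α] [Fintype β] [DecidableEq β] [Fintype δ]
  [DecidableEq δ]

/-- The square of the Euclidean norm. -/
noncomputable def normSq (v : α → ℂ) : ℝ := ∑ i, ‖v i‖ ^ 2

theorem normSq_nonneg (v : α → ℂ) : 0 ≤ normSq v := Finset.sum_nonneg fun _ _ => by positivity

theorem normSq_eq (v : α → ℂ) : normSq v = ‖WithLp.toLp 2 v‖ ^ 2 := by
  rw [EuclideanSpace.norm_sq_eq]; rfl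

theorem normSq_mulVec_le (A : Matrix β α ℂ) (v : α → ℂ) :
    normSq (A *ᵥ v) ≤ ‖A‖ ^ 2 * normSq v := by
  rw [normSq_eq, normSq_eq, ← mul_pow]
  exact pow_le_pow_left₀ (norm_nonneg _) (Matrix.l2_opNorm_mulVec A (WithLp.toLp 2 v)) 2

theorem norm_le_of_normSq {A : Matrix β α ℂ} {c : ℝ} (hc : 0 ≤ c)
    (h : ∀ v, normSq (A *ᵥ v) ≤ c ^ 2 * normSq v) : ‖A‖ ≤ c := by
  rw [Matrix.l2_opNorm_def]
  refine ContinuousLinearMap.opNorm_le_bound _ hc fun v => ?_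
  have := h v.ofLp
  rw [normSq_eq, normSq_eq, ← mul_pow] at this
  exact le_of_sq_le_sq this (by positivity)

theorem norm_le_one_of_isometry {A : Matrix β α ℂ} (h : Aᴴ * A = 1) : ‖A‖ ≤ 1 := by
  have h1 := Matrix.l2_opNorm_conjTranspose_mul_self A
  rw [h] at h1
  rcases isEmpty_or_nonempty α with hα | hα
  · have : (1 : Matrix α α ℂ) = 0 := Subsingleton.elim _ _
    rw [this, norm_zero] at h1
    nlinarith [norm_nonneg A]
  · have : ‖(1 : Matrix α α ℂ)‖ = 1 := norm_one
    rw [this] at h1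
    nlinarith [norm_nonneg A]

theorem norm_proj_le_one (p : α → Bool) : ‖proj p‖ ≤ 1 := by
  rw [proj, Matrix.l2_opNorm_diagonal]
  refine (pi_norm_le_iff_of_nonneg zero_le_one).2 fun i => ?_
  split_ifs <;> simp

theorem normSq_mulVec (A : Matrix β α ℂ) (v : α → ℂ) :
    (normSq (A *ᵥ v) : ℂ) = star v ⬝ᵥ ((Aᴴ * A) *ᵥ v) := by
  rw [← Matrix.mulVec_mulVec, Matrix.dotProduct_mulVec, ← Matrix.star_mulVec, normSq, dotProduct]
  push_cast
  refine Finset.sum_congr rfl fun i _ => ?_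
  rw [Pi.star_apply, ← Complex.conj_mul']
  rfl

theorem norm_dotProduct_mulVec_le (X : Matrix α α ℂ) (v : α → ℂ) :
    ‖star v ⬝ᵥ (X *ᵥ v)‖ ≤ ‖X‖ * normSq v := by
  have h := norm_inner_le_norm (𝕜 := ℂ) (WithLp.toLp 2 v) (WithLp.toLp 2 (X *ᵥ v))
  rw [EuclideanSpace.inner_eq_star_dotProduct, dotProduct_comm] at h
  refine h.trans ?_
  have h2 := Matrix.l2_opNorm_mulVec X (WithLp.toLp 2 v)
  rw [normSq_eq, pow_two, ← mul_assoc, mul_comm]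
  exact mul_le_mul_of_nonneg_right h2 (norm_nonneg _)

open scoped MatrixOrder in
theorem exists_eq_conjTranspose_mul_self {ρ : Matrix α α ℂ} (hρ : ρ.PosSemidef) :
    ∃ C : Matrix α α ℂ, ρ = Cᴴ * C :=
  CStarAlgebra.nonneg_iff_eq_star_mul_self.1 (Matrix.nonneg_iff_posSemidef.2 hρ)

/-- With `ρ = Cᴴ C` the trace is a sum of terms `⟨v, X v⟩` over vectors whose squared norms add up
to `1`. This turns operator norm bounds into bounds on the advantage of a distinguisher. -/
theorem abs_trace_mul_le {ρ : Matrix α α ℂ} (hρ : ρ.PosSemidef) (h1 : ρ.trace = 1)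
    (X : Matrix α α ℂ) : |(ρ * X).trace.re| ≤ ‖X‖ := by
  obtain ⟨C, rfl⟩ := exists_eq_conjTranspose_mul_self hρ
  have hcol : ∀ (Y : Matrix α α ℂ) (i : α), (C * Y * Cᴴ) i i =
      star (fun j => star (C i j)) ⬝ᵥ (Y *ᵥ fun j => star (C i j)) := by
    intro Y i
    rw [Matrix.mul_assoc, Matrix.mul_apply, dotProduct]
    refine Finset.sum_congr rfl fun j _ => ?_
    simp [Matrix.mulVec, dotProduct, Matrix.mul_apply]
  have hn : ∑ i, normSq (fun j => star (C i j)) = 1 := by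
    have : ((∑ i, normSq (fun j => star (C i j)) : ℝ) : ℂ) = 1 := by
      rw [← h1, Matrix.trace_mul_comm, ← Matrix.mul_one C, Matrix.trace]
      push_cast
      refine Finset.sum_congr rfl fun i _ => ?_
      rw [Matrix.diag_apply, Matrix.mul_one, show C * Cᴴ = C * 1 * Cᴴ by rw [Matrix.mul_one],
        hcol]
      have := normSq_mulVec (1 : Matrix α α ℂ) fun j => star (C i j)
      simpa using this
    exact_mod_cast this
  rw [Matrix.mul_assoc, Matrix.trace_mul_comm, Matrix.trace]
  refine (Complex.abs_re_le_norm _).trans ((norm_sum_le _ _).trans ?_)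
  calc ∑ i, ‖(C * X * Cᴴ).diag i‖ ≤ ∑ i, ‖X‖ * normSq (fun j => star (C i j)) :=
        Finset.sum_le_sum fun i _ => by
          rw [Matrix.diag_apply, hcol]
          exact norm_dotProduct_mulVec_le X _
    _ = ‖X‖ := by rw [← Finset.mul_sum, hn, mul_one]

open scoped MatrixOrder in
theorem norm_le_one_of_posSemidef {E : Matrix α α ℂ} (h0 : E.PosSemidef)
    (h1 : (1 - E).PosSemidef) : ‖E‖ ≤ 1 :=
  (CStarAlgebra.norm_le_one_iff_of_nonneg E (Matrix.nonneg_iff_posSemidef.2 h0)).2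
    (Matrix.le_iff.2 h1)

theorem norm_mul_le_one {A : Matrix δ β ℂ} {B : Matrix β α ℂ} (hA : ‖A‖ ≤ 1) (hB : ‖B‖ ≤ 1) :
    ‖A * B‖ ≤ 1 :=
  (Matrix.l2_opNorm_mul A B).trans (mul_le_one₀ hA (norm_nonneg _) hB)

/-- The two occurrences of the contraction are exchanged one at a time, at the cost `‖a - b‖` each.
-/
theorem norm_conj_sub_conj_le {E : Matrix β β ℂ} (hE : ‖E‖ ≤ 1) {a b : Matrix β α ℂ}
    (ha : ‖a‖ ≤ 1) (hb : ‖b‖ ≤ 1) : ‖aᴴ * E * a - bᴴ * E * b‖ ≤ 2 * ‖a - b‖ := by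
  have h : aᴴ * E * a - bᴴ * E * b = aᴴ * E * (a - b) + (a - b)ᴴ * (E * b) := by
    rw [Matrix.conjTranspose_sub, Matrix.mul_sub, Matrix.sub_mul, ← Matrix.mul_assoc,
      ← Matrix.mul_assoc]
    abel
  rw [h]
  refine (norm_add_le _ _).trans ?_
  have h1 : ‖aᴴ * E‖ ≤ 1 := norm_mul_le_one ((Matrix.l2_opNorm_conjTranspose a).trans_le ha) hE
  have h2 : ‖E * b‖ ≤ 1 := norm_mul_le_one hE hb
  have h3 := Matrix.l2_opNorm_mul (aᴴ * E) (a - b)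
  have h4 := Matrix.l2_opNorm_mul (a - b)ᴴ (E * b)
  rw [Matrix.l2_opNorm_conjTranspose] at h4
  nlinarith [norm_nonneg (a - b), norm_nonneg (aᴴ * E), norm_nonneg (E * b)]

/-! ### Oblivious amplitude amplification -/

/-- One Grover step. If `Θ` is an isometry, the good amplitude is `1/2 = sin(π/6)` for every input
and the rotation to `sin(3π/6)` leaves exactly `-Θ`. No such assumption is made here, so that the
defect `Θᴴ Θ - 1` stays visible for the perturbation. -/
theorem amplification_eq {W Pg : Matrix β β ℂ} {J Θ : Matrix β α ℂ} (hW : Wᴴ * W = 1)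
    (hW' : W * Wᴴ = 1) (hJ : Jᴴ * J = 1) (hP : Pgᴴ = Pg) (hP' : Pg * Pg = Pg)
    (hΘ : (2 : ℂ) • (Pg * (W * J)) = Θ) :
    W * (1 - (2 : ℂ) • (J * Jᴴ)) * Wᴴ * (1 - (2 : ℂ) • Pg) * W * J =
      W * J * (Θᴴ * Θ - 1) - Θ := by
  have e1 : Wᴴ * (W * J) = J := by rw [← Matrix.mul_assoc, hW, Matrix.one_mul]
  have e2 : W * (Wᴴ * (Pg * (W * J))) = Pg * (W * J) := by
    rw [← Matrix.mul_assoc, hW', Matrix.one_mul]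
  have e3 : Jᴴ * (Wᴴ * (Pg * (Pg * (W * J)))) = Jᴴ * (Wᴴ * (Pg * (W * J))) := by
    rw [← Matrix.mul_assoc Pg Pg, hP']
  have hT : Θᴴ * Θ = (4 : ℂ) • (Jᴴ * (Wᴴ * (Pg * (W * J)))) := by
    rw [← hΘ, Matrix.conjTranspose_smul, Matrix.conjTranspose_mul, Matrix.conjTranspose_mul, hP]
    simp only [Matrix.mul_assoc, Matrix.smul_mul, Matrix.mul_smul, smul_smul, e3]
    norm_num
  rw [hT, ← hΘ]
  simp only [Matrix.mul_assoc, Matrix.mul_sub, Matrix.sub_mul, Matrix.mul_one,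
    Matrix.smul_mul, Matrix.mul_smul, smul_smul, smul_sub, e1, e2, hJ]
  module

/-- For `Θ - E` in place of `Θ` the defect is `Eᴴ E - Eᴴ Θ - Θᴴ E`, of norm at most `3η` because `η
≤ 1`; the direct contribution of `E` is the fourth `η`. -/
theorem norm_amplification_add_le {W : Matrix β β ℂ} {J Θ E : Matrix β α ℂ}
    (hW : Wᴴ * W = 1) (hJ : Jᴴ * J = 1) (hΘ : Θᴴ * Θ = 1) {η : ℝ} (hE : ‖E‖ ≤ η)
    (hη : η ≤ 1) :
    ‖W * J * ((Θ - E)ᴴ * (Θ - E) - 1) - (Θ - E) + Θ‖ ≤ 4 * η := by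
  have h1 : (Θ - E)ᴴ * (Θ - E) - 1 = Eᴴ * E - Eᴴ * Θ - Θᴴ * E := by
    rw [Matrix.conjTranspose_sub, Matrix.sub_mul, Matrix.mul_sub, Matrix.mul_sub, hΘ]
    abel
  have h2 : W * J * ((Θ - E)ᴴ * (Θ - E) - 1) - (Θ - E) + Θ =
      W * J * (Eᴴ * E - Eᴴ * Θ - Θᴴ * E) + E := by rw [h1]; abel
  have hE0 := norm_nonneg E
  have nΘ : ‖Θ‖ ≤ 1 := norm_le_one_of_isometry hΘ
  have nWJ : ‖W * J‖ ≤ 1 := norm_le_one_of_isometry (by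
    rw [Matrix.conjTranspose_mul, Matrix.mul_assoc, ← Matrix.mul_assoc Wᴴ, hW, Matrix.one_mul, hJ])
  have a1 : ‖Eᴴ * E‖ ≤ η := by
    rw [Matrix.l2_opNorm_conjTranspose_mul_self]; nlinarith
  have a2 : ‖Eᴴ * Θ‖ ≤ η := (Matrix.l2_opNorm_mul _ _).trans (by
    rw [Matrix.l2_opNorm_conjTranspose]; nlinarith [norm_nonneg Θ])
  have a3 : ‖Θᴴ * E‖ ≤ η := (Matrix.l2_opNorm_mul _ _).trans (by
    rw [Matrix.l2_opNorm_conjTranspose]; nlinarith [norm_nonneg Θ])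
  have a4 : ‖Eᴴ * E - Eᴴ * Θ - Θᴴ * E‖ ≤ 3 * η :=
    (norm_sub_le _ _).trans (by linarith [norm_sub_le (Eᴴ * E) (Eᴴ * Θ)])
  rw [h2]
  refine (norm_add_le _ _).trans ?_
  have a5 := Matrix.l2_opNorm_mul (W * J) (Eᴴ * E - Eᴴ * Θ - Θᴴ * E)
  nlinarith [norm_nonneg (W * J), norm_nonneg (Eᴴ * E - Eᴴ * Θ - Θᴴ * E)]

/-! ### The probability that all rounds of the extraction fail -/

/-- The effect of failing in all of `m + 1` rounds, in terms of the effect `R` of failing in one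
round. -/
noncomputable def failOp (R : Matrix α α ℂ) (m : ℕ) : Matrix α α ℂ :=
  R * (1 - (2 : ℂ) • R + (2 : ℂ) • (R * R)) ^ m

/-- By the spectral theorem a polynomial in `R` is unitarily equivalent to the diagonal matrix of
its values at the eigenvalues, which lie between `0` and `1`. -/
theorem norm_aeval_le {R : Matrix α α ℂ} (h0 : R.PosSemidef) (h1 : (1 - R).PosSemidef)
    (p : Polynomial ℂ) {c : ℝ} (hc : 0 ≤ c)
    (hp : ∀ x : ℝ, 0 ≤ x → x ≤ 1 → ‖p.eval (x : ℂ)‖ ≤ c) : ‖Polynomial.aeval R p‖ ≤ c := by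
  have hH := h0.isHermitian
  have hev : ∀ i, 0 ≤ hH.eigenvalues i ∧ hH.eigenvalues i ≤ 1 := by
    intro i
    refine ⟨h0.eigenvalues_nonneg i, ?_⟩
    -- The upper bound comes from testing `1 - R` on the normalized eigenvector.
    have hv := hH.mulVec_eigenvectorBasis i
    have h2 := (h1.re_dotProduct_nonneg (hH.eigenvectorBasis i).ofLp)
    rw [Matrix.sub_mulVec, Matrix.one_mulVec, hv, dotProduct_sub] at h2
    have h3 : star (hH.eigenvectorBasis i).ofLp ⬝ᵥ (hH.eigenvectorBasis i).ofLp = 1 := by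
      have := (hH.eigenvectorBasis).orthonormal.1 i
      have h4 := inner_self_eq_norm_sq_to_K (𝕜 := ℂ) (hH.eigenvectorBasis i)
      rw [this, EuclideanSpace.inner_eq_star_dotProduct, dotProduct_comm] at h4
      simpa using h4
    rw [dotProduct_smul, h3] at h2
    simpa using h2
  have hD : Polynomial.aeval (Matrix.diagonal (RCLike.ofReal ∘ hH.eigenvalues) : Matrix α α ℂ) p =
      Matrix.diagonal fun i => p.eval (hH.eigenvalues i : ℂ) := by
    have := Polynomial.aeval_algHom_apply (Matrix.diagonalAlgHom (n := α) (α := ℂ) ℂ)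
      (RCLike.ofReal ∘ hH.eigenvalues : α → ℂ) p
    rw [Matrix.diagonalAlgHom_apply, Matrix.diagonalAlgHom_apply] at this
    rw [this]
    congr 1
    funext i
    have h2 := Polynomial.aeval_algHom_apply (Pi.evalAlgHom ℂ (fun _ : α => ℂ) i)
      (RCLike.ofReal ∘ hH.eigenvalues : α → ℂ) p
    simp only [Pi.evalAlgHom_apply, Function.comp_apply] at h2
    rw [← h2, Polynomial.coe_aeval_eq_eval]
    rfl
  have hs := hH.spectral_theorem
  rw [hs, Polynomial.aeval_algHom_apply, hD, Unitary.conjStarAlgAut_apply]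
  have hu : ‖(hH.eigenvectorUnitary : Matrix α α ℂ)‖ ≤ 1 :=
    norm_le_one_of_isometry (Unitary.coe_star_mul_self hH.eigenvectorUnitary)
  have hd : ‖(Matrix.diagonal fun i => p.eval (hH.eigenvalues i : ℂ) : Matrix α α ℂ)‖ ≤ c := by
    rw [Matrix.l2_opNorm_diagonal]
    exact (pi_norm_le_iff_of_nonneg hc).2 fun i => hp _ (hev i).1 (hev i).2
  have hu' : ‖star (hH.eigenvectorUnitary : Matrix α α ℂ)‖ ≤ 1 := by
    rw [norm_star]; exact hu
  have h3 := (norm_mul_le (hH.eigenvectorUnitary : Matrix α α ℂ)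
    (Matrix.diagonal fun i => p.eval (hH.eigenvalues i : ℂ))).trans
    (mul_le_mul hu hd (norm_nonneg _) zero_le_one)
  rw [one_mul] at h3
  exact (norm_mul_le _ _).trans ((mul_le_mul h3 hu' (norm_nonneg _) hc).trans_eq (mul_one c))

/-- With `y = x (1 - x) ≤ 1/2`, Bernoulli gives `(1 - 2y)^m (1 + 2my) ≤ (1 - 4y²)^m ≤ 1`. Since `2y
≤ 1`, also `2y (1 - 2y)^m ≤ (1 - 2y)^m`, and adding the two yields `2 (m + 1) y (1 - 2y)^m ≤ 1`. -/
theorem mul_pow_le {x : ℝ} (h0 : 0 ≤ x) (h1 : x ≤ 1) (m : ℕ) :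
    x * (1 - x) * (1 - 2 * x + 2 * (x * x)) ^ m ≤ 1 / (2 * (m + 1)) := by
  have hy0 : 0 ≤ x * (1 - x) := mul_nonneg h0 (by linarith)
  have hy1 : 2 * (x * (1 - x)) ≤ 1 := by nlinarith [sq_nonneg (2 * x - 1)]
  rw [show 1 - 2 * x + 2 * (x * x) = 1 - 2 * (x * (1 - x)) by ring]
  set y := x * (1 - x)
  have hb : 1 + m * (2 * y) ≤ (1 + 2 * y) ^ m := one_add_mul_le_pow (by linarith) m
  have hp : (0 : ℝ) ≤ (1 - 2 * y) ^ m := pow_nonneg (by linarith) m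
  have hm : (1 - 2 * y) ^ m * (1 + 2 * y) ^ m ≤ 1 := by
    rw [← mul_pow]
    exact pow_le_one₀ (by nlinarith) (by nlinarith)
  rw [le_div_iff₀ (by positivity)]
  have : (0 : ℝ) ≤ m := Nat.cast_nonneg m
  nlinarith [mul_le_mul_of_nonneg_left hb hp]

theorem base_mem {x : ℝ} (h0 : 0 ≤ x) (h1 : x ≤ 1) :
    0 ≤ 1 - 2 * x + 2 * (x * x) ∧ 1 - 2 * x + 2 * (x * x) ≤ 1 :=
  ⟨by nlinarith [sq_nonneg (2 * x - 1)], by nlinarith⟩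

theorem norm_failOp_le {R : Matrix α α ℂ} (h0 : R.PosSemidef) (h1 : (1 - R).PosSemidef) (m : ℕ) :
    ‖failOp R m‖ ≤ 1 := by
  have h := norm_aeval_le h0 h1 (.X * (1 - .C 2 * .X + .C 2 * (.X * .X)) ^ m) zero_le_one
    fun x hx0 hx1 => ?_
  · simpa [failOp, Algebra.smul_def] using h
  · obtain ⟨hb0, hb1⟩ := base_mem hx0 hx1
    have : (Polynomial.eval (x : ℂ) (.X * (1 - .C 2 * .X + .C 2 * (.X * .X)) ^ m)) =
        ((x * (1 - 2 * x + 2 * (x * x)) ^ m : ℝ) : ℂ) := by simp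
    rw [this, Complex.norm_real, Real.norm_of_nonneg (mul_nonneg hx0 (pow_nonneg hb0 m))]
    exact mul_le_one₀ hx1 (pow_nonneg hb0 m) (pow_le_one₀ hb0 hb1)

/-- On an eigenvalue one of the two factors from `failOp` is estimated by `1`, and `mul_pow_le`
bounds the rest. A small eigenvalue makes `R` small, one near `1` makes `1 - R` small, and between
them the power decays. -/
theorem norm_failOp_mul_le {R : Matrix α α ℂ} (h0 : R.PosSemidef) (h1 : (1 - R).PosSemidef)
    (m : ℕ) : ‖failOp R m * (1 - R) * failOp R m‖ ≤ 1 / (2 * (m + 1)) := by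
  have h := norm_aeval_le h0 h1 ((.X * (1 - .C 2 * .X + .C 2 * (.X * .X)) ^ m) * (1 - .X) *
    (.X * (1 - .C 2 * .X + .C 2 * (.X * .X)) ^ m)) (c := 1 / (2 * (m + 1))) (by positivity)
    fun x hx0 hx1 => ?_
  · simpa [failOp, Algebra.smul_def] using h
  · obtain ⟨hb0, hb1⟩ := base_mem hx0 hx1
    have : (Polynomial.eval (x : ℂ) ((.X * (1 - .C 2 * .X + .C 2 * (.X * .X)) ^ m) * (1 - .X) *
      (.X * (1 - .C 2 * .X + .C 2 * (.X * .X)) ^ m))) =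
        (((x * (1 - 2 * x + 2 * (x * x)) ^ m) * (1 - x) *
          (x * (1 - 2 * x + 2 * (x * x)) ^ m) : ℝ) : ℂ) := by simp
    have hq0 := mul_nonneg hx0 (pow_nonneg hb0 m)
    have hq1 := mul_le_one₀ hx1 (pow_nonneg hb0 m) (pow_le_one₀ hb0 hb1)
    have hx2 : 0 ≤ 1 - x := by linarith
    rw [this, Complex.norm_real, Real.norm_of_nonneg (mul_nonneg (mul_nonneg hq0 hx2) hq0)]
    refine le_trans ?_ (mul_pow_le hx0 hx1 m)
    calc x * (1 - 2 * x + 2 * (x * x)) ^ m * (1 - x) * (x * (1 - 2 * x + 2 * (x * x)) ^ m)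
        ≤ x * (1 - 2 * x + 2 * (x * x)) ^ m * (1 - x) * 1 :=
          mul_le_mul_of_nonneg_left hq1 (mul_nonneg hq0 hx2)
      _ = x * (1 - x) * (1 - 2 * x + 2 * (x * x)) ^ m := by ring

theorem conjTranspose_failOp {R : Matrix α α ℂ} (hR : Rᴴ = R) (m : ℕ) :
    (failOp R m)ᴴ = failOp R m := by
  have hK : (1 - (2 : ℂ) • R + (2 : ℂ) • (R * R))ᴴ = 1 - (2 : ℂ) • R + (2 : ℂ) • (R * R) := by
    simp [Matrix.conjTranspose_add, Matrix.conjTranspose_sub, Matrix.conjTranspose_smul,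
      Matrix.conjTranspose_mul, hR]
  rw [failOp, Matrix.conjTranspose_mul, Matrix.conjTranspose_pow, hK, hR]
  refine (Commute.pow_right ?_ m).eq.symm
  refine ((Commute.one_right R).sub_right ((Commute.refl R).smul_right 2)).add_right
    (((Commute.refl R).mul_right (Commute.refl R)).smul_right 2)

/-- If every vector on which `Y` is large is one on which `Z` is not too small, then `Y` is small
on the part that survives many rounds of failed attempts. -/
theorem norm_mul_failOp_le {Y : Matrix β α ℂ} {Z : Matrix δ α ℂ} {γ δ' : ℝ} (hY : ‖Y‖ ≤ 1)
    (hγ : 0 < γ) (hδ : 0 < δ')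
    (hYZ : ∀ v, γ * normSq v ≤ normSq (Y *ᵥ v) → δ' * normSq v ≤ normSq (Z *ᵥ v))
    (hR : (1 - Zᴴ * Z).PosSemidef) {m : ℕ} (hm : 1 / (2 * (m + 1)) ≤ γ * δ') :
    ‖Y * failOp (1 - Zᴴ * Z) m‖ ≤ √γ := by
  set R := 1 - Zᴴ * Z with hRdef
  have hR1 : 1 - R = Zᴴ * Z := by rw [hRdef]; abel
  have hR1' : (1 - R).PosSemidef := by
    rw [hR1]; exact Matrix.posSemidef_conjTranspose_mul_self Z
  have hφ := norm_failOp_le hR hR1' m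
  -- Since `Zᴴ Z = 1 - R`, the square of this norm is the norm of `φ (1 - R) φ`.
  have hZφ : ‖Z * failOp R m‖ ^ 2 ≤ 1 / (2 * (m + 1)) := by
    rw [pow_two, ← Matrix.l2_opNorm_conjTranspose_mul_self, Matrix.conjTranspose_mul,
      conjTranspose_failOp hR.isHermitian, Matrix.mul_assoc, ← Matrix.mul_assoc Zᴴ, ← hR1,
      ← Matrix.mul_assoc]
    exact norm_failOp_mul_le hR hR1' m
  refine norm_le_of_normSq (Real.sqrt_nonneg _) fun v => ?_
  rw [Real.sq_sqrt hγ.le, ← Matrix.mulVec_mulVec]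
  set u := failOp R m *ᵥ v with hu
  have h1 : normSq u ≤ normSq v := by
    refine (normSq_mulVec_le _ v).trans ?_
    have := pow_le_one₀ (norm_nonneg _) hφ (n := 2)
    nlinarith [normSq_nonneg v]
  have h2 : normSq (Y *ᵥ u) ≤ normSq u := by
    refine (normSq_mulVec_le _ u).trans ?_
    have := pow_le_one₀ (norm_nonneg _) hY (n := 2)
    nlinarith [normSq_nonneg u]
  have h3 : normSq (Z *ᵥ u) ≤ γ * δ' * normSq v := by
    rw [hu, Matrix.mulVec_mulVec]
    refine (normSq_mulVec_le _ v).trans ?_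
    exact mul_le_mul_of_nonneg_right (hZφ.trans hm) (normSq_nonneg v)
  -- Either `Y` is small on `u`, or the hypothesis gives `δ' ‖u‖² ≤ ‖Z u‖² ≤ γ δ' ‖v‖²`, so that `u`
  -- itself is short.
  by_cases h : γ * normSq u ≤ normSq (Y *ᵥ u)
  · have h4 := (hYZ u h).trans h3
    have h5 : normSq u ≤ γ * normSq v := by
      by_contra hlt
      push Not at hlt
      nlinarith
    exact h2.trans h5
  · push Not at h
    exact h.le.trans (mul_le_mul_of_nonneg_left h1 hγ.le)

/-- The effect of failing in all of `m` rounds in which first the projection `1 - P` and then `Q` are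
measured. -/
noncomputable def failEff (P Q : Matrix β β ℂ) : ℕ → Matrix β β ℂ
  | 0 => 1
  | m + 1 => P * (Q * failEff P Q m * Q + (1 - Q) * failEff P Q m * (1 - Q)) * P

/-- Put `C = P Q P`. After a failure the outcome `Q` followed by another failure contributes `C²`,
and the outcome `1 - Q` contributes `(P - C)²`. The sum is `P (1 - 2C + 2C²)`, and everything
commutes with `C`. -/
theorem failEff_succ {P Q : Matrix β β ℂ} (hP : P * P = P) (hQ : Q * Q = Q) (m : ℕ) :
    failEff P Q (m + 1) =
      P * (1 - (2 : ℂ) • (P * Q * P) + (2 : ℂ) • (P * Q * P * (P * Q * P))) ^ m := by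
  set C := P * Q * P with hC
  set K := 1 - (2 : ℂ) • C + (2 : ℂ) • (C * C) with hK
  have hPC : P * C = C := by rw [hC, ← Matrix.mul_assoc, ← Matrix.mul_assoc, hP]
  have hCP : C * P = C := by rw [hC, Matrix.mul_assoc, hP]
  have hcP : Commute P C := by rw [Commute, SemiconjBy, hPC, hCP]
  have hcPK : Commute P K := ((Commute.one_right P).sub_right (hcP.smul_right 2)).add_right
    ((hcP.mul_right hcP).smul_right 2)
  have hcCK : Commute C K := ((Commute.one_right C).sub_right
    ((Commute.refl C).smul_right 2)).add_right
    (((Commute.refl C).mul_right (Commute.refl C)).smul_right 2)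
  induction m with
  | zero =>
    have h : Q * 1 * Q + (1 - Q) * 1 * (1 - Q) = 1 := by
      simp only [Matrix.mul_one, Matrix.mul_sub, Matrix.sub_mul, Matrix.one_mul, hQ]
      abel
    rw [failEff, failEff, h, pow_zero, Matrix.mul_one, hP]
  | succ m ih =>
    rw [failEff, ih, pow_succ]
    have h1 := (hcPK.pow_right m).eq
    have h2 := (hcCK.pow_right m).eq
    generalize K ^ m = M at h1 h2 ⊢
    have hPM : P * M = P * M * P := by rw [Matrix.mul_assoc, ← h1, ← Matrix.mul_assoc, hP]
    have hPQ : P * (1 - Q) * P = P - C := by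
      rw [Matrix.mul_sub, Matrix.mul_one, Matrix.sub_mul, hP, hC]
    have e1 : P * (Q * (P * M) * Q) * P = M * (C * C) := by
      calc P * (Q * (P * M) * Q) * P = P * (Q * (P * M * P) * Q) * P := by rw [← hPM]
        _ = C * M * C := by simp only [hC, Matrix.mul_assoc]
        _ = M * (C * C) := by rw [h2, Matrix.mul_assoc]
    have e2 : P * ((1 - Q) * (P * M) * (1 - Q)) * P = M * ((P - C) * (P - C)) := by
      calc P * ((1 - Q) * (P * M) * (1 - Q)) * P
          = P * ((1 - Q) * (P * M * P) * (1 - Q)) * P := by rw [← hPM]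
        _ = (P * (1 - Q) * P) * M * (P * (1 - Q) * P) := by simp only [Matrix.mul_assoc]
        _ = M * ((P - C) * (P - C)) := by
          rw [hPQ, Matrix.sub_mul, h1, h2, ← Matrix.mul_sub, Matrix.mul_assoc]
    have e3 : (P - C) * (P - C) = P - (2 : ℂ) • C + C * C := by
      rw [Matrix.sub_mul, Matrix.mul_sub, Matrix.mul_sub, hP, hPC, hCP, two_smul]
      abel
    have e4 : P * K = P - (2 : ℂ) • C + (2 : ℂ) • (C * C) := by
      rw [hK, Matrix.mul_add, Matrix.mul_sub, Matrix.mul_smul, Matrix.mul_smul, Matrix.mul_one,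
        ← Matrix.mul_assoc P C, hPC]
    rw [Matrix.mul_add, Matrix.add_mul, e1, e2, e3, ← Matrix.mul_assoc P M, h1, Matrix.mul_assoc M P, e4,
      ← Matrix.mul_add, two_smul ℂ (C * C)]
    congr 1
    abel

/-- For `Q = J Jᴴ` the map `P J` intertwines `C = P Q P` with `R = Jᴴ P J`, so polynomials in `C`
become polynomials in `R` on the input space. -/
theorem conj_failEff {P : Matrix β β ℂ} {J : Matrix β α ℂ} (hP : P * P = P) (hJ : Jᴴ * J = 1)
    (m : ℕ) : Jᴴ * failEff P (J * Jᴴ) (m + 1) * J = failOp (Jᴴ * P * J) m := by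
  have hQ : J * Jᴴ * (J * Jᴴ) = J * Jᴴ := by
    rw [Matrix.mul_assoc, ← Matrix.mul_assoc Jᴴ, hJ, Matrix.one_mul]
  rw [failEff_succ hP hQ, failOp]
  set R := Jᴴ * P * J with hR
  set C := P * (J * Jᴴ) * P with hC
  have hCPJ : C * (P * J) = P * J * R := by
    calc C * (P * J) = P * (J * Jᴴ) * (P * P) * J := by rw [hC]; simp only [Matrix.mul_assoc]
      _ = P * J * R := by rw [hP, hR]; simp only [Matrix.mul_assoc]
  have key : ∀ m, (1 - (2 : ℂ) • C + (2 : ℂ) • (C * C)) ^ m * (P * J) =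
      P * J * (1 - (2 : ℂ) • R + (2 : ℂ) • (R * R)) ^ m := by
    intro m
    induction m with
    | zero => simp
    | succ m ih =>
      rw [pow_succ, Matrix.mul_assoc]
      have : (1 - (2 : ℂ) • C + (2 : ℂ) • (C * C)) * (P * J) =
          P * J * (1 - (2 : ℂ) • R + (2 : ℂ) • (R * R)) := by
        rw [Matrix.add_mul, Matrix.sub_mul, Matrix.smul_mul, Matrix.smul_mul, Matrix.one_mul,
          Matrix.mul_assoc C C, hCPJ, ← Matrix.mul_assoc C, hCPJ, Matrix.mul_add, Matrix.mul_sub,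
          Matrix.mul_one, Matrix.mul_smul, Matrix.mul_smul, Matrix.mul_assoc (P * J) R R]
      rw [this, ← Matrix.mul_assoc, ih, Matrix.mul_assoc, ← pow_succ]
  have hPC : P * C = C := by rw [hC, ← Matrix.mul_assoc, ← Matrix.mul_assoc, hP]
  have hCP : C * P = C := by rw [hC, Matrix.mul_assoc, hP]
  have hcP : Commute P C := by rw [Commute, SemiconjBy, hPC, hCP]
  have hPK := (Commute.pow_right (((Commute.one_right P).sub_right (hcP.smul_right (2 : ℂ))).add_right
    ((hcP.mul_right hcP).smul_right (2 : ℂ))) m).eq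
  have hK := key m
  generalize (1 - (2 : ℂ) • C + (2 : ℂ) • (C * C)) ^ m = M at hPK hK ⊢
  have hPM : P * M = P * M * P := by rw [Matrix.mul_assoc, ← hPK, ← Matrix.mul_assoc, hP]
  rw [hPM, Matrix.mul_assoc, Matrix.mul_assoc, Matrix.mul_assoc, hK, hR]
  simp only [← Matrix.mul_assoc]
  rw [Matrix.mul_assoc Jᴴ P P, hP]

end Norms

/-! ### Intertwining relations and the record of a projective outcome -/

section Generic
variable {V W : Type} [Fintype V] [DecidableEq V] [Fintype W] [DecidableEq W]
variable {α : Type*} [Fintype α] [DecidableEq α]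

/-- The embedding freezes the wires outside the range of `e`, and the lifted operator does not touch
them. -/
theorem liftOp_mul_pmat_extend {e : V → W} (he : Function.Injective e) (A : Op V) (y₀ : Bits W) :
    liftOp e A * pmat (fun v => Function.extend e v y₀) =
      pmat (fun v => Function.extend e v y₀) * A := by
  have hz : ∀ v, Function.extend e v y₀ ∘ e = v := fun v => extend_comp_self he v y₀
  ext x v
  rw [mul_pmat_apply, Matrix.mul_apply]
  by_cases h : ∀ w, w ∉ Set.range e → x w = y₀ w
  · rw [liftOp_apply_of_agree, hz, Finset.sum_eq_single (x ∘ e)]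
    · simp only [pmat, Matrix.of_apply]
      rw [if_pos ((extend_eq_iff he _ _ _).2 ⟨h, rfl⟩), one_mul]
    · intro v' _ hv'
      simp only [pmat, Matrix.of_apply]
      rw [if_neg, zero_mul]
      intro hx
      exact hv' (((extend_eq_iff he _ _ _).1 hx).2).symm
    · simp
    · intro w hw
      rw [extend_of_notMem v y₀ hw, h w hw]
  · rw [liftOp_apply_of_not_agree, Finset.sum_eq_zero]
    · intro v' _
      simp only [pmat, Matrix.of_apply]
      rw [if_neg, zero_mul]
      intro hx
      exact h ((extend_eq_iff he _ _ _).1 hx).1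
    · intro h'
      refine h fun w hw => ?_
      rw [h' w hw, extend_of_notMem v y₀ hw]

/-- Only basis states in the support of `N` matter. The actual copying may thus be replaced by an
ideal one on the states that occur. -/
theorem pmat_mul_congr {β δ : Type*} [Fintype β] [DecidableEq β] [DecidableEq δ]
    {f g : β → δ} {N : Matrix β α ℂ}
    (h : ∀ x, f x = g x ∨ ∀ y, N x y = 0) : pmat f * N = pmat g * N := by
  ext z y
  rw [Matrix.mul_apply, Matrix.mul_apply]
  refine Finset.sum_congr rfl fun x _ => ?_
  rcases h x with h | h
  · simp [pmat, h]
  · simp [h]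

theorem ActsOn.commute' {s t : Set W} {A B : Op W} (hA : ActsOn s A) (hB : ActsOn t B)
    (h : ∀ w ∈ s, w ∉ t) : Commute A B :=
  hA.commute hB (Set.disjoint_left.2 h)

/-- One step of the backward propagation of the effect of failing, for a round that records the
outcome of `Q` in a fresh register flipped by `X`. -/
theorem record_conj {β : Type*} [Fintype β] [DecidableEq β] {Q X Y Z : Matrix β β ℂ}
    (hQ : Qᴴ = Q) (hX : Xᴴ * X = 1)
    (hXQ : Commute X Q) (hXY : Commute X Y) (hZQ : Commute Z Q) (hZY : Commute Z Y)
    (hZ : Z * Z = Z) (hZX : Z * X * Z = 0) (hZX' : Z * Xᴴ * Z = 0) :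
    Z * (X * Q + (1 - Q))ᴴ * Y * (X * Q + (1 - Q)) * Z =
      (Q * Y * Q + (1 - Q) * Y * (1 - Q)) * Z := by
  have h1 : (1 - Q)ᴴ = 1 - Q := by rw [Matrix.conjTranspose_sub, Matrix.conjTranspose_one, hQ]
  have hZQ' : Commute Z (1 - Q) := (Commute.one_right Z).sub_right hZQ
  have hXQ' : Commute X (1 - Q) := (Commute.one_right X).sub_right hXQ
  rw [Matrix.conjTranspose_add, Matrix.conjTranspose_mul, h1, hQ]
  have e : Z * (Q * Xᴴ + (1 - Q)) * Y * (X * Q + (1 - Q)) * Z =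
      Z * Q * (Xᴴ * (Y * X)) * Q * Z + Z * Q * Xᴴ * Y * (1 - Q) * Z
      + Z * (1 - Q) * Y * (X * Q) * Z + Z * (1 - Q) * Y * (1 - Q) * Z := by
    simp only [Matrix.mul_add, Matrix.add_mul, Matrix.mul_assoc]
    abel
  rw [e]
  have e1 : Z * Q * (Xᴴ * (Y * X)) * Q * Z = Q * Y * Q * Z := by
    rw [← hXY.eq, ← Matrix.mul_assoc Xᴴ, hX, Matrix.one_mul, hZQ.eq, Matrix.mul_assoc Q,
      hZY.eq, Matrix.mul_assoc, Matrix.mul_assoc, Matrix.mul_assoc Y, ← Matrix.mul_assoc Z Q,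
      hZQ.eq, Matrix.mul_assoc Q Z, hZ]
    simp only [Matrix.mul_assoc]
  have e4 : Z * (1 - Q) * Y * (1 - Q) * Z = (1 - Q) * Y * (1 - Q) * Z := by
    rw [hZQ'.eq, Matrix.mul_assoc (1 - Q) Z Y, hZY.eq, Matrix.mul_assoc, Matrix.mul_assoc,
      Matrix.mul_assoc Y, ← Matrix.mul_assoc Z (1 - Q), hZQ'.eq, Matrix.mul_assoc (1 - Q) Z, hZ]
    simp only [Matrix.mul_assoc]
  -- The cross terms vanish because the record distinguishes the two outcomes: `Z` commutes past
  -- everything but `X`, and `Z Xᴴ Z = 0`.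
  have e2 : Z * Q * Xᴴ * Y * (1 - Q) * Z = 0 := by
    calc Z * Q * Xᴴ * Y * (1 - Q) * Z = Z * Q * Xᴴ * Y * ((1 - Q) * Z) := by
          simp only [Matrix.mul_assoc]
      _ = Q * Z * Xᴴ * Y * (Z * (1 - Q)) := by rw [← hZQ'.eq, hZQ.eq]
      _ = Q * (Z * Xᴴ * (Y * Z)) * (1 - Q) := by simp only [Matrix.mul_assoc]
      _ = Q * (Z * Xᴴ * Z * Y) * (1 - Q) := by rw [← hZY.eq]; simp only [Matrix.mul_assoc]
      _ = 0 := by rw [hZX']; simp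
  have e3 : Z * (1 - Q) * Y * (X * Q) * Z = 0 := by
    calc Z * (1 - Q) * Y * (X * Q) * Z = Z * (1 - Q) * Y * X * (Q * Z) := by
          simp only [Matrix.mul_assoc]
      _ = (1 - Q) * (Z * Y) * X * (Z * Q) := by
          rw [← hZQ.eq, hZQ'.eq]; simp only [Matrix.mul_assoc]
      _ = (1 - Q) * Y * (Z * X * Z) * Q := by rw [hZY.eq]; simp only [Matrix.mul_assoc]
      _ = 0 := by rw [hZX]; simp
  rw [e1, e2, e3, e4, Matrix.add_mul]
  abel

end Generic

/-! ### Coherent extraction attempts -/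

/-- The wires of the extract-and-simulate circuit, apart from auxiliary ones: the input, the
ancillas of the two given circuits, the results and the records of the `N` extraction attempts,
the extracted value, the guess and a flag that halves the amplitude. -/
inductive Reg (X KA GA : Type) (N k : ℕ) : Type
  | x (i : X)
  | ka (i : KA)
  | ga (i : GA)
  | c (i : Fin N) (j : Fin k)
  | r (i : Fin N)
  | o (j : Fin k)
  | g
  | h
  deriving DecidableEq, Fintype

namespace Reg
variable {X KA GA : Type} {N k : ℕ}

def eK : X ⊕ KA → Reg X KA GA N k := Sum.elim .x .ka
def eG : X ⊕ GA → Reg X KA GA N k := Sum.elim .x .ga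

theorem eK_injective : Function.Injective (eK : X ⊕ KA → Reg X KA GA N k) := by
  rintro (a | a) (b | b) <;> simp [eK]

theorem eG_injective : Function.Injective (eG : X ⊕ GA → Reg X KA GA N k) := by
  rintro (a | a) (b | b) <;> simp [eG]

/-- Supports of the operators below; most commutation relations are read off from their
disjointness. -/
def kset : Set (Reg X KA GA N k) := {w | match w with | .x _ => True | .ka _ => True | _ => False}
def gset : Set (Reg X KA GA N k) := {w | match w with | .x _ => True | .ga _ => True | _ => False}
def cset (is : List (Fin N)) : Set (Reg X KA GA N k) :=
  {w | match w with | .c i _ => i ∈ is | .r i => i ∈ is | _ => False}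
def oset : Set (Reg X KA GA N k) := {w | match w with | .o _ => True | _ => False}

end Reg

section Rounds
open Reg
variable {X KA GA : Type} [Fintype X] [DecidableEq X] [Fintype KA] [DecidableEq KA]
  [Fintype GA] [DecidableEq GA] {N k : ℕ}

/-- Copy the outcome of an attempt, if successful. -/
def cpFun (kout : Fin k → KA) (j₀ : Fin k) (i : Fin N) (y : Bits (Reg X KA GA N k)) :
    Bits (Reg X KA GA N k)
  | .c i' j => if i' = i then xor (y (.c i' j)) (y (.ka (kout j₀)) && y (.ka (kout j)))
      else y (.c i' j)
  | w => y w

def kaZero (y : Bits (Reg X KA GA N k)) : Bool := decide (∀ i, y (.ka i) = false)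

/-- Record whether the ancillas of the extractor have returned to zero. -/
def recFun (i : Fin N) (y : Bits (Reg X KA GA N k)) : Bits (Reg X KA GA N k)
  | .r i' => if i' = i then xor (y (.r i')) (kaZero y) else y (.r i')
  | w => y w

/-- The unconditional form of `recFun`, in the role of `X` in `record_conj`. -/
def flipR (i : Fin N) (y : Bits (Reg X KA GA N k)) : Bits (Reg X KA GA N k)
  | .r i' => if i' = i then !(y (.r i')) else y (.r i')
  | w => y w

def crZero (is : List (Fin N)) (y : Bits (Reg X KA GA N k)) : Bool :=
  decide (∀ i ∈ is, (∀ j, y (.c i j) = false) ∧ y (.r i) = false)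

/-- Bit `j₀` is meant to be the leading bit of the extractor's output, which is `1` exactly if a
value is found; it is copied along with the value and marks success. -/
def allFail (j₀ : Fin k) (is : List (Fin N)) (y : Bits (Reg X KA GA N k)) : Bool :=
  decide (∀ i ∈ is, y (.c i j₀) = false)

theorem actsOn_cp (kout : Fin k → KA) (j₀ : Fin k) (i : Fin N) :
    ActsOn (kset ∪ cset [i]) (pmat (cpFun (X := X) (GA := GA) kout j₀ i)) := by
  refine actsOn_pmat ?_ ?_
  · rintro y (w | w | w | ⟨i', j⟩ | w | w | _ | _) hw <;> simp_all [cpFun, kset, cset]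
  · intro y y' h w hw
    have hk : ∀ j, y (.ka j) = y' (.ka j) := fun j => h _ (by simp [kset])
    cases w <;> simp_all [cpFun, kset, cset]

theorem actsOn_rec (i : Fin N) :
    ActsOn (kset ∪ cset [i]) (pmat (recFun (X := X) (KA := KA) (GA := GA) (k := k) i)) := by
  refine actsOn_pmat ?_ ?_
  · rintro y (w | w | w | ⟨i', j⟩ | w | w | _ | _) hw <;> simp_all [recFun, kset, cset]
  · intro y y' h w hw
    have hk : ∀ j, y (.ka j) = y' (.ka j) := fun j => h _ (by simp [kset])
    cases w <;> simp_all [recFun, kset, cset, kaZero]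

theorem actsOn_flipR (i : Fin N) :
    ActsOn (cset [i]) (pmat (flipR (X := X) (KA := KA) (GA := GA) (k := k) i)) := by
  refine actsOn_pmat ?_ ?_
  · rintro y (w | w | w | ⟨i', j⟩ | w | w | _ | _) hw <;> simp_all [flipR, cset]
  · intro y y' h w hw
    cases w <;> simp_all [flipR, cset]

theorem actsOn_crZero (is : List (Fin N)) :
    ActsOn (cset is) (proj (crZero (X := X) (KA := KA) (GA := GA) (k := k) is)) := by
  refine actsOn_proj fun y y' h => ?_
  rw [crZero, crZero, decide_eq_decide]
  refine forall₂_congr fun i hi => ?_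
  rw [h (.r i) (by simp [cset, hi])]
  refine and_congr_left' (forall_congr' fun j => ?_)
  rw [h (.c i j) (by simp [cset, hi])]

theorem actsOn_allFail (j₀ : Fin k) (is : List (Fin N)) :
    ActsOn (cset is) (proj (allFail (X := X) (KA := KA) (GA := GA) j₀ is)) := by
  refine actsOn_proj fun y y' h => ?_
  rw [allFail, allFail, decide_eq_decide]
  refine forall₂_congr fun i hi => ?_
  rw [h (.c i j₀) (by simp [cset, hi])]

theorem actsOn_eK (A : Op (X ⊕ KA)) :
    ActsOn (kset (GA := GA) (N := N) (k := k)) (liftOp eK A) :=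
  actsOn_liftOp A (by rintro (v | v) <;> simp [eK, kset])

theorem actsOn_eG (A : Op (X ⊕ GA)) :
    ActsOn (gset (KA := KA) (N := N) (k := k)) (liftOp eG A) :=
  actsOn_liftOp A (by rintro (v | v) <;> simp [eG, gset])

/-- One extraction attempt. -/
noncomputable def roundOp (uK : Op (X ⊕ KA)) (kout : Fin k → KA) (j₀ : Fin k) (i : Fin N) :
    Op (Reg X KA GA N k) :=
  pmat (recFun i) * ((liftOp eK uK)ᴴ * (pmat (cpFun kout j₀ i) * liftOp eK uK))

noncomputable def ampOp (uK : Op (X ⊕ KA)) (kout : Fin k → KA) (j₀ : Fin k) :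
    List (Fin N) → Op (Reg X KA GA N k)
  | [] => 1
  | i :: is => ampOp uK kout j₀ is * roundOp uK kout j₀ i

theorem actsOn_roundOp (uK : Op (X ⊕ KA)) (kout : Fin k → KA) (j₀ : Fin k) (i : Fin N) :
    ActsOn (kset ∪ cset [i]) (roundOp (GA := GA) uK kout j₀ i) := by
  have h := (actsOn_eK (GA := GA) (N := N) (k := k) uK).mono
    (Set.subset_union_left (t := cset [i]))
  exact (actsOn_rec i).mul (h.conjTranspose.mul ((actsOn_cp kout j₀ i).mul h))

theorem actsOn_ampOp (uK : Op (X ⊕ KA)) (kout : Fin k → KA) (j₀ : Fin k) (is : List (Fin N)) :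
    ActsOn (kset ∪ cset is) (ampOp (GA := GA) uK kout j₀ is) := by
  induction is with
  | nil => exact actsOn_one _
  | cons i is ih =>
    refine (ih.mono ?_).mul ((actsOn_roundOp uK kout j₀ i).mono ?_) <;>
    · rintro (w | w | w | ⟨i', j⟩ | w | w | _ | _) <;> simp [kset, cset] <;> tauto

theorem recFun_injective (i : Fin N) :
    Function.Injective (recFun (X := X) (KA := KA) (GA := GA) (k := k) i) := by
  have : Function.Involutive (recFun (X := X) (KA := KA) (GA := GA) (k := k) i) := by
    intro y
    have h : kaZero (recFun i y) = kaZero y := rfl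
    funext w
    cases w <;> simp [recFun]
    split_ifs <;> simp_all
  exact this.injective

theorem cpFun_injective (kout : Fin k → KA) (j₀ : Fin k) (i : Fin N) :
    Function.Injective (cpFun (X := X) (GA := GA) kout j₀ i) := by
  have : Function.Involutive (cpFun (X := X) (GA := GA) kout j₀ i) := by
    intro y
    funext w
    cases w <;> simp [cpFun]
    split_ifs <;> simp_all
  exact this.injective

theorem flipR_injective (i : Fin N) :
    Function.Injective (flipR (X := X) (KA := KA) (GA := GA) (k := k) i) := by
  have : Function.Involutive (flipR (X := X) (KA := KA) (GA := GA) (k := k) i) := by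
    intro y
    funext w
    cases w <;> simp [flipR]
    split_ifs <;> simp_all
  exact this.injective

/-- Recording is a flip controlled by the projection `kaZero`, the shape needed for `record_conj`.
-/
theorem pmat_recFun (i : Fin N) : pmat (recFun (X := X) (KA := KA) (GA := GA) (k := k) i) =
    pmat (flipR i) * proj kaZero + (1 - proj kaZero) := by
  rw [← proj_not]
  ext x y
  rw [Matrix.add_apply, mul_proj_apply, proj, Matrix.diagonal_apply, pmat, pmat, Matrix.of_apply,
    Matrix.of_apply]
  cases h : kaZero y
  · have : recFun i y = y := by
      funext w; cases w <;> simp [recFun, h]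
    by_cases hxy : x = y
    · subst hxy; simp [this, h]
    · simp [this, hxy]
  · have : recFun i y = flipR i y := by
      funext w; cases w <;> simp [recFun, flipR, h]
    by_cases hxy : x = y
    · subst hxy; simp [this, h]
    · simp [this, hxy]

end Rounds

section Rounds
open Reg
variable {X KA GA : Type} [Fintype X] [DecidableEq X] [Fintype KA] [DecidableEq KA]
  [Fintype GA] [DecidableEq GA] {N k : ℕ}

theorem kaZero_eq_liftOp : proj (kaZero : Bits (Reg X KA GA N k) → Bool) =
    liftOp eK (proj fun y : Bits (X ⊕ KA) => decide (∀ i, y (.inr i) = false)) := by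
  rw [liftOp_proj]; rfl

theorem allFail_mul_cp_mul (kout : Fin k → KA) (j₀ : Fin k) (i : Fin N) :
    proj (allFail (X := X) (GA := GA) j₀ [i]) * pmat (cpFun kout j₀ i) * proj (crZero [i]) =
      liftOp eK (proj fun y => !y (.inr (kout j₀))) * proj (crZero [i]) := by
  rw [liftOp_proj, proj_mul_pmat, Matrix.mul_assoc, proj_mul_proj, proj_mul_proj]
  have h : ∀ y : Bits (Reg X KA GA N k), crZero [i] y = true →
      allFail j₀ [i] (cpFun kout j₀ i y) = !y (.ka (kout j₀)) := by
    intro y hy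
    simp only [crZero, List.mem_singleton, forall_eq, decide_eq_true_eq] at hy
    simp [allFail, cpFun, hy.1]
  calc _ = pmat id * proj (fun y => allFail j₀ [i] (cpFun kout j₀ i y) && crZero [i] y) := by
        refine pmat_mul_proj_congr fun y hy => ?_
        rw [Bool.and_eq_true] at hy
        rw [h y hy.2] at hy
        simp only [crZero, List.mem_singleton, forall_eq, decide_eq_true_eq] at hy
        funext w
        cases w with
        | c i' j =>
          by_cases hi : i' = i
          · subst hi; simp_all [cpFun]
          · simp [cpFun, hi]
        | _ => simp [cpFun]
    _ = _ := by
        rw [pmat_id, Matrix.one_mul]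
        congr 1
        funext y
        cases hy : crZero [i] y
        · simp
        · rw [h y hy]; simp [eK]

/-- Conditioned on failure with a fresh record, the copy does nothing, and what remains of a round
is the projection to failing runs followed by the record. -/
theorem allFail_mul_roundOp_mul (uK : Op (X ⊕ KA)) (kout : Fin k → KA) (j₀ : Fin k) (i : Fin N) :
    proj (allFail (X := X) (GA := GA) j₀ [i]) * roundOp uK kout j₀ i * proj (crZero [i]) =
      pmat (recFun i) * (liftOp eK (uKᴴ * proj (fun y => !y (.inr (kout j₀))) * uK) *
        proj (crZero [i])) := by
  have hF : Commute (proj (allFail (X := X) (KA := KA) (GA := GA) j₀ [i])) (pmat (recFun i)) := by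
    rw [Commute, SemiconjBy, proj_mul_pmat]
    congr 2
  have hU : Commute (proj (allFail (X := X) (KA := KA) (GA := GA) j₀ [i])) (liftOp eK uK)ᴴ :=
    (actsOn_allFail j₀ [i]).commute' (actsOn_eK uK).conjTranspose (by
      rintro (w | w | w | ⟨i', j⟩ | w | w | _ | _) <;> simp [kset, cset])
  have hZ : Commute (liftOp eK uK) (proj (crZero (X := X) (KA := KA) (GA := GA) (k := k) [i])) :=
    (actsOn_eK uK).commute' (actsOn_crZero [i]) (by
      rintro (w | w | w | ⟨i', j⟩ | w | w | _ | _) <;> simp [kset, cset])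
  rw [roundOp, ← Matrix.mul_assoc, hF.eq, Matrix.mul_assoc, Matrix.mul_assoc]
  congr 1
  rw [← Matrix.mul_assoc, ← Matrix.mul_assoc, hU.eq, Matrix.mul_assoc, Matrix.mul_assoc,
    Matrix.mul_assoc, hZ.eq, ← Matrix.mul_assoc (pmat _), ← Matrix.mul_assoc (proj _),
    ← Matrix.mul_assoc (proj _), allFail_mul_cp_mul, Matrix.mul_assoc, ← hZ.eq,
    ← liftOp_mul eK_injective, ← liftOp_mul eK_injective, ← conjTranspose_liftOp]
  simp only [Matrix.mul_assoc]

theorem crZero_flip_crZero (i : Fin N) :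
    proj (crZero [i]) * pmat (flipR i) * proj (crZero [i]) = (0 : Op (Reg X KA GA N k)) := by
  rw [proj_mul_pmat, Matrix.mul_assoc, proj_mul_proj]
  have : (fun y : Bits (Reg X KA GA N k) => crZero [i] (flipR i y) && crZero [i] y) =
      fun _ => false := by
    funext y
    by_cases h : y (.r i) = false
    · simp [crZero, flipR, h]
    · simp [crZero, h]
  rw [this]
  simp [proj]

/-- The effect of failing in all attempts, restricted to fresh registers. -/
theorem crZero_ampOp_allFail (uK : Op (X ⊕ KA))
    (kout : Fin k → KA) (j₀ : Fin k) {is : List (Fin N)} (his : is.Nodup) :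
    proj (crZero is) * ((ampOp uK kout j₀ is)ᴴ * proj (allFail j₀ is) * ampOp uK kout j₀ is) *
        proj (crZero is) =
      liftOp (eK (GA := GA)) (failEff (uKᴴ * proj (fun y => !y (.inr (kout j₀))) * uK)
        (proj fun y => decide (∀ i, y (.inr i) = false)) is.length) * proj (crZero is) := by
  induction is with
  | nil =>
    have h1 : (crZero [] : Bits (Reg X KA GA N k) → Bool) = fun _ => true := by
      funext y; simp [crZero]
    have h2 : (allFail j₀ [] : Bits (Reg X KA GA N k) → Bool) = fun _ => true := by
      funext y; simp [allFail]
    simp [h1, h2, proj_true, ampOp, failEff, liftOp_one]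
  | cons i is ih =>
    obtain ⟨hi, his⟩ := List.nodup_cons.1 his
    specialize ih his
    set P := uKᴴ * proj (fun y : Bits (X ⊕ KA) => !y (.inr (kout j₀))) * uK with hP
    set L := failEff P (proj fun y : Bits (X ⊕ KA) => decide (∀ i, y (.inr i) = false))
      is.length with hL
    have hz : proj (crZero (i :: is) : Bits (Reg X KA GA N k) → Bool) =
        proj (crZero [i]) * proj (crZero is) := by
      rw [proj_mul_proj]; congr 1; funext y; simp [crZero]
    -- The test for round `i` is written on both sides, so that each copy can be absorbed by the
    -- adjacent round operator.
    have hf : proj (allFail j₀ (i :: is) : Bits (Reg X KA GA N k) → Bool) =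
        proj (allFail j₀ [i]) * proj (allFail j₀ is) * proj (allFail j₀ [i]) := by
      rw [proj_mul_proj, proj_mul_proj]; congr 1; funext y
      by_cases h : y (.c i j₀) = false <;> simp [allFail, h]
    have d1 : ∀ w : Reg X KA GA N k, w ∈ cset [i] → w ∉ kset ∪ cset is := by
      rintro (w | w | w | ⟨i', j⟩ | w | w | _ | _) <;> simp [kset, cset] <;>
        rintro rfl <;> exact hi
    have d2 : ∀ w : Reg X KA GA N k, w ∈ cset is → w ∉ kset ∪ cset [i] := by
      rintro (w | w | w | ⟨i', j⟩ | w | w | _ | _) <;> simp [kset, cset] <;>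
        rintro h rfl <;> exact hi h
    have c1 : Commute (proj (allFail (X := X) (GA := GA) j₀ [i])) (ampOp uK kout j₀ is) :=
      (actsOn_allFail j₀ [i]).commute' (actsOn_ampOp uK kout j₀ is) d1
    have c1' : Commute (proj (allFail (X := X) (GA := GA) j₀ [i])) (ampOp uK kout j₀ is)ᴴ :=
      (actsOn_allFail j₀ [i]).commute' (actsOn_ampOp uK kout j₀ is).conjTranspose d1
    have c2 : Commute (proj (crZero (X := X) (GA := GA) (k := k) is)) (roundOp uK kout j₀ i) :=
      (actsOn_crZero is).commute' (actsOn_roundOp uK kout j₀ i) d2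
    have c2' : Commute (proj (crZero (X := X) (GA := GA) (k := k) is)) (roundOp uK kout j₀ i)ᴴ :=
      (actsOn_crZero is).commute' (actsOn_roundOp uK kout j₀ i).conjTranspose d2
    have c3 : ∀ p, Commute (proj (crZero (X := X) (KA := KA) (GA := GA) (k := k) is)) (proj p) :=
      fun p => by
        rw [Commute, SemiconjBy, proj_mul_proj, proj_mul_proj]
        congr 1; funext y; exact Bool.and_comm _ _
    have c4 : ∀ A, Commute (proj (crZero (X := X) (KA := KA) (GA := GA) (k := k) [i]))
        (liftOp eK A) := fun A => (actsOn_crZero [i]).commute' (actsOn_eK A) (by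
      rintro (w | w | w | ⟨i', j⟩ | w | w | _ | _) <;> simp [kset, cset])
    have c5 : ∀ A, Commute (pmat (flipR (X := X) (KA := KA) (GA := GA) (k := k) i))
        (liftOp eK A) := fun A => (actsOn_flipR i).commute' (actsOn_eK A) (by
      rintro (w | w | w | ⟨i', j⟩ | w | w | _ | _) <;> simp [kset, cset])
    have hrec := record_conj (X := pmat (flipR i)) (Q := proj kaZero)
      (Z := proj (crZero (X := X) (KA := KA) (GA := GA) (k := k) [i])) (Y := liftOp eK L)
      (conjTranspose_proj _) (conjTranspose_pmat_mul_self (flipR_injective i))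
      (by rw [kaZero_eq_liftOp]; exact c5 _) (c5 _) (by rw [kaZero_eq_liftOp]; exact c4 _) (c4 _)
      (proj_idem _) (crZero_flip_crZero i) (by
        have := congrArg Matrix.conjTranspose (crZero_flip_crZero (X := X) (KA := KA) (GA := GA)
          (k := k) i)
        simpa only [Matrix.conjTranspose_mul, conjTranspose_proj, Matrix.conjTranspose_zero,
          ← Matrix.mul_assoc] using this)
    rw [← pmat_recFun] at hrec
    have hround := allFail_mul_roundOp_mul (GA := GA) uK kout j₀ i
    rw [← hP] at hround
    have hPP : Pᴴ = P := by
      rw [hP, Matrix.conjTranspose_mul, Matrix.conjTranspose_mul, conjTranspose_proj,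
        Matrix.conjTranspose_conjTranspose, Matrix.mul_assoc]
    have hround' := congrArg Matrix.conjTranspose hround
    simp only [Matrix.conjTranspose_mul, conjTranspose_proj, conjTranspose_liftOp, hPP] at hround'
    set T := roundOp (GA := GA) uK kout j₀ i with hT
    set A := ampOp (GA := GA) uK kout j₀ is with hA
    set Zi := proj (crZero (X := X) (KA := KA) (GA := GA) (k := k) [i]) with hZi
    set Z := proj (crZero (X := X) (KA := KA) (GA := GA) (k := k) is) with hZ
    set Fi := proj (allFail (X := X) (KA := KA) (GA := GA) j₀ [i]) with hFi
    set F := proj (allFail (X := X) (KA := KA) (GA := GA) j₀ is) with hF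
    set Rc := pmat (recFun (X := X) (KA := KA) (GA := GA) (k := k) i) with hRc
    have hZFi : Commute Z Fi := c3 _
    have hZZi : Commute Z Zi := c3 _
    rw [hz, hf, List.length_cons, failEff, ← hL]
    clear_value L P
    rw [← liftOp_mul eK_injective,
      ← liftOp_mul eK_injective, liftOp_add, ← liftOp_mul eK_injective, ← liftOp_mul eK_injective,
      ← liftOp_mul eK_injective, ← liftOp_mul eK_injective, liftOp_sub, liftOp_one,
      ← kaZero_eq_liftOp]
    rw [show ampOp (GA := GA) uK kout j₀ (i :: is) = A * T from rfl, Matrix.conjTranspose_mul]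
    -- The projections of the later rounds are moved past the first round, which exposes the
    -- induction hypothesis. The failing first round then contributes `P` on either side, and
    -- `record_conj` gives the measurement of `kaZero` in between.
    calc Zi * Z * (Tᴴ * Aᴴ * (Fi * F * Fi) * (A * T)) * (Zi * Z)
        = Zi * Z * Tᴴ * (Aᴴ * Fi) * F * (Fi * A) * T * (Zi * Z) := by
          simp only [Matrix.mul_assoc]
      _ = Zi * (Z * Tᴴ) * Fi * (Aᴴ * F * A) * Fi * T * (Z * Zi) := by
          rw [← c1'.eq, c1.eq, hZZi.eq]; simp only [Matrix.mul_assoc]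
      _ = Zi * Tᴴ * (Z * Fi) * (Aᴴ * F * A) * Fi * (T * Z) * Zi := by
          rw [c2'.eq]; simp only [Matrix.mul_assoc]
      _ = Zi * Tᴴ * Fi * Z * (Aᴴ * F * A) * (Fi * Z) * T * Zi := by
          rw [← c2.eq, hZFi.eq]; simp only [Matrix.mul_assoc]
      _ = Zi * Tᴴ * Fi * (Z * (Aᴴ * F * A) * Z) * (Fi * T * Zi) := by
          rw [← hZFi.eq]; simp only [Matrix.mul_assoc]
      _ = (Zi * Tᴴ * Fi) * liftOp eK L * (Z * Fi) * T * Zi := by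
          rw [ih]; simp only [Matrix.mul_assoc]
      _ = (Zi * Tᴴ * Fi) * liftOp eK L * Fi * (Z * T) * Zi := by
          rw [hZFi.eq]; simp only [Matrix.mul_assoc]
      _ = (Zi * Tᴴ * Fi) * liftOp eK L * Fi * T * (Z * Zi) := by
          rw [c2.eq]; simp only [Matrix.mul_assoc]
      _ = (Zi * (Tᴴ * Fi)) * liftOp eK L * (Fi * T * Zi) * Z := by
          rw [hZZi.eq]; simp only [Matrix.mul_assoc]
      _ = (Zi * liftOp eK P) * Rcᴴ * liftOp eK L * Rc * (liftOp eK P * Zi) * Z := by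
          rw [hround, hround']; simp only [Matrix.mul_assoc]
      _ = liftOp eK P * (Zi * Rcᴴ * liftOp eK L * Rc) * (liftOp eK P * Zi) * Z := by
          rw [(c4 P).eq]; simp only [Matrix.mul_assoc]
      _ = liftOp eK P * (Zi * Rcᴴ * liftOp eK L * Rc * Zi) * liftOp eK P * Z := by
          rw [← (c4 P).eq]; simp only [Matrix.mul_assoc]
      _ = liftOp eK P * (proj kaZero * liftOp eK L * proj kaZero +
            (1 - proj kaZero) * liftOp eK L * (1 - proj kaZero)) * (Zi * liftOp eK P) * Z := by
          rw [hrec]; simp only [Matrix.mul_assoc]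
      _ = _ := by
          rw [(c4 P).eq]; simp only [Matrix.mul_assoc]

end Rounds

/-- Extend by zeros. -/
def zext {X A : Type} (u : Bits X) : Bits (X ⊕ A) := Sum.elim u fun _ => false

theorem zext_injective {X A : Type} : Function.Injective (zext : Bits X → Bits (X ⊕ A)) :=
  fun _ _ h => funext fun i => congrFun h (.inl i)

/-- The isometry that appends zeros. -/
noncomputable def zmat (X A : Type) [Fintype X] [DecidableEq X] [Fintype A] [DecidableEq A] :
    Matrix (Bits (X ⊕ A)) (Bits X) ℂ := pmat zext

theorem conjTranspose_zmat_mul_self {X A : Type} [Fintype X] [DecidableEq X] [Fintype A]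
    [DecidableEq A] : (zmat X A)ᴴ * zmat X A = 1 := conjTranspose_pmat_mul_self zext_injective

section Rounds
open Reg
variable {X KA GA : Type} [Fintype X] [DecidableEq X] [Fintype KA] [DecidableEq KA]
  [Fintype GA] [DecidableEq GA] {N k : ℕ}
variable {α : Type*} [Fintype α] [DecidableEq α]

theorem proj_inr_zero {A : Type} [Fintype A] [DecidableEq A] :
    proj (fun y : Bits (X ⊕ A) => decide (∀ i, y (.inr i) = false)) =
      zmat X A * (zmat X A)ᴴ := by
  refine proj_eq_pmat_mul_conjTranspose _ zext_injective _ fun y => ?_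
  rw [decide_eq_true_eq]
  constructor
  · intro h
    refine ⟨y ∘ Sum.inl, funext ?_⟩
    rintro (i | i)
    · rfl
    · exact (h i).symm
  · rintro ⟨u, rfl⟩ i
    rfl

theorem zext_eq_extend {A : Type} :
    (zext : Bits X → Bits (X ⊕ A)) = fun u => Function.extend Sum.inl u fun _ => false := by
  funext u w
  rcases w with i | i
  · exact (Sum.inl_injective.extend_apply u _ i).symm
  · refine (Function.extend_apply' _ _ _ ?_).symm
    simp

theorem liftOp_inl_mul_zext {A : Type} [Fintype A] [DecidableEq A] (B : Op X) :
    liftOp (Sum.inl : X → X ⊕ A) B * zmat X A = zmat X A * B := by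
  rw [zmat, zext_eq_extend]
  exact liftOp_mul_pmat_extend Sum.inl_injective B _

/-- All registers of the extraction are zero. -/
def ancZero (y : Bits (Reg X KA GA N k)) : Bool := kaZero y && crZero (List.finRange N) y

/-- Here the effect of total failure becomes an operator on the input alone: `crZero_ampOp_allFail`
removes the records, and `conj_failEff` removes the ancillas of the extractor. -/
theorem ancZero_ampOp_allFail (uK : Op (X ⊕ KA)) (huK : uK * uKᴴ = 1) (kout : Fin k → KA)
    (j₀ : Fin k) {m : ℕ} (hN : N = m + 1) :
    proj ancZero * ((ampOp uK kout j₀ (List.finRange N))ᴴ * proj (allFail j₀ (List.finRange N)) *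
        ampOp uK kout j₀ (List.finRange N)) * proj ancZero =
      liftOp (.x : X → Reg X KA GA N k) (failOp ((uK * zmat X KA)ᴴ *
        proj (fun y : Bits (X ⊕ KA) => !y (.inr (kout j₀))) * (uK * zmat X KA)) m) * proj ancZero := by
  subst hN
  have h := crZero_ampOp_allFail (GA := GA) uK kout j₀ (List.nodup_finRange (m + 1))
  set Y := (ampOp uK kout j₀ (List.finRange (m + 1)))ᴴ * proj (allFail j₀ (List.finRange (m + 1))) *
        ampOp (GA := GA) uK kout j₀ (List.finRange (m + 1))
  set P := uKᴴ * proj (fun y : Bits (X ⊕ KA) => !y (.inr (kout j₀))) * uK with hPdef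
  have hP : P * P = P := by
    calc P * P = uKᴴ * proj (fun y : Bits (X ⊕ KA) => !y (.inr (kout j₀))) * (uK * uKᴴ) *
          proj (fun y : Bits (X ⊕ KA) => !y (.inr (kout j₀))) * uK := by
          simp only [hPdef, Matrix.mul_assoc]
      _ = uKᴴ * (proj (fun y : Bits (X ⊕ KA) => !y (.inr (kout j₀))) * proj (fun y : Bits (X ⊕ KA) => !y (.inr (kout j₀)))) *
          uK := by rw [huK]; simp only [Matrix.mul_assoc, Matrix.one_mul]
      _ = P := by rw [proj_idem]
  have ha : proj (ancZero (X := X) (KA := KA) (GA := GA) (N := m + 1) (k := k)) =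
      proj kaZero * proj (crZero (List.finRange (m + 1))) := by rw [proj_mul_proj]; rfl
  have ha' : proj (ancZero (X := X) (KA := KA) (GA := GA) (N := m + 1) (k := k)) =
      proj (crZero (List.finRange (m + 1))) * proj kaZero := by
    rw [proj_mul_proj]; congr 1; funext y; exact Bool.and_comm _ _
  have hR : (uK * zmat X KA)ᴴ * proj (fun y : Bits (X ⊕ KA) => !y (.inr (kout j₀))) * (uK * zmat X KA) =
      (zmat X KA)ᴴ * P * zmat X KA := by
    rw [Matrix.conjTranspose_mul, hPdef]; simp only [Matrix.mul_assoc]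
  rw [List.length_finRange, proj_inr_zero] at h
  have hφ : ∀ E, zmat X KA * (zmat X KA)ᴴ * E * (zmat X KA * (zmat X KA)ᴴ) =
      liftOp Sum.inl ((zmat X KA)ᴴ * E * zmat X KA) * (zmat X KA * (zmat X KA)ᴴ) := by
    intro E
    rw [← Matrix.mul_assoc (liftOp _ _), liftOp_inl_mul_zext]
    simp only [Matrix.mul_assoc]
  have hφ' := hφ (failEff P (zmat X KA * (zmat X KA)ᴴ) (m + 1))
  rw [conj_failEff hP conjTranspose_zmat_mul_self] at hφ'
  have hx : (.x : X → Reg X KA GA (m + 1) k) = eK ∘ Sum.inl := rfl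
  rw [hR, hx, ← liftOp_liftOp eK_injective]
  calc _ = proj kaZero * (proj (crZero (List.finRange (m + 1))) * Y *
        proj (crZero (List.finRange (m + 1)))) * proj kaZero := by
        nth_rewrite 1 [ha]; rw [ha']; simp only [Matrix.mul_assoc]
    _ = liftOp eK (zmat X KA * (zmat X KA)ᴴ *
          failEff P (zmat X KA * (zmat X KA)ᴴ) (m + 1) * (zmat X KA * (zmat X KA)ᴴ)) *
          proj (crZero (List.finRange (m + 1))) := by
        rw [h, kaZero_eq_liftOp, Matrix.mul_assoc, Matrix.mul_assoc, ← kaZero_eq_liftOp, ← ha', ha,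
          kaZero_eq_liftOp, ← Matrix.mul_assoc, ← Matrix.mul_assoc, liftOp_mul eK_injective,
          liftOp_mul eK_injective, proj_inr_zero]
    _ = _ := by
        rw [hφ', ← liftOp_mul eK_injective, ← proj_inr_zero, ← kaZero_eq_liftOp, Matrix.mul_assoc,
          ← ha]

/-- A successful extraction whose result is not the string `s`. -/
def badK (kout : Fin k → KA) (j₀ : Fin k) (s : Fin k → Bool) (y : Bits (X ⊕ KA)) : Bool :=
  y (.inr (kout j₀)) && decide (∃ j, y (.inr (kout j)) ≠ s j)

/-- Zero records are exempt, since failed attempts leave them behind. -/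
def badC (s : Fin k → Bool) (i : Fin N) (y : Bits (Reg X KA GA N k)) : Bool :=
  decide ((∃ j, y (.c i j) ≠ false) ∧ ∃ j, y (.c i j) ≠ s j)

/-- On zero ancillas wrong results have no amplitude, and elsewhere the record does nothing, so it
is invisible to them. The wrong amplitude therefore passes through a round unchanged up to the copy,
and stays zero if it was zero. -/
theorem badK_mul_roundOp (uK : Op (X ⊕ KA)) (huK : uK * uKᴴ = 1) (kout : Fin k → KA) (j₀ : Fin k)
    (s : Fin k → Bool)
    (hbad : proj (badK kout j₀ s) * uK *
      proj (fun y : Bits (X ⊕ KA) => decide (∀ i, y (.inr i) = false)) = 0)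
    (i : Fin N) :
    liftOp eK (proj (badK kout j₀ s) * uK) * roundOp (GA := GA) uK kout j₀ i =
      pmat (cpFun kout j₀ i) * liftOp eK (proj (badK kout j₀ s) * uK) := by
  have c1 : Commute (pmat (flipR (X := X) (KA := KA) (GA := GA) (k := k) i))
      (liftOp eK (proj (badK kout j₀ s) * uK)) := (actsOn_flipR i).commute' (actsOn_eK _) (by
    rintro (w | w | w | ⟨i', j⟩ | w | w | _ | _) <;> simp [kset, cset])
  have h0 : liftOp eK (proj (badK kout j₀ s) * uK) *
      proj (kaZero : Bits (Reg X KA GA N k) → Bool) = 0 := by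
    rw [kaZero_eq_liftOp, liftOp_mul eK_injective, hbad, liftOp_zero]
  have h1 : liftOp eK (proj (badK kout j₀ s) * uK) * pmat (recFun (GA := GA) (k := k) i) =
      liftOp eK (proj (badK kout j₀ s) * uK) := by
    rw [pmat_recFun, Matrix.mul_add, ← Matrix.mul_assoc, ← c1.eq, Matrix.mul_assoc, h0,
      Matrix.mul_zero, Matrix.mul_sub, h0, Matrix.mul_one, sub_zero, zero_add]
  rw [roundOp, ← Matrix.mul_assoc, h1, ← liftOp_mul eK_injective, conjTranspose_liftOp,
    Matrix.mul_assoc, ← Matrix.mul_assoc (liftOp eK uK), liftOp_mul eK_injective, huK, liftOp_one,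
    Matrix.one_mul, ← Matrix.mul_assoc, liftOp_proj, proj_mul_pmat, ← Matrix.mul_assoc]
  rfl

/-- Two properties of `M` are carried through the rounds: no amplitude on wrong results and fresh
records. The general `M` lets the induction continue from the state after the first round. -/
theorem badC_mul_ampOp (uK : Op (X ⊕ KA)) (huK : uK * uKᴴ = 1) (kout : Fin k → KA) (j₀ : Fin k)
    (s : Fin k → Bool)
    (hbad : proj (badK kout j₀ s) * uK *
      proj (fun y : Bits (X ⊕ KA) => decide (∀ i, y (.inr i) = false)) = 0)
    {is : List (Fin N)} (his : is.Nodup)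
    (M : Matrix (Bits (Reg X KA GA N k)) α ℂ)
    (hM : liftOp (eK (GA := GA) (N := N) (k := k)) (proj (badK kout j₀ s) * uK) * M = 0)
    (hz : proj (crZero (X := X) (KA := KA) (GA := GA) (k := k) is) * M = M)
    {i : Fin N} (hi : i ∈ is) :
    proj (badC (X := X) (KA := KA) (GA := GA) s i) * (ampOp (GA := GA) uK kout j₀ is * M) = 0 := by
  induction is generalizing M with
  | nil => simp at hi
  | cons i' is ih =>
    obtain ⟨hi', his⟩ := List.nodup_cons.1 his
    have hz1 : proj (crZero (X := X) (KA := KA) (GA := GA) (k := k) is) * M = M := by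
      rw [← hz, ← Matrix.mul_assoc, proj_mul_proj]
      congr 2; funext y
      by_cases h : crZero (i' :: is) y = true
      · rw [h]; simp_all [crZero]
      · rw [Bool.not_eq_true] at h; rw [h]; simp
    have hz2 : proj (crZero (X := X) (KA := KA) (GA := GA) (k := k) [i']) * M = M := by
      rw [← hz, ← Matrix.mul_assoc, proj_mul_proj]
      congr 2; funext y
      by_cases h : crZero (i' :: is) y = true
      · rw [h]; simp_all [crZero]
      · rw [Bool.not_eq_true] at h; rw [h]; simp
    have d2 : ∀ w : Reg X KA GA N k, w ∈ cset is → w ∉ kset ∪ cset [i'] := by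
      rintro (w | w | w | ⟨i', j⟩ | w | w | _ | _) <;> simp [kset, cset] <;>
        rintro h rfl <;> exact hi' h
    have d1 : ∀ w : Reg X KA GA N k, w ∈ cset [i'] → w ∉ kset ∪ cset is := by
      rintro (w | w | w | ⟨i', j⟩ | w | w | _ | _) <;> simp [kset, cset] <;>
        rintro rfl <;> exact hi'
    rw [show ampOp (GA := GA) uK kout j₀ (i' :: is) = ampOp uK kout j₀ is * roundOp uK kout j₀ i'
      from rfl, Matrix.mul_assoc]
    rcases List.mem_cons.1 hi with rfl | hi
    · have b1 : ActsOn (cset [i]) (proj (badC (X := X) (KA := KA) (GA := GA) s i)) := by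
        refine actsOn_proj fun y y' h => ?_
        have : ∀ j, y (.c i j) = y' (.c i j) := fun j => h _ (by simp [cset])
        simp [badC, this]
      have c1 := b1.commute' (actsOn_ampOp uK kout j₀ is) d1
      have c2 : Commute (proj (badC (X := X) (KA := KA) (GA := GA) s i)) (liftOp eK uK)ᴴ :=
        b1.commute' (actsOn_eK uK).conjTranspose (by
          rintro (w | w | w | ⟨i', j⟩ | w | w | _ | _) <;> simp [kset, cset])
      have c3 : Commute (proj (crZero [i])) (liftOp (eK (GA := GA) (N := N) (k := k)) uK) :=
        (actsOn_crZero [i]).commute' (actsOn_eK uK) (by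
          rintro (w | w | w | ⟨i', j⟩ | w | w | _ | _) <;> simp [kset, cset])
      have c4 : Commute (proj (badC (X := X) (KA := KA) (GA := GA) s i)) (pmat (recFun i)) := by
        rw [Commute, SemiconjBy, proj_mul_pmat]
        rfl
      -- On a fresh record, a wrong copy arises only from a wrong result shown by the extractor,
      -- which `hM` excludes.
      have h0 : proj (badC (X := X) (KA := KA) (GA := GA) s i) *
          (pmat (cpFun (X := X) (GA := GA) kout j₀ i) *
            (liftOp (eK (GA := GA) (N := N) (k := k)) uK * M)) = 0 := by
        have e : liftOp (eK (GA := GA) (N := N) (k := k)) uK * M =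
            proj (crZero (X := X) (KA := KA) (GA := GA) (k := k) [i]) *
              (liftOp (eK (GA := GA) (N := N) (k := k)) uK * M) := by
          rw [← Matrix.mul_assoc, c3.eq, Matrix.mul_assoc, hz2]
        have e2 : (fun y : Bits (Reg X KA GA N k) => badC s i (cpFun kout j₀ i y) &&
            crZero [i] y) = fun y => (badC s i (cpFun kout j₀ i y) && crZero [i] y) &&
              badK kout j₀ s (y ∘ eK) := by
          funext y
          cases h1 : crZero [i] y
          · simp
          · simp only [crZero, List.mem_singleton, forall_eq, decide_eq_true_eq] at h1
            cases h2 : y (.ka (kout j₀))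
            · simp [badC, cpFun, h1.1, h2]
            · by_cases h3 : ∃ j, y (.ka (kout j)) ≠ s j
              · have : badK kout j₀ s (y ∘ eK) = true := by
                  rw [badK, Bool.and_eq_true, decide_eq_true_eq]
                  exact ⟨h2, h3⟩
                rw [this]; simp
              · have : badC s i (cpFun kout j₀ i y) = false := by
                  push Not at h3
                  simp [badC, cpFun, h1.1, h2, h3]
                rw [this]; simp
        rw [e, ← Matrix.mul_assoc, proj_mul_pmat, Matrix.mul_assoc, ← Matrix.mul_assoc (proj _),
          proj_mul_proj, e2, ← proj_mul_proj _ fun y => badK kout j₀ s (y ∘ eK), ← liftOp_proj,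
          Matrix.mul_assoc (proj _), ← Matrix.mul_assoc (liftOp eK (proj _)),
          liftOp_mul eK_injective, hM]
        simp
      rw [← Matrix.mul_assoc, c1.eq, Matrix.mul_assoc, roundOp, Matrix.mul_assoc (pmat _),
        ← Matrix.mul_assoc (proj _), c4.eq, Matrix.mul_assoc (pmat _), Matrix.mul_assoc _ᴴ,
        ← Matrix.mul_assoc (proj _), c2.eq, Matrix.mul_assoc _ᴴ, Matrix.mul_assoc (pmat _), h0]
      simp
    · refine ih his _ ?_ ?_ hi
      · rw [← Matrix.mul_assoc, badK_mul_roundOp uK huK kout j₀ s hbad, Matrix.mul_assoc, hM,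
          Matrix.mul_zero]
      · rw [← Matrix.mul_assoc, ((actsOn_crZero is).commute' (actsOn_roundOp uK kout j₀ i') d2).eq,
          Matrix.mul_assoc, hz1]

end Rounds

theorem had_mul_pmat {W : Type} [Fintype W] [DecidableEq W] {α : Type*} [Fintype α]
    [DecidableEq α] (i : W) (f : α → Bits W) (hf : ∀ u, f u i = false) :
    (Gate.had i).op * pmat f = ((Real.sqrt 2 : ℂ)⁻¹) •
      (pmat f + pmat fun u => Function.update (f u) i true) := by
  ext x u
  rw [mul_pmat_apply, Matrix.smul_apply, Matrix.add_apply]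
  simp only [Gate.op, pmat, Matrix.of_apply, hf, Bool.false_eq_true, and_false, if_false]
  by_cases h : ∀ j, j ≠ i → x j = f u j
  · rw [if_pos h]
    cases hx : x i
    · have e1 : x = f u := by
        funext j
        by_cases hj : j = i
        · subst hj; rw [hx, hf]
        · exact h j hj
      have e2 : x ≠ Function.update (f u) i true := by
        intro e; rw [e] at hx; simp at hx
      rw [if_pos e1, if_neg e2]; simp
    · have e1 : x ≠ f u := by intro e; rw [e, hf] at hx; simp at hx
      have e2 : x = Function.update (f u) i true := by
        funext j
        by_cases hj : j = i
        · subst hj; rw [hx, Function.update_self]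
        · rw [Function.update_of_ne hj]; exact h j hj
      rw [if_neg e1, if_pos e2]; simp
  · rw [if_neg h, if_neg, if_neg]
    · simp
    · intro e; exact h fun j hj => by rw [e, Function.update_of_ne hj]
    · intro e; exact h fun j _ => by rw [e]

/-! ### Copying the extracted value and undoing the attempts -/

section Copy
open Reg
variable {X KA GA : Type} [Fintype X] [DecidableEq X] [Fintype KA] [DecidableEq KA]
  [Fintype GA] [DecidableEq GA] {N k : ℕ}

/-- If the guess is `1` and all earlier attempts failed, copy the result of attempt `i`. -/
def copyStage (j₀ : Fin k) (prev : List (Fin N)) (i : Fin N) (y : Bits (Reg X KA GA N k)) :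
    Bits (Reg X KA GA N k)
  | .o j => xor (y (.o j)) ((y .g && allFail j₀ prev y) && y (.c i j))
  | w => y w

/-- The first list collects the attempts already treated, on whose failure the current copy is
conditioned. -/
def copyList (j₀ : Fin k) : List (Fin N) → List (Fin N) → Bits (Reg X KA GA N k) →
    Bits (Reg X KA GA N k)
  | _, [], y => y
  | prev, i :: is, y => copyList j₀ (prev ++ [i]) is (copyStage j₀ prev i y)

def copyIdeal (j₀ : Fin k) (s : Fin k → Bool) (is : List (Fin N)) (y : Bits (Reg X KA GA N k)) :
    Bits (Reg X KA GA N k)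
  | .o j => xor (y (.o j)) ((y .g && !allFail j₀ is y) && s j)
  | w => y w

def flipO (s : Fin k → Bool) (y : Bits (Reg X KA GA N k)) : Bits (Reg X KA GA N k)
  | .o j => xor (y (.o j)) (s j)
  | w => y w

/-- Only the first success is copied, and without wrong records it carries `s`. Since `s j₀ = true`,
a record whose bit `j₀` is zero must vanish entirely, so failed attempts copy nothing. -/
theorem copyList_eq (j₀ : Fin k) {s : Fin k → Bool} (hs : s j₀ = true) (is prev : List (Fin N))
    (y : Bits (Reg X KA GA N k)) (hy : ∀ i ∈ is, badC s i y = false) :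
    copyList j₀ prev is y = if allFail j₀ prev y then copyIdeal j₀ s is y else y := by
  induction is generalizing prev y with
  | nil =>
    have : copyIdeal j₀ s [] y = y := by
      funext w; cases w <;> simp [copyIdeal, allFail]
    simp [copyList, this]
  | cons i is ih =>
    rw [copyList, ih _ (copyStage j₀ prev i y) fun i hi => hy i (List.mem_cons_of_mem _ hi)]
    have h1 : allFail j₀ (prev ++ [i]) (copyStage j₀ prev i y) =
        (allFail j₀ prev y && !y (.c i j₀)) := by
      rw [Bool.eq_iff_iff]
      simp [allFail, List.mem_append, copyStage, or_imp, forall_and]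
    have h2 : allFail j₀ (i :: is) y = (!y (.c i j₀) && allFail j₀ is y) := by
      rw [Bool.eq_iff_iff]
      simp [allFail]
    have h3 := hy i List.mem_cons_self
    simp only [badC, decide_eq_false_iff_not, not_and, not_exists, not_not] at h3
    have h4 : ∀ y' : Bits (Reg X KA GA N k), allFail j₀ is (copyStage j₀ prev i y') =
      allFail j₀ is y' := fun _ => rfl
    rw [h1]
    cases hp : allFail j₀ prev y
    · simp only [Bool.false_and, Bool.false_eq_true, if_false]
      funext w
      cases w <;> simp [copyStage, hp]
    · cases hc : y (.c i j₀)
      · have hc' : ∀ j, y (.c i j) = false := by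
          by_contra hne
          push Not at hne
          obtain ⟨j, hj⟩ := hne
          have := h3 ⟨j, hj⟩ j₀
          rw [hc, hs] at this
          simp at this
        simp only [Bool.not_false, Bool.and_true, if_true]
        funext w
        cases w <;> simp [copyIdeal, h2, h4, hc]
        all_goals simp [copyStage, hc']
      · have hc' : ∀ j, y (.c i j) = s j := h3 ⟨j₀, by simp [hc]⟩
        simp only [Bool.not_true, Bool.and_false, Bool.false_eq_true, if_false, if_true]
        funext w
        cases w <;> simp [copyIdeal, h2, copyStage, hp, hc, hc']

theorem copyList_of_g (j₀ : Fin k) (is prev : List (Fin N)) (y : Bits (Reg X KA GA N k))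
    (hy : y .g = false) : copyList j₀ prev is y = y := by
  induction is generalizing prev y with
  | nil => rfl
  | cons i is ih =>
    have : copyStage j₀ prev i y = y := by
      funext w; cases w <;> simp [copyStage, hy]
    rw [copyList, this, ih _ _ hy]

/-- The input with guess `a` and flag `b`. -/
def inp (a b : Bool) (u : Bits X) : Bits (Reg X KA GA N k)
  | .x i => u i
  | .g => a
  | .h => b
  | _ => false

/-- The isometry of `inp`. -/
noncomputable def inpMat (X KA GA : Type) [Fintype X] [DecidableEq X] [Fintype KA] [DecidableEq KA]
    [Fintype GA] [DecidableEq GA] (N k : ℕ) (a b : Bool) :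
    Matrix (Bits (Reg X KA GA N k)) (Bits X) ℂ := pmat (inp a b)

/-- The attempts are undone after the copy so that the input is available again for the simulated
algorithm. -/
noncomputable def extractOp (uK : Op (X ⊕ KA)) (kout : Fin k → KA) (j₀ : Fin k) :
    Op (Reg X KA GA N k) :=
  (ampOp uK kout j₀ (List.finRange N))ᴴ *
    (pmat (copyList j₀ [] (List.finRange N)) * ampOp uK kout j₀ (List.finRange N))

theorem ampOp_conjTranspose_mul_self (uK : Op (X ⊕ KA)) (huK : uKᴴ * uK = 1)
    (huK' : uK * uKᴴ = 1) (kout : Fin k → KA) (j₀ : Fin k) (is : List (Fin N)) :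
    (ampOp (GA := GA) uK kout j₀ is)ᴴ * ampOp uK kout j₀ is = 1 := by
  induction is with
  | nil => simp [ampOp]
  | cons i is ih =>
    set U : Op (Reg X KA GA N k) := liftOp eK uK with hU
    have h1 : Uᴴ * U = 1 := by
      rw [hU, conjTranspose_liftOp, liftOp_mul eK_injective, huK, liftOp_one]
    have h2 : U * Uᴴ = 1 := by
      rw [hU, conjTranspose_liftOp, liftOp_mul eK_injective, huK', liftOp_one]
    have hr : (roundOp (GA := GA) uK kout j₀ i)ᴴ * roundOp uK kout j₀ i = 1 := by
      rw [roundOp, ← hU]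
      simp only [Matrix.conjTranspose_mul, Matrix.conjTranspose_conjTranspose, Matrix.mul_assoc]
      rw [← Matrix.mul_assoc (pmat (recFun i))ᴴ, conjTranspose_pmat_mul_self (recFun_injective i),
        Matrix.one_mul, ← Matrix.mul_assoc U Uᴴ, h2, Matrix.one_mul,
        ← Matrix.mul_assoc (pmat (cpFun kout j₀ i))ᴴ,
        conjTranspose_pmat_mul_self (cpFun_injective kout j₀ i), Matrix.one_mul, h1]
    rw [show ampOp (GA := GA) uK kout j₀ (i :: is) = ampOp uK kout j₀ is * roundOp uK kout j₀ i
      from rfl, Matrix.conjTranspose_mul, Matrix.mul_assoc,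
      ← Matrix.mul_assoc (ampOp uK kout j₀ is)ᴴ, ih, Matrix.one_mul, hr]

/-- With guess `0` nothing is copied, and the attempts cancel against their inverse. -/
theorem extractOp_mul_inp_false (uK : Op (X ⊕ KA)) (huK : uKᴴ * uK = 1)
    (huK' : uK * uKᴴ = 1) (kout : Fin k → KA) (j₀ : Fin k) (b : Bool) :
    extractOp (GA := GA) (N := N) uK kout j₀ * inpMat X KA GA N k false b = inpMat X KA GA N k false b := by
  set A := ampOp (GA := GA) uK kout j₀ (List.finRange N) with hA
  set Z : Op (Reg X KA GA N k) := proj (fun y => !y .g) with hZ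
  have hz : Z * inpMat X KA GA N k false b = inpMat X KA GA N k false b :=
    proj_mul_pmat_of_forall fun u => by simp [inp]
  have hc : Commute Z A := by
    refine ActsOn.commute' (s := {.g}) (actsOn_proj fun y y' h => ?_) (actsOn_ampOp uK kout j₀ _) ?_
    · rw [h .g rfl]
    · rintro w rfl; simp [kset, cset]
  have hp : pmat (copyList j₀ [] (List.finRange N)) * Z = Z := by
    rw [hZ, pmat_mul_proj_congr (g := id) fun y hy => copyList_of_g j₀ _ _ y (by simpa using hy),
      pmat_id, Matrix.one_mul]
  rw [extractOp, ← hA, ← hz, Matrix.mul_assoc, Matrix.mul_assoc, ← Matrix.mul_assoc A, ← hc.eq,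
    Matrix.mul_assoc, ← Matrix.mul_assoc (pmat _) Z, hp, ← Matrix.mul_assoc Z A, hc.eq,
    Matrix.mul_assoc, ← Matrix.mul_assoc _ᴴ, hA,
    ampOp_conjTranspose_mul_self uK huK huK', Matrix.one_mul]

theorem actsOn_flipO (s : Fin k → Bool) :
    ActsOn oset (pmat (flipO (X := X) (KA := KA) (GA := GA) (N := N) s)) := by
  refine actsOn_pmat ?_ ?_
  · rintro y (w | w | w | ⟨i', j⟩ | w | w | _ | _) hw <;> simp_all [flipO, oset]
  · intro y y' h w hw
    cases w <;> simp_all [flipO, oset]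

/-- On the states that occur, the copy is the identity where all attempts failed and adds `s`
elsewhere. Undoing the attempts turns the failure projection `F` into `Aᴴ F A`, whose compression to
clean registers is `φ` by `ancZero_ampOp_allFail`. -/
theorem ancZero_extractOp_mul_inp_true (uK : Op (X ⊕ KA)) (huK : uKᴴ * uK = 1)
    (huK' : uK * uKᴴ = 1) (kout : Fin k → KA) (j₀ : Fin k) {s : Fin k → Bool} (hs : s j₀ = true)
    (hbad : proj (badK (X := X) kout j₀ s) * (uK * zmat X KA) = 0) {m : ℕ} (hN : N = m + 1) (b : Bool)
    {φ : Op X} (hφ : φ = failOp ((uK * zmat X KA)ᴴ *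
        proj (fun y : Bits (X ⊕ KA) => !y (.inr (kout j₀))) * (uK * zmat X KA)) m) :
    proj (ancZero (X := X) (KA := KA) (GA := GA) (N := N) (k := k)) *
        (extractOp (GA := GA) (N := N) uK kout j₀ * inpMat X KA GA N k true b) =
      inpMat X KA GA N k true b * φ +
        pmat (flipO (X := X) (KA := KA) (GA := GA) (N := N) s) * inpMat X KA GA N k true b *
          ((1 : Op X) - φ) := by
  have hbad' : proj (badK kout j₀ s) * uK *
      proj (fun y : Bits (X ⊕ KA) => decide (∀ i, y (.inr i) = false)) = 0 := by
    rw [proj_inr_zero, Matrix.mul_assoc, ← Matrix.mul_assoc uK, ← Matrix.mul_assoc, hbad,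
      Matrix.zero_mul]
  have hY := ancZero_ampOp_allFail (GA := GA) uK huK' kout j₀ hN
  rw [← hφ] at hY
  set A : Op (Reg X KA GA N k) := ampOp uK kout j₀ (List.finRange N) with hA
  set J : Matrix (Bits (Reg X KA GA N k)) (Bits X) ℂ := inpMat X KA GA N k true b with hJ
  set F : Op (Reg X KA GA N k) := proj (allFail j₀ (List.finRange N)) with hF
  set Z : Op (Reg X KA GA N k) := proj ancZero with hZ
  set O : Op (Reg X KA GA N k) := pmat (flipO s) with hO
  have hZJ : Z * J = J := proj_mul_pmat_of_forall fun u => by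
    simp [ancZero, kaZero, crZero, inp]
  have hkJ : proj (kaZero : Bits (Reg X KA GA N k) → Bool) * J = J :=
    proj_mul_pmat_of_forall fun u => by simp [kaZero, inp]
  have hcJ : proj (crZero (List.finRange N) : Bits (Reg X KA GA N k) → Bool) * J = J :=
    proj_mul_pmat_of_forall fun u => by simp [crZero, inp]
  have hBJ : liftOp (eK (GA := GA) (N := N) (k := k)) (proj (badK kout j₀ s) * uK) * J = 0 := by
    rw [← hkJ, ← Matrix.mul_assoc, kaZero_eq_liftOp, liftOp_mul eK_injective, hbad', liftOp_zero,
      Matrix.zero_mul]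
  have hsupp : ∀ i y u, badC s i y = true → (A * J) y u = 0 := by
    intro i y u hy
    have := congrFun₂ (badC_mul_ampOp uK huK' kout j₀ s hbad' (List.nodup_finRange N) J hBJ hcJ
      (List.mem_finRange i)) y u
    rw [proj_mul_apply, if_pos hy] at this
    exact this
  have hgJ : ∀ y u, y .g = false → (A * J) y u = 0 := by
    intro y u hy
    have hc : Commute (proj (fun y : Bits (Reg X KA GA N k) => !y .g)) A := by
      refine ActsOn.commute' (s := {.g}) (actsOn_proj fun y y' h => ?_)
        (actsOn_ampOp uK kout j₀ _) ?_
      · rw [h .g rfl]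
      · rintro w rfl; simp [kset, cset]
    have h0 : proj (fun y : Bits (Reg X KA GA N k) => !y .g) * (A * J) = 0 := by
      rw [← Matrix.mul_assoc, hc.eq, Matrix.mul_assoc, hJ, inpMat, proj_mul_pmat_eq_zero, Matrix.mul_zero]
      intro u; simp [inp]
    have := congrFun₂ h0 y u
    rw [proj_mul_apply, if_pos (by simp [hy])] at this
    exact this
  have e1 : pmat (copyList (X := X) (KA := KA) (GA := GA) j₀ [] (List.finRange N)) * (A * J) =
      F * (A * J) + O * ((1 - F) * (A * J)) := by
    -- The two maps may differ for wrong records or for guess `0`; neither occurs in `A * J`.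
    have e2 : pmat (copyList (X := X) (KA := KA) (GA := GA) j₀ [] (List.finRange N)) * (A * J) =
        pmat (fun y : Bits (Reg X KA GA N k) => if allFail j₀ (List.finRange N) y then y else flipO s y) * (A * J) := by
      refine pmat_mul_congr fun y => ?_
      by_cases hb : ∀ i, badC s i y = false
      · cases hg : y .g
        · exact .inr fun u => hgJ y u hg
        · refine .inl ?_
          rw [copyList_eq j₀ hs _ _ y fun i _ => hb i, if_pos (by simp [allFail])]
          funext w
          cases ha : allFail j₀ (List.finRange N) y <;> cases w <;>
            simp [copyIdeal, flipO, hg, ha]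
      · push Not at hb
        obtain ⟨i, hi⟩ := hb
        exact .inr fun u => hsupp i y u (by simpa using hi)
    have e3 : pmat (fun y => if allFail j₀ (List.finRange N) y then y else flipO s y) =
        F + O * (1 - F) := by
      have a1 : pmat (fun y : Bits (Reg X KA GA N k) =>
          if allFail j₀ (List.finRange N) y then y else flipO s y) * F = F := by
        rw [hF, pmat_mul_proj_congr (g := id), pmat_id, Matrix.one_mul]
        intro y hy; simp [hy]
      have a2 : pmat (fun y : Bits (Reg X KA GA N k) =>
          if allFail j₀ (List.finRange N) y then y else flipO s y) * (1 - F) = O * (1 - F) := by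
        rw [hF, ← proj_not, pmat_mul_proj_congr (g := flipO s)]
        intro y hy
        rw [if_neg]; simpa using hy
      calc _ = _ * (F + (1 - F)) := by rw [add_sub_cancel, Matrix.mul_one]
        _ = _ := by rw [Matrix.mul_add, a1, a2]
    rw [e2, e3, Matrix.add_mul, Matrix.mul_assoc]
  have cOA : Commute O Aᴴ := (actsOn_flipO s).commute' (actsOn_ampOp uK kout j₀ _).conjTranspose (by
    rintro (w | w | w | ⟨i', j⟩ | w | w | _ | _) <;> simp [oset, kset, cset])
  have cOZ : Commute Z O := by
    rw [Commute, SemiconjBy, hZ, hO, proj_mul_pmat]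
    rfl
  have hAA : Aᴴ * A = 1 := ampOp_conjTranspose_mul_self uK huK huK' kout j₀ _
  have e4 : extractOp (GA := GA) (N := N) uK kout j₀ * J = Aᴴ * F * A * J + O * (J - Aᴴ * F * A * J) := by
    have : J = Aᴴ * (A * J) := by rw [← Matrix.mul_assoc, hAA, Matrix.one_mul]
    rw [extractOp, ← hA, Matrix.mul_assoc, Matrix.mul_assoc, e1, Matrix.mul_add,
      ← Matrix.mul_assoc Aᴴ O, ← cOA.eq, Matrix.sub_mul, Matrix.one_mul, Matrix.mul_assoc O,
      Matrix.mul_sub, ← this]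
    simp only [Matrix.mul_assoc]
  have e5 : Z * (Aᴴ * F * A * J) = J * φ := by
    calc Z * (Aᴴ * F * A * J) = Z * (Aᴴ * F * A * (Z * J)) := by rw [hZJ]
      _ = Z * (Aᴴ * F * A) * Z * J := by simp only [Matrix.mul_assoc]
      _ = liftOp (Reg.x (KA := KA) (GA := GA) (N := N) (k := k)) φ * J := by rw [hY, Matrix.mul_assoc, hZJ]
      _ = J * φ := by
        have : (inp true b : Bits X → Bits (Reg X KA GA N k)) =
            fun v => Function.extend Reg.x v (inp true b fun _ => false) := by
          funext v w
          have hx : Function.Injective (Reg.x : X → Reg X KA GA N k) := fun a b h => by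
            simpa using h
          cases w with
          | x i => exact (hx.extend_apply v _ i).symm
          | _ => rw [Function.extend_apply' _ _ _ (by simp)]; rfl
        rw [hJ, inpMat, this]
        exact liftOp_mul_pmat_extend (fun a b h => by simpa using h) φ _
  rw [e4, Matrix.mul_add, e5, ← Matrix.mul_assoc, cOZ.eq, Matrix.mul_assoc, Matrix.mul_sub, hZJ, e5,
    Matrix.mul_assoc, Matrix.mul_sub J, Matrix.mul_one]

end Copy

/-! ### Guessing the decision, simulation, and amplification -/

section Simulate
open Reg
variable {X KA GA : Type} [Fintype X] [DecidableEq X] [Fintype KA] [DecidableEq KA]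
  [Fintype GA] [DecidableEq GA] {N k : ℕ}

/-- Put guess and flag into uniform superposition. -/
noncomputable def hadOp (X KA GA : Type) [Fintype X] [DecidableEq X] [Fintype KA] [DecidableEq KA]
    [Fintype GA] [DecidableEq GA] (N k : ℕ) : Op (Reg X KA GA N k) :=
  (Gate.had .h).op * (Gate.had .g).op

/-- Guess the decision, extract accordingly, and run the simulated algorithm. -/
noncomputable def guessOp (uK : Op (X ⊕ KA)) (uG : Op (X ⊕ GA)) (kout : Fin k → KA) (j₀ : Fin k) :
    Op (Reg X KA GA N k) :=
  liftOp eG uG * (extractOp uK kout j₀ * hadOp X KA GA N k)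

/-- The guess was right, the extraction succeeded if it had to, and its registers are clean. -/
def good (b : GA) (j₀ : Fin k) (y : Bits (Reg X KA GA N k)) : Bool :=
  (y (.ga b) == y .g) && ((!y .h && (y (.o j₀) == y .g)) && ancZero y)

/-- The final configuration belonging to a final configuration of the simulated algorithm. -/
def simOut (b : GA) (s : Fin k → Bool) (z : Bits (X ⊕ GA)) : Bits (Reg X KA GA N k)
  | .x i => z (.inl i)
  | .ga i => z (.inr i)
  | .o j => z (.inr b) && s j
  | .g => z (.inr b)
  | _ => false

theorem simOut_injective (b : GA) (s : Fin k → Bool) :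
    Function.Injective (simOut b s : Bits (X ⊕ GA) → Bits (Reg X KA GA N k)) := by
  intro z z' h
  funext w
  rcases w with i | i
  · exact congrFun h (.x i)
  · exact congrFun h (.ga i)

/-- Unlike in `simOut`, guess and value are not yet tied to the decision bit. This embedding is
therefore intertwined with the simulated algorithm. -/
def simOutOf (a : Bool) (s : Fin k → Bool) (z : Bits (X ⊕ GA)) : Bits (Reg X KA GA N k)
  | .x i => z (.inl i)
  | .ga i => z (.inr i)
  | .o j => s j
  | .g => a
  | _ => false

theorem simOutOf_eq_extend (a : Bool) (s : Fin k → Bool) :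
    (simOutOf a s : Bits (X ⊕ GA) → Bits (Reg X KA GA N k)) =
      fun z => Function.extend eG z (simOutOf a s fun _ => false) := by
  funext z w
  cases w with
  | x i => exact (eG_injective.extend_apply z _ (.inl i)).symm
  | ga i => exact (eG_injective.extend_apply z _ (.inr i)).symm
  | _ => rw [Function.extend_apply' _ _ _ (by simp [eG])]; rfl

theorem had_had_mul_inpMat :
    hadOp X KA GA N k * inpMat X KA GA N k false false =
      (2 : ℂ)⁻¹ • (inpMat X KA GA N k false false + inpMat X KA GA N k false true +
        (inpMat X KA GA N k true false + inpMat X KA GA N k true true)) := by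
  have u1 : ∀ a : Bool, (fun u : Bits X => Function.update (inp a false u :
      Bits (Reg X KA GA N k)) .h true) = inp a true := by
    intro a
    funext u w
    cases w <;> simp [inp]
  have u2 : (fun u : Bits X => Function.update (inp false false u :
      Bits (Reg X KA GA N k)) .g true) = inp true false := by
    funext u w
    cases w <;> simp [inp]
  have h2 : ((Real.sqrt 2 : ℂ)⁻¹) * ((Real.sqrt 2 : ℂ)⁻¹) = (2 : ℂ)⁻¹ := by
    rw [← mul_inv, ← Complex.ofReal_mul, Real.mul_self_sqrt (by norm_num)]
    norm_num
  simp only [inpMat, hadOp]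
  rw [Matrix.mul_assoc, had_mul_pmat (.g : Reg X KA GA N k) (inp false false) fun u => rfl, u2, Matrix.mul_smul, Matrix.mul_add,
    had_mul_pmat (.h : Reg X KA GA N k) (inp false false) fun u => rfl,
    had_mul_pmat (.h : Reg X KA GA N k) (inp true false) fun u => rfl, u1, u1, ← smul_add, smul_smul,
    h2]

set_option maxHeartbeats 400000 in
-- Guess and flag give four branches of amplitude `1/2`. For each decision only flag `0` with the
-- matching guess survives, whence the factor `2`. In the accepting branch the share `φ`, where
-- nothing was extracted, is lost because bit `j₀` of `o` then differs from the guess.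
theorem guessOp_amplitude (uK : Op (X ⊕ KA)) (huK : uKᴴ * uK = 1)
    (huK' : uK * uKᴴ = 1) (uG : Op (X ⊕ GA)) (kout : Fin k → KA) (j₀ : Fin k) {s : Fin k → Bool}
    (hs : s j₀ = true) (hbad : proj (badK (X := X) kout j₀ s) * (uK * zmat X KA) = 0) {m : ℕ}
    (hN : N = m + 1) (b : GA) {φ : Op X} (hφ : φ = failOp ((uK * zmat X KA)ᴴ *
        proj (fun y : Bits (X ⊕ KA) => !y (.inr (kout j₀))) * (uK * zmat X KA)) m) :
    (2 : ℂ) • (proj (good (X := X) (KA := KA) (GA := GA) (N := N) b j₀) *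
        (guessOp (N := N) uK uG kout j₀ * inpMat X KA GA N k false false)) =
      pmat (simOut (X := X) (KA := KA) (GA := GA) (N := N) b s) * (uG * zmat X GA) -
        pmat (simOut (X := X) (KA := KA) (GA := GA) (N := N) b s) *
          (proj (fun z : Bits (X ⊕ GA) => z (.inr b)) * (uG * zmat X GA) * φ) := by
  set V := extractOp (GA := GA) (N := N) uK kout j₀ with hV
  set U : Op (Reg X KA GA N k) := liftOp eG uG with hU
  set Z : Op (Reg X KA GA N k) := proj ancZero with hZ
  set H : Op (Reg X KA GA N k) := proj (fun y => !y .h && (y (.o j₀) == y .g)) with hH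
  set B : Op (Reg X KA GA N k) := proj (fun y => y (.ga b) == y .g) with hB
  set O : Op (Reg X KA GA N k) := pmat (flipO s) with hO
  set S : Bool → (Fin k → Bool) → Matrix (Bits (Reg X KA GA N k)) (Bits (X ⊕ GA)) ℂ :=
    fun a t => pmat (simOutOf a t) with hS
  have hg : proj (good (X := X) (KA := KA) (GA := GA) (N := N) b j₀) = B * (H * Z) := by
    rw [hH, hZ, hB, proj_mul_proj, proj_mul_proj]; rfl
  -- These tests concern wires outside the simulated algorithm, so they may be applied before it
  -- runs.
  have hc : Commute (H * Z) U := by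
    rw [hH, hZ, proj_mul_proj]
    refine ActsOn.commute' (s := gsetᶜ) (actsOn_proj fun y y' h => ?_) (actsOn_eG uG) fun w hw => hw
    have h1 : kaZero y = kaZero y' := by
      rw [kaZero, kaZero, decide_eq_decide]
      exact forall_congr' fun i => by rw [h (.ka i) (by simp [gset])]
    have h2 : crZero (List.finRange N) y = crZero (List.finRange N) y' := by
      rw [crZero, crZero, decide_eq_decide]
      refine forall₂_congr fun i _ => ?_
      rw [h (.r i) (by simp [gset])]
      refine and_congr_left' (forall_congr' fun j => ?_)
      rw [h (.c i j) (by simp [gset])]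
    simp only [ancZero, h1, h2, h .h (by simp [gset]), h (.o j₀) (by simp [gset]),
      h .g (by simp [gset])]
  have e0 : ∀ a, Z * (V * inpMat X KA GA N k false a) = inpMat X KA GA N k false a := by
    intro a
    rw [hV, extractOp_mul_inp_false uK huK huK', inpMat, hZ]
    exact proj_mul_pmat_of_forall fun u => by simp [ancZero, kaZero, crZero, inp]
  have e1 := ancZero_extractOp_mul_inp_true (GA := GA) uK huK huK' kout j₀ hs hbad hN false hφ
  have e2 := ancZero_extractOp_mul_inp_true (GA := GA) uK huK huK' kout j₀ hs hbad hN true hφ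
  rw [← hV, ← hZ, ← hO] at e1 e2
  have f1 : H * inpMat X KA GA N k false false = inpMat X KA GA N k false false :=
    proj_mul_pmat_of_forall fun u => by simp [inp]
  have f2 : H * inpMat X KA GA N k false true = 0 :=
    proj_mul_pmat_eq_zero fun u => by simp [inp]
  have f3 : ∀ a, H * inpMat X KA GA N k true a = 0 := fun a =>
    proj_mul_pmat_eq_zero fun u => by simp [inp]
  have f4 : H * (O * inpMat X KA GA N k true false) =
      O * inpMat X KA GA N k true false := by
    rw [inpMat, hO, pmat_mul_pmat]
    exact proj_mul_pmat_of_forall fun u => by simp [inp, flipO, hs]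
  have f5 : H * (O * inpMat X KA GA N k true true) = 0 := by
    rw [inpMat, hO, pmat_mul_pmat]
    exact proj_mul_pmat_eq_zero fun u => by simp [inp, flipO]
  have g1 : inpMat X KA GA N k false false = S false (fun _ => false) * zmat X GA := by
    rw [hS, zmat, pmat_mul_pmat, inpMat]
    congr 1; funext u w
    cases w <;> simp [inp, simOutOf, zext]
  have g2 : O * inpMat X KA GA N k true false =
      S true s * zmat X GA := by
    rw [hS, hO, zmat, pmat_mul_pmat, inpMat, pmat_mul_pmat]
    congr 1; funext u w
    cases w <;> simp [inp, simOutOf, zext, flipO]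
  have hUs : ∀ a (t : Fin k → Bool), U * S a t = S a t * uG := by
    intro a t
    simp only [hU, hS]
    rw [simOutOf_eq_extend]
    exact liftOp_mul_pmat_extend eG_injective uG _
  -- Comparing guess and decision selects one decision, and on that part the embedding agrees with
  -- `simOut`.
  have k1 : B * S false (fun _ => false) =
      pmat (simOut (X := X) (KA := KA) (GA := GA) (N := N) b s) * (1 - proj (fun z : Bits (X ⊕ GA) => z (.inr b))) := by
    rw [hB, hS, proj_mul_pmat, ← proj_not]
    have : (fun y : Bits (X ⊕ GA) => simOutOf (KA := KA) (N := N) (k := k) false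
        (fun _ => false) y (.ga b) == simOutOf (KA := KA) (N := N) (k := k) false
        (fun _ => false) y .g) = fun y => !y (.inr b) := by
      funext y; simp [simOutOf]
    rw [this]
    refine pmat_mul_proj_congr fun z hz => funext fun w => ?_
    rw [Bool.not_eq_true'] at hz
    cases w <;> simp [simOutOf, simOut, hz]
  have k2 : B * S true s =
      pmat (simOut (X := X) (KA := KA) (GA := GA) (N := N) b s) *
        proj (fun z : Bits (X ⊕ GA) => z (.inr b)) := by
    rw [hB, hS, proj_mul_pmat]
    have : (fun y : Bits (X ⊕ GA) => simOutOf (KA := KA) (N := N) (k := k) true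
        s y (.ga b) == simOutOf (KA := KA) (N := N) (k := k) true
        s y .g) = fun y => y (.inr b) := by
      funext y; simp [simOutOf]
    rw [this]
    refine pmat_mul_proj_congr fun z hz => funext fun w => ?_
    cases w <;> simp [simOutOf, simOut, hz]
  have key : H * Z * (V * (hadOp X KA GA N k *
      inpMat X KA GA N k false false)) = (2 : ℂ)⁻¹ • (inpMat X KA GA N k false false +
        O * inpMat X KA GA N k true false * (1 - φ)) := by
    rw [had_had_mul_inpMat, Matrix.mul_smul, Matrix.mul_smul, Matrix.mul_assoc H]
    refine congrArg ((2 : ℂ)⁻¹ • ·) ?_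
    simp only [Matrix.mul_add]
    rw [e0, e0, e1, e2, f1, f2]
    simp only [Matrix.mul_add, ← Matrix.mul_assoc H]
    rw [f3, f3]
    simp only [Matrix.mul_assoc H]
    rw [← Matrix.mul_assoc H, f4, ← Matrix.mul_assoc H, f5]
    simp only [Matrix.zero_mul, add_zero, zero_add]
  rw [hg, guessOp, ← hU, ← hV]
  have step : B * (H * Z) * (U * (V * hadOp X KA GA N k) *
      inpMat X KA GA N k false false) = B * (U * (H * Z * (V * (hadOp X KA GA N k *
        inpMat X KA GA N k false false)))) := by
    rw [← Matrix.mul_assoc U (H * Z), ← hc.eq]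
    simp only [Matrix.mul_assoc]
  rw [step, key, Matrix.mul_smul, Matrix.mul_smul, smul_smul, mul_inv_cancel₀ two_ne_zero, one_smul,
    g1, g2, Matrix.mul_add, Matrix.mul_add, ← Matrix.mul_assoc U, ← Matrix.mul_assoc U,
    ← Matrix.mul_assoc U, hUs, hUs]
  have r1 : B * (S false (fun _ => false) * uG * zmat X GA) =
      (B * S false (fun _ => false)) * (uG * zmat X GA) := by
    simp only [Matrix.mul_assoc]
  have r2 : B * (S true s * uG * zmat X GA * (1 - φ)) =
      (B * S true s) * (uG * zmat X GA) * (1 - φ) := by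
    simp only [Matrix.mul_assoc]
  rw [r1, r2, k1, k2]
  simp only [Matrix.mul_sub, Matrix.sub_mul, Matrix.mul_one, Matrix.mul_assoc]
  abel

/-- The operator of the extract-and-simulate circuit. -/
noncomputable def simOp (uK : Op (X ⊕ KA)) (uG : Op (X ⊕ GA)) (kout : Fin k → KA) (j₀ : Fin k)
    (b : GA) : Op (Reg X KA GA N k) :=
  guessOp uK uG kout j₀ *
    (1 - (2 : ℂ) • (inpMat X KA GA N k false false * (inpMat X KA GA N k false false)ᴴ)) *
    (guessOp uK uG kout j₀)ᴴ * (1 - (2 : ℂ) • proj (good b j₀)) * guessOp uK uG kout j₀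

theorem inp_injective (a b : Bool) :
    Function.Injective (inp a b : Bits X → Bits (Reg X KA GA N k)) :=
  fun _ _ h => funext fun i => congrFun h (.x i)

/-- Amplification with `Θ` the embedded final state of the simulated algorithm and `E` the part lost
through failed extraction. The sum appears because the amplified state is close to `-Θ`. -/
theorem norm_simOp_add_le (uK : Op (X ⊕ KA)) (huK : uKᴴ * uK = 1)
    (huK' : uK * uKᴴ = 1) (uG : Op (X ⊕ GA)) (huG : uGᴴ * uG = 1) (kout : Fin k → KA) (j₀ : Fin k)
    (hW : (guessOp (N := N) uK uG kout j₀)ᴴ * guessOp uK uG kout j₀ = 1) {s : Fin k → Bool}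
    (hs : s j₀ = true) (hbad : proj (badK (X := X) kout j₀ s) * (uK * zmat X KA) = 0) {m : ℕ}
    (hN : N = m + 1) (b : GA) {η : ℝ} (hη : η ≤ 1)
    (hE : ‖proj (fun z : Bits (X ⊕ GA) => z (.inr b)) * (uG * zmat X GA) *
      failOp ((uK * zmat X KA)ᴴ * proj (fun y : Bits (X ⊕ KA) => !y (.inr (kout j₀))) *
        (uK * zmat X KA)) m‖ ≤ η) :
    ‖simOp (N := N) uK uG kout j₀ b * inpMat X KA GA N k false false +
      pmat (simOut (X := X) (KA := KA) (GA := GA) (N := N) b s) * (uG * zmat X GA)‖ ≤ 4 * η := by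
  have hamp := guessOp_amplitude (GA := GA) uK huK huK' uG kout j₀ hs hbad hN b rfl
  set ι := pmat (simOut (X := X) (KA := KA) (GA := GA) (N := N) b s) with hι
  have hιι : ιᴴ * ι = 1 := conjTranspose_pmat_mul_self (simOut_injective b s)
  set J := inpMat X KA GA N k false false with hJ
  have hJJ : Jᴴ * J = 1 := conjTranspose_pmat_mul_self (inp_injective false false)
  set E := proj (fun z : Bits (X ⊕ GA) => z (.inr b)) * (uG * zmat X GA) *
      failOp ((uK * zmat X KA)ᴴ * proj (fun y : Bits (X ⊕ KA) => !y (.inr (kout j₀))) *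
        (uK * zmat X KA)) m with hEdef
  have hEι : ‖ι * E‖ ≤ η := (Matrix.l2_opNorm_mul _ _).trans ((mul_le_of_le_one_left
    (norm_nonneg _) (norm_le_one_of_isometry hιι)).trans hE)
  have hM : (uG * zmat X GA)ᴴ * (uG * zmat X GA) = 1 := by
    rw [Matrix.conjTranspose_mul, Matrix.mul_assoc, ← Matrix.mul_assoc uGᴴ, huG, Matrix.one_mul,
      conjTranspose_zmat_mul_self]
  have hΘ : (ι * (uG * zmat X GA))ᴴ * (ι * (uG * zmat X GA)) = 1 := by
    rw [Matrix.conjTranspose_mul, Matrix.mul_assoc, ← Matrix.mul_assoc ιᴴ, hιι, Matrix.one_mul, hM]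
  have := amplification_eq hW (mul_eq_one_comm.1 hW) hJJ (conjTranspose_proj _)
    (proj_idem (good b j₀)) hamp
  rw [simOp, ← hJ, this]
  exact norm_amplification_add_le hW hJJ hΘ hEι hη

end Simulate

/-! ### Gates read from blocks -/

def blockGates {W : Type} [DecidableEq W] (wire : ℕ → Option W) (bs : List Blk) : List (Gate W) :=
  bs.flatMap fun b => (gateOf wire b.1 b.2.1 b.2.2.1 b.2.2.2).toList

section Blocks
variable {V W : Type} [DecidableEq V] [DecidableEq W]

theorem blockGates_append (wire : ℕ → Option W) (bs bs' : List Blk) :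
    blockGates wire (bs ++ bs') = blockGates wire bs ++ blockGates wire bs' :=
  List.flatMap_append

theorem readGates_eq (wire : ℕ → Option W) (l : List ℕ) :
    readGates wire l = blockGates wire (toBlocks l) := by
  induction l using toBlocks.induct with
  | case1 g i j l rest ih => rw [readGates, toBlocks, ih]; rfl
  | case2 l h =>
    have h1 : toBlocks l = [] := by
      unfold toBlocks; split
      · exact absurd rfl (h _ _ _ _ _)
      · rfl
    have h2 : readGates wire l = [] := by
      unfold readGates; split
      · exact absurd rfl (h _ _ _ _ _)
      · rfl
    rw [h1, h2]; rfl

/-- Injectivity of `e` preserves the distinctness tests. By `h`, numbers without a wire are sent to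
numbers without a wire, so blocks that are skipped stay skipped. -/
theorem gateOf_map {wire : ℕ → Option V} {wire' : ℕ → Option W} {f : ℕ → ℕ} {e : V → W}
    (he : Function.Injective e) (h : ∀ j, wire' (f j) = (wire j).map e) (g i j l : ℕ) :
    gateOf wire' g (f i) (f j) (f l) = (gateOf wire g i j l).map (Gate.map e he) := by
  rcases g with _ | _ | _ | _ | _ | _ | g
  · simp only [gateOf, h]; cases wire i <;> rfl
  · simp only [gateOf, h]; cases wire i <;> rfl
  · simp only [gateOf, h]; cases wire i <;> rfl
  · simp only [gateOf, h]; cases wire i <;> rfl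
  · simp only [gateOf, h]
    cases wire i <;> cases wire j <;> try rfl
    rename_i x y
    by_cases hxy : x = y
    · simp [hxy]
    · simp [hxy, he.ne hxy, Gate.map]
  · simp only [gateOf, h]
    cases wire i <;> cases wire j <;> cases wire l <;> try rfl
    rename_i x y t
    by_cases hx : x = t
    · simp [hx]
    · by_cases hy : y = t
      · simp [hy]
      · simp [hx, hy, he.ne hx, he.ne hy, Gate.map]
  · rfl

def Blk.mapWires (f : ℕ → ℕ) (b : Blk) : Blk := (b.1, f b.2.1, f b.2.2.1, f b.2.2.2)

theorem blockGates_mapWires {wire : ℕ → Option V} {wire' : ℕ → Option W} {f : ℕ → ℕ} {e : V → W}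
    (he : Function.Injective e) (h : ∀ j, wire' (f j) = (wire j).map e) (bs : List Blk) :
    blockGates wire' (bs.map (Blk.mapWires f)) = (blockGates wire bs).map (Gate.map e he) := by
  rw [blockGates, blockGates, List.flatMap_map, List.map_flatMap]
  congr 1; funext b
  simp only [Blk.mapWires]
  rw [gateOf_map he h]
  cases gateOf wire b.1 b.2.1 b.2.2.1 b.2.2.2 <;> rfl

theorem gateOf_inv (wire : ℕ → Option W) (b : Blk) :
    (gateOf wire b.inv.1 b.inv.2.1 b.inv.2.2.1 b.inv.2.2.2) =
      (gateOf wire b.1 b.2.1 b.2.2.1 b.2.2.2).map Gate.inv := by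
  obtain ⟨g, i, j, l⟩ := b
  rcases g with _ | _ | _ | _ | _ | _ | g
  · simp only [Blk.inv, gateOf]; cases wire i <;> rfl
  · simp only [Blk.inv, gateOf]; cases wire i <;> rfl
  · simp only [Blk.inv, gateOf]; cases wire i <;> rfl
  · simp only [Blk.inv, gateOf]; cases wire i <;> rfl
  · simp only [Blk.inv, gateOf]
    cases wire i <;> cases wire j <;> try rfl
    rename_i x y
    by_cases hxy : x = y
    · simp [hxy]
    · simp [hxy, Gate.inv]
  · simp only [Blk.inv, gateOf]
    cases wire i <;> cases wire j <;> cases wire l <;> try rfl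
    rename_i x y t
    by_cases hx : x = t
    · simp [hx]
    · by_cases hy : y = t
      · simp [hy]
      · simp [hx, hy, Gate.inv]
  · rfl

theorem invGates_append (gs gs' : List (Gate W)) :
    invGates (gs ++ gs') = invGates gs' ++ invGates gs := by
  simp [invGates]

theorem blockGates_invBlocks (wire : ℕ → Option W) (bs : List Blk) :
    blockGates wire (invBlocks bs) = invGates (blockGates wire bs) := by
  induction bs with
  | nil => rfl
  | cons b bs ih =>
    have h1 : invBlocks (b :: bs) = invBlocks bs ++ [b.inv] := by simp [invBlocks]
    have h2 : blockGates wire (b :: bs) = blockGates wire [b] ++ blockGates wire bs :=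
      blockGates_append wire [b] bs
    rw [h1, h2, blockGates_append, invGates_append, ih]
    congr 1
    simp only [blockGates, List.flatMap_cons, List.flatMap_nil, List.append_nil, gateOf_inv]
    cases gateOf wire b.1 b.2.1 b.2.2.1 b.2.2.2 <;> rfl

end Blocks

/-! ### Implementation with clean ancillas -/

/-- The gates act as `Ω` on the wires `R`, and return the ancillas `T` to zero. -/
def Impl {R T : Type} [Fintype R] [DecidableEq R] [Fintype T] [DecidableEq T]
    (gs : List (Gate (R ⊕ T))) (Ω : Op R) : Prop :=
  gatesOp gs * zmat R T = zmat R T * Ω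

section Impl
variable {R T : Type} [Fintype R] [DecidableEq R] [Fintype T] [DecidableEq T]

theorem Impl.append {gs gs' : List (Gate (R ⊕ T))} {Ω Ω' : Op R} (h : Impl gs Ω)
    (h' : Impl gs' Ω') : Impl (gs ++ gs') (Ω' * Ω) := by
  rw [Impl] at *
  rw [gatesOp_append, Matrix.mul_assoc, h, ← Matrix.mul_assoc, h', Matrix.mul_assoc]

theorem Impl.isometry {gs : List (Gate (R ⊕ T))} {Ω : Op R} (h : Impl gs Ω) : Ωᴴ * Ω = 1 := by
  rw [Impl] at h
  calc Ωᴴ * Ω = Ωᴴ * ((zmat R T)ᴴ * zmat R T) * Ω := by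
        rw [conjTranspose_zmat_mul_self, Matrix.mul_one]
    _ = (zmat R T * Ω)ᴴ * (zmat R T * Ω) := by
        rw [Matrix.conjTranspose_mul]; simp only [Matrix.mul_assoc]
    _ = (zmat R T)ᴴ * ((gatesOp gs)ᴴ * gatesOp gs) * zmat R T := by
        rw [← h, Matrix.conjTranspose_mul]; simp only [Matrix.mul_assoc]
    _ = 1 := by
        rw [conjTranspose_gatesOp_mul_self, Matrix.mul_one, conjTranspose_zmat_mul_self]

/-- A square isometry is unitary, so `Ω` may be cancelled on either side. -/
theorem Impl.inv {gs : List (Gate (R ⊕ T))} {Ω : Op R} (h : Impl gs Ω) :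
    Impl (invGates gs) Ωᴴ := by
  have h1 := mul_eq_one_comm.1 h.isometry
  rw [Impl] at *
  rw [gatesOp_invGates]
  calc (gatesOp gs)ᴴ * zmat R T = (gatesOp gs)ᴴ * (zmat R T * Ω) * Ωᴴ := by
        rw [Matrix.mul_assoc, Matrix.mul_assoc, h1, Matrix.mul_one]
    _ = zmat R T * Ωᴴ := by
        rw [← h, ← Matrix.mul_assoc, conjTranspose_gatesOp_mul_self, Matrix.one_mul]

theorem Impl.of_map (gs : List (Gate R)) :
    Impl (gs.map (Gate.map (Sum.inl : R → R ⊕ T) Sum.inl_injective)) (gatesOp gs) := by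
  rw [Impl, gatesOp_map, liftOp_inl_mul_zext]

/-- Compute something into the ancillas, use it, and uncompute it. -/
theorem Impl.of_compute {gs mid : List (Gate (R ⊕ T))} {A : Matrix (Bits (R ⊕ T)) (Bits R) ℂ}
    {Ω : Op R} (h : gatesOp gs * zmat R T = A) (hm : gatesOp mid * A = A * Ω) :
    Impl (gs ++ mid ++ invGates gs) Ω := by
  rw [Impl, gatesOp_append, gatesOp_append, gatesOp_invGates]
  calc (gatesOp gs)ᴴ * (gatesOp mid * gatesOp gs) * zmat R T
      = (gatesOp gs)ᴴ * (gatesOp mid * (gatesOp gs * zmat R T)) := by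
        simp only [Matrix.mul_assoc]
    _ = ((gatesOp gs)ᴴ * gatesOp gs) * zmat R T * Ω := by
        rw [h, hm, ← h]; simp only [Matrix.mul_assoc]
    _ = zmat R T * Ω := by rw [conjTranspose_gatesOp_mul_self, Matrix.one_mul]

end Impl

/-- Computes the conjunctions of the negations of the wires `w 0, w 1, …` into the wires
`t, t + 1, …`. -/
def chainB (t len : ℕ) (w : ℕ → ℕ) : List Blk :=
  (3, t, 0, 0) :: (List.range len).flatMap fun i =>
    [(3, w i, 0, 0), (5, w i, t + i, t + i + 1), (3, w i, 0, 0)]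

/-- Reflection about the states in which all the wires `w 0, w 1, …` are zero. -/
def reflB (t len : ℕ) (w : ℕ → ℕ) : List Blk :=
  chainB t len w ++ [(1, t + len, 0, 0), (1, t + len, 0, 0), (1, t + len, 0, 0),
    (1, t + len, 0, 0)] ++ invBlocks (chainB t len w)

/-- Flips the wire `r` if all the wires `w 0, w 1, …` are zero. -/
def recB (t len : ℕ) (w : ℕ → ℕ) (r : ℕ) : List Blk :=
  chainB t len w ++ [(4, t + len, r, 0)] ++ invBlocks (chainB t len w)

section Wires
variable {W : Type} [Fintype W] [DecidableEq W] {α : Type*} [Fintype α] [DecidableEq α]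

theorem gatesOp_singleton (g : Gate W) : gatesOp [g] = g.op := by simp [gatesOp]

theorem not_mul_pmat (w : W) (f : α → Bits W) : gatesOp [Gate.not w] * pmat f =
    pmat fun u => Function.update (f u) w (!(f u w)) := by
  rw [gatesOp_singleton]; exact pmat_mul_pmat _ _

theorem cnot_mul_pmat {c t : W} (h : c ≠ t) (f : α → Bits W) : gatesOp [Gate.cnot c t h] * pmat f =
    pmat fun u => Function.update (f u) t (xor (f u t) (f u c)) := by
  rw [gatesOp_singleton]; exact pmat_mul_pmat _ _

theorem toffoli_mul_pmat {c c' t : W} (h : c ≠ t) (h' : c' ≠ t) (f : α → Bits W) :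
    gatesOp [Gate.toffoli c c' t h h'] * pmat f =
      pmat fun u => Function.update (f u) t (xor (f u t) (f u c && f u c')) := by
  rw [gatesOp_singleton]; exact pmat_mul_pmat _ _

variable {wire : ℕ → Option W} {num : W → ℕ}

theorem blockGates_had (hw : ∀ w, wire (num w) = some w) (w : W) :
    blockGates wire [(0, num w, 0, 0)] = [Gate.had w] := by
  simp [blockGates, gateOf, hw]

theorem blockGates_not (hw : ∀ w, wire (num w) = some w) (w : W) :
    blockGates wire [(3, num w, 0, 0)] = [Gate.not w] := by
  simp [blockGates, gateOf, hw]

theorem blockGates_cnot (hw : ∀ w, wire (num w) = some w) {c t : W} (h : c ≠ t) :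
    blockGates wire [(4, num c, num t, 0)] = [Gate.cnot c t h] := by
  simp [blockGates, gateOf, hw, h]

theorem blockGates_toffoli (hw : ∀ w, wire (num w) = some w) {c c' t : W} (h : c ≠ t)
    (h' : c' ≠ t) :
    blockGates wire [(5, num c, num c', num t)] = [Gate.toffoli c c' t h h'] := by
  simp [blockGates, gateOf, hw, h, h']

/-- Four T gates multiply the states with bit `1` by `exp(iπ) = -1`. -/
theorem gatesOp_phase (hw : ∀ w, wire (num w) = some w) (w : W) :
    gatesOp (blockGates wire [(1, num w, 0, 0), (1, num w, 0, 0), (1, num w, 0, 0),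
      (1, num w, 0, 0)]) = 1 - (2 : ℂ) • proj fun x => x w := by
  have h1 : blockGates wire [(1, num w, 0, 0), (1, num w, 0, 0), (1, num w, 0, 0),
      (1, num w, 0, 0)] = [.phaseT w, .phaseT w, .phaseT w, .phaseT w] := by
    simp [blockGates, gateOf, hw]
  rw [h1]
  simp only [gatesOp, Gate.op, Matrix.one_mul, Matrix.diagonal_mul_diagonal]
  ext x y
  rw [Matrix.sub_apply, Matrix.smul_apply, proj, Matrix.diagonal_apply, Matrix.diagonal_apply,
    Matrix.one_apply]
  by_cases hxy : x = y
  · subst hxy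
    cases hx : x w
    · simp
    · simp only [if_true, ← Complex.exp_add, smul_eq_mul, mul_one]
      rw [show (Real.pi / 4 * Complex.I + Real.pi / 4 * Complex.I + Real.pi / 4 * Complex.I +
        Real.pi / 4 * Complex.I : ℂ) = Real.pi * Complex.I by ring, Complex.exp_pi_mul_I]
      norm_num
  · simp [hxy]

/-- Toffoli gates with distinct targets. -/
theorem gatesOp_toffolis (hw : ∀ w, wire (num w) = some w) {ι : Type*} (a b t : ι → W)
    {js : List ι} (hj : (js.map t).Nodup) (ha : ∀ i ∈ js, ∀ j ∈ js, a i ≠ t j)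
    (hb : ∀ i ∈ js, ∀ j ∈ js, b i ≠ t j) {F : Bits W → Bits W}
    (hF : ∀ y, ∀ j ∈ js, F y (t j) = xor (y (t j)) (y (a j) && y (b j)))
    (hF' : ∀ y w, (∀ j ∈ js, t j ≠ w) → F y w = y w) :
    gatesOp (blockGates wire (js.map fun j => (5, num (a j), num (b j), num (t j)))) = pmat F := by
  induction js generalizing F with
  | nil =>
    have : F = id := funext fun y => funext fun w => hF' y w (by simp)
    rw [this, pmat_id]; rfl
  | cons j js ih =>
    have hja := ha j List.mem_cons_self j List.mem_cons_self
    have hjb := hb j List.mem_cons_self j List.mem_cons_self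
    rw [List.map_cons] at hj
    obtain ⟨hj1, hj2⟩ := List.nodup_cons.1 hj
    have hne : ∀ i ∈ js, t i ≠ t j := fun i hi e => hj1 (e ▸ List.mem_map_of_mem hi)
    rw [List.map_cons, ← List.singleton_append, blockGates_append, gatesOp_append,
      blockGates_toffoli hw hja hjb,
      ih hj2 (F := fun y w => if w = t j then y w else F y w)
        (fun i hi i' hi' => ha i (List.mem_cons_of_mem _ hi) i' (List.mem_cons_of_mem _ hi'))
        (fun i hi i' hi' => hb i (List.mem_cons_of_mem _ hi) i' (List.mem_cons_of_mem _ hi'))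
        (fun y i hi => by
          rw [if_neg (hne i hi), hF y i (List.mem_cons_of_mem _ hi)])
        (fun y w h => by
          split_ifs with e
          · rfl
          · refine hF' y w fun i hi => ?_
            rcases List.mem_cons.1 hi with rfl | hi
            · exact fun h' => e h'.symm
            · exact h i hi), gatesOp_singleton]
    refine (pmat_mul_pmat _ _).trans (congrArg pmat (funext fun y => funext fun w => ?_))
    simp only [Function.comp_apply]
    by_cases e : w = t j
    · rw [if_pos e, e, Function.update_self, hF y j List.mem_cons_self]
    · rw [if_neg e]
      by_cases hi : ∃ i ∈ js, t i = w
      · obtain ⟨i, hi, rfl⟩ := hi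
        have hi' := List.mem_cons_of_mem j hi
        rw [hF _ i hi', hF _ i hi', Function.update_of_ne e,
          Function.update_of_ne (ha i hi' j List.mem_cons_self),
          Function.update_of_ne (hb i hi' j List.mem_cons_self)]
      · push Not at hi
        have : ∀ i ∈ j :: js, t i ≠ w := by
          intro i h
          rcases List.mem_cons.1 h with rfl | h
          · exact fun h' => e h'.symm
          · exact hi i h
        rw [hF' _ w this, hF' _ w this, Function.update_of_ne e]

end Wires

/-! ### Testing a list of wires for zero -/

section Chain
variable {R : Type} [Fintype R] [DecidableEq R] {L : ℕ}
  {wire : ℕ → Option (R ⊕ Fin (L + 1))} {num : R ⊕ Fin (L + 1) → ℕ}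

/-- State after `m` links: ancilla `t ≤ m` holds the conjunction of the first `t` negations, and the
later ones are still zero. All prefixes are kept because the copy stages use them too. -/
def chainEmb (L m : ℕ) (ws : List R) (y : Bits R) : Bits (R ⊕ Fin (L + 1)) :=
  Sum.elim y fun t => decide ((t : ℕ) ≤ m) && (ws.take t).all fun w => !y w

theorem gatesOp_chain (hw : ∀ w, wire (num w) = some w) {t : ℕ}
    (ht : ∀ i : Fin (L + 1), num (.inr i) = t + i) {ws : List R} {wn : ℕ → ℕ}
    (hwn : ∀ i (h : i < ws.length), wn i = num (.inl ws[i])) (hL : ws.length ≤ L) {m : ℕ}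
    (hm : m ≤ ws.length) :
    gatesOp (blockGates wire (chainB t m wn)) * zmat R (Fin (L + 1)) =
      pmat (chainEmb L m ws) := by
  have ht' : ∀ i, (h : i < L + 1) → t + i = num (.inr ⟨i, h⟩) := fun i h => (ht ⟨i, h⟩).symm
  induction m with
  | zero =>
    have h0 := ht' 0 (by omega)
    rw [Nat.add_zero] at h0
    have hc : chainB t 0 wn = [(3, t, 0, 0)] := rfl
    rw [hc, h0, blockGates_not hw, zmat, not_mul_pmat]
    refine congrArg pmat (funext fun y => funext fun w => ?_)
    rcases w with w | i
    · simp [zext, chainEmb]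
    · by_cases hi : i = 0
      · subst hi
        simp [chainEmb, zext]
      · have : ¬ ((i : ℕ) ≤ 0) := fun h => hi (Fin.ext (Nat.le_zero.1 h))
        rw [Function.update_of_ne (by simpa using hi)]
        simp [chainEmb, zext, hi]
  | succ m ih =>
    have hc : chainB t (m + 1) wn = chainB t m wn ++ ([(3, wn m, 0, 0)] ++
        ([(5, wn m, t + m, t + (m + 1))] ++ [(3, wn m, 0, 0)])) := by
      simp [chainB, List.range_succ, List.flatMap_append, Nat.add_assoc]
    have hm' : m < ws.length := hm
    have hne : (Sum.inr ⟨m, by omega⟩ : R ⊕ Fin (L + 1)) ≠ .inr ⟨m + 1, by omega⟩ := by simp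
    have hne' : (Sum.inl ws[m] : R ⊕ Fin (L + 1)) ≠ .inr ⟨m + 1, by omega⟩ := by simp
    rw [hc, blockGates_append, gatesOp_append, Matrix.mul_assoc, ih (by omega), hwn m hm',
      ht' m (by omega), ht' (m + 1) (by omega), blockGates_append, blockGates_append,
      blockGates_not hw, blockGates_toffoli hw hne' hne, gatesOp_append, gatesOp_append,
      Matrix.mul_assoc, Matrix.mul_assoc, not_mul_pmat, toffoli_mul_pmat, not_mul_pmat]
    refine congrArg pmat (funext fun y => funext fun w => ?_)
    rcases w with w | i
    · by_cases e : w = ws[m]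
      · rw [e, Function.update_self, Function.update_of_ne (by simp), Function.update_self,
          Bool.not_not]
        rfl
      · rw [Function.update_of_ne (by simpa using e), Function.update_of_ne (by simp),
          Function.update_of_ne (by simpa using e)]
        rfl
    · rw [Function.update_of_ne (by simp)]
      by_cases e : i = ⟨m + 1, by omega⟩
      · rw [e, Function.update_self, Function.update_of_ne (by simp), Function.update_self,
          Function.update_of_ne (by simp)]
        have h1 : chainEmb L m ws y (.inr ⟨m + 1, by omega⟩) = false := by
          simp only [chainEmb, Sum.elim_inr, Bool.and_eq_false_iff, decide_eq_false_iff_not]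
          exact .inl (by omega)
        have h2 : chainEmb L m ws y (.inr ⟨m, by omega⟩) = (ws.take m).all fun w => !y w := by
          simp [chainEmb]
        have h3 : chainEmb L m ws y (.inl ws[m]) = y ws[m] := rfl
        have h4 : chainEmb L (m + 1) ws y (.inr ⟨m + 1, by omega⟩) =
            (ws.take (m + 1)).all fun w => !y w := by
          simp [chainEmb]
        rw [h1, h2, h3, h4, List.take_succ_eq_append_getElem hm', List.all_append, Bool.false_xor,
          Bool.and_comm, List.all_cons, List.all_nil, Bool.and_true]
      · rw [Function.update_of_ne (by simpa using e), Function.update_of_ne (by simp)]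
        simp only [chainEmb, Sum.elim_inr]
        have : ((i : ℕ) ≤ m) ↔ ((i : ℕ) ≤ m + 1) := by
          have : (i : ℕ) ≠ m + 1 := fun h => e (Fin.ext h)
          omega
        rw [decide_eq_decide.2 this]

def allZero (ws : List R) (y : Bits R) : Bool := ws.all fun w => !y w

theorem chainEmb_last {ws : List R} (hL : ws.length ≤ L) (y : Bits R) :
    chainEmb L ws.length ws y (.inr ⟨ws.length, by omega⟩) = allZero ws y := by
  simp [chainEmb, allZero]

theorem impl_reflB (hw : ∀ w, wire (num w) = some w) {t : ℕ}
    (ht : ∀ i : Fin (L + 1), num (.inr i) = t + i) {ws : List R} {wn : ℕ → ℕ}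
    (hwn : ∀ i (h : i < ws.length), wn i = num (.inl ws[i])) (hL : ws.length ≤ L) :
    Impl (blockGates wire (reflB t ws.length wn)) (1 - (2 : ℂ) • proj (allZero ws)) := by
  rw [reflB, blockGates_append, blockGates_append, blockGates_invBlocks]
  refine Impl.of_compute (gatesOp_chain hw ht hwn hL le_rfl) ?_
  rw [show t + ws.length = num (.inr ⟨ws.length, by omega⟩) from
    (ht ⟨ws.length, by omega⟩).symm, gatesOp_phase hw,
    Matrix.sub_mul, Matrix.mul_sub, Matrix.one_mul, Matrix.mul_one, Matrix.smul_mul,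
    Matrix.mul_smul, proj_mul_pmat]
  simp only [chainEmb_last hL]

/-- The target must not be among the tested wires; otherwise the chain could not be undone after the
flip. -/
theorem impl_recB (hw : ∀ w, wire (num w) = some w) {t : ℕ}
    (ht : ∀ i : Fin (L + 1), num (.inr i) = t + i) {ws : List R} {wn : ℕ → ℕ}
    (hwn : ∀ i (h : i < ws.length), wn i = num (.inl ws[i])) (hL : ws.length ≤ L) {r : R}
    (hr : r ∉ ws) : Impl (blockGates wire (recB t ws.length wn (num (.inl r))))
      (pmat fun y => Function.update y r (xor (y r) (allZero ws y))) := by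
  rw [recB, blockGates_append, blockGates_append, blockGates_invBlocks]
  refine Impl.of_compute (gatesOp_chain hw ht hwn hL le_rfl) ?_
  rw [show t + ws.length = num (.inr ⟨ws.length, by omega⟩) from
    (ht ⟨ws.length, by omega⟩).symm,
    blockGates_cnot hw (by simp), cnot_mul_pmat, pmat_mul_pmat]
  refine congrArg pmat (funext fun y => funext fun w => ?_)
  rw [chainEmb_last hL]
  rcases w with w | i
  · by_cases e : w = r
    · subst e; simp [chainEmb]
    · rw [Function.update_of_ne (by simpa using e)]
      simp [chainEmb, Function.update_of_ne e]
  · rw [Function.update_of_ne (by simp)]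
    simp only [chainEmb, Function.comp_apply, Sum.elim_inr]
    congr 1
    rw [Bool.eq_iff_iff, List.all_eq_true, List.all_eq_true]
    refine forall₂_congr fun w hw => ?_
    have hne : w ≠ r := fun e => hr (e ▸ List.mem_of_mem_take hw)
    rw [Function.update_of_ne hne]

end Chain

/-! ### Numbering of the wires -/

/-- Sizes of the registers of the extractor (`cK`, `mK`, `aK`) and of the simulated algorithm
(`cG`, `mG`, `aG`) on `n` input qubits, and the number `N` of attempts. -/
structure Sz where
  (n cK mK aK cG mG aG N : ℕ)

namespace Sz
variable (p : Sz)

abbrev KA : Type := Fin p.cK ⊕ Fin p.mK ⊕ Fin p.aK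
abbrev GA : Type := Fin p.cG ⊕ Fin p.mG ⊕ Fin p.aG
abbrev R : Type := Reg (Fin p.n) p.KA p.GA p.N p.cK

/-- Offsets. The input, the classical and the quantum output come first, as `wireOf` prescribes.
Then `b1` starts the extractor's ancillas, `b2` the records of zero ancillas, `b3` the copied
results, `b4` flag and guess, and `b5` the chain ancillas. -/
def ak : ℕ := p.cK + p.mK + p.aK
def b1 : ℕ := p.n + p.cK + p.mG + p.cG + p.aG
def b2 : ℕ := p.b1 + p.ak
def b3 : ℕ := p.b2 + p.N
def b4 : ℕ := p.b3 + p.N * p.cK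
-- The number of registers apart from the input. The longest test involves all of them, so `len + 1`
-- chain ancillas suffice.
def len : ℕ := p.cK + p.mG + p.cG + p.aG + p.ak + p.N + p.N * p.cK + 2
def b5 : ℕ := p.n + p.len
def work : ℕ := p.cG + p.aG + p.ak + p.N + p.N * p.cK + 2 + (p.len + 1)
def tot : ℕ := p.b5 + p.len + 1

/-- The number of a wire. -/
def num : p.R ⊕ Fin (p.len + 1) → ℕ
  | .inl (.x i) => i
  | .inl (.o j) => p.n + j
  | .inl (.ga (.inr (.inl q))) => p.n + p.cK + q
  | .inl (.ga (.inl q)) => p.n + p.cK + p.mG + q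
  | .inl (.ga (.inr (.inr q))) => p.n + p.cK + p.mG + p.cG + q
  | .inl (.ka (.inl q)) => p.b1 + q
  | .inl (.ka (.inr (.inl q))) => p.b1 + p.cK + q
  | .inl (.ka (.inr (.inr q))) => p.b1 + p.cK + p.mK + q
  | .inl (.r i) => p.b2 + i
  | .inl (.c i j) => p.b3 + (i * p.cK + j)
  | .inl .h => p.b4
  | .inl .g => p.b4 + 1
  | .inr t => p.b5 + t

theorem mul_add_lt {N k : ℕ} (i : Fin N) (j : Fin k) : (i : ℕ) * k + j < N * k := by
  calc (i : ℕ) * k + j < (i : ℕ) * k + k := by omega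
    _ = (i + 1) * k := by ring
    _ ≤ N * k := Nat.mul_le_mul_right k i.2

theorem num_injective : Function.Injective p.num := by
  have key : ∀ w w' : p.R ⊕ Fin (p.len + 1), p.num w = p.num w' → w = w' := by
    have hc := fun (i : Fin p.N) (j : Fin p.cK) => mul_add_lt i j
    rintro ((_ | (_ | _ | _) | (_ | _ | _) | ⟨i, j⟩ | _ | _ | _ | _) | _)
      ((_ | (_ | _ | _) | (_ | _ | _) | ⟨i', j'⟩ | _ | _ | _ | _) | _) h <;>
    simp only [num, b2, b3, b4, b5, b1, ak, len, Sum.inl.injEq, Sum.inr.injEq, Reg.x.injEq,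
      Reg.ka.injEq, Reg.ga.injEq, Reg.c.injEq, Reg.r.injEq, Reg.o.injEq, reduceCtorEq,
      Fin.ext_iff] at h ⊢ <;>
    first
    | omega
    | (have := hc i j; omega)
    | (have := hc i' j'; omega)
    | exact congrArg Sum.inr (Fin.ext (by omega))
    | skip
    -- Two result bits remain to be compared; attempt and position are recovered as quotient and
    -- remainder modulo `cK`.
    have hk : 0 < p.cK := j.pos
    have e : (i : ℕ) * p.cK + j = i' * p.cK + j' := by omega
    have e1 := congrArg (· / p.cK) e
    have e2 := congrArg (· % p.cK) e
    simp only [Nat.mod_eq_of_lt j.2, Nat.mod_eq_of_lt j'.2,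
      mul_comm _ p.cK, Nat.mul_add_div hk, Nat.div_eq_of_lt j.2, Nat.div_eq_of_lt j'.2,
      Nat.mul_add_mod] at e1 e2
    omega
  exact fun w w' => key w w'

theorem num_lt (w : p.R ⊕ Fin (p.len + 1)) : p.num w < p.tot := by
  rcases w with (_ | (_ | _ | _) | (_ | _ | _) | ⟨i, j⟩ | _ | _ | _ | _) | _ <;>
    simp only [num, b2, b3, b4, b5, b1, ak, len, tot]
  all_goals first | omega | (have := mul_add_lt i j; omega)

theorem exists_num {j : ℕ} (hj : j < p.tot) : ∃ w, p.num w = j := by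
  simp only [tot, b5, len, ak] at hj
  by_cases h1 : j < p.n
  · exact ⟨.inl (.x ⟨j, h1⟩), rfl⟩
  by_cases h2 : j < p.n + p.cK
  · exact ⟨.inl (.o ⟨j - p.n, by omega⟩), by simp only [num]; omega⟩
  by_cases h3 : j < p.n + p.cK + p.mG
  · exact ⟨.inl (.ga (.inr (.inl ⟨j - p.n - p.cK, by omega⟩))), by simp only [num]; omega⟩
  by_cases h4 : j < p.n + p.cK + p.mG + p.cG
  · exact ⟨.inl (.ga (.inl ⟨j - p.n - p.cK - p.mG, by omega⟩)), by simp only [num]; omega⟩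
  by_cases h5 : j < p.b1
  · simp only [b1] at h5
    exact ⟨.inl (.ga (.inr (.inr ⟨j - p.n - p.cK - p.mG - p.cG, by omega⟩))),
      by simp only [num]; omega⟩
  by_cases h6 : j < p.b1 + p.cK
  · exact ⟨.inl (.ka (.inl ⟨j - p.b1, by omega⟩)), by simp only [num]; omega⟩
  by_cases h7 : j < p.b1 + p.cK + p.mK
  · exact ⟨.inl (.ka (.inr (.inl ⟨j - p.b1 - p.cK, by omega⟩))), by simp only [num]; omega⟩
  by_cases h8 : j < p.b2
  · simp only [b2, ak] at h8
    exact ⟨.inl (.ka (.inr (.inr ⟨j - p.b1 - p.cK - p.mK, by omega⟩))),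
      by simp only [num]; omega⟩
  by_cases h9 : j < p.b3
  · simp only [b3] at h9
    exact ⟨.inl (.r ⟨j - p.b2, by omega⟩), by simp only [num]; omega⟩
  by_cases h10 : j < p.b4
  · simp only [b4] at h10
    have hk : 0 < p.cK := by
      rcases Nat.eq_zero_or_pos p.cK with h | h
      · rw [h, Nat.mul_zero] at h10; omega
      · exact h
    refine ⟨.inl (.c ⟨(j - p.b3) / p.cK, ?_⟩ ⟨(j - p.b3) % p.cK, Nat.mod_lt _ hk⟩), ?_⟩
    · rw [Nat.div_lt_iff_lt_mul hk]; omega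
    · simp only [num]
      have := Nat.div_add_mod' (j - p.b3) p.cK
      omega
  by_cases h11 : j = p.b4
  · exact ⟨.inl .h, h11.symm⟩
  by_cases h12 : j = p.b4 + 1
  · exact ⟨.inl .g, h12.symm⟩
  · simp only [b4, b3, b2, b1, ak] at h10 h11 h12
    exact ⟨.inr ⟨j - p.b5, by simp only [b5, len, ak]; omega⟩, by
      simp only [num, b5, len, ak]; omega⟩

open Classical in
/-- The wire with a given number. -/
noncomputable def wire (j : ℕ) : Option (p.R ⊕ Fin (p.len + 1)) :=
  if h : ∃ w, p.num w = j then some h.choose else none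

theorem wire_num (w : p.R ⊕ Fin (p.len + 1)) : p.wire (p.num w) = some w := by
  have h : ∃ w', p.num w' = p.num w := ⟨w, rfl⟩
  rw [wire, dif_pos h]
  exact congrArg some (p.num_injective h.choose_spec)

theorem wire_of_le {j : ℕ} (hj : p.tot ≤ j) : p.wire j = none := by
  rw [wire, dif_neg]
  rintro ⟨w, rfl⟩
  exact absurd (p.num_lt w) (by omega)

end Sz

theorem wireOf_eq_none_iff {n c m a j : ℕ} : wireOf n c m a j = none ↔ n + c + m + a ≤ j := by
  unfold wireOf
  split_ifs <;> simp <;> omega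

def wireNum {n c m a : ℕ} : Wire n c m a → ℕ
  | .inl i => i
  | .inr (.inl i) => n + i
  | .inr (.inr (.inl i)) => n + c + i
  | .inr (.inr (.inr i)) => n + c + m + i

theorem wireNum_of_wireOf {n c m a j : ℕ} {w : Wire n c m a} (h : wireOf n c m a j = some w) :
    wireNum w = j := by
  unfold wireOf at h
  split_ifs at h <;> cases h <;> simp only [wireNum] <;> omega

theorem wireOf_wireNum {n c m a : ℕ} (w : Wire n c m a) : wireOf n c m a (wireNum w) = some w := by
  rcases w with i | i | i | i
  · simp [wireOf, wireNum]
  · simp [wireOf, wireNum]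
  · have h2 : ¬ n + c + (i : ℕ) < n := by omega
    have h3 : ¬ n + c + (i : ℕ) - n < c := by omega
    have h4 : n + c + (i : ℕ) - n - c = i := by omega
    simp [wireOf, wireNum, h2, h3, h4]
  · have h2 : ¬ n + c + m + (i : ℕ) < n := by omega
    have h3 : ¬ n + c + m + (i : ℕ) - n < c := by omega
    have h5 : ¬ n + c + m + (i : ℕ) - n - c < m := by omega
    have h4 : n + c + m + (i : ℕ) - n - c - m = i := by omega
    simp [wireOf, wireNum, h2, h3, h4, h5]

namespace Sz
variable (p : Sz)

theorem wireOf_num_isSome (w : p.R ⊕ Fin (p.len + 1)) :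
    (wireOf p.n p.cK p.mG p.work (p.num w)).isSome := by
  rw [← Option.ne_none_iff_isSome, Ne, wireOf_eq_none_iff]
  have := p.num_lt w
  simp only [tot, b5, work, len] at *
  omega

/-- The wires as those of a circuit that returns the extracted value and the quantum output of the
simulated algorithm. -/
def emb (w : p.R ⊕ Fin (p.len + 1)) : Wire p.n p.cK p.mG p.work :=
  (wireOf p.n p.cK p.mG p.work (p.num w)).get (p.wireOf_num_isSome w)

theorem wireOf_num (w : p.R ⊕ Fin (p.len + 1)) :
    wireOf p.n p.cK p.mG p.work (p.num w) = some (p.emb w) := (Option.some_get _).symm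

theorem wireNum_emb (w : p.R ⊕ Fin (p.len + 1)) : wireNum (p.emb w) = p.num w :=
  wireNum_of_wireOf (p.wireOf_num w)

theorem emb_injective : Function.Injective p.emb := fun w w' h =>
  p.num_injective (by rw [← wireNum_emb, ← wireNum_emb, h])

theorem emb_eq {w : p.R ⊕ Fin (p.len + 1)} {v : Wire p.n p.cK p.mG p.work}
    (h : p.num w = wireNum v) : p.emb w = v := by
  have := p.wireOf_num w
  rw [h, wireOf_wireNum] at this
  exact (Option.some.inj this).symm

/-- Both numberings cover exactly the numbers below `tot`, so gates can be analysed on the labelled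
wires and then embedded. -/
theorem wireOf_eq (j : ℕ) : wireOf p.n p.cK p.mG p.work j = (p.wire j).map p.emb := by
  by_cases hj : j < p.tot
  · obtain ⟨w, rfl⟩ := p.exists_num hj
    rw [wire_num, wireOf_num]; rfl
  · rw [p.wire_of_le (by omega), Option.map_none, wireOf_eq_none_iff]
    simp only [tot, b5, work, len] at *
    omega

end Sz

section Generic
variable {R T : Type} [Fintype R] [DecidableEq R] [Fintype T] [DecidableEq T]

theorem Impl.of_basis {gs : List (Gate (R ⊕ T))} {F : Bits (R ⊕ T) → Bits (R ⊕ T)}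
    {f : Bits R → Bits R} (h : gatesOp gs = pmat F) (hF : ∀ y, F (zext y) = zext (f y)) :
    Impl gs (pmat f) := by
  rw [Impl, h, zmat, pmat_mul_pmat, pmat_mul_pmat]
  exact congrArg pmat (funext hF)

theorem Impl.of_gate (g : Gate R) :
    Impl [Gate.map (Sum.inl : R → R ⊕ T) Sum.inl_injective g] g.op := by
  have := Impl.of_map (T := T) [g]
  rwa [gatesOp_singleton] at this

/-- Conjugating a reflection by a permutation of the basis states. -/
theorem pmat_conj_reflection {f f' : Bits R → Bits R} (h : ∀ y, f' (f y) = y)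
    (q : Bits R → Bool) : pmat f' * ((1 - (2 : ℂ) • proj q) * pmat f) =
      1 - (2 : ℂ) • proj fun y => q (f y) := by
  have h1 : pmat f' * pmat f = 1 := by
    rw [pmat_mul_pmat, ← pmat_id]; exact congrArg pmat (funext h)
  rw [Matrix.sub_mul, Matrix.one_mul, Matrix.smul_mul, proj_mul_pmat, Matrix.mul_sub, h1,
    Matrix.mul_smul, ← Matrix.mul_assoc, h1, Matrix.one_mul]

end Generic

namespace Sz
variable (p : Sz)

/-! ### The description of the circuit -/

/-- Numbers beyond the extractor's wires go to `tot`, which is no wire. -/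
def kMap (j : ℕ) : ℕ :=
  if j < p.n then j else if j < p.n + p.ak then j - p.n + p.b1 else p.tot

/-- The quantum output of the simulated algorithm is moved in front of its classical output, since
it becomes the quantum output of the simulation while the decision becomes work space. -/
def gMap (j : ℕ) : ℕ :=
  if j < p.n then j else if j < p.n + p.cG then j + p.cK + p.mG
  else if j < p.n + p.cG + p.mG then j - p.cG + p.cK
  else if j < p.n + p.cG + p.mG + p.aG then j + p.cK else p.tot

def cpB (i : ℕ) : List Blk :=
  (List.range p.cK).map fun j => (5, p.b1, p.b1 + j, p.b3 + (i * p.cK + j))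

def roundB (kB : List Blk) (i : ℕ) : List Blk :=
  kB ++ p.cpB i ++ invBlocks kB ++ recB p.b5 p.ak (fun j => p.b1 + j) (p.b2 + i)

def ampB (kB : List Blk) : List Blk := (List.range p.N).flatMap (p.roundB kB)

/-- Chain ancilla `i + 1` combines the guess and the attempts before `i`. -/
def stageB (i : ℕ) : List Blk :=
  (List.range p.cK).map fun j => (5, p.b5 + (i + 1), p.b3 + (i * p.cK + j), p.n + j)

def copyChainB : List Blk :=
  chainB p.b5 (p.N + 1) fun i => if i = 0 then p.b4 + 1 else p.b3 + (i - 1) * p.cK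

/-- The guess is negated around the chain so that guess `1` passes the test for zero. -/
def copyB : List Blk :=
  [(3, p.b4 + 1, 0, 0)] ++ (p.copyChainB ++ (List.range p.N).flatMap p.stageB ++
    invBlocks p.copyChainB) ++ [(3, p.b4 + 1, 0, 0)]

def extractB (kB : List Blk) : List Blk := p.ampB kB ++ p.copyB ++ invBlocks (p.ampB kB)

def guessB (kB gB : List Blk) : List Blk :=
  [(0, p.b4 + 1, 0, 0)] ++ [(0, p.b4, 0, 0)] ++ p.extractB kB ++ gB

/-- Ancillas, records, results and flag occupy consecutive numbers starting at `b1`. -/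
def goodLen : ℕ := p.ak + p.N + p.N * p.cK + 1

/-- Two CNOTs from the guess turn both equality conditions of `good` into conditions that a wire is
zero; they are undone after the reflection. -/
def goodB : List Blk :=
  [(4, p.b4 + 1, p.n + p.cK + p.mG, 0)] ++ [(4, p.b4 + 1, p.n, 0)] ++
    reflB p.b5 (p.goodLen + 2) (fun i => if i < p.goodLen then p.b1 + i else
      if i = p.goodLen then p.n else p.n + p.cK + p.mG) ++
    [(4, p.b4 + 1, p.n, 0)] ++ [(4, p.b4 + 1, p.n + p.cK + p.mG, 0)]

def zeroB : List Blk := reflB p.b5 p.len fun i => p.n + i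

def simB (kB gB : List Blk) : List Blk :=
  p.guessB kB gB ++ p.goodB ++ invBlocks (p.guessB kB gB) ++ p.zeroB ++ p.guessB kB gB

/-! ### What the circuit does -/

theorem wire_kMap (j : ℕ) : p.wire (p.kMap j) =
    (wireOf p.n p.cK p.mK p.aK j).map (fun w => .inl (Reg.eK w)) := by
  rcases h : wireOf p.n p.cK p.mK p.aK j with _ | w
  · rw [wireOf_eq_none_iff] at h
    rw [kMap, if_neg (by omega), if_neg (by simp only [ak]; omega), p.wire_of_le le_rfl]; rfl
  · have := wireNum_of_wireOf h
    rw [Option.map_some, ← wire_num]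
    congr 1
    rcases w with w | w | w | w <;> simp only [wireNum] at this <;> subst this <;>
      simp only [Reg.eK, Sum.elim_inl, Sum.elim_inr, num, kMap]
    · rw [if_pos (by omega)]
    all_goals rw [if_neg (by omega), if_pos (by simp only [ak]; omega)]; omega

theorem wire_gMap (j : ℕ) : p.wire (p.gMap j) =
    (wireOf p.n p.cG p.mG p.aG j).map (fun w => .inl (Reg.eG w)) := by
  rcases h : wireOf p.n p.cG p.mG p.aG j with _ | w
  · rw [wireOf_eq_none_iff] at h
    rw [gMap, if_neg (by omega), if_neg (by omega), if_neg (by omega), if_neg (by omega),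
      p.wire_of_le le_rfl]; rfl
  · have := wireNum_of_wireOf h
    rw [Option.map_some, ← wire_num]
    congr 1
    rcases w with w | w | w | w <;> simp only [wireNum] at this <;> subst this <;>
      simp only [Reg.eG, Sum.elim_inl, Sum.elim_inr, num, gMap] <;> split_ifs <;> omega

theorem exists_wires {len : ℕ} {wn : ℕ → ℕ} (h : ∀ i < len, ∃ w, wn i = p.num (.inl w)) :
    ∃ ws : List p.R, ws.length = len ∧ (∀ i (hi : i < ws.length), wn i = p.num (.inl ws[i])) ∧
      ∀ w, w ∈ ws ↔ ∃ i < len, wn i = p.num (.inl w) := by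
  choose f hf using h
  refine ⟨List.ofFn fun i : Fin len => f i i.2, List.length_ofFn, fun i hi => ?_, fun w => ?_⟩
  · rw [List.getElem_ofFn]
    exact hf i (by simpa using hi)
  · rw [List.mem_ofFn]
    constructor
    · rintro ⟨i, rfl⟩
      exact ⟨i, i.2, hf i i.2⟩
    · rintro ⟨i, hi, e⟩
      refine ⟨⟨i, hi⟩, ?_⟩
      rw [hf i hi] at e
      exact Sum.inl_injective (p.num_injective e)

theorem exists_reg {j : ℕ} (hj : j < p.b5) : ∃ w, j = p.num (.inl w) := by
  obtain ⟨w | t, hw⟩ := p.exists_num (j := j) (by simp only [tot]; omega)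
  · exact ⟨w, hw.symm⟩
  · simp only [num] at hw; omega

theorem num_inr (t : Fin (p.len + 1)) : p.num (.inr t) = p.b5 + t := rfl

theorem impl_map {V : Type} [Fintype V] [DecidableEq V] {e : V → p.R} (he : Function.Injective e)
    (gs : List (Gate V)) :
    Impl (gs.map (Gate.map (fun v => (.inl (e v) : p.R ⊕ Fin (p.len + 1)))
      (Sum.inl_injective.comp he))) (liftOp e (gatesOp gs)) := by
  rw [Impl, gatesOp_map, ← liftOp_inl_mul_zext, liftOp_liftOp Sum.inl_injective]
  rfl

theorem map_range_eq_finRange {α : Type*} (k : ℕ) (f : ℕ → α) :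
    (List.range k).map f = (List.finRange k).map fun j : Fin k => f (j : ℕ) := by
  rw [← List.map_coe_finRange_eq_range, List.map_map]; rfl

theorem flatMap_range_eq_finRange {α : Type*} (k : ℕ) (f : ℕ → List α) :
    (List.range k).flatMap f = (List.finRange k).flatMap fun j : Fin k => f (j : ℕ) := by
  rw [← List.map_coe_finRange_eq_range, List.flatMap_map]

/-- The wire holding bit `j` of the result of the extractor. -/
def kout (j : Fin p.cK) : p.KA := .inl j

theorem impl_cpB (j₀ : Fin p.cK) (hj : (j₀ : ℕ) = 0) (i : Fin p.N) :
    Impl (blockGates p.wire (p.cpB i)) (pmat (cpFun (X := Fin p.n) (GA := p.GA) p.kout j₀ i)) := by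
  have hb : p.cpB i = (List.finRange p.cK).map fun j : Fin p.cK => (5, p.num (.inl (.ka (p.kout j₀))),
      p.num (.inl (.ka (p.kout j))), p.num (.inl (.c i j))) := by
    rw [cpB, map_range_eq_finRange]
    simp [num, kout, hj]
  have := gatesOp_toffolis (F := fun y => Sum.elim (cpFun p.kout j₀ i (y ∘ Sum.inl))
    (y ∘ Sum.inr)) p.wire_num (fun _ => .inl (.ka (p.kout j₀))) (fun j => .inl (.ka (p.kout j)))
    (fun j => .inl (.c i j)) (js := List.finRange p.cK)
    ((List.nodup_finRange _).map fun a b h => by simpa using h) (by simp) (by simp)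
    (fun y j _ => by simp [cpFun]) (fun y w h => by
      rcases w with w | w
      · cases w with
        | c i' j =>
          have : ¬ i' = i := fun e => h j (List.mem_finRange j) (by rw [e])
          simp [cpFun, this]
        | _ => rfl
      · rfl)
  rw [hb]
  exact Impl.of_basis this fun y => rfl

theorem impl_recB' (i : Fin p.N) : Impl (blockGates p.wire
    (recB p.b5 p.ak (fun j => p.b1 + j) (p.b2 + i)))
      (pmat (recFun (X := Fin p.n) (KA := p.KA) (GA := p.GA) (k := p.cK) i)) := by
  obtain ⟨ws, h1, h2, h3⟩ := p.exists_wires (len := p.ak) (wn := fun j => p.b1 + j) fun j hj =>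
    p.exists_reg (by simp only [b5, len, b1] at *; omega)
  have hmem : ∀ w : p.R, w ∈ ws ↔ ∃ a, w = .ka a := by
    intro w
    rw [h3]
    constructor
    · rintro ⟨j, hj, e⟩
      rcases w with _ | a | (_ | _ | _) | _ | _ | _ | _ | _
      case ka => exact ⟨a, rfl⟩
      all_goals
        simp only [num, b1, b2, b3, b4, ak] at e hj
        omega
    · rintro ⟨a, rfl⟩
      refine ⟨p.num (.inl (.ka a)) - p.b1, ?_, ?_⟩ <;> rcases a with a | a | a <;>
        simp only [num, ak] <;> omega
  have hr : (.r i : p.R) ∉ ws := by rw [hmem]; simp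
  have := impl_recB p.wire_num p.num_inr h2 (by rw [h1]; simp only [len]; omega) hr
  rw [h1] at this
  have e : (fun y : Bits p.R => Function.update y (.r i) (xor (y (.r i)) (allZero ws y))) =
      recFun i := by
    funext y w
    have hz : allZero ws y = kaZero y := by
      rw [Bool.eq_iff_iff, allZero, List.all_eq_true, kaZero, decide_eq_true_eq]
      constructor
      · intro h a
        simpa using h _ ((hmem _).2 ⟨a, rfl⟩)
      · intro h w hw
        obtain ⟨a, rfl⟩ := (hmem w).1 hw
        simp [h a]
    rw [hz]
    cases w with
    | r i' =>
      by_cases e : i' = i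
      · subst e; simp [recFun]
      · rw [Function.update_of_ne (by simpa using e)]; simp [recFun, e]
    | _ => rw [Function.update_of_ne (by simp)]; rfl
  rw [e] at this
  exact this

variable {kB gB : List Blk} {gK : List (Gate (Fin p.n ⊕ p.KA))} {gG : List (Gate (Fin p.n ⊕ p.GA))}

theorem impl_roundB (hk : blockGates p.wire kB = gK.map (Gate.map (fun v => .inl (Reg.eK v))
      (Sum.inl_injective.comp Reg.eK_injective))) (j₀ : Fin p.cK) (hj : (j₀ : ℕ) = 0)
    (i : Fin p.N) : Impl (blockGates p.wire (p.roundB kB i))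
      (roundOp (GA := p.GA) (gatesOp gK) p.kout j₀ i) := by
  have h1 : Impl (blockGates p.wire kB) (liftOp Reg.eK (gatesOp gK)) := by
    rw [hk]; exact p.impl_map Reg.eK_injective gK
  have := ((h1.append (p.impl_cpB j₀ hj i)).append h1.inv).append (p.impl_recB' i)
  rw [← blockGates_invBlocks, ← blockGates_append, ← blockGates_append, ← blockGates_append]
    at this
  exact this

theorem impl_ampB_aux (hk : blockGates p.wire kB = gK.map (Gate.map (fun v => .inl (Reg.eK v))
      (Sum.inl_injective.comp Reg.eK_injective))) (j₀ : Fin p.cK) (hj : (j₀ : ℕ) = 0)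
    (is : List (Fin p.N)) : Impl (blockGates p.wire (is.flatMap fun i : Fin p.N => p.roundB kB (i : ℕ)))
      (ampOp (GA := p.GA) (gatesOp gK) p.kout j₀ is) := by
  induction is with
  | nil => simp [Impl, blockGates, gatesOp, ampOp]
  | cons i is ih =>
    rw [List.flatMap_cons, blockGates_append]
    exact (p.impl_roundB hk j₀ hj i).append ih

theorem impl_ampB (hk : blockGates p.wire kB = gK.map (Gate.map (fun v => .inl (Reg.eK v))
      (Sum.inl_injective.comp Reg.eK_injective))) (j₀ : Fin p.cK) (hj : (j₀ : ℕ) = 0) :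
    Impl (blockGates p.wire (p.ampB kB))
      (ampOp (GA := p.GA) (gatesOp gK) p.kout j₀ (List.finRange p.N)) := by
  rw [ampB, flatMap_range_eq_finRange]
  exact p.impl_ampB_aux hk j₀ hj _

end Sz

/-! ### Gates for the copy -/

section Copy
variable {X KA GA : Type} [Fintype X] [DecidableEq X] [Fintype KA] [DecidableEq KA]
  [Fintype GA] [DecidableEq GA] {N k L : ℕ}

def flipG (y : Bits (Reg X KA GA N k)) : Bits (Reg X KA GA N k) := Function.update y .g (!y .g)

theorem flipG_flipG (y : Bits (Reg X KA GA N k)) : flipG (flipG y) = y := by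
  funext w
  cases w <;> simp [flipG]

/-- The wires whose vanishing is tested for the copy. -/
def copyWires (X KA GA : Type) (N : ℕ) (j₀ : Fin k) : List (Reg X KA GA N k) :=
  .g :: (List.finRange N).map fun i => .c i j₀

theorem length_copyWires (j₀ : Fin k) : (copyWires X KA GA N j₀).length = N + 1 := by
  simp [copyWires]

theorem take_copyWires_all (j₀ : Fin k) {prev is : List (Fin N)} {i : Fin N}
    (h : prev ++ i :: is = List.finRange N) (y : Bits (Reg X KA GA N k)) :
    (((copyWires X KA GA N j₀).take (i + 1)).all fun w => !y w) =
      (!y .g && allFail j₀ prev y) := by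
  have hlen : prev.length = i := by
    have h1 : (prev ++ i :: is)[prev.length]? = some i := by simp
    rw [h, List.getElem?_eq_some_iff] at h1
    obtain ⟨h2, h3⟩ := h1
    rw [List.getElem_finRange] at h3
    rw [← h3]; rfl
  have hp : (List.finRange N).take i = prev := by
    rw [← h, ← hlen, List.take_left]
  rw [copyWires, List.take_succ_cons, ← List.map_take, hp, List.all_cons]
  congr 1
  rw [Bool.eq_iff_iff]
  simp [allFail]

/-- The conditions of all stages can be computed beforehand because the stages change only `o`,
which no condition reads. -/
theorem gatesOp_copyStages {wire : ℕ → Option (Reg X KA GA N k ⊕ Fin (L + 1))}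
    {num : Reg X KA GA N k ⊕ Fin (L + 1) → ℕ} (hw : ∀ w, wire (num w) = some w)
    (hL : N + 1 ≤ L) {st : Fin N → List Blk}
    (hst : ∀ i, st i = (List.finRange k).map fun j : Fin k =>
      (5, num (.inr ⟨i + 1, by omega⟩), num (.inl (.c i j)), num (.inl (.o j))))
    (j₀ : Fin k) (is prev : List (Fin N)) (h : prev ++ is = List.finRange N) :
    gatesOp (blockGates wire (is.flatMap st)) *
        pmat (chainEmb L (N + 1) (copyWires X KA GA N j₀)) =
      pmat (chainEmb L (N + 1) (copyWires X KA GA N j₀)) *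
        pmat fun y : Bits (Reg X KA GA N k) => flipG (copyList j₀ prev is (flipG y)) := by
  induction is generalizing prev with
  | nil =>
    have : (fun y : Bits (Reg X KA GA N k) => flipG (copyList j₀ prev [] (flipG y))) = id :=
      funext fun y => flipG_flipG y
    rw [this, pmat_id, Matrix.mul_one]
    exact Matrix.one_mul _
  | cons i is ih =>
    have hF := gatesOp_toffolis hw (ι := Fin k) (fun _ => .inr ⟨i + 1, by omega⟩)
      (fun j => .inl (.c i j)) (fun j => .inl (.o j)) (js := List.finRange k)
      ((List.nodup_finRange _).map fun a b h => by simpa using h) (by simp) (by simp)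
      (F := fun y w => match w with
        | .inl (.o j) => xor (y (.inl (.o j))) (y (.inr ⟨i + 1, by omega⟩) && y (.inl (.c i j)))
        | w => y w) (fun y j _ => rfl) (fun y w hne => by
          rcases w with w | w
          · cases w with
            | o j => exact absurd rfl (hne j (List.mem_finRange j))
            | _ => rfl
          · rfl)
    rw [List.flatMap_cons, blockGates_append, gatesOp_append, Matrix.mul_assoc, hst i, hF,
      pmat_mul_pmat]
    have e : ((fun y w => match w with
        | .inl (.o j) => xor (y (.inl (.o j))) (y (.inr ⟨i + 1, by omega⟩) && y (.inl (.c i j)))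
        | w => y w) : Bits (Reg X KA GA N k ⊕ Fin (L + 1)) → Bits _) ∘
          chainEmb L (N + 1) (copyWires X KA GA N j₀) =
        chainEmb L (N + 1) (copyWires X KA GA N j₀) ∘
          fun y => flipG (copyStage j₀ prev i (flipG y)) := by
      funext y w
      have hi : ((i : ℕ) + 1 ≤ N + 1) := by omega
      rcases w with w | t
      · cases w with
        | o j =>
          have h2 : allFail j₀ prev (flipG y) = allFail j₀ prev y := rfl
          simp [chainEmb, take_copyWires_all j₀ h, flipG, copyStage]
          rfl
        | g => simp [chainEmb, flipG, copyStage]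
        | _ => rfl
      · simp only [Function.comp_apply, chainEmb, Sum.elim_inr]
        refine congrArg _ ?_
        rw [Bool.eq_iff_iff, List.all_eq_true, List.all_eq_true]
        refine forall₂_congr fun w hw => ?_
        have hw' := List.mem_of_mem_take hw
        cases w with
        | o j => simp [copyWires] at hw'
        | g => simp [flipG, copyStage]
        | _ => rfl
    rw [e, ← pmat_mul_pmat, ← Matrix.mul_assoc, ih (prev ++ [i]) (by simpa using h),
      Matrix.mul_assoc, pmat_mul_pmat]
    refine congrArg _ (congrArg pmat (funext fun y => ?_))
    rw [Function.comp_apply, flipG_flipG]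
    rfl

end Copy

namespace Sz
variable (p : Sz)

theorem impl_not (w : p.R) : Impl (blockGates p.wire [(3, p.num (.inl w), 0, 0)])
    (pmat fun y : Bits p.R => Function.update y w (!y w)) := by
  rw [blockGates_not p.wire_num]
  exact Impl.of_gate (Gate.not w)

theorem impl_cnot {c t : p.R} (h : c ≠ t) :
    Impl (blockGates p.wire [(4, p.num (.inl c), p.num (.inl t), 0)])
      (pmat fun y : Bits p.R => Function.update y t (xor (y t) (y c))) := by
  rw [blockGates_cnot p.wire_num (Sum.inl_injective.ne h)]
  exact Impl.of_gate (Gate.cnot c t h)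

theorem impl_had (w : p.R) : Impl (blockGates p.wire [(0, p.num (.inl w), 0, 0)])
    (Gate.had w).op := by
  rw [blockGates_had p.wire_num]
  exact Impl.of_gate (Gate.had w)

theorem impl_copyB (j₀ : Fin p.cK) (hj : (j₀ : ℕ) = 0) :
    Impl (blockGates p.wire p.copyB)
      (pmat (copyList (X := Fin p.n) (KA := p.KA) (GA := p.GA) j₀ [] (List.finRange p.N))) := by
  have hL : p.N + 1 ≤ p.len := by simp only [len]; omega
  have hn : Impl (blockGates p.wire [(3, p.b4 + 1, 0, 0)]) (pmat (flipG : Bits p.R → _)) :=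
    p.impl_not .g
  have hwn : ∀ i (h : i < (copyWires (Fin p.n) p.KA p.GA p.N j₀).length),
      (if i = 0 then p.b4 + 1 else p.b3 + (i - 1) * p.cK) =
        p.num (.inl (copyWires (Fin p.n) p.KA p.GA p.N j₀)[i]) := by
    rintro (_ | i) h
    · rfl
    · simp only [copyWires, List.getElem_cons_succ, List.getElem_map, List.getElem_finRange, num]
      simp [hj]
  have h1 := gatesOp_chain p.wire_num p.num_inr hwn (by rw [length_copyWires]; exact hL)
    (m := p.N + 1) (by rw [length_copyWires])
  have h2 := gatesOp_copyStages p.wire_num hL (st := fun i : Fin p.N => p.stageB (i : ℕ))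
    (fun i => by rw [stageB, map_range_eq_finRange]; rfl) j₀ (List.finRange p.N) [] rfl
  have h3 := Impl.of_compute h1 h2
  rw [← blockGates_invBlocks, ← blockGates_append, ← blockGates_append,
    ← flatMap_range_eq_finRange] at h3
  have h4 := (hn.append h3).append hn
  rw [← blockGates_append, ← blockGates_append] at h4
  have e : pmat (flipG : Bits p.R → _) * (pmat (fun y : Bits p.R => flipG
      (copyList j₀ [] (List.finRange p.N) (flipG y))) * pmat flipG) =
        pmat (copyList j₀ [] (List.finRange p.N)) := by
    refine (congrArg _ (pmat_mul_pmat _ _)).trans ((pmat_mul_pmat _ _).trans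
      (congrArg pmat (funext fun y => ?_)))
    simp only [Function.comp_apply, flipG_flipG]
  rw [e] at h4
  exact h4

theorem impl_goodB (j₀ : Fin p.cK) (hj : (j₀ : ℕ) = 0) (b₀ : Fin p.cG) (hb : (b₀ : ℕ) = 0) :
    Impl (blockGates p.wire p.goodB) (1 - (2 : ℂ) • proj
      (good (X := Fin p.n) (KA := p.KA) (GA := p.GA) (N := p.N) (.inl b₀) j₀)) := by
  have h1 := p.impl_cnot (c := .g) (t := .ga (.inl b₀)) (by simp)
  have h2 := p.impl_cnot (c := .g) (t := .o j₀) (by simp)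
  simp only [num, hj, hb, Nat.add_zero] at h1 h2
  obtain ⟨ws, hw1, hw2, hw3⟩ := p.exists_wires (len := p.goodLen + 2) (wn := fun i =>
      if i < p.goodLen then p.b1 + i else if i = p.goodLen then p.n else p.n + p.cK + p.mG)
    fun i hi => p.exists_reg (by
      have := b₀.pos
      have := j₀.pos
      split_ifs <;> simp only [b5, len, b1, goodLen] at * <;> omega)
  have hmem : ∀ w : p.R, w ∈ ws ↔ (∃ a, w = .ka a) ∨ (∃ i, w = .r i) ∨ (∃ i j, w = .c i j) ∨
      w = .h ∨ w = .o j₀ ∨ w = .ga (.inl b₀) := by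
    have ho : p.num (.inl (.o j₀)) = p.n := by simp [num, hj]
    have hga : p.num (.inl (.ga (.inl b₀))) = p.n + p.cK + p.mG := by simp [num, hb]
    intro w
    rw [hw3]
    constructor
    · rintro ⟨i, hi, e⟩
      split_ifs at e with h1 h2
      · rcases w with _ | _ | (_ | _ | _) | _ | _ | _ | _ | _
        case ka => simp
        case r => simp
        case c => simp
        case h => simp
        all_goals
          simp only [num, b1, b2, b3, b4, goodLen] at e h1
          omega
      · rw [← ho] at e
        simp [← Sum.inl_injective (p.num_injective e)]
      · rw [← hga] at e
        simp [← Sum.inl_injective (p.num_injective e)]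
    · rintro (⟨a, rfl⟩ | ⟨i, rfl⟩ | ⟨i, j, rfl⟩ | rfl | rfl | rfl)
      · have : p.b1 ≤ p.num (.inl (.ka a)) ∧ p.num (.inl (.ka a)) < p.b1 + p.ak := by
          rcases a with a | a | a <;> simp only [num, ak] <;> omega
        refine ⟨p.num (.inl (.ka a)) - p.b1, ?_, ?_⟩
        · simp only [goodLen]; omega
        · rw [if_pos (by simp only [goodLen]; omega)]; omega
      · refine ⟨p.ak + i, ?_, ?_⟩
        · simp only [goodLen]; omega
        · rw [if_pos (by simp only [goodLen]; omega)]; simp only [num, b2]; omega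
      · have := mul_add_lt i j
        refine ⟨p.ak + p.N + (i * p.cK + j), ?_, ?_⟩
        · simp only [goodLen]; omega
        · rw [if_pos (by simp only [goodLen]; omega)]; simp only [num, b2, b3]; omega
      · refine ⟨p.ak + p.N + p.N * p.cK, ?_, ?_⟩
        · simp only [goodLen]; omega
        · rw [if_pos (by simp only [goodLen]; omega)]; simp only [num, b2, b3, b4]; omega
      · refine ⟨p.goodLen, by omega, ?_⟩
        rw [if_neg (by omega), if_pos rfl, ho]
      · refine ⟨p.goodLen + 1, by omega, ?_⟩
        rw [if_neg (by omega), if_neg (by omega), hga]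
  have h3 := impl_reflB p.wire_num p.num_inr hw2 (by
    rw [hw1]; have := b₀.pos; have := j₀.pos; simp only [goodLen, len]; omega)
  rw [hw1] at h3
  have h4 := (((h1.append h2).append h3).append h2).append h1
  rw [← blockGates_append, ← blockGates_append, ← blockGates_append, ← blockGates_append] at h4
  have e := pmat_conj_reflection (R := p.R)
    (f := fun y => Function.update (Function.update y (.ga (.inl b₀))
      (xor (y (.ga (.inl b₀))) (y .g))) (.o j₀) (xor (y (.o j₀)) (y .g)))
    (f' := fun y => Function.update (Function.update y (.ga (.inl b₀))
      (xor (y (.ga (.inl b₀))) (y .g))) (.o j₀) (xor (y (.o j₀)) (y .g)))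
    (fun y => by
      funext w
      rcases w with _ | _ | _ | _ | _ | j | _ | _
      case ga a =>
        by_cases h : a = .inl b₀ <;> simp [h]
      case o =>
        by_cases h : j = j₀ <;> simp [h]
      all_goals simp) (allZero ws)
  have e1 : (fun y : Bits p.R => allZero ws (Function.update (Function.update y (.ga (.inl b₀))
      (xor (y (.ga (.inl b₀))) (y .g))) (.o j₀) (xor (y (.o j₀)) (y .g)))) =
        good (.inl b₀) j₀ := by
    funext y
    rw [Bool.eq_iff_iff, allZero, List.all_eq_true]
    simp only [hmem, or_imp, forall_and, forall_exists_index, forall_eq_apply_imp_iff, forall_eq]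
    simp [good, ancZero, kaZero, crZero]
    constructor
    · rintro ⟨h1, h2, h3, h4, h5, h6⟩
      exact ⟨h6, ⟨h4, h5⟩, h1, fun i => ⟨fun j => by simpa using h3 _ i j rfl, h2 i⟩⟩
    · rintro ⟨h6, ⟨h4, h5⟩, h1, h2⟩
      refine ⟨h1, fun i => (h2 i).2, ?_, h4, h5, h6⟩
      rintro _ i j rfl
      simpa using (h2 i).1 j
  rw [e1] at e
  have c1 : pmat (fun y : Bits p.R => Function.update y (.o j₀) (xor (y (.o j₀)) (y .g))) *
      pmat (fun y : Bits p.R => Function.update y (.ga (.inl b₀)) (xor (y (.ga (.inl b₀)))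
        (y .g))) = pmat fun y => Function.update (Function.update y (.ga (.inl b₀))
      (xor (y (.ga (.inl b₀))) (y .g))) (.o j₀) (xor (y (.o j₀)) (y .g)) :=
    (pmat_mul_pmat _ _).trans (congrArg pmat (funext fun y => by simp))
  have c2 : pmat (fun y : Bits p.R => Function.update y (.ga (.inl b₀)) (xor (y (.ga (.inl b₀)))
      (y .g))) * pmat (fun y : Bits p.R => Function.update y (.o j₀) (xor (y (.o j₀)) (y .g))) =
      pmat fun y => Function.update (Function.update y (.ga (.inl b₀))
      (xor (y (.ga (.inl b₀))) (y .g))) (.o j₀) (xor (y (.o j₀)) (y .g)) :=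
    (pmat_mul_pmat _ _).trans (congrArg pmat (funext fun y => by
      rw [Function.comp_apply, Function.update_comm (by simp)]; simp))
  rw [← e, ← c1]
  nth_rw 1 [c1, ← c2]
  rw [Matrix.mul_assoc]
  exact h4

theorem impl_zeroB : Impl (blockGates p.wire p.zeroB) (1 - (2 : ℂ) •
    (inpMat (Fin p.n) p.KA p.GA p.N p.cK false false *
      (inpMat (Fin p.n) p.KA p.GA p.N p.cK false false)ᴴ)) := by
  obtain ⟨ws, hw1, hw2, hw3⟩ := p.exists_wires (len := p.len) (wn := fun i => p.n + i)
    fun i hi => p.exists_reg (by simp only [b5]; omega)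
  have hmem : ∀ w : p.R, w ∈ ws ↔ ¬ ∃ i, w = .x i := by
    intro w
    rw [hw3]
    have hb : p.num (.inl w) < p.b5 := by
      rcases w with _ | (_ | _ | _) | (_ | _ | _) | ⟨i, j⟩ | _ | _ | _ | _ <;>
        simp only [num, b2, b3, b4, b5, b1, ak, len]
      all_goals first | omega | (have := mul_add_lt i j; omega)
    constructor
    · rintro ⟨j, hj, e⟩ ⟨i, rfl⟩
      simp only [num] at e; omega
    · intro h
      refine ⟨p.num (.inl w) - p.n, ?_, ?_⟩
      · simp only [b5, len] at *; omega
      · have : p.n ≤ p.num (.inl w) := by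
          rcases w with _ | (_ | _ | _) | (_ | _ | _) | _ | _ | _ | _ | _
          case x i => exact absurd ⟨i, rfl⟩ h
          all_goals simp only [num, b1, b2, b3, b4]; omega
        omega
  have h3 := impl_reflB p.wire_num p.num_inr hw2 (by rw [hw1])
  rw [hw1] at h3
  have e : proj (allZero ws) = inpMat (Fin p.n) p.KA p.GA p.N p.cK false false *
      (inpMat (Fin p.n) p.KA p.GA p.N p.cK false false)ᴴ := by
    refine proj_eq_pmat_mul_conjTranspose _ (inp_injective false false) _ fun y => ?_
    rw [allZero, List.all_eq_true]
    constructor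
    · intro h
      refine ⟨fun i => y (.x i), funext fun w => ?_⟩
      have := fun w hw => h w ((hmem w).2 hw)
      cases w with
      | x i => rfl
      | _ => simpa [inp] using this _ (by simp)
    · rintro ⟨u, rfl⟩ w hw
      have := (hmem w).1 hw
      cases w with
      | x i => exact absurd ⟨i, rfl⟩ this
      | _ => rfl
  rw [e] at h3
  exact h3

variable {kB gB : List Blk} {gK : List (Gate (Fin p.n ⊕ p.KA))} {gG : List (Gate (Fin p.n ⊕ p.GA))}

theorem impl_guessB (hk : blockGates p.wire kB = gK.map (Gate.map (fun v => .inl (Reg.eK v))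
      (Sum.inl_injective.comp Reg.eK_injective)))
    (hg : blockGates p.wire gB = gG.map (Gate.map (fun v => .inl (Reg.eG v))
      (Sum.inl_injective.comp Reg.eG_injective))) (j₀ : Fin p.cK) (hj : (j₀ : ℕ) = 0) :
    Impl (blockGates p.wire (p.guessB kB gB))
      (guessOp (gatesOp gK) (gatesOp gG) p.kout j₀) := by
  have h1 := p.impl_ampB hk j₀ hj
  have h2 : Impl (blockGates p.wire gB) (liftOp Reg.eG (gatesOp gG)) := by
    rw [hg]; exact p.impl_map Reg.eG_injective gG
  have h3 := (h1.append (p.impl_copyB j₀ hj)).append h1.inv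
  have h4 := (((p.impl_had .g).append (p.impl_had .h)).append h3).append h2
  rw [← blockGates_invBlocks, ← blockGates_append, ← blockGates_append, ← blockGates_append,
    ← blockGates_append, ← blockGates_append] at h4
  exact h4

theorem impl_simB (hk : blockGates p.wire kB = gK.map (Gate.map (fun v => .inl (Reg.eK v))
      (Sum.inl_injective.comp Reg.eK_injective)))
    (hg : blockGates p.wire gB = gG.map (Gate.map (fun v => .inl (Reg.eG v))
      (Sum.inl_injective.comp Reg.eG_injective))) (j₀ : Fin p.cK) (hj : (j₀ : ℕ) = 0)
    (b₀ : Fin p.cG) (hb : (b₀ : ℕ) = 0) :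
    Impl (blockGates p.wire (p.simB kB gB))
      (simOp (gatesOp gK) (gatesOp gG) p.kout j₀ (.inl b₀)) := by
  have h1 := p.impl_guessB hk hg j₀ hj
  have h2 := (((h1.append (p.impl_goodB j₀ hj b₀ hb)).append h1.inv).append p.impl_zeroB).append h1
  rw [← blockGates_invBlocks, ← blockGates_append, ← blockGates_append, ← blockGates_append,
    ← blockGates_append] at h2
  rw [simOp]
  simp only [Matrix.mul_assoc]
  exact h2

end Sz

/-! ### Output statistics of a circuit -/

section Effect
variable {n c m a : ℕ}

/-- The wires of the quantum output. -/
def qWire (n c m a : ℕ) (q : Fin m) : Wire n c m a := .inr (.inr (.inl q))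

theorem qWire_injective : Function.Injective (qWire n c m a) := fun q q' h => by
  simpa [qWire] using h

/-- The value of the classical output register. -/
def cBits (x : Bits (Wire n c m a)) : Bits (Fin c) := fun j => x (.inr (.inl j))

/-- The effect that measures the classical output `w` and then the effect `E w` on the quantum
output. -/
noncomputable def effOp (E : Bits (Fin c) → Op (Fin m)) : Op (Wire n c m a) :=
  Matrix.of fun x y => liftOp (qWire n c m a) (E (cBits x)) x y

/-- The block form over the classical outcomes, from which positivity is inherited blockwise. -/
theorem effOp_eq_sum (E : Bits (Fin c) → Op (Fin m)) :
    (effOp E : Op (Wire n c m a)) = ∑ w, (proj fun x => decide (cBits x = w)) *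
      liftOp (qWire n c m a) (E w) * (proj fun x => decide (cBits x = w)) := by
  ext x y
  rw [Matrix.sum_apply]
  simp only [mul_proj_apply, proj_mul_apply, decide_eq_true_eq]
  rw [Finset.sum_eq_single (cBits x)]
  · simp only [if_true]
    split_ifs with h
    · rfl
    · rw [effOp, Matrix.of_apply, liftOp_apply_of_not_agree]
      intro h'
      refine h (funext fun j => (h' _ ?_).symm)
      simp [qWire]
  · intro w _ hw
    simp [hw.symm]
  · simp

theorem posSemidef_liftOp {V W : Type} [Fintype V] [DecidableEq V] [Fintype W] [DecidableEq W]
    {e : V → W} (he : Function.Injective e) {A : Op V} (hA : A.PosSemidef) :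
    (liftOp e A).PosSemidef := by
  obtain ⟨B, rfl⟩ := exists_eq_conjTranspose_mul_self hA
  rw [← liftOp_mul he, ← conjTranspose_liftOp]
  exact Matrix.posSemidef_conjTranspose_mul_self _

theorem posSemidef_effOp {E : Bits (Fin c) → Op (Fin m)} (hE : ∀ w, (E w).PosSemidef) :
    (effOp E : Op (Wire n c m a)).PosSemidef := by
  rw [effOp_eq_sum]
  refine Matrix.posSemidef_sum _ fun w _ => ?_
  have := (posSemidef_liftOp (qWire_injective (n := n) (c := c) (a := a)) (hE w)).conjTranspose_mul_mul_same
    (proj fun x => decide (cBits x = w))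
  rwa [conjTranspose_proj] at this

theorem one_sub_effOp (E : Bits (Fin c) → Op (Fin m)) :
    1 - (effOp E : Op (Wire n c m a)) = effOp fun w => 1 - E w := by
  ext x y
  rw [Matrix.sub_apply, effOp, effOp, Matrix.of_apply, Matrix.of_apply, liftOp_sub, liftOp_one,
    Matrix.sub_apply]

theorem norm_effOp_le_one {E : Bits (Fin c) → Op (Fin m)} (h0 : ∀ w, (E w).PosSemidef)
    (h1 : ∀ w, (1 - E w).PosSemidef) : ‖(effOp E : Op (Wire n c m a))‖ ≤ 1 :=
  norm_le_one_of_posSemidef (posSemidef_effOp h0)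
    (by rw [one_sub_effOp]; exact posSemidef_effOp h1)

theorem effOp_ite (q : Bits (Fin c) → Bool) :
    (effOp fun w => if q w = true then 1 else 0 : Op (Wire n c m a)) =
      proj fun x => q (cBits x) := by
  ext x y
  rw [effOp, Matrix.of_apply, proj, Matrix.diagonal_apply]
  by_cases h : q (cBits x) = true
  · rw [if_pos h, liftOp_one, Matrix.one_apply]
    simp [h]
  · rw [if_neg h, liftOp_zero]
    simp [h]

theorem sum_bits_wire (F : Bits (Wire n c m a) → ℂ) :
    ∑ x, F x = ∑ w, ∑ q, ∑ u, ∑ v, F (joinBits u w q v) := by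
  have e : ∀ (α β : Type) [Fintype α] [DecidableEq α] [Fintype β] [DecidableEq β]
      (F : Bits (α ⊕ β) → ℂ), ∑ x, F x = ∑ u, ∑ v, F (Sum.elim u v) := by
    intro α β _ _ _ _ F
    rw [← (Equiv.sumArrowEquivProdArrow α β Bool).symm.sum_comp, Fintype.sum_prod_type]
    rfl
  rw [e]
  simp_rw [e]
  rw [Finset.sum_comm]
  refine Finset.sum_congr rfl fun w _ => ?_
  rw [Finset.sum_comm]
  rfl

/-- Partial trace is dual to tensoring with the identity, so a measurement of the outputs is a
single effect on all wires. -/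
theorem trace_effOp_mul (E : Bits (Fin c) → Op (Fin m)) (A : Op (Wire n c m a)) :
    (effOp E * A).trace = ∑ w, (E w * Matrix.of fun q q' => ∑ u, ∑ v,
      A (joinBits u w q v) (joinBits u w q' v)).trace := by
  rw [Matrix.trace, sum_bits_wire]
  refine Finset.sum_congr rfl fun w _ => ?_
  rw [Matrix.trace]
  refine Finset.sum_congr rfl fun q _ => ?_
  simp only [Matrix.diag_apply, Matrix.mul_apply, Matrix.of_apply, Finset.mul_sum]
  conv_rhs => rw [Finset.sum_comm]
  refine Finset.sum_congr rfl fun u _ => ?_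
  conv_rhs => rw [Finset.sum_comm]
  refine Finset.sum_congr rfl fun v _ => ?_
  rw [sum_eq_sum_extend (qWire_injective (n := n) (c := c) (a := a)) (joinBits u w q v)]
  · refine Finset.sum_congr rfl fun q' _ => ?_
    have : Function.extend (qWire n c m a) q' (joinBits u w q v) = joinBits u w q' v := by
      symm
      rw [extend_eq_iff qWire_injective]
      constructor
      · rintro (i | i | i | i) hi
        · rfl
        · rfl
        · exact absurd ⟨i, rfl⟩ hi
        · rfl
      · rfl
    rw [this, effOp, Matrix.of_apply, liftOp_apply_of_agree]
    · rfl
    · rintro (i | i | i | i) hi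
      · rfl
      · rfl
      · exact absurd ⟨i, rfl⟩ hi
      · rfl
  · intro y hy
    rw [effOp, Matrix.of_apply, liftOp_apply_of_not_agree _ hy, zero_mul]

theorem withAncillas_eq (ρ : Op (Fin n)) : (withAncillas ρ : Op (Wire n c m a)) =
    zmat (Fin n) (Fin c ⊕ Fin m ⊕ Fin a) * ρ * (zmat (Fin n) (Fin c ⊕ Fin m ⊕ Fin a))ᴴ := by
  have key : ∀ (u u' : Bits (Fin n)) (x : Bits (Wire n c m a)),
      zmat (Fin n) (Fin c ⊕ Fin m ⊕ Fin a) x u =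
        if (∀ j, x (.inr j) = false) ∧ u = fun i => x (.inl i) then 1 else 0 := by
    intro u u' x
    rw [zmat, pmat, Matrix.of_apply]
    refine if_congr ?_ rfl rfl
    constructor
    · rintro rfl
      exact ⟨fun j => rfl, rfl⟩
    · rintro ⟨h, rfl⟩
      funext w
      rcases w with i | j
      · rfl
      · exact h j
  ext x y
  rw [withAncillas, Matrix.of_apply, Matrix.mul_apply]
  simp_rw [Matrix.mul_apply, Matrix.conjTranspose_apply, key _ (fun _ => false)]
  by_cases hx : ∀ j, x (.inr j) = false
  · by_cases hy : ∀ j, y (.inr j) = false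
    · simp [hx, hy]
    · rw [if_neg fun h => hy h.2]
      simp only [hy, false_and, if_false, star_zero, mul_zero, Finset.sum_const_zero]
  · rw [if_neg fun h => hx h.1]
    simp only [hx, false_and, if_false, zero_mul, Finset.sum_const_zero]

end Effect

/-! ### The isometry of a circuit and its output probabilities -/

section Circuit
variable {n : ℕ} (C : Circuit n)

/-- The isometry from the input to all wires implemented by the circuit. -/
noncomputable def Circuit.iso :
    Matrix (Bits (Wire n C.cOut C.qOut C.work)) (Bits (Fin n)) ℂ :=
  gatesOp C.gates * zmat (Fin n) (Fin C.cOut ⊕ Fin C.qOut ⊕ Fin C.work)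

theorem Circuit.conjTranspose_iso_mul_self : (C.iso)ᴴ * C.iso = 1 := by
  rw [Circuit.iso, Matrix.conjTranspose_mul, Matrix.mul_assoc, ← Matrix.mul_assoc (gatesOp _)ᴴ,
    conjTranspose_gatesOp_mul_self, Matrix.one_mul, conjTranspose_zmat_mul_self]

/-- The effect that measures the classical output and then the corresponding effect `E w` on the
quantum output. -/
noncomputable def Circuit.eff (E : Bits (Fin C.cOut) → Op (Fin C.qOut)) :
    Op (Wire n C.cOut C.qOut C.work) := effOp E

/-- The projection to the classical outputs with property `q`. -/
noncomputable def Circuit.outProj (q : Bits (Fin C.cOut) → Bool) :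
    Op (Wire n C.cOut C.qOut C.work) := proj fun x => q (cBits x)

theorem Circuit.final_eq (ρ : Op (Fin n)) : C.final ρ = C.iso * ρ * (C.iso)ᴴ := by
  rw [Circuit.final, withAncillas_eq, Circuit.iso, Matrix.conjTranspose_mul]
  simp only [Matrix.mul_assoc]

/-- The Heisenberg picture: acceptance is given by one operator on the input space, so two circuits
with the same input are compared by an operator norm, whatever their work wires are. -/
theorem acceptProb_map_run {α : Type} (D : Distinguisher α) (f : List Bool → α)
    (ρ : Op (Fin n)) : D.acceptProb ((C.run ρ).map f) =
      (ρ * ((C.iso)ᴴ * C.eff (fun w => D.effect C.qOut (f (List.ofFn w))) * C.iso)).trace.re := by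
  have h1 : D.acceptProb ((C.run ρ).map f) =
      ∑ w, (D.effect C.qOut (f (List.ofFn w)) * C.outcome ρ w).trace.re := by
    have hadd : ∀ (v : α) (A B : Op (Fin C.qOut)), (D.effect C.qOut v * (A + B)).trace.re =
        (D.effect C.qOut v * A).trace.re + (D.effect C.qOut v * B).trace.re := by
      intro v A B
      rw [Matrix.mul_add, Matrix.trace_add, Complex.add_re]
    have hzero : ∀ v : α, (D.effect C.qOut v * (0 : Op (Fin C.qOut))).trace.re = 0 := by simp
    change ((∑ w, Finsupp.single (List.ofFn w) (C.outcome ρ w)).mapDomain f).sum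
      (fun v A => (D.effect C.qOut v * A).trace.re) = _
    rw [Finsupp.sum_mapDomain_index hzero hadd,
      ← Finsupp.sum_finsetSum_index (fun _ => hzero _) (fun _ => hadd _)]
    refine Finset.sum_congr rfl fun w _ => ?_
    rw [Finsupp.sum_single_index (hzero _)]
  rw [h1, ← Complex.re_sum]
  congr 1
  have h2 := trace_effOp_mul (fun w => D.effect C.qOut (f (List.ofFn w))) (C.final ρ)
  refine h2.symm.trans ?_
  rw [Circuit.final_eq, Matrix.trace_mul_comm, Matrix.mul_assoc, Matrix.mul_assoc,
    Matrix.trace_mul_comm]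
  simp only [Circuit.eff, Matrix.mul_assoc]

open Classical in
/-- The distinguisher that accepts the label `v`. -/
noncomputable def labelDistinguisher {α : Type} (v : α) : Distinguisher α where
  effect _ v' := if v' = v then 1 else 0
  nonneg m v' := by split_ifs; exacts [Matrix.PosSemidef.one, Matrix.PosSemidef.zero]
  le_one m v' := by
    split_ifs
    · rw [sub_self]; exact Matrix.PosSemidef.zero
    · rw [sub_zero]; exact Matrix.PosSemidef.one

theorem prob_eq_acceptProb {α : Type} (X : CQOutput α) (v : α) :
    X.prob v = (labelDistinguisher v).acceptProb X := by
  classical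
  rw [CQOutput.prob, Distinguisher.acceptProb, Finsupp.sum, Finset.sum_eq_single v]
  · simp [labelDistinguisher]
  · intro v' _ h
    simp [labelDistinguisher, h]
  · intro h
    rw [Finsupp.notMem_support_iff.1 h]; simp

theorem prob_map_run {α : Type} [DecidableEq α] (f : List Bool → α) (v : α) (ρ : Op (Fin n)) :
    ((C.run ρ).map f).prob v = (ρ * ((C.iso)ᴴ *
      C.outProj (fun w => decide (f (List.ofFn w) = v)) * C.iso)).trace.re := by
  rw [prob_eq_acceptProb, acceptProb_map_run, Circuit.outProj,
    ← effOp_ite fun w => decide (f (List.ofFn w) = v), Circuit.eff]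
  simp only [labelDistinguisher, decide_eq_true_eq]
  congr!

end Circuit

/-! ### Pure states -/

section Pure
variable {n : ℕ}

noncomputable def pureState (v : Bits (Fin n) → ℂ) (hv : normSq v = 1) : QState n where
  mat := Matrix.vecMulVec v (star v)
  posSemidef := Matrix.posSemidef_vecMulVec_self_star v
  trace_one := by
    rw [Matrix.trace_vecMulVec, dotProduct]
    have := congrArg (fun x : ℝ => (x : ℂ)) hv
    simp only [normSq] at this
    push_cast at this
    rw [← this]
    refine Finset.sum_congr rfl fun i _ => ?_
    rw [Pi.star_apply, ← Complex.mul_conj']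
    rfl

theorem trace_pureState_mul {β : Type*} [Fintype β] [DecidableEq β] {v : Bits (Fin n) → ℂ}
    (hv : normSq v = 1) (A : Matrix β (Bits (Fin n)) ℂ) :
    ((pureState v hv).mat * (Aᴴ * A)).trace.re = normSq (A *ᵥ v) := by
  have h : ((pureState v hv).mat * (Aᴴ * A)).trace = star v ⬝ᵥ ((Aᴴ * A) *ᵥ v) := by
    rw [pureState, Matrix.trace_mul_comm, Matrix.mul_vecMulVec, Matrix.trace_vecMulVec,
      dotProduct_comm]
  rw [h, ← normSq_mulVec, Complex.ofReal_re]

end Pure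

/-! ### The simulation as a circuit -/

section Embed
variable {R T W : Type} [Fintype R] [DecidableEq R] [Fintype T] [DecidableEq T] [Fintype W]
  [DecidableEq W] {α : Type*} [Fintype α] [DecidableEq α]

theorem Impl.gatesOp_map_mul {e : R ⊕ T → W} (he : Function.Injective e)
    {gs : List (Gate (R ⊕ T))} {Ω : Op R} (h : Impl gs Ω) (f : α → Bits R) :
    gatesOp (gs.map (Gate.map e he)) *
        pmat (fun u => Function.extend e (zext (f u)) fun _ => false) =
      pmat (fun y : Bits R => Function.extend e (zext y) fun _ => false) * (Ω * pmat f) := by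
  have h1 : pmat (fun u => Function.extend e (zext (f u)) fun _ => false) =
      pmat (fun y : Bits (R ⊕ T) => Function.extend e y fun _ => false) *
        (zmat R T * pmat f) := by
    rw [zmat, pmat_mul_pmat, pmat_mul_pmat]; rfl
  have h2 : pmat (fun y : Bits R => Function.extend e (zext y) fun _ => false) =
      pmat (fun y : Bits (R ⊕ T) => Function.extend e y fun _ => false) * zmat R T := by
    rw [zmat, pmat_mul_pmat]; rfl
  rw [h1, h2, gatesOp_map, ← Matrix.mul_assoc, liftOp_mul_pmat_extend he, Matrix.mul_assoc,
    ← Matrix.mul_assoc (gatesOp gs), show gatesOp gs * zmat R T = zmat R T * Ω from h]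
  simp only [Matrix.mul_assoc]

end Embed

namespace Sz
variable (p : Sz)

/-- Embeds the configurations into those of the circuit. -/
noncomputable def ext (y : Bits p.R) : Bits (Wire p.n p.cK p.mG p.work) :=
  Function.extend p.emb (zext y) fun _ => false

theorem ext_emb (y : Bits p.R) (w : p.R) : p.ext y (p.emb (.inl w)) = y w :=
  p.emb_injective.extend_apply _ _ _

theorem ext_injective : Function.Injective p.ext := fun y y' h => funext fun w => by
  rw [← p.ext_emb y w, h, ext_emb]

theorem emb_x (i : Fin p.n) : p.emb (.inl (.x i)) = .inl i := p.emb_eq rfl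
theorem emb_o (j : Fin p.cK) : p.emb (.inl (.o j)) = .inr (.inl j) := p.emb_eq rfl
theorem emb_q (q : Fin p.mG) : p.emb (.inl (.ga (.inr (.inl q)))) = qWire _ _ _ _ q :=
  p.emb_eq rfl

theorem zext_inp : (zext : Bits (Fin p.n) → Bits (Wire p.n p.cK p.mG p.work)) =
    fun u => p.ext (inp false false u) := by
  funext u w
  by_cases hw : ∃ w', p.emb w' = w
  · obtain ⟨w' | t, rfl⟩ := hw
    · rw [ext_emb]
      by_cases hx : ∃ i, w' = .x i
      · obtain ⟨i, rfl⟩ := hx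
        rw [emb_x]; rfl
      · have h1 : inp false false u w' = false := by
          cases w' with
          | x i => exact absurd ⟨i, rfl⟩ hx
          | _ => rfl
        rw [h1]
        rcases he : p.emb (.inl w') with i | i
        · rw [← emb_x] at he
          exact absurd ⟨i, Sum.inl_injective (p.emb_injective he)⟩ hx
        · rfl
    · rw [ext, p.emb_injective.extend_apply]
      rcases he : p.emb (.inr t) with i | i
      · rw [← emb_x] at he
        exact absurd (p.emb_injective he) (by simp)
      · rfl
  · rw [ext, Function.extend_apply' _ _ _ hw]
    rcases w with i | i
    · exact absurd ⟨_, p.emb_x i⟩ hw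
    · rfl

/-- Guess and value in `simOut` are functions of the decision bit. That bit is traced out in the
simulation and measured in the original, so on both sides entries between different decisions vanish
and the extra wires cause no further decoherence. -/
theorem effOp_ext (E : Bits (Fin p.cK) → Op (Fin p.mG)) (E' : Bits (Fin p.cG) → Op (Fin p.mG))
    (b₀ : Fin p.cG) (s : Fin p.cK → Bool) (hE : ∀ w, E (fun j => w b₀ && s j) = E' w)
    (z z' : Bits (Wire p.n p.cG p.mG p.aG)) :
    (effOp E : Op (Wire p.n p.cK p.mG p.work)) (p.ext (simOut (.inl b₀) s z))
      (p.ext (simOut (.inl b₀) s z')) = (effOp E' : Op (Wire p.n p.cG p.mG p.aG)) z z' := by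
  have hc : cBits (p.ext (simOut (.inl b₀) s z)) = fun j => cBits z b₀ && s j := by
    funext j
    rw [cBits, ← emb_o, ext_emb]; rfl
  have hq : ∀ z, p.ext (simOut (.inl b₀) s z) ∘ qWire p.n p.cK p.mG p.work =
      z ∘ qWire p.n p.cG p.mG p.aG := by
    intro z
    funext q
    rw [Function.comp_apply, ← emb_q, ext_emb]; rfl
  rw [effOp, effOp, Matrix.of_apply, Matrix.of_apply, hc, hE]
  by_cases h : ∀ w, w ∉ Set.range (qWire p.n p.cG p.mG p.aG) → z w = z' w
  · rw [liftOp_apply_of_agree _ h, liftOp_apply_of_agree, hq, hq]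
    intro w hw
    by_cases hw' : ∃ w', p.emb w' = w
    · obtain ⟨w' | t, rfl⟩ := hw'
      · rw [ext_emb, ext_emb]
        have hb : z (.inr (.inl b₀)) = z' (.inr (.inl b₀)) := h _ (by simp [qWire])
        cases w' with
        | x i => exact h _ (by simp [qWire])
        | ga i =>
          rcases i with i | i | i
          · exact h _ (by simp [qWire])
          · exact absurd ⟨i, (p.emb_q i).symm⟩ hw
          · exact h _ (by simp [qWire])
        | o j => simp [simOut, hb]
        | g => simp [simOut, hb]
        | _ => rfl
      · rw [ext, ext, p.emb_injective.extend_apply, p.emb_injective.extend_apply]; rfl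
    · rw [ext, ext, Function.extend_apply' _ _ _ hw', Function.extend_apply' _ _ _ hw']
  · rw [liftOp_apply_of_not_agree _ h, liftOp_apply_of_not_agree]
    intro h'
    refine h fun w hw => ?_
    have key : ∀ r : p.R, (∀ q, r ≠ .ga (.inr (.inl q))) →
        (simOut (.inl b₀) s z : Bits p.R) r = simOut (.inl b₀) s z' r := by
      intro r hr
      rw [← p.ext_emb (simOut (.inl b₀) s z) r, h', ext_emb]
      rintro ⟨q, hq⟩
      rw [← emb_q] at hq
      exact hr q (Sum.inl_injective (p.emb_injective hq)).symm
    rcases w with i | i | i | i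
    · exact key (.x i) (by simp)
    · exact key (.ga (.inl i)) (by simp)
    · exact absurd ⟨i, rfl⟩ hw
    · exact key (.ga (.inr (.inr i))) (by simp)

/-- The circuit of the extractor with gates `kB`. -/
noncomputable def circK (kB : List Blk) : Circuit p.n :=
  ⟨p.cK, p.mK, p.aK, blockGates (wireOf p.n p.cK p.mK p.aK) kB⟩

/-- The circuit of the simulated algorithm with gates `gB`. -/
noncomputable def circG (gB : List Blk) : Circuit p.n :=
  ⟨p.cG, p.mG, p.aG, blockGates (wireOf p.n p.cG p.mG p.aG) gB⟩

/-- The circuit that extracts and simulates. -/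
noncomputable def circSim (kB gB : List Blk) : Circuit p.n :=
  ⟨p.cK, p.mG, p.work, blockGates (wireOf p.n p.cK p.mG p.work)
    (p.simB (kB.map (Blk.mapWires p.kMap)) (gB.map (Blk.mapWires p.gMap)))⟩

noncomputable def uK (kB : List Blk) : Op (Fin p.n ⊕ p.KA) :=
  gatesOp (blockGates (wireOf p.n p.cK p.mK p.aK) kB)

noncomputable def uG (gB : List Blk) : Op (Fin p.n ⊕ p.GA) :=
  gatesOp (blockGates (wireOf p.n p.cG p.mG p.aG) gB)

noncomputable def uSim (kB gB : List Blk) : Op (Wire p.n p.cK p.mG p.work) :=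
  gatesOp (blockGates (wireOf p.n p.cK p.mG p.work)
    (p.simB (kB.map (Blk.mapWires p.kMap)) (gB.map (Blk.mapWires p.gMap))))

noncomputable def isoK (kB : List Blk) : Matrix (Bits (Fin p.n ⊕ p.KA)) (Bits (Fin p.n)) ℂ :=
  p.uK kB * zmat (Fin p.n) p.KA

noncomputable def isoG (gB : List Blk) : Matrix (Bits (Fin p.n ⊕ p.GA)) (Bits (Fin p.n)) ℂ :=
  p.uG gB * zmat (Fin p.n) p.GA

noncomputable def isoSim (kB gB : List Blk) :
    Matrix (Bits (Wire p.n p.cK p.mG p.work)) (Bits (Fin p.n)) ℂ :=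
  p.uSim kB gB * zmat (Fin p.n) (Fin p.cK ⊕ Fin p.mG ⊕ Fin p.work)

theorem isoSim_eq (kB gB : List Blk) {j₀ : Fin p.cK} (hj : (j₀ : ℕ) = 0) {b₀ : Fin p.cG}
    (hb : (b₀ : ℕ) = 0) : p.isoSim kB gB =
    pmat p.ext * (simOp (N := p.N) (p.uK kB) (p.uG gB) p.kout j₀ (.inl b₀) *
      inpMat (Fin p.n) p.KA p.GA p.N p.cK false false) := by
  have h1 := blockGates_mapWires (Sum.inl_injective.comp Reg.eK_injective) p.wire_kMap kB
  have h2 := blockGates_mapWires (Sum.inl_injective.comp Reg.eG_injective) p.wire_gMap gB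
  have h3 := p.impl_simB h1 h2 j₀ hj b₀ hb
  have h4 := blockGates_mapWires (f := id) p.emb_injective p.wireOf_eq
    (p.simB (kB.map (Blk.mapWires p.kMap)) (gB.map (Blk.mapWires p.gMap)))
  have h5 : (Blk.mapWires id) = id := rfl
  rw [h5, List.map_id] at h4
  have h7 := h3.gatesOp_map_mul p.emb_injective (inp false false)
  rw [isoSim, uSim, h4, zmat, zext_inp]
  exact h7

theorem guessOp_isometry (kB gB : List Blk) {j₀ : Fin p.cK} (hj : (j₀ : ℕ) = 0) :
    (guessOp (N := p.N) (p.uK kB) (p.uG gB) p.kout j₀)ᴴ *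
      guessOp (p.uK kB) (p.uG gB) p.kout j₀ = 1 := by
  have h1 := blockGates_mapWires (Sum.inl_injective.comp Reg.eK_injective) p.wire_kMap kB
  have h2 := blockGates_mapWires (Sum.inl_injective.comp Reg.eG_injective) p.wire_gMap gB
  exact (p.impl_guessB h1 h2 j₀ hj).isometry

/-- The simulation's isometry is within `4η` of minus the embedded isometry of the simulated
circuit. The sign cancels in the effect, and `norm_conj_sub_conj_le` doubles the distance. -/
theorem norm_sim_sub_le (kB gB : List Blk) {j₀ : Fin p.cK} (hj : (j₀ : ℕ) = 0) {b₀ : Fin p.cG}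
    (hb : (b₀ : ℕ) = 0) {s : Fin p.cK → Bool} (hs : s j₀ = true)
    (hbad : proj (badK (X := Fin p.n) p.kout j₀ s) * p.isoK kB = 0) {m : ℕ} (hN : p.N = m + 1)
    {η : ℝ} (hη : η ≤ 1)
    (hE : ‖proj (fun z : Bits (Fin p.n ⊕ p.GA) => z (.inr (.inl b₀))) * p.isoG gB *
      failOp ((p.isoK kB)ᴴ * proj (fun y : Bits (Fin p.n ⊕ p.KA) => !y (.inr (.inl j₀))) *
        p.isoK kB) m‖ ≤ η)
    {E : Bits (Fin p.cK) → Op (Fin p.mG)} {E' : Bits (Fin p.cG) → Op (Fin p.mG)}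
    (h0 : ∀ w, (E w).PosSemidef) (h1 : ∀ w, (1 - E w).PosSemidef)
    (hEE : ∀ w, E (fun j => w b₀ && s j) = E' w) :
    ‖(p.isoSim kB gB)ᴴ * (effOp E : Op (Wire p.n p.cK p.mG p.work)) * p.isoSim kB gB -
      (p.isoG gB)ᴴ * (effOp E' : Op (Wire p.n p.cG p.mG p.aG)) * p.isoG gB‖ ≤ 8 * η := by
  have key := norm_simOp_add_le (N := p.N) (p.uK kB) (conjTranspose_gatesOp_mul_self _)
    (gatesOp_mul_conjTranspose_self _) (p.uG gB) (conjTranspose_gatesOp_mul_self _) p.kout j₀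
    (p.guessOp_isometry kB gB hj) hs hbad hN (.inl b₀) hη hE
  set ι : Matrix (Bits p.R) (Bits (Fin p.n ⊕ p.GA)) ℂ := pmat (simOut (.inl b₀) s) with hι
  set ζ : Matrix (Bits (Wire p.n p.cK p.mG p.work)) (Bits p.R) ℂ := pmat p.ext with hζ
  have hζ1 : ζᴴ * ζ = 1 := conjTranspose_pmat_mul_self p.ext_injective
  have hι1 : ιᴴ * ι = 1 := conjTranspose_pmat_mul_self (simOut_injective _ _)
  have hG : (p.isoG gB)ᴴ * p.isoG gB = 1 := (p.circG gB).conjTranspose_iso_mul_self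
  have hS : (p.isoSim kB gB)ᴴ * p.isoSim kB gB = 1 :=
    (p.circSim kB gB).conjTranspose_iso_mul_self
  set F : Op (Wire p.n p.cK p.mG p.work) := effOp E with hF
  have hFn : ‖F‖ ≤ 1 := norm_effOp_le_one h0 h1
  have hEG : (effOp E' : Op (Wire p.n p.cG p.mG p.aG)) = (ζ * ι)ᴴ * F * (ζ * ι) := by
    have : ζ * ι = pmat (p.ext ∘ simOut (.inl b₀) s) := pmat_mul_pmat _ _
    rw [this, conjTranspose_pmat_mul_mul_pmat]
    ext z z'
    exact (p.effOp_ext E E' b₀ s hEE z z').symm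
  set b : Matrix (Bits (Wire p.n p.cK p.mG p.work)) (Bits (Fin p.n)) ℂ :=
    -(ζ * (ι * p.isoG gB)) with hbdef
  have hbb : bᴴ * b = 1 := by
    rw [hbdef, Matrix.conjTranspose_neg, Matrix.neg_mul, Matrix.mul_neg, neg_neg,
      Matrix.conjTranspose_mul, Matrix.mul_assoc, ← Matrix.mul_assoc ζᴴ, hζ1, Matrix.one_mul,
      Matrix.conjTranspose_mul, Matrix.mul_assoc, ← Matrix.mul_assoc ιᴴ, hι1, Matrix.one_mul, hG]
  have hbF : bᴴ * F * b = (p.isoG gB)ᴴ * (effOp E' : Op (Wire p.n p.cG p.mG p.aG)) *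
      p.isoG gB := by
    rw [hEG, hbdef, Matrix.conjTranspose_neg, Matrix.neg_mul, Matrix.neg_mul, Matrix.mul_neg,
      neg_neg]
    simp only [Matrix.conjTranspose_mul, Matrix.mul_assoc]
  rw [← hbF]
  refine (norm_conj_sub_conj_le hFn (norm_le_one_of_isometry hS)
    (norm_le_one_of_isometry hbb)).trans ?_
  have hab : p.isoSim kB gB - b = ζ * (simOp (N := p.N) (p.uK kB) (p.uG gB) p.kout j₀ (.inl b₀) *
      inpMat (Fin p.n) p.KA p.GA p.N p.cK false false + ι * p.isoG gB) := by
    rw [p.isoSim_eq kB gB hj hb, hbdef, sub_neg_eq_add, Matrix.mul_add]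
  have hn : ‖p.isoSim kB gB - b‖ ≤ 4 * η := by
    rw [hab]
    exact (Matrix.l2_opNorm_mul _ _).trans ((mul_le_of_le_one_left (norm_nonneg _)
      (norm_le_one_of_isometry hζ1)).trans key)
  linarith

end Sz

/-! ### From output probabilities to amplitudes -/

section Prob
variable {n : ℕ} (C : Circuit n)

theorem prob_pureState {α : Type} [DecidableEq α] (f : List Bool → α) (v : α)
    {ψ : Bits (Fin n) → ℂ} (hψ : normSq ψ = 1) :
    ((C.run (pureState ψ hψ).mat).map f).prob v =
      normSq ((C.outProj (fun w => decide (f (List.ofFn w) = v)) * C.iso) *ᵥ ψ) := by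
  rw [prob_map_run, ← trace_pureState_mul hψ, Matrix.conjTranspose_mul, Circuit.outProj,
    conjTranspose_proj]
  rw [Matrix.mul_assoc, Matrix.mul_assoc, ← Matrix.mul_assoc (proj _) (proj _), proj_idem]

theorem normSq_outProj_mulVec (q : Bits (Fin C.cOut) → Bool) (ψ : Bits (Fin n) → ℂ) :
    normSq ((C.outProj q * C.iso) *ᵥ ψ) =
      ∑ x, if q (cBits x) = true then ‖(C.iso *ᵥ ψ) x‖ ^ 2 else 0 := by
  rw [← Matrix.mulVec_mulVec, normSq]
  refine Finset.sum_congr rfl fun x _ => ?_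
  rw [Circuit.outProj, proj, Matrix.mulVec_diagonal]
  split_ifs <;> simp

theorem normSq_outProj_mono {q q' : Bits (Fin C.cOut) → Bool} (h : ∀ w, q w = true → q' w = true)
    (ψ : Bits (Fin n) → ℂ) : normSq ((C.outProj q * C.iso) *ᵥ ψ) ≤
      normSq ((C.outProj q' * C.iso) *ᵥ ψ) := by
  rw [normSq_outProj_mulVec, normSq_outProj_mulVec]
  refine Finset.sum_le_sum fun x _ => ?_
  by_cases hq : q (cBits x) = true
  · rw [if_pos hq, if_pos (h _ hq)]
  · rw [if_neg hq]; positivity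

theorem normSq_single (u : Bits (Fin n)) : normSq (Pi.single u 1 : Bits (Fin n) → ℂ) = 1 := by
  rw [normSq, Finset.sum_eq_single u]
  · simp
  · intro v _ h; simp [h]
  · simp

/-- If an output never occurs, the corresponding amplitudes vanish. -/
theorem iso_apply_eq_zero {α : Type} [DecidableEq α] (f : List Bool → α) (v : α)
    (h : ∀ ρ : QState n, ((C.run ρ.mat).map f).prob v = 0)
    {x : Bits (Wire n C.cOut C.qOut C.work)} (hx : f (List.ofFn (cBits x)) = v)
    (u : Bits (Fin n)) : C.iso x u = 0 := by
  have h1 := h (pureState _ (normSq_single u))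
  rw [prob_pureState, normSq_outProj_mulVec, Finset.sum_eq_zero_iff_of_nonneg
    (fun x _ => by split_ifs <;> positivity)] at h1
  have h2 := h1 x (Finset.mem_univ x)
  rw [if_pos (by simpa using hx), Matrix.mulVec_single_one] at h2
  simpa using h2

theorem normSq_smul {α : Type*} [Fintype α] [DecidableEq α] (c : ℂ) (ψ : α → ℂ) :
    normSq (c • ψ) = ‖c‖ ^ 2 * normSq ψ := by
  simp [normSq, Finset.mul_sum, mul_pow]

/-- A property of unit vectors that is invariant under scaling holds for all vectors. -/
theorem forall_of_normSq_eq_one {α β δ : Type*} [Fintype α] [DecidableEq α] [Fintype β] [DecidableEq β]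
    [Fintype δ] [DecidableEq δ]
    {Y : Matrix β α ℂ} {Z : Matrix δ α ℂ} {a b : ℝ}
    (h : ∀ ψ, normSq ψ = 1 → a ≤ normSq (Y *ᵥ ψ) → b ≤ normSq (Z *ᵥ ψ)) (ψ : α → ℂ)
    (hψ : a * normSq ψ ≤ normSq (Y *ᵥ ψ)) : b * normSq ψ ≤ normSq (Z *ᵥ ψ) := by
  rcases (normSq_nonneg ψ).eq_or_lt with h0 | h0
  · rw [← h0, mul_zero]; exact normSq_nonneg _
  · set c : ℂ := (((√(normSq ψ))⁻¹ : ℝ) : ℂ) with hc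
    have hc2 : ‖c‖ ^ 2 = (normSq ψ)⁻¹ := by
      rw [hc, Complex.norm_real, Real.norm_eq_abs, sq_abs, inv_pow, Real.sq_sqrt h0.le]
    have h1 : normSq (c • ψ) = 1 := by rw [normSq_smul, hc2, inv_mul_cancel₀ h0.ne']
    have h2 := h (c • ψ) h1
    rw [Matrix.mulVec_smul, Matrix.mulVec_smul, normSq_smul, normSq_smul, hc2,
      inv_mul_eq_div, inv_mul_eq_div, le_div_iff₀ h0, le_div_iff₀ h0] at h2
    exact h2 hψ

theorem CQOutput.map_map {α β δ : Type} (f : α → β) (g : β → δ) (X : CQOutput α) :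
    (X.map f).map g = X.map (g ∘ f) := by
  simp only [CQOutput.map, Finsupp.mapDomain_comp]
  rfl

end Prob

theorem toDecision_ofFn {c : ℕ} (w : Fin c → Bool) (b₀ : Fin c) (hb : (b₀ : ℕ) = 0) :
    toDecision (List.ofFn w) = w b₀ := by
  obtain ⟨c, rfl⟩ : ∃ c', c = c' + 1 := ⟨c - 1, by have := b₀.pos; omega⟩
  have : b₀ = 0 := Fin.ext hb
  rw [this, List.ofFn_succ]; rfl

theorem toValue_ofFn_of_true {c : ℕ} {w : Fin c → Bool} {b₀ : Fin c} (hb : (b₀ : ℕ) = 0)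
    (hw : w b₀ = true) : toValue (List.ofFn w) = some (List.ofFn w).tail := by
  obtain ⟨c, rfl⟩ : ∃ c', c = c' + 1 := ⟨c - 1, by have := b₀.pos; omega⟩
  have : b₀ = 0 := Fin.ext hb
  rw [this] at hw
  rw [List.ofFn_succ, hw]; rfl

theorem toValue_ofFn_of_false {c : ℕ} {w : Fin c → Bool} {b₀ : Fin c} (hb : (b₀ : ℕ) = 0)
    (hw : w b₀ = false) : toValue (List.ofFn w) = none := by
  obtain ⟨c, rfl⟩ : ∃ c', c = c' + 1 := ⟨c - 1, by have := b₀.pos; omega⟩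
  have : b₀ = 0 := Fin.ext hb
  rw [this] at hw
  rw [List.ofFn_succ, hw]; rfl

/-! ### The error of the simulation -/

namespace Sz
variable (p : Sz)

/-- An effect of this form does not connect different decisions, and for decision `0` the two agree.
-/
theorem effOp_sub_effOp {E E' : Bits (Fin p.cG) → Op (Fin p.mG)} {b₀ : Fin p.cG}
    (h : ∀ w, w b₀ = false → E w = E' w) :
    (effOp E - effOp E' : Op (Wire p.n p.cG p.mG p.aG)) =
      proj (fun x => x (.inr (.inl b₀))) * (effOp E - effOp E') *
        proj (fun x => x (.inr (.inl b₀))) := by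
  ext x y
  rw [mul_proj_apply, proj_mul_apply]
  cases hx : x (.inr (.inl b₀))
  · rw [Matrix.sub_apply, effOp, effOp, Matrix.of_apply, Matrix.of_apply, h (cBits x) hx]
    simp
  · cases hy : y (.inr (.inl b₀))
    · rw [Matrix.sub_apply, effOp, effOp, Matrix.of_apply, Matrix.of_apply,
        liftOp_apply_of_not_agree, liftOp_apply_of_not_agree]
      · simp
      all_goals
        intro h'
        have := h' (.inr (.inl b₀)) (by simp [qWire])
        rw [hx, hy] at this
        simp at this
    · simp

/-- The circuit extracts and simulates up to an error that is controlled by the probability `γ`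
above which extraction succeeds with probability `δ`. -/
theorem abs_acceptProb_circSim_sub_le (kB gB : List Blk) (hcK : 0 < p.cK) (hcG : 0 < p.cG) {m : ℕ}
    (hN : p.N = m + 1) {sstar : List Bool}
    (hK : ∀ (ρ : QState p.n) (s : List Bool),
      (((p.circK kB).run ρ.mat).map toValue).prob (some s) ≠ 0 → s = sstar)
    {γ δ : ℝ} (hγ : 0 < γ) (hγ1 : γ ≤ 1) (hδ : 0 < δ)
    (hGK : ∀ ρ : QState p.n, γ ≤ (((p.circG gB).run ρ.mat).map toDecision).prob true →
      δ ≤ (((p.circK kB).run ρ.mat).map toValue).prob (some sstar))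
    (hm : 1 / (2 * (m + 1)) ≤ γ * δ) (D : Distinguisher (Option (List Bool))) (ρ : QState p.n) :
    |D.acceptProb (((p.circSim kB gB).run ρ.mat).map toValue) -
      D.acceptProb ((((p.circG gB).run ρ.mat).map toDecision).map (Gam sstar))| ≤
        8 * √γ + 2 * γ := by
  set j₀ : Fin p.cK := ⟨0, hcK⟩ with hj₀
  set b₀ : Fin p.cG := ⟨0, hcG⟩ with hb₀
  have hzero : ∀ (x : Bits (Fin p.n ⊕ p.KA)) (s : List Bool),
      toValue (List.ofFn fun j => x (.inr (.inl j))) = some s → s ≠ sstar →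
        ∀ u, p.isoK kB x u = 0 := by
    intro x s hx hs u
    refine iso_apply_eq_zero (p.circK kB) toValue (some s) (fun ρ => ?_) hx u
    by_contra h
    exact hs (hK ρ s h)
  set Y : Matrix (Bits (Fin p.n ⊕ p.GA)) (Bits (Fin p.n)) ℂ :=
    proj (fun z : Bits (Fin p.n ⊕ p.GA) => z (.inr (.inl b₀))) * p.isoG gB with hY
  set Z : Matrix (Bits (Fin p.n ⊕ p.KA)) (Bits (Fin p.n)) ℂ :=
    proj (fun y : Bits (Fin p.n ⊕ p.KA) => y (.inr (.inl j₀))) * p.isoK kB with hZ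
  have hKK : (p.isoK kB)ᴴ * p.isoK kB = 1 := (p.circK kB).conjTranspose_iso_mul_self
  have hGG : (p.isoG gB)ᴴ * p.isoG gB = 1 := (p.circG gB).conjTranspose_iso_mul_self
  have hY1 : ‖Y‖ ≤ 1 := norm_mul_le_one (norm_proj_le_one _) (norm_le_one_of_isometry hGG)
  have hYprob : ∀ ψ (hψ : normSq ψ = 1), normSq (Y *ᵥ ψ) =
      (((p.circG gB).run (pureState ψ hψ).mat).map toDecision).prob true := by
    intro ψ hψ
    rw [prob_pureState]
    have : (fun z : Bits (Fin p.n ⊕ p.GA) => z (.inr (.inl b₀))) =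
        fun z => decide (toDecision (List.ofFn fun j => z (.inr (.inl j))) = true) := by
      funext z
      rw [toDecision_ofFn _ b₀ rfl]; simp
    rw [hY, this]
    rfl
  have hYK : ∀ ψ (hψ : normSq ψ = 1), γ ≤ normSq (Y *ᵥ ψ) →
      δ ≤ (((p.circK kB).run (pureState ψ hψ).mat).map toValue).prob (some sstar) :=
    fun ψ hψ h => hGK _ (by rwa [← hYprob ψ hψ])
  -- The hypothesis on acceptance and extraction, applied to pure states and scaled to all vectors.
  have hYZ : ∀ ψ, γ * normSq ψ ≤ normSq (Y *ᵥ ψ) → δ * normSq ψ ≤ normSq (Z *ᵥ ψ) := by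
    refine forall_of_normSq_eq_one fun ψ hψ h => (hYK ψ hψ h).trans ?_
    rw [prob_pureState]
    refine normSq_outProj_mono (p.circK kB) (q' := fun w => w j₀) (fun w hw => ?_) ψ
    by_contra h'
    rw [Bool.not_eq_true] at h'
    rw [decide_eq_true_eq] at hw
    exact absurd ((toValue_ofFn_of_false (c := p.cK) rfl h').symm.trans hw) (by simp)
  have hR : (p.isoK kB)ᴴ * proj (fun y : Bits (Fin p.n ⊕ p.KA) => !y (.inr (.inl j₀))) *
      p.isoK kB = 1 - Zᴴ * Z := by
    have : Zᴴ * Z = (p.isoK kB)ᴴ * proj (fun y : Bits (Fin p.n ⊕ p.KA) => y (.inr (.inl j₀))) *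
        p.isoK kB := by
      rw [hZ, Matrix.conjTranspose_mul, conjTranspose_proj, Matrix.mul_assoc, Matrix.mul_assoc,
        ← Matrix.mul_assoc (proj _) (proj _), proj_idem]
    rw [proj_not, Matrix.mul_sub, Matrix.sub_mul, Matrix.mul_one, hKK, this]
  have hR1 : (1 - Zᴴ * Z).PosSemidef := by
    rw [← hR]
    have : (p.isoK kB)ᴴ * proj (fun y : Bits (Fin p.n ⊕ p.KA) => !y (.inr (.inl j₀))) *
        p.isoK kB = (proj (fun y : Bits (Fin p.n ⊕ p.KA) => !y (.inr (.inl j₀))) *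
          p.isoK kB)ᴴ * (proj (fun y : Bits (Fin p.n ⊕ p.KA) => !y (.inr (.inl j₀))) *
          p.isoK kB) := by
      rw [Matrix.conjTranspose_mul, conjTranspose_proj, Matrix.mul_assoc, Matrix.mul_assoc,
        ← Matrix.mul_assoc (proj _) (proj _), proj_idem]
    rw [this]
    exact Matrix.posSemidef_conjTranspose_mul_self _
  have hfail := norm_mul_failOp_le hY1 hγ hδ hYZ hR1 hm
  rw [← hR] at hfail
  -- If the register cannot hold `sstar` with its leading `1`, any string with that leading bit may
  -- serve as the ideal value.
  obtain ⟨s, hs, hs'⟩ : ∃ s : Fin p.cK → Bool, s j₀ = true ∧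
      ((List.ofFn s).tail = sstar ∨ p.cK ≠ sstar.length + 1) := by
    by_cases h : p.cK = sstar.length + 1
    · refine ⟨fun j => (true :: sstar)[(j : ℕ)]'(by simp only [List.length_cons]; omega), rfl,
        .inl ?_⟩
      have : List.ofFn (fun j : Fin p.cK =>
          (true :: sstar)[(j : ℕ)]'(by simp only [List.length_cons]; omega)) = true :: sstar :=
        List.ext_getElem (by simp [h]) fun i _ _ => by simp
      rw [this]; rfl
    · exact ⟨fun _ => true, rfl, .inr h⟩
  have hlen : ∀ w : Fin p.cK → Bool, p.cK ≠ sstar.length + 1 → (List.ofFn w).tail ≠ sstar := by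
    intro w h e
    have := congrArg List.length e
    rw [List.length_tail, List.length_ofFn] at this
    omega
  -- Values other than `sstar` never occur; for a register of the wrong length this rules out every
  -- success.
  have hbad : proj (badK (X := Fin p.n) p.kout j₀ s) * p.isoK kB = 0 := by
    ext x u
    rw [proj_mul_apply, Matrix.zero_apply]
    split_ifs with hx
    · rw [badK, Bool.and_eq_true] at hx
      obtain ⟨hx0, hx1⟩ := hx
      obtain ⟨j, hj⟩ := of_decide_eq_true hx1
      refine hzero x _ (toValue_ofFn_of_true rfl hx0) ?_ u
      rcases hs' with hs' | hs'
      · intro e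
        refine hj ?_
        have hcons : ∀ w : Fin p.cK → Bool, w j₀ = true →
            List.ofFn w = true :: (List.ofFn w).tail := by
          intro w hw
          have := toValue_ofFn_of_true rfl hw
          rcases hl : List.ofFn w with _ | ⟨a, l⟩
          · rw [hl] at this; simp [toValue] at this
          · rw [hl] at this; cases a
            · simp [toValue] at this
            · rfl
        have h1 : List.ofFn (fun j => x (.inr (.inl j))) = List.ofFn s := by
          rw [hcons _ hx0, hcons s hs, e, hs']
        exact congrFun (List.ofFn_injective h1) j
      · exact hlen _ hs'
    · rfl
  have hγs : √γ ≤ 1 := Real.sqrt_le_one.2 hγ1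
  set E : Bits (Fin p.cK) → Op (Fin p.mG) := fun w => D.effect p.mG (toValue (List.ofFn w))
  set E₁ : Bits (Fin p.cG) → Op (Fin p.mG) := fun w =>
    D.effect p.mG (Gam (List.ofFn s).tail (toDecision (List.ofFn w))) with hE₁
  set E₂ : Bits (Fin p.cG) → Op (Fin p.mG) := fun w =>
    D.effect p.mG (Gam sstar (toDecision (List.ofFn w))) with hE₂
  have hEE : ∀ w, E (fun j => w b₀ && s j) = E₁ w := by
    intro w
    simp only [E, E₁]
    rw [toDecision_ofFn w b₀ rfl]
    cases hw : w b₀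
    · rw [toValue_ofFn_of_false (b₀ := j₀) rfl (by simp)]; rfl
    · simp only [Bool.true_and]
      rw [toValue_ofFn_of_true rfl hs]; rfl
  have hmain := p.norm_sim_sub_le kB gB (j₀ := j₀) rfl (b₀ := b₀) rfl hs hbad hN hγs hfail
    (E := E) (E' := E₁) (fun w => D.nonneg _ _) (fun w => D.le_one _ _) hEE
  have hext : ‖(p.isoG gB)ᴴ * (effOp E₁ : Op (Wire p.n p.cG p.mG p.aG)) * p.isoG gB -
      (p.isoG gB)ᴴ * (effOp E₂ : Op (Wire p.n p.cG p.mG p.aG)) * p.isoG gB‖ ≤ 2 * γ := by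
    rcases hs' with hs' | hs'
    · have : E₁ = E₂ := by rw [hE₁, hE₂, hs']
      rw [this, sub_self, norm_zero]; positivity
    -- Here `sstar` is never extracted, which contradicts `0 < δ` unless acceptance stays below `γ`.
    · have hYγ : ‖Y‖ ≤ √γ := by
        refine norm_le_of_normSq (Real.sqrt_nonneg γ) fun ψ => ?_
        rw [Real.sq_sqrt hγ.le]
        by_contra hlt
        rw [not_le] at hlt
        have h0 := forall_of_normSq_eq_one (Y := Y) (Z := (0 : Op (Fin p.n))) (b := δ)
          (fun ψ hψ h => absurd (hYK ψ hψ h) ?_) ψ hlt.le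
        · rw [Matrix.zero_mulVec] at h0
          have h1 : normSq (0 : Bits (Fin p.n) → ℂ) = 0 := by simp [normSq]
          have h2 : normSq ψ ≤ 0 := by
            rw [h1] at h0
            exact nonpos_of_mul_nonpos_right h0 hδ
          have h3 := normSq_mulVec_le Y ψ
          have h4 : normSq ψ = 0 := le_antisymm h2 (normSq_nonneg ψ)
          rw [h4, mul_zero] at h3 hlt
          linarith
        · rw [prob_pureState, normSq_outProj_mulVec, Finset.sum_eq_zero, not_le]
          · exact hδ
          · intro x _
            rw [if_neg]
            rw [decide_eq_true_eq]
            intro h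
            change toValue (List.ofFn fun j : Fin p.cK => x (.inr (.inl j))) = _ at h
            cases hx : x (.inr (.inl j₀))
            · rw [toValue_ofFn_of_false (b₀ := j₀) rfl hx] at h
              simp at h
            · rw [toValue_ofFn_of_true (b₀ := j₀) rfl hx, Option.some.injEq] at h
              exact hlen _ hs' h
      set Δ : Op (Wire p.n p.cG p.mG p.aG) := effOp E₁ - effOp E₂ with hΔ
      -- The effects differ only upon acceptance, so `Y` occurs on both sides of `Δ`, and two
      -- factors `√γ` give `2γ`.
      have hd : Δ = proj (fun x => x (.inr (.inl b₀))) * Δ * proj (fun x => x (.inr (.inl b₀))) :=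
        p.effOp_sub_effOp (b₀ := b₀) fun w hw => by
          simp only [hE₁, hE₂]; rw [toDecision_ofFn w b₀ rfl, hw]; rfl
      have hΔn : ‖Δ‖ ≤ 2 := (norm_sub_le _ _).trans (by
        have h1 : ‖(effOp E₁ : Op (Wire p.n p.cG p.mG p.aG))‖ ≤ 1 :=
          norm_effOp_le_one (fun w => D.nonneg _ _) (fun w => D.le_one _ _)
        have h2 : ‖(effOp E₂ : Op (Wire p.n p.cG p.mG p.aG))‖ ≤ 1 :=
          norm_effOp_le_one (fun w => D.nonneg _ _) (fun w => D.le_one _ _)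
        linarith)
      have e : (p.isoG gB)ᴴ * (effOp E₁ : Op (Wire p.n p.cG p.mG p.aG)) * p.isoG gB -
          (p.isoG gB)ᴴ * (effOp E₂ : Op (Wire p.n p.cG p.mG p.aG)) * p.isoG gB =
            Yᴴ * (Δ * Y) := by
        rw [← Matrix.sub_mul, ← Matrix.mul_sub, ← hΔ, hY, Matrix.conjTranspose_mul,
          conjTranspose_proj]
        conv_lhs => rw [hd]
        simp only [Matrix.mul_assoc]
      rw [e]
      calc ‖Yᴴ * (Δ * Y)‖ ≤ ‖Yᴴ‖ * (‖Δ‖ * ‖Y‖) := (Matrix.l2_opNorm_mul _ _).trans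
            (mul_le_mul_of_nonneg_left (Matrix.l2_opNorm_mul _ _) (norm_nonneg _))
        _ ≤ √γ * (2 * √γ) := by
            rw [Matrix.l2_opNorm_conjTranspose]
            gcongr
        _ = 2 * γ := by
            rw [mul_left_comm, Real.mul_self_sqrt hγ.le]
  rw [CQOutput.map_map, acceptProb_map_run, acceptProb_map_run]
  change |(ρ.mat * ((p.isoSim kB gB)ᴴ * (effOp E : Op (Wire p.n p.cK p.mG p.work)) *
    p.isoSim kB gB)).trace.re - (ρ.mat * ((p.isoG gB)ᴴ *
      (effOp E₂ : Op (Wire p.n p.cG p.mG p.aG)) * p.isoG gB)).trace.re| ≤ _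
  rw [← Complex.sub_re, ← Matrix.trace_sub, ← Matrix.mul_sub]
  refine (abs_trace_mul_le ρ.posSemidef ρ.trace_one _).trans ?_
  refine (norm_sub_le_norm_sub_add_norm_sub _ _ _).trans (add_le_add hmain hext)

end Sz

/-! ### The description is computable in polynomial time -/

theorem PTB.singleton {k : ℕ} {a b c d : Store → ℕ} (ha : PTN k a) (hb : PTN k b) (hc : PTN k c)
    (hd : PTN k d) : PTB k fun σ => [(a σ, b σ, c σ, d σ)] :=
  PTB.cons ha hb hc hd (PTB.nil k)

/-- The notion `PT` fixes the number of registers, so `t` is needed at `k` and, inside the loop, at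
`k + 1`, where it must not depend on the counter. -/
theorem PTB.chainB {k : ℕ} {t len : Store → ℕ} {w : Store → ℕ → ℕ} (ht : PTN k t)
    (ht' : PTN (k + 1) t) (hl : PTN k len) (hw : PTN (k + 1) fun σ => w σ (σ k).length)
    (h : ∀ σ v, t (Function.update σ k v) = t σ ∧ w (Function.update σ k v) = w σ) :
    PTB k fun σ => chainB (t σ) (len σ) (w σ) := by
  have h0 := fun c => PTN.const k c
  have h1 := fun c => PTN.const (k + 1) c
  have hi : PTN (k + 1) fun σ => (σ k).length := PTN.var (by omega)
  refine PTB.cons (h0 3) ht (h0 0) (h0 0) (PTB.flatMapRange (F := fun σ i =>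
    [(3, w σ i, 0, 0), (5, w σ i, t σ + i, t σ + i + 1), (3, w σ i, 0, 0)]) hl
    (PTB.cons (h1 3) hw (h1 0) (h1 0) (PTB.cons (h1 5) hw (ht'.add hi) ((ht'.add hi).add (h1 1))
      (PTB.singleton (h1 3) hw (h1 0) (h1 0)))) fun σ v i => ?_)
  simp only [h]

theorem PTB.reflB {k : ℕ} {t len : Store → ℕ} {w : Store → ℕ → ℕ} (ht : PTN k t)
    (ht' : PTN (k + 1) t) (hl : PTN k len) (hw : PTN (k + 1) fun σ => w σ (σ k).length)
    (h : ∀ σ v, t (Function.update σ k v) = t σ ∧ w (Function.update σ k v) = w σ) :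
    PTB k fun σ => reflB (t σ) (len σ) (w σ) := by
  have h0 := fun c => PTN.const k c
  have hc := PTB.chainB ht ht' hl hw h
  have hp := fun (l : Store → List Blk) (hl' : PTB k l) =>
    PTB.cons (h0 1) (ht.add hl) (h0 0) (h0 0) hl'
  exact (hc.append (hp _ (hp _ (hp _ (hp _ (PTB.nil k)))))).append hc.inv

theorem PTB.recB {k : ℕ} {t len r : Store → ℕ} {w : Store → ℕ → ℕ} (ht : PTN k t)
    (ht' : PTN (k + 1) t) (hl : PTN k len) (hw : PTN (k + 1) fun σ => w σ (σ k).length)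
    (hr : PTN k r)
    (h : ∀ σ v, t (Function.update σ k v) = t σ ∧ w (Function.update σ k v) = w σ) :
    PTB k fun σ => recB (t σ) (len σ) (w σ) (r σ) := by
  have h0 := fun c => PTN.const k c
  have hc := PTB.chainB ht ht' hl hw h
  exact (hc.append (PTB.singleton (h0 4) (ht.add hl) hr (h0 0))).append hc.inv

/-- The number with index `i` in a description. -/
def rd (s : List Bool) (i : ℕ) : ℕ := (readUnary 0 s).getD i 0

/-- The gates in a description. -/
def gatesIn (s : List Bool) : List Blk := toBlocks ((readUnary 0 s).drop 3)

/-- The sizes given by the number of input qubits, the two descriptions and the number of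
attempts in the first four registers. An extractor without classical output is replaced by one that
always fails. -/
def szOf (σ : Store) : Sz where
  n := (σ 0).length
  cK := if rd (σ 1) 0 = 0 then 1 else rd (σ 1) 0
  mK := rd (σ 1) 1
  aK := rd (σ 1) 2
  cG := rd (σ 2) 0
  mG := rd (σ 2) 1
  aG := rd (σ 2) 2
  N := (σ 3).length

/-- The gates of the extractor. -/
def kGates (σ : Store) : List Blk := if rd (σ 1) 0 = 0 then [] else gatesIn (σ 1)

theorem szOf_update {k : ℕ} (hk : 4 ≤ k) (σ : Store) (v : List Bool) :
    szOf (Function.update σ k v) = szOf σ := by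
  simp only [szOf, Function.update_of_ne (show 0 ≠ k by omega),
    Function.update_of_ne (show 1 ≠ k by omega), Function.update_of_ne (show 2 ≠ k by omega),
    Function.update_of_ne (show 3 ≠ k by omega)]

theorem PTN.n {k : ℕ} (hk : 4 ≤ k) : PTN k fun σ => (szOf σ).n := PTN.var (by omega)
theorem PTN.N {k : ℕ} (hk : 4 ≤ k) : PTN k fun σ => (szOf σ).N := PTN.var (by omega)
theorem PTN.rd {k : ℕ} (hk : 4 ≤ k) {i : ℕ} (hi : i < 4) (c : ℕ) : PTN k fun σ => rd (σ i) c :=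
  PTN.getD (PT.var (by omega)) (PTN.const k c)
theorem PTN.cK {k : ℕ} (hk : 4 ≤ k) : PTN k fun σ => (szOf σ).cK :=
  PTN.ite_eq (PTN.rd hk (by norm_num) 0) (PTN.const k 0) (PTN.const k 1)
    (PTN.rd hk (by norm_num) 0)
theorem PTN.mK {k : ℕ} (hk : 4 ≤ k) : PTN k fun σ => (szOf σ).mK := PTN.rd hk (by norm_num) 1
theorem PTN.aK {k : ℕ} (hk : 4 ≤ k) : PTN k fun σ => (szOf σ).aK := PTN.rd hk (by norm_num) 2
theorem PTN.cG {k : ℕ} (hk : 4 ≤ k) : PTN k fun σ => (szOf σ).cG := PTN.rd hk (by norm_num) 0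
theorem PTN.mG {k : ℕ} (hk : 4 ≤ k) : PTN k fun σ => (szOf σ).mG := PTN.rd hk (by norm_num) 1
theorem PTN.aG {k : ℕ} (hk : 4 ≤ k) : PTN k fun σ => (szOf σ).aG := PTN.rd hk (by norm_num) 2
theorem PTN.ak {k : ℕ} (hk : 4 ≤ k) : PTN k fun σ => (szOf σ).ak :=
  ((PTN.cK hk).add (PTN.mK hk)).add (PTN.aK hk)
theorem PTN.b1 {k : ℕ} (hk : 4 ≤ k) : PTN k fun σ => (szOf σ).b1 :=
  ((((PTN.n hk).add (PTN.cK hk)).add (PTN.mG hk)).add (PTN.cG hk)).add (PTN.aG hk)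
theorem PTN.b2 {k : ℕ} (hk : 4 ≤ k) : PTN k fun σ => (szOf σ).b2 := (PTN.b1 hk).add (PTN.ak hk)
theorem PTN.b3 {k : ℕ} (hk : 4 ≤ k) : PTN k fun σ => (szOf σ).b3 := (PTN.b2 hk).add (PTN.N hk)
theorem PTN.b4 {k : ℕ} (hk : 4 ≤ k) : PTN k fun σ => (szOf σ).b4 :=
  (PTN.b3 hk).add ((PTN.N hk).mul (PTN.cK hk))
theorem PTN.len {k : ℕ} (hk : 4 ≤ k) : PTN k fun σ => (szOf σ).len :=
  (((((((PTN.cK hk).add (PTN.mG hk)).add (PTN.cG hk)).add (PTN.aG hk)).add (PTN.ak hk)).add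
    (PTN.N hk)).add ((PTN.N hk).mul (PTN.cK hk))).add (PTN.const k 2)
theorem PTN.b5 {k : ℕ} (hk : 4 ≤ k) : PTN k fun σ => (szOf σ).b5 := (PTN.n hk).add (PTN.len hk)
theorem PTN.work {k : ℕ} (hk : 4 ≤ k) : PTN k fun σ => (szOf σ).work :=
  ((((((PTN.cG hk).add (PTN.aG hk)).add (PTN.ak hk)).add (PTN.N hk)).add
    ((PTN.N hk).mul (PTN.cK hk))).add (PTN.const k 2)).add ((PTN.len hk).add (PTN.const k 1))
theorem PTN.tot {k : ℕ} (hk : 4 ≤ k) : PTN k fun σ => (szOf σ).tot :=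
  ((PTN.b5 hk).add (PTN.len hk)).add (PTN.const k 1)

theorem PTN.kMap {k : ℕ} (hk : 4 ≤ k) {f : Store → ℕ} (hf : PTN k f) :
    PTN k fun σ => (szOf σ).kMap (f σ) :=
  PTN.ite_lt hf (PTN.n hk) hf (PTN.ite_lt hf ((PTN.n hk).add (PTN.ak hk))
    ((hf.sub (PTN.n hk)).add (PTN.b1 hk)) (PTN.tot hk))

theorem PTN.gMap {k : ℕ} (hk : 4 ≤ k) {f : Store → ℕ} (hf : PTN k f) :
    PTN k fun σ => (szOf σ).gMap (f σ) :=
  PTN.ite_lt hf (PTN.n hk) hf (PTN.ite_lt hf ((PTN.n hk).add (PTN.cG hk))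
    ((hf.add (PTN.cK hk)).add (PTN.mG hk))
    (PTN.ite_lt hf (((PTN.n hk).add (PTN.cG hk)).add (PTN.mG hk))
      ((hf.sub (PTN.cG hk)).add (PTN.cK hk))
      (PTN.ite_lt hf ((((PTN.n hk).add (PTN.cG hk)).add (PTN.mG hk)).add (PTN.aG hk))
        (hf.add (PTN.cK hk)) (PTN.tot hk))))

theorem gatesIn_eq (s : List Bool) : gatesIn s = (List.range (((readUnary 0 s).length - 3) / 4)).map
    fun i => (rd s (4 * i + 3), rd s (4 * i + 4), rd s (4 * i + 5), rd s (4 * i + 6)) := by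
  rw [gatesIn, toBlocks_eq, List.length_drop]
  simp only [rd, List.getD_eq_getElem?_getD, List.getElem?_drop]
  refine List.map_congr_left fun i _ => ?_
  rw [show 3 + 4 * i = 4 * i + 3 by ring, show 3 + (4 * i + 1) = 4 * i + 4 by ring,
    show 3 + (4 * i + 2) = 4 * i + 5 by ring, show 3 + (4 * i + 3) = 4 * i + 6 by ring]

/-- The gates of a described circuit, with the wires renamed. -/
theorem PTB.mapGates {k r : ℕ} (hk : 4 ≤ k) (hr : r < 4) {f : Sz → ℕ → ℕ} {c : Store → ℕ}
    (hc : PTN k c)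
    (hf : ∀ k, 4 ≤ k → ∀ g : Store → ℕ, PTN k g → PTN k fun σ => f (szOf σ) (g σ)) :
    PTB k fun σ => if c σ = 0 then [] else (gatesIn (σ r)).map (Blk.mapWires (f (szOf σ))) := by
  have h4 : ∀ j, PTN (k + 1) fun σ => rd (σ r) (4 * (σ k).length + j) := fun j =>
    PTN.getD (PT.var (by omega)) (((PTN.const (k + 1) 4).mul (PTN.var (by omega))).add
      (PTN.const (k + 1) j))
  have hfk := fun j => hf (k + 1) (by omega) _ (h4 j)
  have hl : PTN k fun σ => if c σ = 0 then 0 else ((readUnary 0 (σ r)).length - 3) / 4 :=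
    PTN.ite_eq hc (PTN.const k 0) (PTN.const k 0)
      ((PTN.lengthRead (PT.var (by omega))).sub (PTN.const k 3)).divFour
  refine (PTB.mapRange (a := fun σ i => rd (σ r) (4 * i + 3))
    (b := fun σ i => f (szOf σ) (rd (σ r) (4 * i + 4)))
    (c := fun σ i => f (szOf σ) (rd (σ r) (4 * i + 5)))
    (d := fun σ i => f (szOf σ) (rd (σ r) (4 * i + 6))) hl (h4 3) (hfk 4) (hfk 5) (hfk 6)
    fun σ v i => ?_).congr fun σ => ?_
  · rw [szOf_update hk, Function.update_of_ne (by omega)]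
    exact ⟨rfl, rfl, rfl, rfl⟩
  · split_ifs
    · rfl
    · rw [gatesIn_eq, List.map_map]; rfl

/-- The gates of the extractor on the wires of the simulation. -/
def kBlocks (σ : Store) : List Blk := (kGates σ).map (Blk.mapWires (szOf σ).kMap)

/-- The gates of the simulated algorithm on the wires of the simulation. -/
def gBlocks (σ : Store) : List Blk := (gatesIn (σ 2)).map (Blk.mapWires (szOf σ).gMap)

theorem PTB.of_kBlocks {k : ℕ} (hk : 4 ≤ k) : PTB k kBlocks :=
  (PTB.mapGates hk (r := 1) (f := Sz.kMap) (by norm_num) (PTN.rd (i := 1) hk (by norm_num) 0)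
    fun _ hk _ hg => PTN.kMap hk hg).congr fun σ => by
      rw [kBlocks, kGates]; split_ifs <;> rfl

theorem PTB.of_gBlocks {k : ℕ} (hk : 4 ≤ k) : PTB k gBlocks :=
  (PTB.mapGates hk (r := 2) (f := Sz.gMap) (c := fun _ => 1) (by norm_num) (PTN.const k 1)
    fun _ hk _ hg => PTN.gMap hk hg).congr fun σ => rfl

/-- Registers `0` to `3` hold the data of `szOf`, and register `4` the number of the attempt. -/
theorem PTB.of_roundB : PTB 5 fun σ => (szOf σ).roundB (kBlocks σ) (σ 4).length := by
  have h5 : 4 ≤ 5 := by norm_num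
  have h6 : 4 ≤ 6 := by norm_num
  have hi : PTN 5 fun σ => (σ 4).length := PTN.var (by norm_num)
  have hi' : PTN 6 fun σ => (σ 4).length := PTN.var (by norm_num)
  have hj : PTN 6 fun σ => (σ 5).length := PTN.var (by norm_num)
  have hcp : PTB 5 fun σ => (szOf σ).cpB (σ 4).length :=
    PTB.mapRange (a := fun _ _ => 5) (b := fun σ _ => (szOf σ).b1)
      (c := fun σ j => (szOf σ).b1 + j)
      (d := fun σ j => (szOf σ).b3 + ((σ 4).length * (szOf σ).cK + j)) (PTN.cK h5)
      (PTN.const 6 5) (PTN.b1 h6) ((PTN.b1 h6).add hj)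
      ((PTN.b3 h6).add ((hi'.mul (PTN.cK h6)).add hj)) fun σ v i => by
        rw [szOf_update h5, Function.update_of_ne (by norm_num)]
        exact ⟨rfl, rfl, rfl, rfl⟩
  have hrec : PTB 5 fun σ => ExtractSim.recB (szOf σ).b5 (szOf σ).ak (fun j => (szOf σ).b1 + j)
      ((szOf σ).b2 + (σ 4).length) :=
    PTB.recB (PTN.b5 h5) (PTN.b5 h6) (PTN.ak h5) ((PTN.b1 h6).add hj) ((PTN.b2 h5).add hi)
      fun σ v => by rw [szOf_update h5]; exact ⟨rfl, rfl⟩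
  exact (((PTB.of_kBlocks h5).append hcp).append (PTB.of_kBlocks h5).inv).append hrec

theorem kBlocks_update {k : ℕ} (hk : 4 ≤ k) (σ : Store) (v : List Bool) :
    kBlocks (Function.update σ k v) = kBlocks σ := by
  simp only [kBlocks, kGates, szOf_update hk, Function.update_of_ne (show 1 ≠ k by omega)]

theorem PTB.of_ampB : PTB 4 fun σ => (szOf σ).ampB (kBlocks σ) :=
  PTB.flatMapRange (F := fun σ i => (szOf σ).roundB (kBlocks σ) i) (PTN.N le_rfl) PTB.of_roundB
    fun σ v i => by rw [szOf_update le_rfl, kBlocks_update le_rfl]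

theorem PTB.of_copyB : PTB 4 fun σ => (szOf σ).copyB := by
  have h4 : 4 ≤ 4 := le_rfl
  have h5 : 4 ≤ 5 := by norm_num
  have h6 : 4 ≤ 6 := by norm_num
  have hi : PTN 5 fun σ => (σ 4).length := PTN.var (by norm_num)
  have hi' : PTN 6 fun σ => (σ 4).length := PTN.var (by norm_num)
  have hj : PTN 6 fun σ => (σ 5).length := PTN.var (by norm_num)
  have c4 := fun c => PTN.const 4 c
  have c5 := fun c => PTN.const 5 c
  have hx : PTB 4 fun σ => [(3, (szOf σ).b4 + 1, 0, 0)] :=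
    PTB.singleton (c4 3) ((PTN.b4 h4).add (c4 1)) (c4 0) (c4 0)
  have hst : PTB 5 fun σ => (szOf σ).stageB (σ 4).length :=
    PTB.mapRange (a := fun _ _ => 5) (b := fun σ _ => (szOf σ).b5 + ((σ 4).length + 1))
      (c := fun σ j => (szOf σ).b3 + ((σ 4).length * (szOf σ).cK + j))
      (d := fun σ j => (szOf σ).n + j) (PTN.cK h5) (PTN.const 6 5)
      ((PTN.b5 h6).add (hi'.add (PTN.const 6 1)))
      ((PTN.b3 h6).add ((hi'.mul (PTN.cK h6)).add hj)) ((PTN.n h6).add hj) fun σ v i => by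
        rw [szOf_update h5, Function.update_of_ne (by norm_num)]
        exact ⟨rfl, rfl, rfl, rfl⟩
  have hch : PTB 4 fun σ => (szOf σ).copyChainB :=
    PTB.chainB (w := fun σ i => if i = 0 then (szOf σ).b4 + 1 else
        (szOf σ).b3 + (i - 1) * (szOf σ).cK) (PTN.b5 h4) (PTN.b5 h5) ((PTN.N h4).add (c4 1))
      (PTN.ite_eq hi (c5 0) ((PTN.b4 h5).add (c5 1))
        ((PTN.b3 h5).add ((hi.sub (c5 1)).mul (PTN.cK h5)))) fun σ v => by
        rw [szOf_update h4]; exact ⟨rfl, rfl⟩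
  have hfl : PTB 4 fun σ => (List.range (szOf σ).N).flatMap (szOf σ).stageB :=
    PTB.flatMapRange (F := fun σ i => (szOf σ).stageB i) (PTN.N h4) hst
      fun σ v i => by rw [szOf_update h4]
  exact (hx.append ((hch.append hfl).append hch.inv)).append hx

theorem PTB.of_goodB : PTB 4 fun σ => (szOf σ).goodB := by
  have h4 : 4 ≤ 4 := le_rfl
  have h5 : 4 ≤ 5 := by norm_num
  have hi : PTN 5 fun σ => (σ 4).length := PTN.var (by norm_num)
  have c4 := fun c => PTN.const 4 c
  have hgl : ∀ k, 4 ≤ k → PTN k fun σ => (szOf σ).goodLen := fun k h =>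
    (((PTN.ak h).add (PTN.N h)).add ((PTN.N h).mul (PTN.cK h))).add (PTN.const k 1)
  have hb : ∀ k, 4 ≤ k → PTN k fun σ => (szOf σ).n + (szOf σ).cK + (szOf σ).mG := fun k h =>
    ((PTN.n h).add (PTN.cK h)).add (PTN.mG h)
  have h1 : PTB 4 fun σ => [(4, (szOf σ).b4 + 1, (szOf σ).n + (szOf σ).cK + (szOf σ).mG, 0)] :=
    PTB.singleton (c4 4) ((PTN.b4 h4).add (c4 1)) (hb 4 h4) (c4 0)
  have h2 : PTB 4 fun σ => [(4, (szOf σ).b4 + 1, (szOf σ).n, 0)] :=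
    PTB.singleton (c4 4) ((PTN.b4 h4).add (c4 1)) (PTN.n h4) (c4 0)
  have h3 : PTB 4 fun σ => ExtractSim.reflB (szOf σ).b5 ((szOf σ).goodLen + 2) fun i =>
      if i < (szOf σ).goodLen then (szOf σ).b1 + i else
        if i = (szOf σ).goodLen then (szOf σ).n else (szOf σ).n + (szOf σ).cK + (szOf σ).mG :=
    PTB.reflB (PTN.b5 h4) (PTN.b5 h5) ((hgl 4 h4).add (c4 2))
      (PTN.ite_lt hi (hgl 5 h5) ((PTN.b1 h5).add hi)
        (PTN.ite_eq hi (hgl 5 h5) (PTN.n h5) (hb 5 h5))) fun σ v => by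
        rw [szOf_update h4]; exact ⟨rfl, rfl⟩
  exact (((h1.append h2).append h3).append h2).append h1

theorem PTB.of_zeroB : PTB 4 fun σ => (szOf σ).zeroB :=
  PTB.reflB (w := fun σ i => (szOf σ).n + i) (PTN.b5 le_rfl) (PTN.b5 (by norm_num))
    (PTN.len le_rfl) ((PTN.n (by norm_num)).add (PTN.var (by norm_num))) fun σ v => by
      rw [szOf_update le_rfl]; exact ⟨rfl, rfl⟩

theorem PTB.of_simB : PTB 4 fun σ => (szOf σ).simB (kBlocks σ) (gBlocks σ) := by
  have h4 : 4 ≤ 4 := le_rfl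
  have c4 := fun c => PTN.const 4 c
  have h1 : PTB 4 fun σ => [(0, (szOf σ).b4 + 1, 0, 0)] :=
    PTB.singleton (c4 0) ((PTN.b4 h4).add (c4 1)) (c4 0) (c4 0)
  have h2 : PTB 4 fun σ => [(0, (szOf σ).b4, 0, 0)] :=
    PTB.singleton (c4 0) (PTN.b4 h4) (c4 0) (c4 0)
  have h3 : PTB 4 fun σ => (szOf σ).guessB (kBlocks σ) (gBlocks σ) :=
    ((h1.append h2).append ((PTB.of_ampB.append PTB.of_copyB).append PTB.of_ampB.inv)).append
      (PTB.of_gBlocks h4)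
  exact (((h3.append PTB.of_goodB).append h3.inv).append PTB.of_zeroB).append h3

/-- The description of the simulation. An algorithm without classical output is run as it is. -/
def simDescr (σ : Store) : List Bool :=
  if (readUnary 0 (σ 2)).length < 3 then σ 2 else if rd (σ 2) 0 = 0 then σ 2 else
    enc ((szOf σ).cK :: (szOf σ).mG :: (szOf σ).work ::
      flat ((szOf σ).simB (kBlocks σ) (gBlocks σ)))

theorem PT.of_simDescr : PT 4 simDescr := by
  have h2 : PT 4 fun σ => σ 2 := PT.var (by norm_num)
  have h3 : PTL 4 fun σ => (szOf σ).cK :: (szOf σ).mG :: (szOf σ).work ::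
      flat ((szOf σ).simB (kBlocks σ) (gBlocks σ)) :=
    PTL.cons (PTN.cK le_rfl) (PTL.cons (PTN.mG le_rfl) (PTL.cons (PTN.work le_rfl) PTB.of_simB))
  have h4 := PT.ite_eq (PTN.rd (i := 2) le_rfl (by norm_num) 0) (PTN.const 4 0) h2 h3
  exact PT.ite_lt (PTN.lengthRead h2) (PTN.const 4 3) h2 h4

theorem circuitOf_of_le {n : ℕ} {s : List Bool} (h : 3 ≤ (readUnary 0 s).length) :
    circuitOf n s = ⟨rd s 0, rd s 1, rd s 2,
      blockGates (wireOf n (rd s 0) (rd s 1) (rd s 2)) (gatesIn s)⟩ := by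
  unfold circuitOf rd gatesIn
  rcases hr : readUnary 0 s with _ | ⟨c, _ | ⟨m, _ | ⟨a, rest⟩⟩⟩
  · simp [hr] at h
  · simp [hr] at h
  · simp [hr] at h
  · simp only [readGates_eq]; rfl

theorem circuitOf_of_lt {n : ℕ} {s : List Bool} (h : (readUnary 0 s).length < 3) :
    circuitOf n s = ⟨0, 0, 0, []⟩ := by
  unfold circuitOf
  rcases hr : readUnary 0 s with _ | ⟨c, _ | ⟨m, _ | ⟨a, rest⟩⟩⟩
  · rfl
  · rfl
  · rfl
  · simp only [hr, List.length_cons] at h; omega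

theorem circuitOf_simDescr {σ : Store} (h : 3 ≤ (readUnary 0 (σ 2)).length)
    (h0 : rd (σ 2) 0 ≠ 0) : circuitOf (σ 0).length (simDescr σ) =
      (szOf σ).circSim (kGates σ) (gatesIn (σ 2)) := by
  rw [simDescr, if_neg (by omega), if_neg h0, circuitOf]
  rw [readUnary_enc]
  simp only [readGates_eq, toBlocks_flat]
  rfl

theorem ofFn_of_eq_zero {c : ℕ} (hc : c = 0) (w : Fin c → Bool) : List.ofFn w = [] := by
  subst hc; simp

/-- The only measured string is the empty one, which means rejection and also `⊥`; the algorithm is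
then its own simulation. -/
theorem acceptProb_of_cOut_eq_zero {n : ℕ} {C : Circuit n} (hC : C.cOut = 0) (s : List Bool)
    (D : Distinguisher (Option (List Bool))) (ρ : Op (Fin n)) :
    D.acceptProb ((C.run ρ).map toValue) =
      D.acceptProb (((C.run ρ).map toDecision).map (Gam s)) := by
  rw [CQOutput.map_map, acceptProb_map_run, acceptProb_map_run]
  simp only [ofFn_of_eq_zero hC]
  rfl

theorem prob_eq_zero_of_cOut_eq_zero {n : ℕ} {C : Circuit n} (hC : C.cOut = 0) (s : List Bool)
    (ρ : Op (Fin n)) : ((C.run ρ).map toValue).prob (some s) = 0 := by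
  rw [prob_map_run]
  have : C.outProj (fun w => decide (toValue (List.ofFn w) = some s)) = 0 := by
    ext x y
    simp [Circuit.outProj, proj, ofFn_of_eq_zero hC, toValue]
  simp [this]

/-- Untouched output wires read `0`, and a leading `0` means `⊥`. -/
theorem prob_eq_zero_of_gates_eq_nil {n : ℕ} {C : Circuit n} (hC : C.gates = []) (s : List Bool)
    (ρ : Op (Fin n)) : ((C.run ρ).map toValue).prob (some s) = 0 := by
  rw [prob_map_run]
  have : C.outProj (fun w => decide (toValue (List.ofFn w) = some s)) * C.iso = 0 := by
    rw [Circuit.iso, hC, gatesOp, Matrix.one_mul, Circuit.outProj, zmat]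
    refine proj_mul_pmat_eq_zero fun u => ?_
    rw [decide_eq_false_iff_not]
    have h : ∀ c, toValue (List.ofFn fun _ : Fin c => false) = none := by
      rintro (_ | c)
      · simp [toValue]
      · rw [List.ofFn_succ]; rfl
    have h' : toValue (List.ofFn (cBits (zext u : Bits (Wire n C.cOut C.qOut C.work)))) = none :=
      h C.cOut
    rw [h']
    simp
  rw [Matrix.mul_assoc, this]
  simp

/-- The substitute for a degenerate extractor never yields a value, and neither does the original.
-/
theorem prob_circK (σ : Store) (s : List Bool) (ρ : Op (Fin (σ 0).length)) :
    ((((szOf σ).circK (kGates σ)).run ρ).map toValue).prob (some s) =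
      (((circuitOf (σ 0).length (σ 1)).run ρ).map toValue).prob (some s) := by
  by_cases h : 3 ≤ (readUnary 0 (σ 1)).length ∧ rd (σ 1) 0 ≠ 0
  · have : (szOf σ).circK (kGates σ) = circuitOf (σ 0).length (σ 1) := by
      rw [circuitOf_of_le h.1, kGates, if_neg h.2]
      have : (szOf σ).cK = rd (σ 1) 0 := if_neg h.2
      rw [Sz.circK, this]
      rfl
    rw [← this]; rfl
  · have h1 : (circuitOf (σ 0).length (σ 1)).cOut = 0 := by
      by_cases h' : 3 ≤ (readUnary 0 (σ 1)).length
      · rw [circuitOf_of_le h']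
        by_contra h0
        exact h ⟨h', h0⟩
      · rw [circuitOf_of_lt (by omega)]
    have h2 : kGates σ = [] := by
      rw [kGates]
      split_ifs with h0
      · rfl
      · have h3 : (readUnary 0 (σ 1)).length < 3 := by
          by_contra h'
          exact h ⟨by omega, h0⟩
        rw [gatesIn, List.drop_of_length_le h3.le]; rfl
    rw [prob_eq_zero_of_cOut_eq_zero h1]
    refine prob_eq_zero_of_gates_eq_nil ?_ s ρ
    rw [h2]; rfl

/-- The described circuit extracts and simulates. -/
theorem abs_acceptProb_simDescr_sub_le {σ : Store} {n : ℕ} (hn : (σ 0).length = n) {m : ℕ}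
    (hN : (σ 3).length = m + 1) {sstar : List Bool}
    (hK : ∀ (ρ : QState n) (s : List Bool),
      (((circuitOf n (σ 1)).run ρ.mat).map toValue).prob (some s) ≠ 0 → s = sstar)
    {γ δ : ℝ} (hγ : 0 < γ) (hγ1 : γ ≤ 1) (hδ : 0 < δ)
    (hGK : ∀ ρ : QState n, γ ≤ (((circuitOf n (σ 2)).run ρ.mat).map toDecision).prob true →
      δ ≤ (((circuitOf n (σ 1)).run ρ.mat).map toValue).prob (some sstar))
    (hm : 1 / (2 * (m + 1)) ≤ γ * δ) (D : Distinguisher (Option (List Bool))) (ρ : QState n) :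
    |D.acceptProb (((circuitOf n (simDescr σ)).run ρ.mat).map toValue) -
      D.acceptProb ((((circuitOf n (σ 2)).run ρ.mat).map toDecision).map (Gam sstar))| ≤
        8 * √γ + 2 * γ := by
  subst hn
  by_cases h : 3 ≤ (readUnary 0 (σ 2)).length ∧ rd (σ 2) 0 ≠ 0
  · have hG : circuitOf (σ 0).length (σ 2) = (szOf σ).circG (gatesIn (σ 2)) :=
      circuitOf_of_le h.1
    have hcK : 0 < (szOf σ).cK := by
      simp only [szOf]; split_ifs <;> omega
    rw [circuitOf_simDescr h.1 h.2, hG]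
    rw [hG] at hGK
    refine (szOf σ).abs_acceptProb_circSim_sub_le (kGates σ) (gatesIn (σ 2)) hcK
      (Nat.pos_of_ne_zero h.2) hN (fun ρ s hs => hK ρ s ?_) hγ hγ1 hδ (fun ρ hρ => ?_) hm D ρ
    · rw [← prob_circK]; exact hs
    · have := hGK ρ hρ
      rw [← prob_circK] at this
      exact this
  · have h1 : simDescr σ = σ 2 := by
      rw [simDescr]
      split_ifs with h1 h2
      · rfl
      · rfl
      · exact absurd ⟨by omega, h2⟩ h
    have h2 : (circuitOf (σ 0).length (σ 2)).cOut = 0 := by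
      by_cases h' : 3 ≤ (readUnary 0 (σ 2)).length
      · rw [circuitOf_of_le h']
        by_contra h0
        exact h ⟨h', h0⟩
      · rw [circuitOf_of_lt (by omega)]
    rw [h1, acceptProb_of_cOut_eq_zero h2 sstar, sub_self, abs_zero]
    positivity

/-! ### The algorithm -/

/-- Description of the extractor, the simulated algorithm, and number of attempts. -/
def simInput (G K : QPT) (d : ℕ → ℕ → ℕ) (κ t n : ℕ) (z : List Bool) (r : ℕ) : List Bool :=
  if r = 0 then unary n else if r = 1 then K.descr κ (100 * (t * t)) n z else
    if r = 2 then G.descr κ (100 * (t * t)) n z else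
      unary (100 * (t * t) * d κ (100 * (t * t)))

def simStore (G K : QPT) (d : ℕ → ℕ → ℕ) (κ t n : ℕ) (z : List Bool) : Store := fun r =>
  if r < 4 then simInput G K d κ t n z r else []

theorem PT.descr (A : QPT) : PT 4 fun σ =>
    A.descr (σ 0).length (100 * ((σ 1).length * (σ 1).length)) (σ 2).length (σ 3) := by
  obtain ⟨P, p, h⟩ := A.polyTime
  have h1 : PTN 4 fun σ => 100 * ((σ 1).length * (σ 1).length) :=
    (PTN.const 4 100).mul ((PTN.var (by norm_num)).mul (PTN.var (by norm_num)))
  refine PT.call (m := 4) (g := fun i σ => if i = 0 then unary (σ 0).length else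
    if i = 1 then unary (100 * ((σ 1).length * (σ 1).length)) else
      if i = 2 then unary (σ 2).length else σ 3) (P := P) (q := p) ?_ fun σ _ => ?_
  · intro i _
    by_cases h0 : i = 0
    · simp only [h0, if_true]; exact PTN.var (by norm_num)
    by_cases h1' : i = 1
    · simp only [h1', one_ne_zero, if_false, if_true]; exact h1
    by_cases h2 : i = 2
    · simp only [h2, OfNat.ofNat_ne_zero, OfNat.ofNat_ne_one, if_false, if_true]
      exact PTN.var (by norm_num)
    · simp only [h0, h1', h2, if_false]; exact PT.var (by norm_num)
  · have := h (σ 0).length (100 * ((σ 1).length * (σ 1).length)) (σ 2).length (σ 3)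
    simpa [List.range_succ, Finset.sum_range_succ, length_unary] using this

theorem PTN.unary₂ {d : ℕ → ℕ → ℕ} (hd : PolyTimeUnary d) :
    PTN 4 fun σ => d (σ 0).length (100 * ((σ 1).length * (σ 1).length)) := by
  obtain ⟨P, p, h⟩ := hd
  have h1 : PTN 4 fun σ => 100 * ((σ 1).length * (σ 1).length) :=
    (PTN.const 4 100).mul ((PTN.var (by norm_num)).mul (PTN.var (by norm_num)))
  refine PT.call (m := 2) (g := fun i σ => if i = 0 then unary (σ 0).length else
    unary (100 * ((σ 1).length * (σ 1).length))) (P := P) (q := p) ?_ fun σ _ => ?_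
  · intro i _
    by_cases h0 : i = 0
    · simp only [h0, if_true]; exact PTN.var (by norm_num)
    · simp only [h0, if_false]; exact h1
  · have := h (σ 0).length (100 * ((σ 1).length * (σ 1).length))
    simpa [List.range_succ, Finset.sum_range_succ, length_unary] using this

/-- The algorithm that extracts and simulates. -/
def simQPT (G K : QPT) (d : ℕ → ℕ → ℕ) (hd : PolyTimeUnary d) : QPT where
  descr κ t n z := simDescr (simStore G K d κ t n z)
  polyTime := by
    have h1 : PTN 4 fun σ => 100 * ((σ 1).length * (σ 1).length) :=
      (PTN.const 4 100).mul ((PTN.var (by norm_num)).mul (PTN.var (by norm_num)))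
    have h : PT 4 fun σ => simDescr (simStore G K d (σ 0).length (σ 1).length (σ 2).length (σ 3)) := by
      refine PT.comp (by norm_num) PT.of_simDescr (g := fun i σ =>
        simInput G K d (σ 0).length (σ 1).length (σ 2).length (σ 3) i) fun i _ => ?_
      by_cases h0 : i = 0
      · simp only [simInput, h0, if_true]; exact PTN.var (by norm_num)
      by_cases h1' : i = 1
      · simp only [simInput, h1', one_ne_zero, if_false, if_true]; exact PT.descr K
      by_cases h2 : i = 2
      · simp only [simInput, h2, OfNat.ofNat_ne_zero, OfNat.ofNat_ne_one, if_false, if_true]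
        exact PT.descr G
      · simp only [simInput, h0, h1', h2, if_false]; exact h1.mul (PTN.unary₂ hd)
    obtain ⟨P, p, hP⟩ := h.computes (by norm_num)
    refine ⟨P, p, fun κ t n z => ?_⟩
    have := hP [unary κ, unary t, unary n, z] rfl
    simpa [Store.init, length_unary, add_assoc] using this

theorem polyTimeUnary_sq : PolyTimeUnary fun _ t => 100 * (t * t) := by
  have h1 : PTN 2 fun σ => 100 * ((σ 1).length * (σ 1).length) :=
    (PTN.const 2 100).mul ((PTN.var (by norm_num)).mul (PTN.var (by norm_num)))
  obtain ⟨P, p, hP⟩ := PT.computes (by norm_num) h1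
  refine ⟨P, p, fun κ t => ?_⟩
  have := hP [unary κ, unary t] rfl
  simpa [Store.init, length_unary] using this

/-! ### Asymptotics -/

theorem negligible_zero : Negligible fun _ => 0 := by
  refine ⟨fun _ => ⟨le_rfl, zero_le_one⟩, fun p hp => ?_⟩
  filter_upwards [eventually_ge_atTop 1] with κ hκ
  -- Coefficients are natural numbers, so one nonzero coefficient makes the value positive for `κ ≥
  -- 1`.
  have : 0 < p.eval κ := by
    rw [Polynomial.eval_eq_sum]
    obtain ⟨i, hi⟩ := Polynomial.nonempty_support_iff.2 hp
    refine Finset.sum_pos' (fun _ _ => Nat.zero_le _) ⟨i, hi, ?_⟩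
    exact Nat.mul_pos (Nat.pos_of_ne_zero (Polynomial.mem_support_iff.1 hi)) (Nat.pow_pos hκ)
  positivity

theorem one_le_invLen {f : ℕ → ℝ} (hf : Noticeable f) (κ : ℕ) : 1 ≤ invLen f κ :=
  Nat.ceil_pos.2 (inv_pos.2 (hf.1 κ).1)

theorem inv_invLen_le {f : ℕ → ℝ} (hf : Noticeable f) (κ : ℕ) : ((invLen f κ : ℕ) : ℝ)⁻¹ ≤ f κ :=
  inv_le_of_inv_le₀ (hf.1 κ).1 (Nat.le_ceil _)

/-- Rounding the inverse to an integer first makes the inverse of the new function an integer, hence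
exactly computable in unary; squaring a polynomial bound on it keeps it polynomial. -/
theorem noticeable_sq {f : ℕ → ℝ} (hf : Noticeable f) :
    Noticeable fun κ => ((100 * (invLen f κ * invLen f κ) : ℕ) : ℝ)⁻¹ := by
  refine ⟨fun κ => ?_, ?_⟩
  · have h := one_le_invLen hf κ
    have h1 : 1 ≤ 100 * (invLen f κ * invLen f κ) := by nlinarith
    have h2 : (1 : ℝ) ≤ ((100 * (invLen f κ * invLen f κ) : ℕ) : ℝ) := by exact_mod_cast h1
    exact ⟨by positivity, inv_le_one_of_one_le₀ h2⟩
  · obtain ⟨p, hp⟩ := hf.2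
    refine ⟨100 * (p * p), hp.mono fun κ hκ => ?_⟩
    have h := one_le_invLen hf κ
    have h1 : invLen f κ ≤ p.eval κ := by
      refine Nat.ceil_le.2 (inv_le_of_inv_le₀ ?_ ?_)
      · exact_mod_cast hκ.1
      · rw [← one_div]; exact hκ.2
    have h2 : (100 * (p * p) : Polynomial ℕ).eval κ = 100 * (p.eval κ * p.eval κ) := by
      simp
    rw [h2]
    have h3 : 0 < p.eval κ * p.eval κ := Nat.mul_pos hκ.1 hκ.1
    refine ⟨by omega, ?_⟩
    rw [one_div]
    have h4 : 0 < invLen f κ * invLen f κ := Nat.mul_pos h h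
    have h5 : 100 * (invLen f κ * invLen f κ) ≤ 100 * (p.eval κ * p.eval κ) :=
      Nat.mul_le_mul_left _ (Nat.mul_le_mul h1 h1)
    refine inv_anti₀ ?_ (by exact_mod_cast h5)
    exact_mod_cast (by omega : 0 < 100 * (invLen f κ * invLen f κ))

/-- The sequence whose members are all equal to the given ones. -/
def constSeq {n : ℕ} (ρ : QState n) (z : List Bool) : PolySeq where
  n _ := n
  ρ _ := ρ
  z _ := z
  poly := ⟨Polynomial.C (n + z.length), fun κ => by simp⟩

open ExtractSim
theorem mainTheorem4
    (G K : QPT) (sstar : List Bool → List Bool)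
    -- whenever the extractor does not output `⊥`, it outputs `sstar z`
    (hK : ∀ (κ t : ℕ), 1 ≤ t → ∀ (n : ℕ) (ρ : QState n) (z s : List Bool),
      ((K.run κ t ρ z).map toValue).prob (some s) ≠ 0 → s = sstar z)
    -- acceptance with probability `γ` implies extraction with probability `δ`,
    -- where `1^{δ⁻¹}` is computed in polynomial time from `1^κ` and `1^{γ⁻¹}`
    (hGK : ∃ d : ℕ → ℕ → ℕ, PolyTimeUnary d ∧
      ∀ γ : ℕ → ℝ, Noticeable γ →
        ∃ δ : ℕ → ℝ, Noticeable δ ∧ (∀ κ, invLen δ κ = d κ (invLen γ κ)) ∧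
          ∀ (S : PolySeq) (κ : ℕ),
            γ κ ≤ ((G.run κ (invLen γ κ) (S.ρ κ) (S.z κ)).map toDecision).prob true →
            δ κ ≤ ((K.run κ (invLen γ κ) (S.ρ κ) (S.z κ)).map toValue).prob
              (some (sstar (S.z κ)))) :
    ∃ (SE : QPT) (g : ℕ → ℕ → ℕ), PolyTimeUnary g ∧
      ∀ ε : ℕ → ℝ, Noticeable ε →
        ∃ γ : ℕ → ℝ, Noticeable γ ∧ (∀ κ, γ κ ≤ ε κ) ∧ (∀ κ, invLen γ κ = g κ (invLen ε κ)) ∧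
          ∀ S : PolySeq,
            StatClose ε
              (fun κ => (SE.run κ (invLen ε κ) (S.ρ κ) (S.z κ)).map toValue)
              (fun κ => ((G.run κ (invLen γ κ) (S.ρ κ) (S.z κ)).map toDecision).map
                (Gam (sstar (S.z κ)))) := by
  obtain ⟨d, hd, hGK⟩ := hGK
  refine ⟨simQPT G K d hd, fun _ t => 100 * (t * t), polyTimeUnary_sq, fun ε hε => ?_⟩
  set t : ℕ → ℕ := invLen ε with ht
  set γ : ℕ → ℝ := fun κ => ((100 * (t κ * t κ) : ℕ) : ℝ)⁻¹ with hγdef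
  have hγ : Noticeable γ := noticeable_sq hε
  have htpos : ∀ κ, (1 : ℝ) ≤ t κ := fun κ => by exact_mod_cast one_le_invLen hε κ
  have hγinv : ∀ κ, invLen γ κ = 100 * (t κ * t κ) := fun κ => by
    rw [invLen, hγdef, inv_inv, Nat.ceil_natCast]
  have hγt : ∀ κ, γ κ = (10 * (t κ : ℝ))⁻¹ ^ 2 := fun κ => by
    rw [hγdef]; push_cast; rw [inv_pow]; congr 1; ring
  -- Here `√γ = 1 / (10 t)`, so the sum is `0.8 / t + 0.02 / t²`, at most `1 / t ≤ ε`; the constant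
  -- `100` is chosen for this.
  have hbound : ∀ κ, 8 * √(γ κ) + 2 * γ κ ≤ ε κ := by
    intro κ
    have h1 := htpos κ
    refine le_trans ?_ (inv_invLen_le hε κ)
    rw [← ht, hγt, Real.sqrt_sq (by positivity), mul_inv]
    have h2 : ((t κ : ℕ) : ℝ)⁻¹ ≤ 1 := inv_le_one_of_one_le₀ h1
    have h3 : 0 < ((t κ : ℕ) : ℝ)⁻¹ := by positivity
    nlinarith
  obtain ⟨δ, hδ, hδd, hγδ⟩ := hGK γ hγ
  refine ⟨γ, hγ, fun κ => ?_, hγinv, fun S D => ⟨fun _ => 0, negligible_zero, fun κ => ?_⟩⟩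
  · have h := hbound κ
    have h1 := (hγ.1 κ).1
    have h2 := Real.sqrt_nonneg (γ κ)
    linarith
  · rw [add_zero]
    have hT : 0 < 100 * (t κ * t κ) := by
      have : 1 ≤ t κ := one_le_invLen hε κ
      have := Nat.mul_pos this this
      omega
    have hD : 0 < d κ (100 * (t κ * t κ)) := by
      rw [← hγinv, ← hδd]; exact one_le_invLen hδ κ
    -- The number of attempts is `⌈1/γ⌉ ⌈1/δ⌉`, which `failOp` counts as `m + 1`.
    obtain ⟨m, hm⟩ : ∃ m, 100 * (t κ * t κ) * d κ (100 * (t κ * t κ)) = m + 1 :=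
      ⟨_, (Nat.succ_pred_eq_of_pos (Nat.mul_pos hT hD)).symm⟩
    have hm' : 1 / (2 * ((m : ℝ) + 1)) ≤ γ κ * δ κ := by
      have h1 := inv_invLen_le hδ κ
      rw [hδd, hγinv] at h1
      have h2 : ((m : ℝ) + 1) = ((100 * (t κ * t κ) : ℕ) : ℝ) * (d κ (100 * (t κ * t κ)) : ℝ) := by
        exact_mod_cast hm.symm
      calc 1 / (2 * ((m : ℝ) + 1)) ≤ ((m : ℝ) + 1)⁻¹ := by
            rw [one_div]
            exact inv_anti₀ (by positivity) (by linarith [(m.cast_nonneg : (0 : ℝ) ≤ m)])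
        _ = γ κ * (d κ (100 * (t κ * t κ)) : ℝ)⁻¹ := by rw [h2, mul_inv]
        _ ≤ γ κ * δ κ := mul_le_mul_of_nonneg_left h1 (hγ.1 κ).1.le
    refine le_trans ?_ (hbound κ)
    beta_reduce
    rw [hγinv κ]
    refine abs_acceptProb_simDescr_sub_le (σ := simStore G K d κ (t κ) (S.n κ) (S.z κ))
      (length_unary _) (m := m) ((length_unary _).trans hm) (sstar := sstar (S.z κ))
      (fun ρ s h => hK κ (100 * (t κ * t κ)) hT (S.n κ) ρ (S.z κ) s h) (hγ.1 κ).1 (hγ.1 κ).2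
      (hδ.1 κ).1 (fun ρ h => ?_) hm' (D κ) (S.ρ κ)
    -- The bound on extraction is needed for every state of this size, not only for the given one;
    -- constant sequences supply it.
    have := hγδ (constSeq ρ (S.z κ)) κ
    rw [hγinv κ] at this
    exact this h

end ExtractSim

theorem mainTheorem4
    (G K : QPT) (sstar : List Bool → List Bool)
    -- whenever the extractor does not output `⊥`, it outputs `sstar z`
    (hK : ∀ (κ t : ℕ), 1 ≤ t → ∀ (n : ℕ) (ρ : QState n) (z s : List Bool),
      ((K.run κ t ρ z).map toValue).prob (some s) ≠ 0 → s = sstar z)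
    -- acceptance with probability `γ` implies extraction with probability `δ`,
    -- where `1^{δ⁻¹}` is computed in polynomial time from `1^κ` and `1^{γ⁻¹}`
    (hGK : ∃ d : ℕ → ℕ → ℕ, PolyTimeUnary d ∧
      ∀ γ : ℕ → ℝ, Noticeable γ →
        ∃ δ : ℕ → ℝ, Noticeable δ ∧ (∀ κ, invLen δ κ = d κ (invLen γ κ)) ∧
          ∀ (S : PolySeq) (κ : ℕ),
            γ κ ≤ ((G.run κ (invLen γ κ) (S.ρ κ) (S.z κ)).map toDecision).prob true →
            δ κ ≤ ((K.run κ (invLen γ κ) (S.ρ κ) (S.z κ)).map toValue).prob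
              (some (sstar (S.z κ)))) :
    ∃ (SE : QPT) (g : ℕ → ℕ → ℕ), PolyTimeUnary g ∧
      ∀ ε : ℕ → ℝ, Noticeable ε →
        ∃ γ : ℕ → ℝ, Noticeable γ ∧ (∀ κ, γ κ ≤ ε κ) ∧ (∀ κ, invLen γ κ = g κ (invLen ε κ)) ∧
          ∀ S : PolySeq,
            StatClose ε
              (fun κ => (SE.run κ (invLen ε κ) (S.ρ κ) (S.z κ)).map toValue)
              (fun κ => ((G.run κ (invLen γ κ) (S.ρ κ) (S.z κ)).map toDecision).map
                (Gam (sstar (S.z κ)))) := by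
  obtain ⟨d, hd, hGK⟩ := hGK
  refine ⟨simQPT G K d hd, fun _ t => 100 * (t * t), polyTimeUnary_sq, fun ε hε => ?_⟩
  set t : ℕ → ℕ := invLen ε with ht
  set γ : ℕ → ℝ := fun κ => ((100 * (t κ * t κ) : ℕ) : ℝ)⁻¹ with hγdef
  have hγ : Noticeable γ := noticeable_sq hε
  have htpos : ∀ κ, (1 : ℝ) ≤ t κ := fun κ => by exact_mod_cast one_le_invLen hε κ
  have hγinv : ∀ κ, invLen γ κ = 100 * (t κ * t κ) := fun κ => by
    rw [invLen, hγdef, inv_inv, Nat.ceil_natCast]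
  have hγt : ∀ κ, γ κ = (10 * (t κ : ℝ))⁻¹ ^ 2 := fun κ => by
    rw [hγdef]; push_cast; rw [inv_pow]; congr 1; ring
  -- The two error terms are `8 / (10 t)` and `2 / (100 t²)`, with `t ≥ 1`.
  have hbound : ∀ κ, 8 * √(γ κ) + 2 * γ κ ≤ ε κ := by
    intro κ
    have h1 := htpos κ
    refine le_trans ?_ (inv_invLen_le hε κ)
    rw [← ht, hγt, Real.sqrt_sq (by positivity), mul_inv]
    have h2 : ((t κ : ℕ) : ℝ)⁻¹ ≤ 1 := inv_le_one_of_one_le₀ h1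
    have h3 : 0 < ((t κ : ℕ) : ℝ)⁻¹ := by positivity
    nlinarith
  obtain ⟨δ, hδ, hδd, hγδ⟩ := hGK γ hγ
  refine ⟨γ, hγ, fun κ => ?_, hγinv, fun S D => ⟨fun _ => 0, negligible_zero, fun κ => ?_⟩⟩
  · have h := hbound κ
    have h1 := (hγ.1 κ).1
    have h2 := Real.sqrt_nonneg (γ κ)
    linarith
  · rw [add_zero]
    have hT : 0 < 100 * (t κ * t κ) := by
      have : 1 ≤ t κ := one_le_invLen hε κ
      have := Nat.mul_pos this this
      omega
    have hD : 0 < d κ (100 * (t κ * t κ)) := by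
      rw [← hγinv, ← hδd]; exact one_le_invLen hδ κ
    obtain ⟨m, hm⟩ : ∃ m, 100 * (t κ * t κ) * d κ (100 * (t κ * t κ)) = m + 1 :=
      ⟨_, (Nat.succ_pred_eq_of_pos (Nat.mul_pos hT hD)).symm⟩
    -- Already `1 / (m + 1) = γ / d` is at most `γ δ`, because `d` is `1 / δ` rounded up.
    have hm' : 1 / (2 * ((m : ℝ) + 1)) ≤ γ κ * δ κ := by
      have h1 := inv_invLen_le hδ κ
      rw [hδd, hγinv] at h1
      have h2 : ((m : ℝ) + 1) = ((100 * (t κ * t κ) : ℕ) : ℝ) * (d κ (100 * (t κ * t κ)) : ℝ) := by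
        exact_mod_cast hm.symm
      calc 1 / (2 * ((m : ℝ) + 1)) ≤ ((m : ℝ) + 1)⁻¹ := by
            rw [one_div]
            exact inv_anti₀ (by positivity) (by linarith [(m.cast_nonneg : (0 : ℝ) ≤ m)])
        _ = γ κ * (d κ (100 * (t κ * t κ)) : ℝ)⁻¹ := by rw [h2, mul_inv]
        _ ≤ γ κ * δ κ := mul_le_mul_of_nonneg_left h1 (hγ.1 κ).1.le
    refine le_trans ?_ (hbound κ)
    beta_reduce
    rw [hγinv κ]
    refine abs_acceptProb_simDescr_sub_le (σ := simStore G K d κ (t κ) (S.n κ) (S.z κ))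
      (length_unary _) (m := m) ((length_unary _).trans hm) (sstar := sstar (S.z κ))
      (fun ρ s h => hK κ (100 * (t κ * t κ)) hT (S.n κ) ρ (S.z κ) s h) (hγ.1 κ).1 (hγ.1 κ).2
      (hδ.1 κ).1 (fun ρ h => ?_) hm' (D κ) (S.ρ κ)
    have := hγδ (constSeq ρ (S.z κ)) κ
    rw [hγinv κ] at this
    exact this h
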